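/- Fix a field $k$. Let $Ch$ be the category of $\mathbb{Z}$-graded chain complexes over $k$, with the usual symmetric monoidal structure ($\otimes=\otimes_k$, Koszul signs, unit $k$). **Trees.** A *tree* is a finite rooted tree in which every vertex has at least two inputs; its edges form a finite poset with the root as least element, and its leaves are the maximal edges. The tree without vertices is denoted $\eta$. Let $\mathcal{R}$ be the category of trees and root-preserving maps: a morphism $\alpha:S\to T$ is an order embedding of edges that preserves the root and for which every leaf of $T$ lies above (or equals) the image of some leaf of $S$ (so every vertex of $S$ is sent to a subtree of $T$). Let $\mathcal{A}\subset\mathcal{R}$ be the subcategory with the same objects and the morphisms that send leaves to leaves. Every morphism of $\mathcal{R}$ is a morphism of $\mathcal{A}$ followed by a pruning. Let $Psh(\mathcal{R})$ and $Psh(\mathcal{A})$ be the categories of contravariant functors to $Ch$. For $\alpha:S\to T$ in $\mathcal{R}$ and a leaf $\ell$ of $S$, let $T(\alpha)_\ell$ be the subtree of $T$ of all edges above $\alpha(\ell)$. If $S\xrightarrow{\alpha}R\xrightarrow{\beta}T$, then $\beta$ restricts to $\beta_\ell:R(\alpha)_\ell\to T(\beta\alpha)_\ell$; the leaves of $R$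 are the leaves $m$ of the $R(\alpha)_\ell$, and $(T(\beta\alpha)_\ell)(\beta_\ell)_m=T(\beta)_m$. **Preoperads.** A *preoperad* is a presheaf $X$ on $\mathcal{A}$ with $X(\eta)=k$ and a map $\theta_e:X(S\circ_eR)\to X(S)\otimes X(R)$ for each grafting $S\circ_e R$ of a tree $R$ onto a leaf $e$ of a tree $S$, natural in $S$ and $R$, associative for nested and for parallel graftings, and equal to the canonical isomorphism if $S$ or $R$ is $\eta$. For $\alpha:S\to R$ in $\mathcal{R}$, with factorisation $S\xrightarrow{\gamma}S'\to R$ into $\gamma$ in $\mathcal{A}$ and a pruning $S'$ of $R$, the tree $R$ is the grafting of the $R(\alpha)_\ell$ onto the leaves of $S'$; iterating $\theta$ and applying $\gamma^*:X(S')\to X(S)$ gives $$\theta^\alpha:X(R)\to X(S)\otimes\bigotimes_\ell X(R(\alpha)_\ell).$$ **Prealgebras.** For $V\in Psh(\mathcal{R})$ and $\alpha:S\to T$ in $\mathcal{R}$ put $$V_X(\alpha)=X(S)\otimes\bigotimes_\ell V(T(\alpha)_\ell),$$ where $\ell$ runs over the leaves of $S$. A morphism $\beta:T\to T'$ in $\mathcal{R}$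 induces $V_X(\beta\alpha)\to V_X(\alpha)$, and a morphism $\gamma:S_1\to S$ in $\mathcal{A}$ (which is a bijection on leaves) induces $\gamma^*\otimes\mathrm{id}:V_X(\alpha)\to V_X(\alpha\gamma)$. An *$X$-prealgebra* is a presheaf $M$ on $\mathcal{R}$ with maps $\tau^\alpha:M(T)\to M_X(\alpha)$ for all $\alpha:S\to T$ in $\mathcal{R}$ which * are natural in $T$: for $\beta:T\to T'$ in $\mathcal{R}$, $\tau^\alpha\circ\beta^*$ is $\tau^{\beta\alpha}$ followed by $M_X(\beta\alpha)\to M_X(\alpha)$; * satisfy $(\gamma^*\otimes\mathrm{id})\circ\tau^{\alpha}=\tau^{\alpha\gamma}$ for all $\gamma:S_1\to S$ in $\mathcal{A}$; * are unital: for the root inclusion $\eta\to T$, $\tau$ is the canonical isomorphism $M(T)\cong k\otimes M(T)$; * are associative: for all $S\xrightarrow{\alpha}R\xrightarrow{\beta}T$ in $\mathcal{R}$, $$(\mathrm{id}\otimes\textstyle\bigotimes_\ell\tau^{\beta_\ell})\circ\tau^{\beta\alpha}=(\theta^\alpha\otimes\mathrm{id})\circ\tau^\beta$$ as maps $M(T)\to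 X(S)\otimes\bigotimes_\ell X(R(\alpha)_\ell)\otimes\bigotimes_m M(T(\beta)_m)$, with $\ell$ running over the leaves of $S$ and $m$ over those of $R$, up to the symmetry of $\otimes$. Morphisms of $X$-prealgebras are morphisms of presheaves compatible with all $\tau^\alpha$. This gives a category $Prealg(X)$ with a forgetful functor to $Psh(\mathcal{R})$. **Proposition.** Let $X$ be a preoperad. There is a comonad $H_X$ on $Psh(\mathcal{R})$ with $$H_X(V)(T)=\Big(\prod_{\alpha:S\to T}X(S)\otimes\bigotimes_\ell V(T(\alpha)_\ell)\Big)^{inv},$$ where $\alpha$ runs over the morphisms of $\mathcal{R}$ with target $T$ and $inv$ denotes the complex of the families $(\omega_\alpha)_\alpha$ with $(\gamma^*\otimes\mathrm{id})(\omega_\alpha)=\omega_{\alpha\gamma}$ for all $\alpha:S\to T$ in $\mathcal{R}$ and $\gamma:S_1\to S$ in $\mathcal{A}$, and, writing $\mathrm{proj}_\alpha:H_X(V)(T)\to V_X(\alpha)$ for the projections, with the following structure: * for $\beta:T\to T'$ in $\mathcal{R}$, $\mathrm{proj}_\alpha\circ\beta^*$ is $\mathrm{proj}_{\beta\alpha}$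 followed by $V_X(\beta\alpha)\to V_X(\alpha)$; the functoriality in $V$ is the evident one; * the counit $H_X(V)(T)\to V(T)$ is the projection to the factor $X(\eta)\otimes V(T)=V(T)$ of the root inclusion $\eta\to T$; * the comultiplication $\delta:H_X(V)\to H_XH_X(V)$ satisfies, for all $S\xrightarrow{\alpha}R\xrightarrow{\beta}T$ in $\mathcal{R}$, $$(\mathrm{id}\otimes\textstyle\bigotimes_\ell\mathrm{proj}_{\beta_\ell})\circ\mathrm{proj}_{\beta\alpha}\circ\delta=(\theta^\alpha\otimes\mathrm{id})\circ\mathrm{proj}_\beta$$ as maps $H_X(V)(T)\to X(S)\otimes\bigotimes_\ell X(R(\alpha)_\ell)\otimes\bigotimes_m V(T(\beta)_m)$. Moreover, the category $Prealg(X)$ is isomorphic to the category of $H_X$-coalgebras, by an isomorphism that commutes with the forgetful functors to $Psh(\mathcal{R})$ and sends a prealgebra $(M,\tau)$ to $M$ with the coalgebra structure $a:M\to H_X(M)$ determined by $\mathrm{proj}_\alpha\circ a=\tau^\alpha$ for all $\alpha:S\to T$ in $\mathcal{R}$. -/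

import Mathlib

open CategoryTheory Limits Opposite
universe u
namespace Koszul
/-- The sign `(-1)^p` in `d(x ⊗ y) = dx ⊗ y + (-1)^p x ⊗ dy`, for `x` of degree `p`. -/
instance : ComplexShape.TensorSigns (ComplexShape.down ℤ) where
  ε' := MonoidHom.mk' (fun i : Multiplicative ℤ => Int.negOnePow i.toAdd)
    (fun a b => Int.negOnePow_add a.toAdd b.toAdd)
  rel_add p q r (hpq : q + 1 = p) := show q + r + 1 = p + r by lia
  add_rel p q r (hpq : q + 1 = p) := show r + q + 1 = r + p by lia
  ε'_succ := by
    rintro _ q rfl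
    show Int.negOnePow q = - Int.negOnePow (q + 1)
    rw [Int.negOnePow_succ, neg_neg]

/-- Chain complexes of `k`-vector spaces, with their tensor product from Mathlib. -/
abbrev Ch (k : Type u) [Field k] := ChainComplex (ModuleCat.{u} k) ℤ
variable {k : Type u} [Field k]

section
open GradedObject.Monoidal
open MonoidalCategory hiding tensorObj associator whiskerLeft whiskerRight tensorHom

/-- The symmetry `x ⊗ y ↦ (-1)^(pq) y ⊗ x` of graded vector spaces, for `x` of degree `p` and `y`
of degree `q`. -/
noncomputable def gradedBraiding (X Y : GradedObject ℤ (ModuleCat.{u} k)) :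
    tensorObj X Y ⟶ tensorObj Y X := fun n =>
  tensorObjDesc (fun i j hij => (i * j).negOnePow • ((β_ (X i) (Y j)).hom ≫
    ιTensorObj Y X j i n (by simpa only [add_comm j i] using hij)))

lemma ι_gradedBraiding (X Y : GradedObject ℤ (ModuleCat.{u} k)) (i j n : ℤ) (h : i + j = n) :
    ιTensorObj X Y i j n h ≫ gradedBraiding X Y n = (i * j).negOnePow • ((β_ (X i) (Y j)).hom ≫
      ιTensorObj Y X j i n (by rw [add_comm, h])) := by
  simp [gradedBraiding]

lemma ι_gradedBraiding_assoc (X Y : GradedObject ℤ (ModuleCat.{u} k)) (i j n : ℤ) (h : i + j = n)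
    {Z : ModuleCat.{u} k} (f : tensorObj Y X n ⟶ Z) :
    ιTensorObj X Y i j n h ≫ gradedBraiding X Y n ≫ f =
      ((i * j).negOnePow • ((β_ (X i) (Y j)).hom ≫
        ιTensorObj Y X j i n (by rw [add_comm, h]))) ≫ f := by
  rw [← Category.assoc, ι_gradedBraiding]

lemma units_smul_whiskerRight {A B : ModuleCat.{u} k} (r : ℤˣ) (f : A ⟶ B) (Z : ModuleCat.{u} k) :
    (r • f) ▷ Z = r • (f ▷ Z) := by
  rcases Int.units_eq_one_or r with rfl | rfl
  · simp
  · simp only [Units.neg_smul, one_smul]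
    exact (tensorRight Z).map_neg

lemma whiskerLeft_units_smul {A B : ModuleCat.{u} k} (r : ℤˣ) (f : A ⟶ B) (Z : ModuleCat.{u} k) :
    Z ◁ (r • f) = r • (Z ◁ f) := by
  rcases Int.units_eq_one_or r with rfl | rfl
  · simp
  · simp only [Units.neg_smul, one_smul]
    exact (tensorLeft Z).map_neg

lemma graded_hexagon_forward (X Y Z : GradedObject ℤ (ModuleCat.{u} k)) :
    (associator X Y Z).hom ≫ (gradedBraiding X (tensorObj Y Z)) ≫ (associator Y Z X).hom =
      whiskerRight (gradedBraiding X Y) Z ≫ (associator Y X Z).hom ≫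
        whiskerLeft Y (gradedBraiding X Z) := by
  funext k
  apply tensorObj₃'_ext
  intro i₁ i₂ i₃ h
  have hs : (i₁ * (i₂ + i₃)).negOnePow = (i₁ * i₃).negOnePow * (i₁ * i₂).negOnePow := by
    rw [mul_add, Int.negOnePow_add, mul_comm]
  simp only [GradedObject.categoryOfGradedObjects_comp]
  conv_lhs => rw [ιTensorObj₃'_associator_hom_assoc, ιTensorObj₃_eq X Y Z i₁ i₂ i₃ k h _ rfl,
    Category.assoc, ι_gradedBraiding_assoc, Linear.units_smul_comp, Linear.comp_units_smul,
    Linear.comp_units_smul,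
    Category.assoc, ← MonoidalCategory.id_tensorHom,
    BraidedCategory.braiding_naturality_assoc,
    BraidedCategory.braiding_tensor_right_hom, Category.assoc, Category.assoc, Category.assoc, Category.assoc, Iso.hom_inv_id_assoc,
    MonoidalCategory.tensorHom_id,
    ← ιTensorObj₃'_eq_assoc Y Z X i₂ i₃ i₁ k (by rw [add_comm _ i₁, ← add_assoc, h]) _ rfl,
    ιTensorObj₃'_associator_hom, Iso.inv_hom_id_assoc]
  conv_rhs => rw [ιTensorObj₃'_eq X Y Z i₁ i₂ i₃ k h _ rfl, Category.assoc, whiskerRight, ι_tensorHom_assoc,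
    ← MonoidalCategory.tensorHom_id,
    MonoidalCategory.tensorHom_comp_tensorHom_assoc, Category.id_comp, ι_gradedBraiding,
    GradedObject.categoryOfGradedObjects_id, MonoidalCategory.tensorHom_id,
    units_smul_whiskerRight, Linear.units_smul_comp, MonoidalCategory.comp_whiskerRight,
    Category.assoc,
    ← ιTensorObj₃'_eq_assoc Y X Z i₂ i₁ i₃ k
      (by rw [add_comm i₂ i₁, h]) (i₁ + i₂) (add_comm i₂ i₁),
    ιTensorObj₃'_associator_hom_assoc,
    ιTensorObj₃_eq Y X Z i₂ i₁ i₃ k (by rw [add_comm i₂ i₁, h]) _ rfl, Category.assoc,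
    whiskerLeft, ι_tensorHom, GradedObject.categoryOfGradedObjects_id, MonoidalCategory.id_tensorHom,
    ← MonoidalCategory.whiskerLeft_comp_assoc, ι_gradedBraiding,
    whiskerLeft_units_smul, MonoidalCategory.whiskerLeft_comp, Linear.units_smul_comp,
    Linear.comp_units_smul, Linear.comp_units_smul, Category.assoc,
    ← ιTensorObj₃_eq Y Z X i₂ i₃ i₁ k (by rw [add_comm _ i₁, ← add_assoc, h])
      (i₁ + i₃) (add_comm _ _)]
  rw [hs, mul_smul, smul_comm]

lemma gradedBraiding_symm (X Y : GradedObject ℤ (ModuleCat.{u} k)) :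
    gradedBraiding X Y ≫ gradedBraiding Y X = 𝟙 _ := by
  funext n
  apply tensorObj_ext
  intro i j h
  simp only [GradedObject.categoryOfGradedObjects_comp]
  rw [ι_gradedBraiding_assoc, Linear.units_smul_comp, Category.assoc, ι_gradedBraiding,
    Linear.comp_units_smul, smul_smul, mul_comm i j, Int.units_mul_self, one_smul,
    SymmetricCategory.symmetry_assoc, GradedObject.categoryOfGradedObjects_id, Category.comp_id]

lemma gradedBraiding_naturality_left {X Y : GradedObject ℤ (ModuleCat.{u} k)} (f : X ⟶ Y)
    (Z : GradedObject ℤ (ModuleCat.{u} k)) :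
    whiskerRight f Z ≫ gradedBraiding Y Z = gradedBraiding X Z ≫ whiskerLeft Z f := by
  funext n
  apply tensorObj_ext
  intro i j h
  simp only [GradedObject.categoryOfGradedObjects_comp]
  rw [ι_gradedBraiding_assoc, whiskerRight, ι_tensorHom_assoc, ι_gradedBraiding, whiskerLeft,
    Linear.comp_units_smul, Linear.units_smul_comp, Category.assoc, ι_tensorHom]
  simp [GradedObject.categoryOfGradedObjects_id]

lemma gradedBraiding_naturality_right (X : GradedObject ℤ (ModuleCat.{u} k))
    {Y Z : GradedObject ℤ (ModuleCat.{u} k)} (f : Y ⟶ Z) :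
    whiskerLeft X f ≫ gradedBraiding X Z = gradedBraiding X Y ≫ whiskerRight f X := by
  funext n
  apply tensorObj_ext
  intro i j h
  simp only [GradedObject.categoryOfGradedObjects_comp]
  rw [ι_gradedBraiding_assoc, whiskerLeft, ι_tensorHom_assoc, ι_gradedBraiding, whiskerRight,
    Linear.comp_units_smul, Linear.units_smul_comp, Category.assoc, ι_tensorHom]
  simp [GradedObject.categoryOfGradedObjects_id]

end

open MonoidalCategory


lemma ι_tensorObj_d (K L : Ch k) (p q i j : ℤ) (h : p + q = i) (hij : j + 1 = i) :
    HomologicalComplex.ιTensorObj K L p q i h ≫ (HomologicalComplex.tensorObj K L).d i j =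
      K.d p (p - 1) ▷ L.X q ≫ HomologicalComplex.ιTensorObj K L (p - 1) q j (by lia) +
        p.negOnePow • (K.X p ◁ L.d q (q - 1) ≫
          HomologicalComplex.ιTensorObj K L p (q - 1) j (by lia)) := by
  have hp : (ComplexShape.down ℤ).Rel p (p - 1) := by simp
  have hq : (ComplexShape.down ℤ).Rel q (q - 1) := by simp
  rw [HomologicalComplex.mapBifunctor.d_eq, Preadditive.comp_add,
    HomologicalComplex.mapBifunctor.ι_D₁, HomologicalComplex.mapBifunctor.ι_D₂,
    HomologicalComplex.mapBifunctor.d₁_eq _ _ _ _ hp _ _ (show p - 1 + q = j by lia),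
    HomologicalComplex.mapBifunctor.d₂_eq _ _ _ _ _ hq _ (show p + (q - 1) = j by lia)]
  congr 1
  exact one_smul _ _

/-- The symmetry in degree `n`. -/
noncomputable def braidingX (K L : Ch k) (n : ℤ) :
    (HomologicalComplex.tensorObj K L).X n ⟶ (HomologicalComplex.tensorObj L K).X n :=
  gradedBraiding K.X L.X n

lemma ι_braidingX (K L : Ch k) (i j n : ℤ) (h : i + j = n) :
    HomologicalComplex.ιTensorObj K L i j n h ≫ braidingX K L n =
      (i * j).negOnePow • ((β_ (K.X i) (L.X j)).hom ≫
        HomologicalComplex.ιTensorObj L K j i n (by rw [add_comm, h])) :=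
  ι_gradedBraiding K.X L.X i j n h

lemma ι_braidingX_assoc (K L : Ch k) (i j n : ℤ) (h : i + j = n) {Z : ModuleCat.{u} k}
    (f : (HomologicalComplex.tensorObj L K).X n ⟶ Z) :
    HomologicalComplex.ιTensorObj K L i j n h ≫ braidingX K L n ≫ f =
      ((i * j).negOnePow • ((β_ (K.X i) (L.X j)).hom ≫
        HomologicalComplex.ιTensorObj L K j i n (by rw [add_comm, h]))) ≫ f := by
  rw [← Category.assoc, ι_braidingX]

lemma braidingX_comm (K L : Ch k) (i j : ℤ) (hij : (ComplexShape.down ℤ).Rel i j) :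
    braidingX K L i ≫ (HomologicalComplex.tensorObj L K).d i j =
      (HomologicalComplex.tensorObj K L).d i j ≫ braidingX K L j := by
  refine HomologicalComplex.mapBifunctor.hom_ext (K₁ := K) (K₂ := L) (F := curriedTensor _)
    (c := ComplexShape.down ℤ) (fun p q h => ?_)
  replace hij : j + 1 = i := hij
  replace h : p + q = i := h
  have s1 : (p * q).negOnePow * q.negOnePow = ((p - 1) * q).negOnePow := by
    rw [show p * q = (p - 1) * q + q by ring, Int.negOnePow_add, mul_assoc, Int.units_mul_self,
      mul_one]
  have s2 : p.negOnePow * (p * (q - 1)).negOnePow = (p * q).negOnePow := by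
    rw [show p * q = p + p * (q - 1) by ring, Int.negOnePow_add]
  rw [ι_braidingX_assoc, ← Category.assoc, ι_tensorObj_d K L p q i j h hij,
    Linear.units_smul_comp, Category.assoc, ι_tensorObj_d L K q p i j (by lia) hij,
    Preadditive.add_comp, Linear.units_smul_comp, Category.assoc, Category.assoc,
    ι_braidingX, ι_braidingX, Linear.comp_units_smul, Linear.comp_units_smul,
    Preadditive.comp_add, Linear.comp_units_smul, smul_add, smul_smul, smul_smul, s1, s2,
    BraidedCategory.braiding_naturality_left_assoc,
    BraidedCategory.braiding_naturality_right_assoc, add_comm]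

/-- The symmetry with the Koszul sign is a chain map. -/
noncomputable def braidHom (K L : Ch k) : K ⊗ L ⟶ L ⊗ K where
  f n := braidingX K L n
  comm' i j hij := braidingX_comm K L i j hij

lemma braidHom_symm (K L : Ch k) : braidHom K L ≫ braidHom L K = 𝟙 _ := by
  ext1 n
  exact congrFun (gradedBraiding_symm K.X L.X) n

noncomputable def braidIso (K L : Ch k) : K ⊗ L ≅ L ⊗ K where
  hom := braidHom K L
  inv := braidHom L K
  hom_inv_id := braidHom_symm K L
  inv_hom_id := braidHom_symm L K

lemma hexagon (X Y Z : Ch k) :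
    (α_ X Y Z).hom ≫ (braidIso X (Y ⊗ Z)).hom ≫ (α_ Y Z X).hom =
      ((braidIso X Y).hom ▷ Z) ≫ (α_ Y X Z).hom ≫ (Y ◁ (braidIso X Z).hom) := by
  ext1 n
  exact congrFun (graded_hexagon_forward X.X Y.X Z.X) n

lemma braid_naturality_left {X Y : Ch k} (f : X ⟶ Y) (Z : Ch k) :
    f ▷ Z ≫ (braidIso Y Z).hom = (braidIso X Z).hom ≫ Z ◁ f := by
  ext1 n
  exact congrFun (gradedBraiding_naturality_left f.f Z.X) n

lemma braid_naturality_right (X : Ch k) {Y Z : Ch k} (f : Y ⟶ Z) :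
    X ◁ f ≫ (braidIso X Z).hom = (braidIso X Y).hom ≫ f ▷ X := by
  ext1 n
  exact congrFun (gradedBraiding_naturality_right X.X f.f) n

/-- Chain complexes form a symmetric monoidal category, with the Koszul sign rule. -/
noncomputable instance : SymmetricCategory (Ch k) where
  braiding := braidIso
  braiding_naturality_right := braid_naturality_right
  braiding_naturality_left := braid_naturality_left
  hexagon_forward := hexagon
  hexagon_reverse X Y Z := by
    have h := congrArg Iso.inv (Iso.ext (hexagon Z X Y) :
      α_ Z X Y ≪≫ braidIso Z (X ⊗ Y) ≪≫ α_ X Y Z =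
        whiskerRightIso (braidIso Z X) Y ≪≫ α_ X Z Y ≪≫ whiskerLeftIso X (braidIso Z Y))
    simp only [Iso.trans_inv, Category.assoc, whiskerRightIso_inv, whiskerLeftIso_inv] at h
    exact h
  symmetry := braidHom_symm


/-! ### Tensor products of finite families in a symmetric monoidal category -/

section FiniteTensor

variable {C : Type*} [Category C] [MonoidalCategory C]

/-- The tensor product of the family `V` along a list of indices. -/
def tensList {ι : Type} (V : ι → C) : List ι → C
  | [] => 𝟙_ C
  | i :: l => V i ⊗ tensList V l

/-- Functoriality of `tensList` in the family. -/
def tensListMap {ι : Type} {V W : ι → C} (φ : ∀ i, V i ⟶ W i) :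
    (l : List ι) → (tensList V l ⟶ tensList W l)
  | [] => 𝟙 _
  | i :: l => φ i ⊗ₘ tensListMap φ l

@[simp]
lemma tensListMap_id {ι : Type} (V : ι → C) (l : List ι) :
    tensListMap (fun i => 𝟙 (V i)) l = 𝟙 _ := by
  induction l with
  | nil => rfl
  | cons i l ih => simp [tensListMap, ih, tensList]

lemma tensListMap_comp {ι : Type} {V W U : ι → C} (φ : ∀ i, V i ⟶ W i) (ψ : ∀ i, W i ⟶ U i)
    (l : List ι) :
    tensListMap (fun i => φ i ≫ ψ i) l = tensListMap φ l ≫ tensListMap ψ l := by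
  induction l with
  | nil => exact (Category.comp_id _).symm
  | cons i l ih =>
    simp only [tensListMap, ih]
    exact (MonoidalCategory.tensorHom_comp_tensorHom _ _ _ _).symm

/-- Concatenation of lists corresponds to the tensor product. -/
def tensListAppend {ι : Type} (V : ι → C) (l' : List ι) :
    (l : List ι) → (tensList V l ⊗ tensList V l' ⟶ tensList V (l ++ l'))
  | [] => (λ_ _).hom
  | i :: l => (α_ _ _ _).hom ≫ V i ◁ tensListAppend V l' l

/-- Relabelling the indices of a tensor product along a function, keeping the order. -/
def tensListRelabel {ι κ : Type} (V : ι → C) (f : κ → ι) :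
    (l : List κ) → (tensList (fun j => V (f j)) l ⟶ tensList V (l.map f))
  | [] => 𝟙 _
  | j :: l => V (f j) ◁ tensListRelabel V f l

/-- The list of pairs `(i, j)` with `i` in `l` and `j` in `L i`, in lexicographic order. -/
def sigmaList {ι : Type} {κ : ι → Type} (L : ∀ i, List (κ i)) : List ι → List (Σ i, κ i)
  | [] => []
  | i :: l => (L i).map (Sigma.mk i) ++ sigmaList L l

/-- An iterated tensor product `⨂ᵢ ⨂ⱼ V (i, j)` is the tensor product over the pairs `(i, j)`. -/
def tensListFlatten {ι : Type} {κ : ι → Type} (V : (Σ i, κ i) → C) (L : ∀ i, List (κ i)) :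
    (l : List ι) →
      (tensList (fun i => tensList (fun j => V ⟨i, j⟩) (L i)) l ⟶ tensList V (sigmaList L l))
  | [] => 𝟙 _
  | i :: l => (tensListRelabel V (Sigma.mk i) (L i) ⊗ₘ tensListFlatten V L l) ≫
      tensListAppend V _ _

variable [BraidedCategory C]

/-- The shuffle `⨂ᵢ (A i ⊗ B i) ⟶ (⨂ᵢ A i) ⊗ (⨂ᵢ B i)`. -/
def tensListShuffle {ι : Type} (A B : ι → C) :
    (l : List ι) → (tensList (fun i => A i ⊗ B i) l ⟶ tensList A l ⊗ tensList B l)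
  | [] => (λ_ (𝟙_ C)).inv
  | i :: l => (A i ⊗ B i) ◁ tensListShuffle A B l ≫ tensorμ (A i) (B i) _ _

open Classical in
/-- Moving the factor with index `i` to the front by means of the symmetry. -/
noncomputable def tensListExtract {ι : Type} (V : ι → C) (i : ι) :
    (l : List ι) → i ∈ l → (tensList V l ⟶ V i ⊗ tensList V (l.erase i))
  | [], h => absurd h (List.not_mem_nil)
  | j :: l, h =>
    if hj : j = i then
      eqToHom (by subst hj; rw [List.erase_cons_head]; rfl)
    else
      V j ◁ tensListExtract V i l
          ((List.mem_cons.1 h).resolve_left (fun e => hj e.symm)) ≫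
        (α_ _ _ _).inv ≫ (β_ (V j) (V i)).hom ▷ _ ≫ (α_ _ _ _).hom ≫
        eqToHom (by rw [List.erase_cons_tail (by simpa using hj)]; rfl)

open Classical in
/-- Let `f` send the entries of the list `l'` bijectively to those of the list `l`, up to order.
Morphisms `φ j : V (f j) ⟶ W j` induce a morphism from the tensor product of `V` along `l` to that
of `W` along `l'`, the factors being permuted by means of the symmetry. -/
noncomputable def tensListReindex {ι κ : Type} {V : ι → C} {W : κ → C} (f : κ → ι)
    (φ : ∀ j, V (f j) ⟶ W j) :
    (l' : List κ) → (l : List ι) → l.Perm (l'.map f) → (tensList V l ⟶ tensList W l')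
  | [], _, h => eqToHom (by rw [List.perm_nil.1 h]; rfl)
  | j :: l', l, h =>
    tensListExtract V (f j) l (h.mem_iff.2 List.mem_cons_self) ≫
      (φ j ⊗ₘ tensListReindex f φ l' (l.erase (f j)) (List.cons_perm_iff_perm_erase.1 h.symm).2.symm)

/-- The list of all elements of a finite type (each occurring once). -/
noncomputable def enum (ι : Type) [Finite ι] : List ι :=
  letI := Fintype.ofFinite ι
  Finset.univ.toList

lemma mem_enum {ι : Type} [Finite ι] (i : ι) : i ∈ enum ι := by
  simp [enum]

lemma nodup_enum (ι : Type) [Finite ι] : (enum ι).Nodup := Finset.nodup_toList _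

lemma perm_enum {ι : Type} [Finite ι] {l : List ι} (hl : l.Nodup) (h : ∀ i, i ∈ l) :
    (enum ι).Perm l :=
  (List.perm_ext_iff_of_nodup (nodup_enum ι) hl).2 fun i => by simp [mem_enum, h]

lemma perm_enum_map {ι κ : Type} [Finite ι] [Finite κ] {f : κ → ι} (hf : Function.Bijective f) :
    (enum ι).Perm ((enum κ).map f) :=
  perm_enum ((nodup_enum κ).map hf.1) fun i => by
    obtain ⟨j, rfl⟩ := hf.2 i
    exact List.mem_map_of_mem (mem_enum j)

lemma mem_sigmaList {ι : Type} {κ : ι → Type} (L : ∀ i, List (κ i)) (l : List ι) (x : Σ i, κ i) :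
    x ∈ sigmaList L l ↔ x.1 ∈ l ∧ x.2 ∈ L x.1 := by
  induction l with
  | nil => simp [sigmaList]
  | cons i l ih =>
    obtain ⟨a, b⟩ := x
    simp only [sigmaList, List.mem_append, List.mem_map, ih, List.mem_cons]
    constructor
    · rintro (⟨c, hc, h⟩ | h)
      · cases h
        exact ⟨Or.inl rfl, hc⟩
      · exact ⟨Or.inr h.1, h.2⟩
    · rintro ⟨rfl | h, hb⟩
      · exact Or.inl ⟨b, hb, rfl⟩
      · exact Or.inr ⟨h, hb⟩

lemma nodup_sigmaList {ι : Type} {κ : ι → Type} (L : ∀ i, List (κ i)) (hL : ∀ i, (L i).Nodup)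
    (l : List ι) (hl : l.Nodup) : (sigmaList L l).Nodup := by
  induction l with
  | nil => simp [sigmaList]
  | cons i l ih =>
    rw [List.nodup_cons] at hl
    refine List.Nodup.append ((hL i).map sigma_mk_injective) (ih hl.2) ?_
    intro x hx hx'
    obtain ⟨c, _, rfl⟩ := List.mem_map.1 hx
    exact hl.1 ((mem_sigmaList L l _).1 hx').1

/-- The tensor product `⨂ᵢ V i` of a finite family. -/
noncomputable def tens {ι : Type} [Finite ι] (V : ι → C) : C := tensList V (enum ι)

end FiniteTensor

/-! ### Trees -/

/-- A finite open and reduced rooted tree (every vertex has at least two inputs), presented by its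
finite set of edges, ordered by `e ≤ e'` if `e` lies on the path from `e'` to the root edge.
As there are no vertices without inputs, the leaves are the maximal edges, and the vertices
correspond to the other edges: the vertex above `e` has output `e` and as inputs the edges
covering `e`. -/
structure RTree : Type 1 where
  Edge : Type
  [order : PartialOrder Edge]
  [finite : Finite Edge]
  root : Edge
  root_le : ∀ e, root ≤ e
  chain : ∀ {a b e : Edge}, a ≤ e → b ≤ e → a ≤ b ∨ b ≤ a
  reduced : ∀ e : Edge, ¬ IsMax e → ∃ a b : Edge, a ≠ b ∧ e ⋖ a ∧ e ⋖ b

attribute [instance] RTree.order RTree.finite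

namespace RTree

/-- The leaves of a tree. -/
abbrev Leaf (T : RTree) : Type := {e : T.Edge // IsMax e}

/-- Morphisms of the category `ℛ`: the maps of trees which preserve the root, given by their effect on edges.
The condition `cover` says that the images of the leaves of `S` are the leaves of a pruning
of `T`; it implies that the image of each vertex of `S` is a subtree of `T`. -/
@[ext]
structure Hom (S T : RTree) where
  toFun : S.Edge → T.Edge
  le_iff : ∀ {a b : S.Edge}, toFun a ≤ toFun b ↔ a ≤ b
  map_root : toFun S.root = T.root
  cover : ∀ t : T.Edge, IsMax t → ∃ l : S.Edge, IsMax l ∧ toFun l ≤ t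

/-- The category `ℛ` of open reduced trees and root preserving maps. -/
instance : Category RTree where
  Hom := Hom
  id T := ⟨fun e => e, Iff.rfl, rfl, fun t ht => ⟨t, ht, le_rfl⟩⟩
  comp f g := ⟨fun e => g.toFun (f.toFun e), g.le_iff.trans f.le_iff, by
    rw [f.map_root, g.map_root], fun t ht => by
      obtain ⟨m, hm, hmt⟩ := g.cover t ht
      obtain ⟨l, hl, hlm⟩ := f.cover m hm
      exact ⟨l, hl, (g.le_iff.2 hlm).trans hmt⟩⟩

/-- The effect of a morphism on edges. -/
abbrev edge {S T : RTree} (f : S ⟶ T) (e : S.Edge) : T.Edge := Hom.toFun f e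

lemma edge_le_iff {S T : RTree} (f : S ⟶ T) {a b : S.Edge} : edge f a ≤ edge f b ↔ a ≤ b :=
  Hom.le_iff f

lemma edge_injective {S T : RTree} (f : S ⟶ T) : Function.Injective (edge f) := fun _ _ h =>
  le_antisymm ((edge_le_iff f).1 h.le) ((edge_le_iff f).1 h.ge)

lemma edge_lt_iff {S T : RTree} (f : S ⟶ T) {a b : S.Edge} : edge f a < edge f b ↔ a < b := by
  rw [lt_iff_le_not_ge, lt_iff_le_not_ge, edge_le_iff, edge_le_iff]

lemma edge_root {S T : RTree} (f : S ⟶ T) : edge f S.root = T.root := Hom.map_root f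

/-- The property of sending leaves to leaves. -/
def inner : MorphismProperty RTree := fun S _ f => ∀ l : S.Edge, IsMax l → IsMax (edge f l)

instance : inner.IsMultiplicative where
  id_mem _ _ h := h
  comp_mem _ _ hf hg l h := hg _ (hf l h)

lemma exists_leaf {T : RTree} (e : T.Edge) : ∃ l : T.Edge, IsMax l ∧ e ≤ l := by
  obtain ⟨l, hel, hl⟩ := (Set.toFinite {x : T.Edge | e ≤ x}).exists_le_maximal (a := e) le_rfl
  exact ⟨l, fun x hx => hl.2 (le_trans hl.1 hx) hx, hel⟩

/-- The tree `η` without vertices. -/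
def eta : RTree where
  Edge := Unit
  root := ()
  root_le _ := le_rfl
  chain _ _ := Or.inl le_rfl
  reduced _ h := absurd (fun _ _ => le_rfl) h

/-- The inclusion of the root. -/
def rootHom (T : RTree) : eta ⟶ T where
  toFun _ := T.root
  le_iff := Iff.intro (fun _ => le_rfl) (fun _ => le_rfl)
  map_root := rfl
  cover t _ := ⟨(), fun _ _ => le_rfl, T.root_le t⟩

/-- The subtree of `T` with root `e` consisting of all edges above `e`. -/
def above (T : RTree) (e : T.Edge) : RTree where
  Edge := {x : T.Edge // e ≤ x}
  root := ⟨e, le_rfl⟩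
  root_le x := x.2
  chain h h' := T.chain (a := Subtype.val _) h h'
  reduced x hx := by
    obtain ⟨a, b, hab, ha, hb⟩ := T.reduced x.1 fun h => hx fun y hy => h hy
    refine ⟨⟨a, x.2.trans ha.le⟩, ⟨b, x.2.trans hb.le⟩, fun h => hab (congrArg Subtype.val h),
      ⟨ha.lt, fun c h h' => ha.2 (c := c.1) h h'⟩, ⟨hb.lt, fun c h h' => hb.2 (c := c.1) h h'⟩⟩

/-- The pruning of `T` obtained by removing everything above the edges in `s`. -/
def cut (T : RTree) (s : Set T.Edge) : RTree where
  Edge := {x : T.Edge // ∀ e ∈ s, ¬ e < x}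
  root := ⟨T.root, fun e _ h => (h.trans_le (T.root_le e)).false⟩
  root_le x := T.root_le x.1
  chain h h' := T.chain (a := Subtype.val _) h h'
  reduced x hx := by
    obtain ⟨y, hxy⟩ := not_isMax_iff.1 hx
    have hxy' : x.1 < y.1 := hxy
    have key : ∀ a, x.1 ⋖ a → ∀ e ∈ s, ¬ e < a := by
      intro a ha e he hea
      rcases T.chain hea.le ha.le with h | h
      · exact y.2 e he (h.trans_lt hxy')
      · rcases h.eq_or_lt with h | h
        · exact y.2 e he (h ▸ hxy')
        · exact ha.2 h hea
    obtain ⟨a, b, hab, ha, hb⟩ := T.reduced x.1 fun h => (h.not_lt hxy')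
    refine ⟨⟨a, key a ha⟩, ⟨b, key b hb⟩, fun h => hab (congrArg Subtype.val h),
      ⟨ha.lt, fun c h h' => ha.2 (c := c.1) h h'⟩, ⟨hb.lt, fun c h h' => hb.2 (c := c.1) h h'⟩⟩

/-- The restriction of a morphism to the subtrees above corresponding edges. -/
def aboveMap {S T : RTree} (f : S ⟶ T) (e : S.Edge) : S.above e ⟶ T.above (edge f e) where
  toFun x := ⟨edge f x.1, (edge_le_iff f).2 x.2⟩
  le_iff := edge_le_iff f
  map_root := rfl
  cover t ht := by
    obtain ⟨l, hl, hlt⟩ := Hom.cover f t.1 fun y hy =>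
      ht (b := ⟨y, t.2.trans hy⟩) hy
    have hel : e ≤ l := by
      rcases T.chain hlt t.2 with h | h
      · exact hl ((edge_le_iff f).1 h)
      · exact (edge_le_iff f).1 h
    exact ⟨⟨l, hel⟩, fun y hy => hl (b := y.1) hy, hlt⟩

/-- The canonical isomorphism from `T` to its subtree above an edge which is the root. -/
def toAboveRoot (T : RTree) (e : T.Edge) (he : e = T.root) : T ⟶ T.above e where
  toFun x := ⟨x, he ▸ T.root_le x⟩
  le_iff := Iff.rfl
  map_root := Subtype.ext he.symm
  cover t ht := ⟨t.1, fun y hy => ht (b := ⟨y, t.2.trans hy⟩) hy, le_rfl⟩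

/-- The canonical isomorphism between the subtree above `x` of the subtree above `e`, and the
subtree above `x`. -/
def aboveAbove (T : RTree) (e : T.Edge) (x : (T.above e).Edge) :
    (T.above e).above x ⟶ T.above x.1 where
  toFun y := ⟨y.1.1, y.2⟩
  le_iff := Iff.rfl
  map_root := rfl
  cover t ht := ⟨⟨⟨t.1, x.2.trans t.2⟩, t.2⟩, fun y hy => ht (b := ⟨y.1.1, y.2⟩) hy, le_rfl⟩

/-- The effect of a morphism in `𝒜` on leaves. -/
def leafMap {S T : RTree} (f : S ⟶ T) (hf : inner f) (l : S.Leaf) : T.Leaf :=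
  ⟨edge f l.1, hf _ l.2⟩

lemma leafMap_bijective {S T : RTree} (f : S ⟶ T) (hf : inner f) :
    Function.Bijective (leafMap f hf) := by
  constructor
  · intro a b h
    exact Subtype.ext (edge_injective f (congrArg Subtype.val h))
  · intro t
    obtain ⟨l, hl, hlt⟩ := Hom.cover f t.1 t.2
    exact ⟨⟨l, hl⟩, Subtype.ext (le_antisymm hlt (hf l hl hlt))⟩

/-- A leaf of the subtree of `R` above a leaf of `S`, viewed as a leaf of `R`. -/
def leafOfAbove {S R : RTree} (f : S ⟶ R) (x : Σ l : S.Leaf, (R.above (edge f l.1)).Leaf) :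
    R.Leaf :=
  ⟨x.2.1.1, fun y hy => x.2.2 (b := ⟨y, x.2.1.2.trans hy⟩) hy⟩

lemma leaf_eq_of_le {S R : RTree} (f : S ⟶ R) {l m : S.Leaf} {y : R.Edge}
    (hl : edge f l.1 ≤ y) (hm : edge f m.1 ≤ y) : l = m := by
  apply Subtype.ext
  rcases R.chain hl hm with h | h
  · have h' := (edge_le_iff f).1 h
    exact le_antisymm h' (l.2 h')
  · have h' := (edge_le_iff f).1 h
    exact le_antisymm (m.2 h') h'

lemma leafOfAbove_bijective {S R : RTree} (f : S ⟶ R) : Function.Bijective (leafOfAbove f) := by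
  constructor
  · rintro ⟨l, x⟩ ⟨m, y⟩ h
    have h' : x.1.1 = y.1.1 := congrArg Subtype.val h
    obtain rfl : l = m := leaf_eq_of_le f x.1.2 (h' ▸ y.1.2)
    obtain rfl : x = y := Subtype.ext (Subtype.ext h')
    rfl
  · intro t
    obtain ⟨l, hl, hlt⟩ := Hom.cover f t.1 t.2
    exact ⟨⟨⟨l, hl⟩, ⟨⟨t.1, hlt⟩, fun y hy => t.2 (b := y.1) hy⟩⟩, rfl⟩

/-- `T` is the grafting of `R` onto `S` at a leaf of `S`: the tree `T` has an edge `e`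
such that `R` is identified with the subtree of all edges above `e`, and `S` with the subtree of
all edges not strictly above `e`. -/
structure Grafting (S R T : RTree) where
  lower : S.Edge → T.Edge
  upper : R.Edge → T.Edge
  lower_le_iff : ∀ {a b : S.Edge}, lower a ≤ lower b ↔ a ≤ b
  upper_le_iff : ∀ {a b : R.Edge}, upper a ≤ upper b ↔ a ≤ b
  range_lower : ∀ x : T.Edge, (∃ s, lower s = x) ↔ ¬ upper R.root < x
  range_upper : ∀ x : T.Edge, (∃ r, upper r = x) ↔ upper R.root ≤ x

/-- Cutting at one more leaf of `S`. -/
def cutGrafting {S R : RTree} (f : S ⟶ R) (a : S.Leaf) (l : List S.Leaf) (h : (a :: l).Nodup) :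
    Grafting (R.cut {e | ∃ b ∈ a :: l, edge f b.1 = e}) (R.above (edge f a.1))
      (R.cut {e | ∃ b ∈ l, edge f b.1 = e}) where
  lower x := ⟨x.1, fun e ⟨b, hb, he⟩ => x.2 e ⟨b, List.mem_cons_of_mem _ hb, he⟩⟩
  upper x := ⟨x.1, by
    rintro e ⟨b, hb, rfl⟩ hx
    exact (List.nodup_cons.1 h).1 (leaf_eq_of_le f x.2 hx.le ▸ hb)⟩
  lower_le_iff := Iff.rfl
  upper_le_iff := Iff.rfl
  range_lower x := by
    constructor
    · rintro ⟨s, rfl⟩ hx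
      exact s.2 _ ⟨a, List.mem_cons_self, rfl⟩ hx
    · intro hx
      refine ⟨⟨x.1, ?_⟩, rfl⟩
      rintro e ⟨b, hb, rfl⟩ hbx
      rcases List.mem_cons.1 hb with rfl | hb
      · exact hx hbx
      · exact x.2 _ ⟨b, hb, rfl⟩ hbx
  range_upper x := by
    constructor
    · rintro ⟨r, rfl⟩
      exact r.2
    · intro hx
      exact ⟨⟨x.1, hx⟩, rfl⟩

/-- Cutting nowhere. -/
def cutNil {S R : RTree} (f : S ⟶ R) : R.cut {e | ∃ b ∈ ([] : List S.Leaf), edge f b.1 = e} ⟶ R where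
  toFun x := x.1
  le_iff := Iff.rfl
  map_root := rfl
  cover t ht := ⟨⟨t, fun _ ⟨_, hb, _⟩ => absurd hb List.not_mem_nil⟩, fun y hy => ht (b := y.1) hy,
    le_rfl⟩

lemma cutNil_inner {S R : RTree} (f : S ⟶ R) : inner (cutNil f) := fun _ hl y hy =>
  hl (b := ⟨y, fun _ ⟨_, hb, _⟩ => absurd hb List.not_mem_nil⟩) hy

/-- The first part of the factorisation of `f : S ⟶ R` as a morphism in `𝒜` followed by a pruning:
the pruning is obtained by removing everything above the images of the leaves of `S`. -/
def toCut {S R : RTree} (f : S ⟶ R) : S ⟶ R.cut {e | ∃ b ∈ enum S.Leaf, edge f b.1 = e} where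
  toFun x := ⟨edge f x, by
    rintro e ⟨b, _, rfl⟩ h
    exact b.2.not_lt ((edge_lt_iff f).1 h)⟩
  le_iff := edge_le_iff f
  map_root := Subtype.ext (edge_root f)
  cover t ht := by
    obtain ⟨m, hm, htm⟩ := exists_leaf t.1
    obtain ⟨l, hl, hlm⟩ := Hom.cover f m hm
    refine ⟨l, hl, ?_⟩
    rcases R.chain hlm htm with h | h
    · exact h
    · exact ht (b := ⟨edge f l, _⟩) h

lemma toCut_inner {S R : RTree} (f : S ⟶ R) : inner (toCut f) := by
  intro l hl y hy
  have hy' : edge f l ≤ y.1 := hy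
  rcases hy'.eq_or_lt with h | h
  · exact h.ge
  · exact absurd h (y.2 _ ⟨⟨l, hl⟩, mem_enum _, rfl⟩)

end RTree

open RTree

/-- The category `𝒜` of open reduced trees, whose morphisms preserve the root and send leaves to
leaves. -/
abbrev ATree : Type 1 := WideSubcategory RTree.inner

/-- Presheaves of chain complexes on `ℛ`. -/
abbrev Psh (k : Type u) [Field k] := RTreeᵒᵖ ⥤ Ch k

/-! ### Preoperads -/

/-- Preoperads. -/
structure Preoperad (k : Type u) [Field k] where
  X : ATreeᵒᵖ ⥤ Ch k
  /-- the identification `X(η) = k` -/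
  unit : X.obj (op ⟨eta⟩) ≅ 𝟙_ (Ch k)
  /-- the structure maps `X(S ∘ₑ R) ⟶ X(S) ⊗ X(R)` -/
  θ : ∀ {S R T : RTree}, Grafting S R T →
    (X.obj (op ⟨T⟩) ⟶ X.obj (op ⟨S⟩) ⊗ X.obj (op ⟨R⟩))
  θ_natural : ∀ {S R T S' R' T' : RTree} (g : Grafting S R T) (g' : Grafting S' R' T')
    (s : (⟨S⟩ : ATree) ⟶ ⟨S'⟩) (r : (⟨R⟩ : ATree) ⟶ ⟨R'⟩) (t : (⟨T⟩ : ATree) ⟶ ⟨T'⟩),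
    (∀ x, edge t.hom (g.lower x) = g'.lower (edge s.hom x)) →
    (∀ x, edge t.hom (g.upper x) = g'.upper (edge r.hom x)) →
    X.map t.op ≫ θ g = θ g' ≫ (X.map s.op ⊗ₘ X.map r.op)
  /-- associativity for nested graftings `S ∘ (R ∘ U) = (S ∘ R) ∘ U` -/
  θ_nested : ∀ {S R U W P T : RTree} (g₁ : Grafting S W T) (g₂ : Grafting R U W)
    (g₃ : Grafting P U T) (g₄ : Grafting S R P),
    (∀ x, g₃.lower (g₄.lower x) = g₁.lower x) →
    (∀ x, g₃.lower (g₄.upper x) = g₁.upper (g₂.lower x)) →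
    (∀ x, g₃.upper x = g₁.upper (g₂.upper x)) →
    θ g₁ ≫ X.obj (op ⟨S⟩) ◁ θ g₂ = θ g₃ ≫ θ g₄ ▷ X.obj (op ⟨U⟩) ≫ (α_ _ _ _).hom
  /-- associativity for parallel graftings `(S ∘ R) ∘ U = (S ∘ U) ∘ R` -/
  θ_parallel : ∀ {S R U P Q T : RTree} (g₁ : Grafting P U T) (g₂ : Grafting S R P)
    (g₃ : Grafting Q R T) (g₄ : Grafting S U Q),
    (∀ x, g₁.lower (g₂.lower x) = g₃.lower (g₄.lower x)) →
    (∀ x, g₁.lower (g₂.upper x) = g₃.upper x) →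
    (∀ x, g₁.upper x = g₃.lower (g₄.upper x)) →
    θ g₁ ≫ θ g₂ ▷ X.obj (op ⟨U⟩) ≫ (α_ _ _ _).hom ≫ X.obj (op ⟨S⟩) ◁ (β_ _ _).hom =
      θ g₃ ≫ θ g₄ ▷ X.obj (op ⟨R⟩) ≫ (α_ _ _ _).hom
  /-- `θ` is the canonical isomorphism if `S = η` -/
  θ_eta_left : ∀ {R T : RTree} (g : Grafting eta R T) (r : (⟨R⟩ : ATree) ⟶ ⟨T⟩),
    (∀ x, edge r.hom x = g.upper x) →
    θ g ≫ unit.hom ▷ X.obj (op ⟨R⟩) ≫ (λ_ _).hom = X.map r.op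
  /-- `θ` is the canonical isomorphism if `R = η` -/
  θ_eta_right : ∀ {S T : RTree} (g : Grafting S eta T) (s : (⟨S⟩ : ATree) ⟶ ⟨T⟩),
    (∀ x, edge s.hom x = g.lower x) →
    θ g ≫ X.obj (op ⟨S⟩) ◁ unit.hom ≫ (ρ_ _).hom = X.map s.op

namespace Preoperad

variable {k : Type u} [Field k] (X : Preoperad k)

/-- The value of a preoperad at a tree. -/
abbrev val (T : RTree) : Ch k := X.X.obj (op ⟨T⟩)

/-- The iterated structure map `X(R) ⟶ X(R') ⊗ ⨂ₗ X(R(f)ₗ)`, where `l` runs through a list of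
leaves of `S` and `R'` is obtained from `R` by cutting at the images of these leaves. -/
noncomputable def thetaList {S R : RTree} (f : S ⟶ R) : (l : List S.Leaf) → l.Nodup →
    (X.val R ⟶ X.val (R.cut {e | ∃ b ∈ l, edge f b.1 = e}) ⊗
      tensList (fun b : S.Leaf => X.val (R.above (edge f b.1))) l)
  | [], _ => X.X.map (Quiver.Hom.op (X := (⟨_⟩ : ATree)) (Y := ⟨_⟩) ⟨cutNil f, cutNil_inner f⟩) ≫
      (ρ_ _).inv
  | a :: l, h => thetaList f l (List.nodup_cons.1 h).2 ≫ X.θ (cutGrafting f a l h) ▷ _ ≫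
      (α_ _ _ _).hom

/-- The iterated structure map `X(R) ⟶ X(S) ⊗ ⨂ₗ X(R(f)ₗ)` of a preoperad for `f : S ⟶ R` in `ℛ`,
where `l` runs through the leaves of `S`. -/
noncomputable def theta {S R : RTree} (f : S ⟶ R) :
    X.val R ⟶ X.val S ⊗ tens (fun l : S.Leaf => X.val (R.above (edge f l.1))) :=
  X.thetaList f (enum S.Leaf) (nodup_enum _) ≫
    X.X.map (Quiver.Hom.op (X := (⟨_⟩ : ATree)) (Y := ⟨_⟩) ⟨toCut f, toCut_inner f⟩) ▷ _

/-! ### Prealgebras -/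

variable (V W : Psh k)

/-- The complex `X(S) ⊗ V(T/S) = X(S) ⊗ ⨂ₗ V(T(f)ₗ)` for `f : S ⟶ T` in `ℛ`. -/
noncomputable def factor {S T : RTree} (f : S ⟶ T) : Ch k :=
  X.val S ⊗ tens (fun l : S.Leaf => V.obj (op (T.above (edge f l.1))))

variable {V W} in
/-- Functoriality of `X(S) ⊗ V(T/S)` in `V`. -/
noncomputable def factorMap (φ : V ⟶ W) {S T : RTree} (f : S ⟶ T) :
    X.factor V f ⟶ X.factor W f :=
  X.val S ◁ tensListMap (fun l : S.Leaf => φ.app (op (T.above (edge f l.1)))) (enum S.Leaf)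

/-- Functoriality of `X(S) ⊗ V(T/S)` in `T`. -/
noncomputable def factorRestrict {S T T' : RTree} (f : S ⟶ T) (g : T ⟶ T') :
    X.factor V (f ≫ g) ⟶ X.factor V f :=
  X.val S ◁ tensListMap (fun l : S.Leaf => V.map (aboveMap g (edge f l.1)).op) (enum S.Leaf)

/-- Functoriality of `X(S) ⊗ V(T/S)` in `S`, with respect to morphisms in `𝒜`. -/
noncomputable def factorInner {S S' T : RTree} (c : (⟨S⟩ : ATree) ⟶ ⟨S'⟩) (f : S' ⟶ T) :
    X.factor V f ⟶ X.factor V (c.hom ≫ f) :=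
  X.X.map c.op ⊗ₘ tensListReindex (leafMap c.hom c.property) (fun _ => 𝟙 _) (enum S.Leaf)
    (enum S'.Leaf) (perm_enum_map (leafMap_bijective c.hom c.property))

/-- The canonical isomorphism `X(η) ⊗ V(T/η) ⟶ V(T)`. -/
noncomputable def factorRoot (T : RTree) : X.factor V (rootHom T) ⟶ V.obj (op T) :=
  (X.unit.hom ⊗ₘ tensListReindex (W := fun _ : Unit => V.obj (op T))
      (fun _ => ⟨(), fun _ _ => le_rfl⟩)
      (fun _ => V.map (toAboveRoot T _ rfl).op) [()] (enum eta.Leaf)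
      (perm_enum (by simp) (fun _ => List.mem_singleton.2 rfl))) ≫
    (λ_ _).hom ≫ (ρ_ _).hom

variable {S R T : RTree} (f : S ⟶ R) (g : R ⟶ T)

/-- The family of all `V((T/S)ₗ/Rₗ)ₘ` for `l` a leaf of `S` and `m` a leaf of `R` above `l`. -/
abbrev nestedFamily (x : Σ l : S.Leaf, (R.above (edge f l.1)).Leaf) : Ch k :=
  V.obj (op ((T.above (edge (f ≫ g) x.1.1)).above (edge (aboveMap g (edge f x.1.1)) x.2.1)))

/-- The complex `X(S) ⊗ (⨂ₗ X(Rₗ) ⊗ ⨂ₘ V(Tₘ))`, where `l` runs over the leaves of `S` and `m` over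
those of `R`, the latter being indexed by the pairs of a leaf `l` of `S` and a leaf of `R`
above `l`. -/
noncomputable def doubleFactor : Ch k :=
  X.val S ⊗ (tens (fun l : S.Leaf => X.val (R.above (edge f l.1))) ⊗
    tensList (nestedFamily V f g)
      (sigmaList (fun l : S.Leaf => enum (R.above (edge f l.1)).Leaf) (enum S.Leaf)))

/-- The canonical isomorphism
`X(S) ⊗ ⨂ₗ (X(Rₗ) ⊗ ⨂ₘ V(Tₘ)) ⟶ X(S) ⊗ (⨂ₗ X(Rₗ) ⊗ ⨂ₘ V(Tₘ))`. -/
noncomputable def gather :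
    X.val S ⊗ tens (fun l : S.Leaf => X.factor V (aboveMap g (edge f l.1))) ⟶
      X.doubleFactor V f g :=
  X.val S ◁ (tensListShuffle (fun l : S.Leaf => X.val (R.above (edge f l.1)))
      (fun l : S.Leaf => tensList (fun m => nestedFamily V f g ⟨l, m⟩)
        (enum (R.above (edge f l.1)).Leaf)) (enum S.Leaf) ≫
    _ ◁ tensListFlatten (nestedFamily V f g) _ _)

/-- The map `X(R) ⊗ ⨂ₘ V(Tₘ) ⟶ X(S) ⊗ (⨂ₗ X(Rₗ) ⊗ ⨂ₘ V(Tₘ))` induced by the iterated structure map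
of `X`. -/
noncomputable def expand : X.factor V g ⟶ X.doubleFactor V f g :=
  (X.theta f ⊗ₘ tensListReindex (leafOfAbove f)
    (fun x => V.map (aboveAbove T (edge (f ≫ g) x.1.1) (edge (aboveMap g (edge f x.1.1)) x.2.1)).op)
    _ (enum R.Leaf)
    (perm_enum ((nodup_sigmaList _ (fun _ => nodup_enum _) _ (nodup_enum _)).map
      (leafOfAbove_bijective f).1) (fun m => by
        obtain ⟨x, rfl⟩ := (leafOfAbove_bijective f).2 m
        exact List.mem_map_of_mem ((mem_sigmaList _ _ _).2 ⟨mem_enum _, mem_enum _⟩)))) ≫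
    (α_ _ _ _).hom

end Preoperad

open Preoperad

/-- Prealgebras over a preoperad `X`. -/
structure Prealgebra {k : Type u} [Field k] (X : Preoperad k) where
  M : Psh k
  /-- the structure maps `M(T) ⟶ X(S) ⊗ M(T/S)` -/
  τ : ∀ {S T : RTree} (f : S ⟶ T), M.obj (op T) ⟶ X.factor M f
  τ_natural : ∀ {S T T' : RTree} (f : S ⟶ T) (g : T ⟶ T'),
    M.map g.op ≫ τ f = τ (f ≫ g) ≫ X.factorRestrict M f g
  τ_inner : ∀ {S S' T : RTree} (c : (⟨S⟩ : ATree) ⟶ ⟨S'⟩) (f : S' ⟶ T),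
    τ f ≫ X.factorInner M c f = τ (c.hom ≫ f)
  τ_eta : ∀ T : RTree, τ (rootHom T) ≫ X.factorRoot M T = 𝟙 _
  τ_assoc : ∀ {S R T : RTree} (f : S ⟶ R) (g : R ⟶ T),
    τ (f ≫ g) ≫ X.val S ◁ tensListMap (fun l : S.Leaf => τ (aboveMap g (edge f l.1))) (enum S.Leaf) ≫
      X.gather M f g = τ g ≫ X.expand M f g

namespace Prealgebra

variable {k : Type u} [Field k] {X : Preoperad k}

/-- Morphisms of prealgebras. -/
@[ext]
structure Hom (A B : Prealgebra X) where
  hom : A.M ⟶ B.M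
  comm : ∀ {S T : RTree} (f : S ⟶ T), hom.app (op T) ≫ B.τ f = A.τ f ≫ X.factorMap hom f

lemma factorMap_id (V : Psh k) {S T : RTree} (f : S ⟶ T) : X.factorMap (𝟙 V) f = 𝟙 _ := by
  simp only [factorMap, NatTrans.id_app]
  rw [tensListMap_id]
  exact MonoidalCategory.whiskerLeft_id _ _

lemma factorMap_comp {U V W : Psh k} (φ : U ⟶ V) (ψ : V ⟶ W) {S T : RTree} (f : S ⟶ T) :
    X.factorMap (φ ≫ ψ) f = X.factorMap φ f ≫ X.factorMap ψ f := by
  simp only [factorMap, NatTrans.comp_app]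
  rw [tensListMap_comp]
  exact MonoidalCategory.whiskerLeft_comp _ _ _

/-- The category of prealgebras over `X`. -/
instance : Category (Prealgebra X) where
  Hom := Hom
  id A := ⟨𝟙 _, fun f => by rw [factorMap_id]; simp⟩
  comp φ ψ := ⟨φ.hom ≫ ψ.hom, fun f => by
    rw [factorMap_comp, NatTrans.comp_app, Category.assoc, ψ.comm, ← Category.assoc, φ.comm,
      Category.assoc]⟩

variable (X) in
/-- The forgetful functor to presheaves. -/
def forget : Prealgebra X ⥤ Psh k where
  obj A := A.M
  map φ := Hom.hom φ

end Prealgebra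

/-! ### The comonad -/

/-- The comonad `H` on presheaves, together with projections
`H(V)(T) ⟶ X(S) ⊗ V(T/S)` for all `f : S ⟶ T` in `ℛ`, is the comonad `H_X`. -/
structure IsPrealgebraComonad {k : Type u} [Field k] (X : Preoperad k) (H : Comonad (Psh k))
    (π : ∀ (V : Psh k) {S T : RTree} (f : S ⟶ T),
      (H.toFunctor.obj V).obj (op T) ⟶ X.factor V f) : Prop where
  /-- The projections of an element of `H(V)(T)` form a family which is invariant with respect to
  the morphisms `S ⟶ S'` over `T` in `𝒜` ... -/
  invariant : ∀ (V : Psh k) {S S' T : RTree} (c : (⟨S⟩ : ATree) ⟶ ⟨S'⟩) (f : S' ⟶ T),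
    π V f ≫ X.factorInner V c f = π V (c.hom ≫ f)
  /-- ... and `H(V)(T)` is the complex of all invariant families. -/
  existsUnique_lift : ∀ (V : Psh k) (T : RTree) (Z : Ch k) (p : ∀ {S : RTree} (f : S ⟶ T),
      Z ⟶ X.factor V f),
    (∀ {S S' : RTree} (c : (⟨S⟩ : ATree) ⟶ ⟨S'⟩) (f : S' ⟶ T),
      p f ≫ X.factorInner V c f = p (c.hom ≫ f)) →
    ∃! q : Z ⟶ (H.toFunctor.obj V).obj (op T), ∀ {S : RTree} (f : S ⟶ T), q ≫ π V f = p f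
  /-- the presheaf structure of `H(V)` -/
  restrict_π : ∀ (V : Psh k) {S T T' : RTree} (f : S ⟶ T) (g : T ⟶ T'),
    (H.toFunctor.obj V).map g.op ≫ π V f = π V (f ≫ g) ≫ X.factorRestrict V f g
  /-- the functoriality of `H(V)` in `V` -/
  map_π : ∀ {V W : Psh k} (φ : V ⟶ W) {S T : RTree} (f : S ⟶ T),
    (H.toFunctor.map φ).app (op T) ≫ π W f = π V f ≫ X.factorMap φ f
  /-- the counit is the projection to `X(η) ⊗ V(T/η) = V(T)` -/
  counit_eq : ∀ (V : Psh k) (T : RTree),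
    (H.ε.app V).app (op T) = π V (rootHom T) ≫ X.factorRoot V T
  /-- the comultiplication is induced by the maps `X(R) ⟶ X(S) ⊗ ⨂ₗ X(Rₗ)` -/
  comul_π : ∀ (V : Psh k) {S R T : RTree} (f : S ⟶ R) (g : R ⟶ T),
    (H.δ.app V).app (op T) ≫ π (H.toFunctor.obj V) (f ≫ g) ≫
        X.val S ◁ tensListMap (fun l : S.Leaf => π V (aboveMap g (edge f l.1))) (enum S.Leaf) ≫
        X.gather V f g =
      π V g ≫ X.expand V f g

end Koszul

open Koszul

set_option linter.unusedSectionVars false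
-- The invariance condition removes all infinite products. Every map `f : S ⟶ T` factors uniquely as
-- a morphism of `𝒜` into a pruning of `T`, followed by the inclusion of that pruning; the pruning
-- is cut at the images of the leaves of `S`. So an invariant family is the same as an arbitrary
-- choice of components at the finitely many prunings of `T`. Accordingly `familyObj` is a finite
-- biproduct indexed by `Cut`, and `proj f` is the projection to the pruning of `f` followed by
-- functoriality in `𝒜`. Invariance (`proj_inner`) and the universal property (`exists_familyLift`,
-- `familyObj_hom_ext`) follow from uniqueness of the factorisation.
--
-- Finiteness is also what makes the comultiplication exist. The tensor product of complexes is
-- additive in each variable, so `⨂ₗ H(V)(Tₗ)` decomposes over the tuples of prunings of the trees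
-- `Tₗ` above the leaves `l` of `S`. A map into it may be prescribed freely on these pieces and is
-- determined by them (`exists_hom_of_pieces`, `hom_ext_of_pieces`). A tuple of prunings of the `Tₗ`
-- is the same as one pruning of `T` through which `S ⟶ T` factors, namely the union of the tuple
-- (`IsForest.union`). Hence the required formula for `δ`, which is indexed by factorisations `S ⟶ R
-- ⟶ T`, prescribes each component of `δ` exactly once. This gives `comul` and its characterisation
-- `comul_proj`.
--
-- To state that formula without an isomorphism on the wrong side, `gather` is inverted. The
-- resulting map `split`, from `X(R) ⊗ ⨂ₘ V(Tₘ)` to `X(S) ⊗ ⨂ₗ (X(Rₗ) ⊗ ⨂ₘ V(Tₘ))`, carries all the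
-- structure, and the comonad axioms become statements about it. Naturality of `δ` comes from
-- `split_natural`, the counit laws come from `split_rootHom` and `split_id`, and coassociativity
-- comes from `split_comp`. In each case both sides are tested against the projections belonging to
-- prunings of `T` (`tens_family_hom_ext`, `tens_family_hom_ext₂`).
--
-- The properties of `split` separate into two independent inputs. On the factors `V(Tₘ)` only
-- coherence in a symmetric monoidal category is needed: reindexing an iterated tensor product
-- depends only on the bijection of the indices (`tensListReindex_comp`), and it is compatible with
-- concatenation, flattening and shuffling. On the factors from `X` one needs that the iterated
-- structure map `theta` is natural, unital and associative (`theta_natural`, `theta_id`,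
-- `theta_rootHom`, `theta_comp`). Since `theta` is defined by cutting at the leaves in an arbitrary
-- order, it is replaced by the flexible relation `IsTheta`: a map obtained by splitting off given
-- pieces one after the other. All trees involved are realised inside one ambient tree, so that
-- graftings become conditions on sets of edges and compatibilities of inclusions are automatic.
-- Axiom `θ_parallel` makes the result independent of the order (`IsTheta.perm`, `IsTheta.reindex`),
-- and `θ_nested` gives associativity (`IsTheta.gather`).
--
-- Finally, a coaction `M ⟶ H(M)` is by the universal property an invariant family `τ`. Being a map
-- of presheaves, counitality and coassociativity then translate into naturality, unitality and
-- associativity of `τ`. The two translations are inverse on the nose because each coaction is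
-- determined by its projections.
namespace Koszul

open MonoidalCategory

/-! ### Moving one factor of a tensor product to the front -/

section Reindexing

variable {C : Type*} [Category C] [MonoidalCategory C]

/-- The tensor product along a nonempty list. -/
def tensCons {ι : Type} (V : ι → C) (i : ι) (l : List ι) :
    tensList V (i :: l) ≅ V i ⊗ tensList V l :=
  Iso.refl _

/-- The tensor product along the empty list. -/
def tensNil {ι : Type} (V : ι → C) : tensList V [] ≅ 𝟙_ C :=
  Iso.refl _

/-- The isomorphisms `tensCons` and `tensNil` are identities. Making them visible turns the
recursive definitions into honest equations between morphisms of a monoidal category, which can be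
rewritten and cancelled. -/
lemma tensListMap_cons {ι : Type} {V W : ι → C} (φ : ∀ i, V i ⟶ W i) (i : ι) (l : List ι) :
    tensListMap φ (i :: l) =
      (tensCons V i l).hom ≫ (φ i ⊗ₘ tensListMap φ l) ≫ (tensCons W i l).inv := by
  erw [Category.id_comp, Category.comp_id]
  rfl

lemma tensListMap_nil {ι : Type} {V W : ι → C} (φ : ∀ i, V i ⟶ W i) :
    tensListMap φ [] = (tensNil V).hom ≫ (tensNil W).inv :=
  (Category.id_comp _).symm

section Braided

variable [BraidedCategory C]

/-- Exchanging the first two factors of a right-nested tensor product. -/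
def tensSwap (A B Z : C) : A ⊗ B ⊗ Z ⟶ B ⊗ A ⊗ Z :=
  (α_ A B Z).inv ≫ (β_ A B).hom ▷ Z ≫ (α_ B A Z).hom

lemma tensSwap_natural {A A' B B' Z Z' : C} (f : A ⟶ A') (g : B ⟶ B') (h : Z ⟶ Z') :
    (f ⊗ₘ g ⊗ₘ h) ≫ tensSwap A' B' Z' = tensSwap A B Z ≫ (g ⊗ₘ f ⊗ₘ h) := by
  simp only [tensSwap, Category.assoc]
  rw [associator_inv_naturality_assoc, ← tensorHom_id, tensorHom_comp_tensorHom_assoc,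
    BraidedCategory.braiding_naturality, Category.comp_id, ← associator_naturality, ← tensorHom_id,
    tensorHom_comp_tensorHom_assoc, Category.id_comp]

lemma whiskerLeft_tensSwap (A B : C) {Z Z' : C} (h : Z ⟶ Z') :
    A ◁ B ◁ h ≫ tensSwap A B Z' = tensSwap A B Z ≫ B ◁ A ◁ h := by
  simpa using tensSwap_natural (𝟙 A) (𝟙 B) h

/-- This is the Yang–Baxter equation for the braiding, whiskered by the remaining factor `W`; the
rest is coherence of associators. -/
lemma tensSwap_yangBaxter (X Y Z W : C) :
    tensSwap X Y (Z ⊗ W) ≫ Y ◁ tensSwap X Z W ≫ tensSwap Y Z (X ⊗ W) =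
      X ◁ tensSwap Y Z W ≫ tensSwap X Z (Y ⊗ W) ≫ Z ◁ tensSwap X Y W := by
  have h : (α_ X Y (Z ⊗ W)).inv ≫ (α_ (X ⊗ Y) Z W).inv ≫
      ((β_ X Y).hom ▷ Z ⊗≫ Y ◁ (β_ X Z).hom ⊗≫ (β_ Y Z).hom ▷ X) ▷ W ≫
        (α_ (Z ⊗ Y) X W).hom ≫ (α_ Z Y (X ⊗ W)).hom =
      (α_ X Y (Z ⊗ W)).inv ≫ (α_ (X ⊗ Y) Z W).inv ≫
      (𝟙 _ ⊗≫ (X ◁ (β_ Y Z).hom ⊗≫ (β_ X Z).hom ▷ Y ⊗≫ Z ◁ (β_ X Y).hom) ⊗≫ 𝟙 _) ▷ W ≫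
        (α_ (Z ⊗ Y) X W).hom ≫ (α_ Z Y (X ⊗ W)).hom := by
    rw [BraidedCategory.yang_baxter' X Y Z]
  calc _ = _ := by simp only [tensSwap]; monoidal
    _ = _ := h
    _ = _ := by simp only [tensSwap]; monoidal

open Classical in
/-- Moving the factor with index `i` to the front, the list of the other indices being `m`. -/
noncomputable def tensListPull {ι : Type} (V : ι → C) (i : ι) (l m : List ι) (h : i ∈ l)
    (e : l.erase i = m) : tensList V l ⟶ V i ⊗ tensList V m :=
  tensListExtract V i l h ≫ eqToHom (by rw [e])

open Classical in
lemma tensListPull_head {ι : Type} (V : ι → C) (i : ι) (l : List ι)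
    (h : i ∈ i :: l) (e : (i :: l).erase i = l) :
    tensListPull V i (i :: l) l h e = (tensCons V i l).hom := by
  rw [tensListPull, tensListExtract, dif_pos rfl, eqToHom_trans]
  rfl

-- Keeping the remaining list as a variable with an equation, instead of writing `erase`, lets the
-- recursion for a head different from `i` be stated without transports: the head stays in place,
-- `i` is pulled out of the tail, and the two are exchanged.
open Classical in
lemma tensListPull_tail {ι : Type} (V : ι → C) (i j : ι) (l m : List ι) (hj : j ≠ i)
    (h : i ∈ j :: l) (e : (j :: l).erase i = j :: m) (h' : i ∈ l) (e' : l.erase i = m) :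
    tensListPull V i (j :: l) (j :: m) h e =
      (tensCons V j l).hom ≫ V j ◁ tensListPull V i l m h' e' ≫
        tensSwap (V j) (V i) (tensList V m) ≫ V i ◁ (tensCons V j m).inv := by
  subst e'
  have key : ∀ (x : List ι) (hx : x = j :: l.erase i)
      (p : V i ⊗ V j ⊗ tensList V (l.erase i) = V i ⊗ tensList V x)
      (q : V i ⊗ tensList V x = V i ⊗ tensList V (j :: l.erase i)),
      eqToHom p ≫ eqToHom q = V i ◁ (tensCons V j (l.erase i)).inv := by
    rintro x rfl p q
    rw [eqToHom_refl _ q, Category.comp_id]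
    exact (MonoidalCategory.whiskerLeft_id _ _).symm
  rw [← key _ e (by rw [e]; rfl) (by rw [e]), tensListPull, tensListPull, tensListExtract,
    dif_neg hj, eqToHom_refl _ rfl, Category.comp_id]
  refine Eq.trans ?_ (Category.id_comp _).symm
  have reassociate : ∀ {X₁ X₂ X₃ X₄ X₅ X₆ X₇ : C} (a : X₁ ⟶ X₂) (b : X₂ ⟶ X₃) (c : X₃ ⟶ X₄)
      (d : X₄ ⟶ X₅) (e : X₅ ⟶ X₆) (f : X₆ ⟶ X₇),
      (a ≫ b ≫ c ≫ d ≫ e) ≫ f = a ≫ (b ≫ c ≫ d) ≫ e ≫ f := by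
    intros
    simp only [Category.assoc]
  exact reassociate _ _ _ _ _ _

open Classical in
lemma erase_cons_ne {ι : Type} {i j : ι} (hj : j ≠ i) (l : List ι) :
    (j :: l).erase i = j :: l.erase i :=
  List.erase_cons_tail (by simpa using hj)

open Classical in
lemma tensListReindex_cons {ι κ : Type} {V : ι → C} {W : κ → C} (f : κ → ι)
    (φ : ∀ j, V (f j) ⟶ W j) (j : κ) (l' : List κ) (l m : List ι)
    (h : l.Perm ((j :: l').map f)) (hi : f j ∈ l) (e : l.erase (f j) = m)
    (h' : m.Perm (l'.map f)) :
    tensListReindex f φ (j :: l') l h =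
      tensListPull V (f j) l m hi e ≫ (φ j ⊗ₘ tensListReindex f φ l' m h') ≫
        (tensCons W j l').inv := by
  subst e
  rw [tensListPull, eqToHom_refl]
  change _ = (_ ≫ 𝟙 _) ≫ _ ≫ 𝟙 _
  rw [Category.comp_id]
  erw [Category.comp_id]
  rfl

lemma tensListReindex_nil {ι κ : Type} {V : ι → C} {W : κ → C} (f : κ → ι)
    (φ : ∀ j, V (f j) ⟶ W j) (h : ([] : List ι).Perm ([].map f)) :
    tensListReindex (V := V) (W := W) f φ [] [] h = (tensNil V).hom ≫ (tensNil W).inv := by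
  rw [tensListReindex]
  exact (Category.id_comp _).symm

end Braided

variable [SymmetricCategory C]

lemma tensSwap_tensSwap (A B Z : C) : tensSwap A B Z ≫ tensSwap B A Z = 𝟙 _ := by
  simp only [tensSwap, Category.assoc, Iso.hom_inv_id_assoc]
  rw [← comp_whiskerRight_assoc, SymmetricCategory.symmetry]
  simp

-- Independence of the order in which two factors are extracted. If the head of the list is one of
-- the two, the claim is the involutivity of the exchange; otherwise the head must pass both
-- factors, and the Yang–Baxter equation reduces the claim to the tail.
open Classical in
lemma tensListPull_comm {ι : Type} (V : ι → C) (a b : ι) (hab : a ≠ b) (l m m' n : List ι)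
    (h₁ : a ∈ l) (e₁ : l.erase a = m) (h₂ : b ∈ m) (e₂ : m.erase b = n)
    (h₃ : b ∈ l) (e₃ : l.erase b = m') (h₄ : a ∈ m') (e₄ : m'.erase a = n) :
    tensListPull V a l m h₁ e₁ ≫ V a ◁ tensListPull V b m n h₂ e₂ =
      tensListPull V b l m' h₃ e₃ ≫ V b ◁ tensListPull V a m' n h₄ e₄ ≫
        tensSwap (V b) (V a) (tensList V n) := by
  induction l generalizing m m' n with
  | nil => exact absurd h₁ List.not_mem_nil
  | cons j l ih =>
    by_cases hja : j = a
    · subst hja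
      obtain rfl : m = l := by rw [← e₁, List.erase_cons_head]
      have : m' = j :: n := by rw [← e₃, erase_cons_ne hab, e₂]
      subst this
      rw [tensListPull_head, tensListPull_head, tensListPull_tail V b j _ _ hab _ _ h₂ e₂]
      simp only [Category.assoc]
      rw [← MonoidalCategory.whiskerLeft_comp_assoc, Iso.inv_hom_id,
        MonoidalCategory.whiskerLeft_id, Category.id_comp, tensSwap_tensSwap, Category.comp_id]
    by_cases hjb : j = b
    · subst hjb
      obtain rfl : m' = l := by rw [← e₃, List.erase_cons_head]
      have : m = j :: n := by rw [← e₁, erase_cons_ne hab.symm, e₄]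
      subst this
      rw [tensListPull_head, tensListPull_head, tensListPull_tail V a j _ _ hab.symm _ _ h₄ e₄]
      simp only [Category.assoc]
      rw [← MonoidalCategory.whiskerLeft_comp, Iso.inv_hom_id,
        MonoidalCategory.whiskerLeft_id, Category.comp_id]
    have ha : a ∈ l := (List.mem_cons.1 h₁).resolve_left (fun e => hja e.symm)
    have hb : b ∈ l := (List.mem_cons.1 h₃).resolve_left (fun e => hjb e.symm)
    have em : m = j :: l.erase a := by rw [← e₁, erase_cons_ne hja]
    have em' : m' = j :: l.erase b := by rw [← e₃, erase_cons_ne hjb]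
    subst em em'
    have hb' : b ∈ l.erase a := (List.mem_erase_of_ne hab.symm).2 hb
    have ha' : a ∈ l.erase b := (List.mem_erase_of_ne hab).2 ha
    have en : n = j :: (l.erase a).erase b := by rw [← e₂, erase_cons_ne hjb]
    subst en
    have IH := ih (l.erase a) (l.erase b) ((l.erase a).erase b) ha rfl hb' rfl hb rfl ha'
      (List.erase_comm b a)
    rw [tensListPull_tail V a j _ _ hja _ _ ha rfl, tensListPull_tail V b j _ _ hjb _ _ hb rfl,
      tensListPull_tail V b j _ _ hjb _ _ hb' rfl,
      tensListPull_tail V a j _ _ hja _ _ ha' (List.erase_comm b a)]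
    simp only [MonoidalCategory.whiskerLeft_comp, Category.assoc]
    simp only [MonoidalCategory.whiskerLeft_inv_hom_assoc]
    rw [← reassoc_of% (whiskerLeft_tensSwap (V j) (V a) (tensListPull V b _ _ hb' rfl)),
      ← reassoc_of% (whiskerLeft_tensSwap (V j) (V b)
        (tensListPull V a _ _ ha' (List.erase_comm b a)))]
    simp only [← MonoidalCategory.whiskerLeft_comp_assoc, IH]
    simp only [MonoidalCategory.whiskerLeft_comp, Category.assoc]
    -- At this point the factors `j`, `a`, `b` are reversed in two different ways.
    rw [whiskerLeft_tensSwap, ← reassoc_of% tensSwap_yangBaxter]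

end Reindexing

end Koszul

/-! ### Functoriality of reindexing; concatenation and relabelling -/

namespace Koszul

open MonoidalCategory

section Reindexing

variable {C : Type*} [Category C] [MonoidalCategory C] [SymmetricCategory C]

lemma tensSwap_whiskerRight (A B Z W : C) :
    tensSwap A B Z ▷ W ≫ (α_ _ _ _).hom ≫ B ◁ (α_ A Z W).hom =
      (α_ _ _ _).hom ≫ A ◁ (α_ B Z W).hom ≫ tensSwap A B (Z ⊗ W) := by
  simp only [tensSwap]
  monoidal

/-- A hexagon identity: a compound factor is moved past `B` by moving its parts one at a time. -/
lemma tensSwap_tensor_left (A₁ A₂ B Z : C) :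
    tensSwap (A₁ ⊗ A₂) B Z ≫ B ◁ (α_ A₁ A₂ Z).hom =
      (α_ _ _ _).hom ≫ A₁ ◁ tensSwap A₂ B Z ≫ tensSwap A₁ B (A₂ ⊗ Z) := by
  simp only [tensSwap, BraidedCategory.braiding_tensor_left_hom]
  monoidal

lemma tensSwap_tensor_right (A B₁ B₂ Z : C) :
    A ◁ (α_ B₁ B₂ Z).inv ≫ tensSwap A (B₁ ⊗ B₂) Z =
      tensSwap A B₁ (B₂ ⊗ Z) ≫ B₁ ◁ tensSwap A B₂ Z ≫ (α_ _ _ _).inv := by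
  simp only [tensSwap, BraidedCategory.braiding_tensor_right_hom]
  monoidal

lemma tensSwap_unit_left (B Z : C) :
    tensSwap (𝟙_ C) B Z = (λ_ _).hom ≫ B ◁ (λ_ Z).inv := by
  simp only [tensSwap, braiding_tensorUnit_left]
  monoidal

lemma tensSwap_unit_right (A Z : C) :
    tensSwap A (𝟙_ C) Z = A ◁ (λ_ Z).hom ≫ (λ_ _).inv := by
  simp only [tensSwap, braiding_tensorUnit_right]
  monoidal

-- Extraction is natural for reindexing. Induction on the target list; when its head `j` is not `i`,
-- both `f j` and `f i` are pulled out of `l`, in opposite orders on the two sides, and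
-- `tensListPull_comm` compares them.
open Classical in
lemma tensListReindex_pull {ι κ : Type} {V : ι → C} {W : κ → C} (f : κ → ι)
    (φ : ∀ j, V (f j) ⟶ W j) (i : κ) (l' m' : List κ) (l m : List ι) (h : l.Perm (l'.map f))
    (hl : l.Nodup) (hi : i ∈ l') (e' : l'.erase i = m') (hi' : f i ∈ l) (e : l.erase (f i) = m)
    (h' : m.Perm (m'.map f)) :
    tensListReindex f φ l' l h ≫ tensListPull W i l' m' hi e' =
      tensListPull V (f i) l m hi' e ≫ (φ i ⊗ₘ tensListReindex f φ m' m h') := by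
  induction l' generalizing m' l m with
  | nil => exact absurd hi List.not_mem_nil
  | cons j l' ih =>
    have hnd : ((j :: l').map f).Nodup := h.nodup_iff.1 hl
    by_cases hj : j = i
    · subst hj
      obtain rfl : m' = l' := by rw [← e', List.erase_cons_head]
      rw [tensListReindex_cons f φ j _ l m h hi' e h', tensListPull_head]
      simp only [Category.assoc, Iso.inv_hom_id, Category.comp_id]
    · have hi₂ : i ∈ l' := (List.mem_cons.1 hi).resolve_left (fun e => hj e.symm)
      -- Distinctness of the entries of `l` matters here: otherwise the factor pulled out for `i`
      -- could be the one used for `j`.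
      have hf : f j ≠ f i := fun hh =>
        (List.nodup_cons.1 hnd).1 (hh ▸ List.mem_map_of_mem hi₂)
      have em : m' = j :: l'.erase i := by rw [← e', erase_cons_ne hj]
      subst em
      have hj' : f j ∈ l := h.mem_iff.2 List.mem_cons_self
      have hp : (l.erase (f j)).Perm (l'.map f) := (List.cons_perm_iff_perm_erase.1 h.symm).2.symm
      have hip : f i ∈ l.erase (f j) := (List.mem_erase_of_ne hf.symm).2 hi'
      have hjm : f j ∈ m := e ▸ (List.mem_erase_of_ne hf).2 hj'
      have hee : m.erase (f j) = (l.erase (f j)).erase (f i) := by rw [← e, List.erase_comm]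
      have hq : ((l.erase (f j)).erase (f i)).Perm ((l'.erase i).map f) := by
        rw [← hee]
        exact (List.cons_perm_iff_perm_erase.1 h'.symm).2.symm
      rw [tensListReindex_cons f φ j l' l (l.erase (f j)) h hj' rfl hp,
        tensListReindex_cons f φ j (l'.erase i) m ((l.erase (f j)).erase (f i)) h' hjm hee hq,
        tensListPull_tail W i j _ _ hj hi e' hi₂ rfl]
      simp only [Category.assoc, Iso.inv_hom_id_assoc]
      rw [tensorHom_comp_whiskerLeft_assoc,
        ih (l'.erase i) (l.erase (f j)) ((l.erase (f j)).erase (f i)) hp (hl.erase _) hi₂ rfl hip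
          rfl hq,
        ← whiskerLeft_comp_tensorHom_assoc, reassoc_of% tensSwap_natural,
        ← whiskerLeft_comp_tensorHom, reassoc_of% (tensListPull_comm V (f i) (f j) hf.symm l m
          (l.erase (f j)) _ hi' e hjm hee hj' rfl hip rfl), tensorHom_comp_whiskerLeft]

lemma tensListReindex_congr {ι κ : Type} {V : ι → C} {W : κ → C} {f f' : κ → ι} (hf : f = f')
    {φ : ∀ j, V (f j) ⟶ W j} {φ' : ∀ j, V (f' j) ⟶ W j}
    (hφ : ∀ j, φ j = eqToHom (by rw [hf]) ≫ φ' j) (l' : List κ) (l : List ι)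
    (h : l.Perm (l'.map f)) (h' : l.Perm (l'.map f')) :
    tensListReindex (W := W) f φ l' l h = tensListReindex f' φ' l' l h' := by
  subst hf
  congr 1
  funext j
  rw [hφ j, eqToHom_refl, Category.id_comp]

-- The coherence statement used for every permutation of factors below. By induction on the last
-- list, its first factor is pulled out of the middle list, and `tensListReindex_pull` carries this
-- extraction back to the first list.
open Classical in
lemma tensListReindex_comp {ι κ μ : Type} {V : ι → C} {W : κ → C} {U : μ → C} (f : κ → ι)
    (φ : ∀ j, V (f j) ⟶ W j) (g : μ → κ) (ψ : ∀ j, W (g j) ⟶ U j)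
    (l'' : List μ) (l' : List κ) (l : List ι) (h : l.Perm (l'.map f)) (h' : l'.Perm (l''.map g))
    (hl : l.Nodup) (h'' : l.Perm (l''.map (fun j => f (g j)))) :
    tensListReindex f φ l' l h ≫ tensListReindex g ψ l'' l' h' =
      tensListReindex (V := V) (W := U) (fun j => f (g j)) (fun j => φ (g j) ≫ ψ j) l'' l h'' := by
  induction l'' generalizing l l' with
  | nil =>
    obtain rfl : l' = [] := List.perm_nil.1 h'
    obtain rfl : l = [] := List.perm_nil.1 h
    rw [tensListReindex_nil, tensListReindex_nil, tensListReindex_nil]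
    simp
  | cons j l'' ih =>
    have hj : g j ∈ l' := h'.mem_iff.2 List.mem_cons_self
    have hj' : f (g j) ∈ l := h''.mem_iff.2 List.mem_cons_self
    have hp := (List.cons_perm_iff_perm_erase.1 h'.symm).2.symm
    have hp'' := (List.cons_perm_iff_perm_erase.1 h''.symm).2.symm
    have hp' : (l.erase (f (g j))).Perm ((l'.erase (g j)).map f) := by
      have h1 : l.Perm (f (g j) :: (l'.erase (g j)).map f) :=
        h.trans ((List.perm_cons_erase hj).map f)
      exact (List.cons_perm_iff_perm_erase.1 h1.symm).2.symm
    rw [tensListReindex_cons g ψ j l'' l' _ h' hj rfl hp,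
      tensListReindex_cons (V := V) _ _ j l'' l _ h'' hj' rfl hp'',
      reassoc_of% (tensListReindex_pull f φ (g j) l' _ l _ h hl hj rfl hj' rfl hp'),
      tensorHom_comp_tensorHom_assoc, ih (l'.erase (g j)) (l.erase (f (g j))) hp' hp (hl.erase _)]

/-- With this, naturality of any construction in the family becomes the case of the identity
bijection of its compatibility with reindexing. -/
lemma tensListMap_eq_reindex {ι : Type} {V W : ι → C} (φ : ∀ i, V i ⟶ W i) (l : List ι)
    (h : l.Perm (l.map (fun i => i))) :
    tensListMap φ l = tensListReindex (V := V) (W := W) (fun i => i) φ l l h := by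
  classical
  induction l with
  | nil => rw [tensListMap_nil, tensListReindex_nil]
  | cons i l ih =>
    rw [tensListMap_cons, tensListReindex_cons _ φ i l (i :: l) l h List.mem_cons_self
      (List.erase_cons_head ..) (by simp), tensListPull_head, ih]

lemma tensListReindex_id {ι : Type} (V : ι → C) (l : List ι) (h : l.Perm (l.map (fun i => i))) :
    tensListReindex (V := V) (W := V) (fun i => i) (fun i => 𝟙 (V i)) l l h = 𝟙 _ := by
  rw [← tensListMap_eq_reindex, tensListMap_id]

lemma tensListMap_reindex {ι κ : Type} {V W : ι → C} {U : κ → C} (φ : ∀ i, V i ⟶ W i)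
    (f : κ → ι) (ψ : ∀ j, W (f j) ⟶ U j) (l' : List κ) (l : List ι) (h : l.Perm (l'.map f))
    (hl : l.Nodup) :
    tensListMap φ l ≫ tensListReindex f ψ l' l h =
      tensListReindex f (fun j => φ (f j) ≫ ψ j) l' l h := by
  rw [tensListMap_eq_reindex φ l (by simp), tensListReindex_comp _ _ _ _ _ _ _ _ _ hl]

lemma tensListReindex_map {ι κ : Type} {V : ι → C} {W U : κ → C}
    (f : κ → ι) (φ : ∀ j, V (f j) ⟶ W j) (ψ : ∀ j, W j ⟶ U j) (l' : List κ) (l : List ι)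
    (h : l.Perm (l'.map f)) (hl : l.Nodup) :
    tensListReindex f φ l' l h ≫ tensListMap ψ l' =
      tensListReindex f (fun j => φ j ≫ ψ j) l' l h := by
  rw [tensListMap_eq_reindex ψ l' (by simp), tensListReindex_comp _ _ _ _ _ _ _ _ _ hl]

/-! #### Concatenation and relabelling -/

lemma tensListRelabel_nil {ι κ : Type} (V : ι → C) (f : κ → ι) :
    tensListRelabel V f [] = (tensNil _).hom ≫ (tensNil V).inv :=
  (Category.id_comp _).symm

lemma tensListRelabel_cons {ι κ : Type} (V : ι → C) (f : κ → ι) (j : κ) (l : List κ) :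
    tensListRelabel V f (j :: l) =
      (tensCons _ j l).hom ≫ V (f j) ◁ tensListRelabel V f l ≫ (tensCons V (f j) (l.map f)).inv := by
  erw [Category.id_comp, Category.comp_id]
  rfl

lemma tensListAppend_nil {ι : Type} (V : ι → C) (l' : List ι) :
    tensListAppend V l' [] = (tensNil V).hom ▷ _ ≫ (λ_ _).hom := by
  erw [id_whiskerRight, Category.id_comp]
  rfl

lemma tensListAppend_cons {ι : Type} (V : ι → C) (l' : List ι) (i : ι) (l : List ι) :
    tensListAppend V l' (i :: l) = (tensCons V i l).hom ▷ _ ≫ (α_ _ _ _).hom ≫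
      V i ◁ tensListAppend V l' l ≫ (tensCons V i (l ++ l')).inv := by
  erw [id_whiskerRight, Category.id_comp, Category.comp_id]
  rfl

/-- Relabelling along `f` is undone by reindexing along `f` with identity components, since neither
changes the order of the factors; the general case follows by functoriality of reindexing. -/
lemma tensListRelabel_reindex {ι κ μ : Type} (V : ι → C) {W : μ → C} (f : κ → ι) (g : μ → κ)
    (φ : ∀ j, V (f (g j)) ⟶ W j) (l' : List μ) (l : List κ) (h : l.Perm (l'.map g))
    (h' : (l.map f).Perm (l'.map (fun j => f (g j)))) (hl : (l.map f).Nodup) :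
    tensListRelabel V f l ≫ tensListReindex (V := V) (W := W) (fun j => f (g j)) φ l' (l.map f) h' =
      tensListReindex (V := fun j => V (f j)) (W := W) g φ l' l h := by
  classical
  have hself : ∀ l : List κ, (l.map f).Nodup →
      tensListRelabel V f l ≫ tensListReindex (V := V) (W := fun j => V (f j)) f
        (fun j => 𝟙 (V (f j))) l (l.map f) (List.Perm.refl _) = 𝟙 _ := by
    intro l hl
    induction l with
    | nil =>
      rw [tensListRelabel_nil]
      erw [tensListReindex_nil]
      simp
    | cons j l ih =>
      rw [tensListRelabel_cons]
      erw [tensListReindex_cons (V := V) f (fun j => 𝟙 (V (f j))) j l (f j :: l.map f) (l.map f)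
        (List.Perm.refl _) List.mem_cons_self (List.erase_cons_head ..) (List.Perm.refl _),
        tensListPull_head]
      simp only [Category.assoc, Iso.inv_hom_id_assoc, id_tensorHom]
      rw [← MonoidalCategory.whiskerLeft_comp_assoc, ih (List.nodup_cons.1 hl).2]
      simp
  have h1 := tensListReindex_comp (V := V) (W := fun j => V (f j)) (U := W) f
    (fun j => 𝟙 (V (f j))) g φ l' l (l.map f) (List.Perm.refl _) h hl h'
  simp only [Category.id_comp] at h1
  rw [← h1, ← Category.assoc, hself l hl, Category.id_comp]

lemma tensListReindex_self_relabel {ι κ : Type} (V : ι → C) (f : κ → ι) (l : List κ)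
    (h : (l.map f).Perm (l.map f)) :
    tensListReindex (V := V) (W := fun j => V (f j)) f
      (fun j => 𝟙 (V (f j))) l (l.map f) h ≫ tensListRelabel V f l = 𝟙 _ := by
  classical
  induction l with
  | nil =>
    rw [tensListRelabel_nil]
    erw [tensListReindex_nil]
    simp
  | cons j l ih =>
    rw [tensListRelabel_cons]
    erw [tensListReindex_cons (V := V) f (fun j => 𝟙 (V (f j))) j l (f j :: l.map f) (l.map f)
      h List.mem_cons_self (List.erase_cons_head ..) (List.Perm.refl _),
      tensListPull_head]
    simp only [Category.assoc, Iso.inv_hom_id_assoc, id_tensorHom]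
    rw [← MonoidalCategory.whiskerLeft_comp_assoc, ih]
    simp

/-- Reindexing to `l'.map f` is determined by its composite with the relabelling. -/
lemma tensListReindex_relabel {ι κ μ : Type} {V : ι → C} (W : μ → C) (f : κ → μ) (g : μ → ι)
    (φ : ∀ j, V (g j) ⟶ W j) (l' : List κ) (l : List ι) (h : l.Perm (l'.map (fun j => g (f j))))
    (h' : l.Perm ((l'.map f).map g)) (hl : l.Nodup) :
    tensListReindex (V := V) (W := fun j => W (f j)) (fun j => g (f j)) (fun j => φ (f j)) l' l h ≫
      tensListRelabel W f l' = tensListReindex g φ (l'.map f) l h' := by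
  have h1 := tensListReindex_comp (V := V) (W := W) (U := fun j => W (f j)) g φ f
    (fun j => 𝟙 (W (f j))) l' (l'.map f) l h' (List.Perm.refl _) hl h
  simp only [Category.comp_id] at h1
  rw [← h1, Category.assoc, tensListReindex_self_relabel, Category.comp_id]

open Classical in
lemma tensListAppend_pull_left {ι : Type} (V : ι → C) (l₂ : List ι) (i : ι) (l m : List ι)
    (h : i ∈ l) (e : l.erase i = m) (h' : i ∈ l ++ l₂) (e' : (l ++ l₂).erase i = m ++ l₂) :
    tensListAppend V l₂ l ≫ tensListPull V i (l ++ l₂) (m ++ l₂) h' e' =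
      tensListPull V i l m h e ▷ _ ≫ (α_ _ _ _).hom ≫ V i ◁ tensListAppend V l₂ m := by
  induction l generalizing m with
  | nil => exact absurd h List.not_mem_nil
  | cons j l ih =>
    by_cases hj : j = i
    · subst hj
      obtain rfl : m = l := by rw [← e, List.erase_cons_head]
      rw [tensListPull_head, tensListAppend_cons]
      erw [tensListPull_head]
      simp
    · have hi : i ∈ l := (List.mem_cons.1 h).resolve_left (fun e => hj e.symm)
      have em : m = j :: l.erase i := by rw [← e, erase_cons_ne hj]
      subst em
      have e₂ : (l ++ l₂).erase i = l.erase i ++ l₂ := List.erase_append_left _ hi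
      rw [tensListPull_tail V i j l _ hj h e hi rfl, tensListAppend_cons, tensListAppend_cons]
      erw [tensListPull_tail V i j (l ++ l₂) (l.erase i ++ l₂) hj h' e'
        (List.mem_append_left _ hi) e₂]
      simp only [Category.assoc, Iso.inv_hom_id_assoc]
      rw [← MonoidalCategory.whiskerLeft_comp_assoc, ih _ hi rfl (List.mem_append_left _ hi) e₂]
      simp only [comp_whiskerRight, MonoidalCategory.whiskerLeft_comp, Category.assoc]
      rw [reassoc_of% whiskerLeft_tensSwap]
      simp only [whisker_assoc, Category.assoc, Iso.inv_hom_id_assoc]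
      rw [← MonoidalCategory.whiskerLeft_comp_assoc (V i) ((tensCons V j _).inv ▷ _),
        inv_hom_whiskerRight, MonoidalCategory.whiskerLeft_id, Category.id_comp,
        reassoc_of% tensSwap_whiskerRight, Iso.inv_hom_id_assoc]

-- As `i` does not occur in `l₁`, it has to travel past the whole block `l₁`. The exchange with the
-- block unfolds, by the hexagon identity, into exchanges with the single factors.
open Classical in
lemma tensListAppend_pull_right {ι : Type} (V : ι → C) (l₁ : List ι) (i : ι) (l m : List ι)
    (h : i ∈ l) (e : l.erase i = m) (hi : i ∉ l₁) (h' : i ∈ l₁ ++ l)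
    (e' : (l₁ ++ l).erase i = l₁ ++ m) :
    tensListAppend V l l₁ ≫ tensListPull V i (l₁ ++ l) (l₁ ++ m) h' e' =
      _ ◁ tensListPull V i l m h e ≫ tensSwap _ _ _ ≫ V i ◁ tensListAppend V m l₁ := by
  induction l₁ with
  | nil =>
    rw [tensListAppend_nil, tensListAppend_nil, MonoidalCategory.whiskerLeft_comp]
    have h1 : tensSwap (tensList V []) (V i) (tensList V m) ≫ V i ◁ (tensNil V).hom ▷ _ =
        (tensNil V).hom ▷ _ ≫ tensSwap _ _ _ := by
      simpa using (tensSwap_natural (tensNil V).hom (𝟙 (V i)) (𝟙 (tensList V m))).symm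
    rw [reassoc_of% h1, tensSwap_unit_left, Category.assoc, Category.assoc,
      ← MonoidalCategory.whiskerLeft_comp, Iso.inv_hom_id, MonoidalCategory.whiskerLeft_id,
      Category.comp_id, whisker_exchange_assoc]
    exact congrArg _ (leftUnitor_naturality _).symm
  | cons j l₁ ih =>
    have hj : j ≠ i := fun hh => hi (hh ▸ List.mem_cons_self)
    have hi' : i ∉ l₁ := fun hh => hi (List.mem_cons_of_mem _ hh)
    have e₂ : (l₁ ++ l).erase i = l₁ ++ m := by rw [List.erase_append_right _ hi', e]
    have h₂ : i ∈ l₁ ++ l := List.mem_append_right _ h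
    rw [tensListAppend_cons, tensListAppend_cons]
    erw [tensListPull_tail V i j (l₁ ++ l) (l₁ ++ m) hj h' e' h₂ e₂]
    simp only [Category.assoc, Iso.inv_hom_id_assoc]
    rw [← MonoidalCategory.whiskerLeft_comp_assoc, ih hi' h₂ e₂]
    have h1 : tensSwap (tensList V (j :: l₁)) (V i) (tensList V m) ≫ V i ◁ (tensCons V j l₁).hom ▷ _ =
        (tensCons V j l₁).hom ▷ _ ≫ tensSwap _ _ _ := by
      simpa using (tensSwap_natural (tensCons V j l₁).hom (𝟙 (V i)) (𝟙 (tensList V m))).symm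
    simp only [MonoidalCategory.whiskerLeft_comp, Category.assoc]
    rw [reassoc_of% whiskerLeft_tensSwap, reassoc_of% h1, reassoc_of% tensSwap_tensor_left,
      whisker_exchange_assoc, associator_naturality_right_assoc]

end Reindexing

end Koszul

/-! ### Reindexing against flattening and shuffling -/

namespace Koszul

open MonoidalCategory

section Flattening

variable {C : Type*} [Category C] [MonoidalCategory C] [SymmetricCategory C]

/-- Induction on `l₁'`: its first factor is found in `l₁`, so the extraction takes place in the left
block and commutes with concatenation by `tensListAppend_pull_left`. -/
lemma tensListReindex_append {ι κ : Type} {V : ι → C} {W : κ → C} (f : κ → ι)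
    (φ : ∀ j, V (f j) ⟶ W j) (l₁' l₂' : List κ) (l₁ l₂ : List ι) (h₁ : l₁.Perm (l₁'.map f))
    (h₂ : l₂.Perm (l₂'.map f)) (h : (l₁ ++ l₂).Perm ((l₁' ++ l₂').map f)) :
    (tensListReindex f φ l₁' l₁ h₁ ⊗ₘ tensListReindex f φ l₂' l₂ h₂) ≫ tensListAppend W l₂' l₁' =
      tensListAppend V l₂ l₁ ≫ tensListReindex f φ (l₁' ++ l₂') (l₁ ++ l₂) h := by
  classical
  induction l₁' generalizing l₁ with
  | nil =>
    obtain rfl : l₁ = [] := List.perm_nil.1 h₁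
    rw [tensListReindex_nil, tensListAppend_nil, tensListAppend_nil,
      tensorHom_comp_whiskerRight_assoc, Category.assoc, Iso.inv_hom_id, Category.comp_id,
      MonoidalCategory.tensorHom_def, Category.assoc, Category.assoc]
    exact congrArg _ (leftUnitor_naturality _)
  | cons j l₁' ih =>
    have hj : f j ∈ l₁ := h₁.mem_iff.2 List.mem_cons_self
    have hp : (l₁.erase (f j)).Perm (l₁'.map f) :=
      (List.cons_perm_iff_perm_erase.1 h₁.symm).2.symm
    have e : (l₁ ++ l₂).erase (f j) = l₁.erase (f j) ++ l₂ := List.erase_append_left _ hj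
    have hp' : (l₁.erase (f j) ++ l₂).Perm ((l₁' ++ l₂').map f) := by
      rw [List.map_append]
      exact hp.append h₂
    rw [tensListReindex_cons f φ j l₁' l₁ _ h₁ hj rfl hp, tensListAppend_cons]
    erw [tensListReindex_cons f φ j (l₁' ++ l₂') (l₁ ++ l₂) (l₁.erase (f j) ++ l₂) h
      (List.mem_append_left _ hj) e hp']
    rw [reassoc_of% (tensListAppend_pull_left V l₂ (f j) l₁ _ hj rfl
      (List.mem_append_left _ hj) e), tensorHom_comp_whiskerRight_assoc, whiskerLeft_comp_tensorHom_assoc,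
      ← ih _ hp hp']
    simp only [Category.assoc, Iso.inv_hom_id, Category.comp_id]
    rw [← whiskerRight_comp_tensorHom_assoc, associator_naturality_assoc,
      tensorHom_comp_whiskerLeft_assoc]

lemma tensSwap_tensor_right' (A B₁ B₂ Z : C) :
    tensSwap A (B₁ ⊗ B₂) Z ≫ (α_ _ _ _).hom =
      A ◁ (α_ B₁ B₂ Z).hom ≫ tensSwap A B₁ (B₂ ⊗ Z) ≫ B₁ ◁ tensSwap A B₂ Z := by
  have h := tensSwap_tensor_right A B₁ B₂ Z
  rw [← cancel_mono (α_ _ _ _).hom] at h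
  simp only [Category.assoc, Iso.inv_hom_id, Category.comp_id] at h
  rw [← h, ← MonoidalCategory.whiskerLeft_comp_assoc, Iso.hom_inv_id,
    MonoidalCategory.whiskerLeft_id, Category.id_comp]

/-- Exchanging two blocks of a list. -/
lemma tensSwap_append {ι : Type} (V : ι → C) (l₁ l₂ l₃ : List ι) (hnd : (l₁ ++ (l₂ ++ l₃)).Nodup)
    (h : (l₁ ++ (l₂ ++ l₃)).Perm ((l₂ ++ (l₁ ++ l₃)).map (fun i => i))) :
    tensSwap (tensList V l₁) (tensList V l₂) (tensList V l₃) ≫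
        tensList V l₂ ◁ tensListAppend V l₃ l₁ ≫ tensListAppend V (l₁ ++ l₃) l₂ =
      tensList V l₁ ◁ tensListAppend V l₃ l₂ ≫ tensListAppend V (l₂ ++ l₃) l₁ ≫
        tensListReindex (V := V) (W := V) (fun i => i) (fun i => 𝟙 (V i)) (l₂ ++ (l₁ ++ l₃))
          (l₁ ++ (l₂ ++ l₃)) h := by
  classical
  induction l₂ with
  | nil =>
    erw [tensListReindex_id]
    have h1 : tensSwap (tensList V l₁) (tensList V []) (tensList V l₃) ≫ (tensNil V).hom ▷ _ =
        _ ◁ (tensNil V).hom ▷ _ ≫ tensSwap _ _ _ := by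
      simpa using (tensSwap_natural (𝟙 (tensList V l₁)) (tensNil V).hom (𝟙 (tensList V l₃))).symm
    rw [tensListAppend_nil, tensListAppend_nil, whisker_exchange_assoc, reassoc_of% h1,
      tensSwap_unit_right]
    simp
  | cons j l₂ ih =>
    have hnd' : j ∉ l₁ ∧ (l₁ ++ (l₂ ++ l₃)).Nodup := by
      have := (List.nodup_middle).1 hnd
      rw [List.nodup_cons] at this
      exact ⟨fun hj => this.1 (List.mem_append_left _ hj), this.2⟩
    have hp : (l₁ ++ (l₂ ++ l₃)).Perm ((l₂ ++ (l₁ ++ l₃)).map (fun i => i)) := by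
      rw [List.map_id', ← List.append_assoc, ← List.append_assoc]
      exact List.perm_append_comm.append_right _
    have e : (l₁ ++ (j :: (l₂ ++ l₃))).erase j = l₁ ++ (l₂ ++ l₃) := by
      rw [List.erase_append_right _ hnd'.1, List.erase_cons_head]
    have h1 : tensSwap (tensList V l₁) (tensList V (j :: l₂)) (tensList V l₃) ≫
        (tensCons V j l₂).hom ▷ _ = _ ◁ (tensCons V j l₂).hom ▷ _ ≫ tensSwap _ _ _ := by
      simpa using
        (tensSwap_natural (𝟙 (tensList V l₁)) (tensCons V j l₂).hom (𝟙 (tensList V l₃))).symm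
    erw [tensListReindex_cons (V := V) (fun i => i) (fun i => 𝟙 (V i)) j (l₂ ++ (l₁ ++ l₃))
      (l₁ ++ (j :: (l₂ ++ l₃))) (l₁ ++ (l₂ ++ l₃)) h (by simp) e hp]
    -- Since `j` is not in `l₁`, extracting it means moving it past all of `l₁`. This peels one
    -- factor off the block exchange.
    have h2 := tensListAppend_pull_right V l₁ j (j :: (l₂ ++ l₃)) (l₂ ++ l₃) List.mem_cons_self
      (List.erase_cons_head ..) hnd'.1 (by simp) e
    erw [reassoc_of% h2]
    rw [tensListPull_head, tensListAppend_cons, tensListAppend_cons, whisker_exchange_assoc,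
      reassoc_of% h1]
    simp only [tensor_whiskerLeft, Category.assoc, Iso.inv_hom_id_assoc]
    have IH := congrArg (V j ◁ ·) (ih hnd'.2 hp)
    simp only [MonoidalCategory.whiskerLeft_comp] at IH
    rw [reassoc_of% tensSwap_tensor_right', reassoc_of% IH]
    simp only [MonoidalCategory.whiskerLeft_comp, Category.assoc, id_tensorHom,
      MonoidalCategory.whiskerLeft_inv_hom_assoc]
    rw [reassoc_of% whiskerLeft_tensSwap]

/-- `tensListFlatten`, the target being given by an equal list. -/
def tensListFlattenTo {ι : Type} {κ : ι → Type} (V : (Σ i, κ i) → C) (L : ∀ i, List (κ i))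
    (l : List ι) (s : List (Σ i, κ i)) (hs : sigmaList L l = s) :
    tensList (fun i => tensList (fun j => V ⟨i, j⟩) (L i)) l ⟶ tensList V s :=
  tensListFlatten V L l ≫ eqToHom (by rw [hs])

lemma tensListFlattenTo_rfl {ι : Type} {κ : ι → Type} (V : (Σ i, κ i) → C) (L : ∀ i, List (κ i))
    (l : List ι) : tensListFlattenTo V L l _ rfl = tensListFlatten V L l :=
  Category.comp_id _

lemma tensListFlattenTo_nil {ι : Type} {κ : ι → Type} (V : (Σ i, κ i) → C) (L : ∀ i, List (κ i))
    (hs : sigmaList L [] = []) :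
    tensListFlattenTo V L [] [] hs = (tensNil _).hom ≫ (tensNil V).inv := by
  rfl

lemma tensListFlattenTo_cons {ι : Type} {κ : ι → Type} (V : (Σ i, κ i) → C) (L : ∀ i, List (κ i))
    (i : ι) (l : List ι) (s : List (Σ i, κ i)) (hs : sigmaList L l = s)
    (hs' : sigmaList L (i :: l) = (L i).map (Sigma.mk i) ++ s) :
    tensListFlattenTo V L (i :: l) ((L i).map (Sigma.mk i) ++ s) hs' =
      (tensCons _ i l).hom ≫ (tensListRelabel V (Sigma.mk i) (L i) ⊗ₘ tensListFlattenTo V L l s hs) ≫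
        tensListAppend V s ((L i).map (Sigma.mk i)) := by
  subst hs
  rw [tensListFlattenTo_rfl]
  refine Eq.trans ?_ (Category.id_comp _).symm
  exact Category.comp_id _

-- Moving an outer factor to the front before flattening amounts to moving its whole block to the
-- front afterwards. For a head `j` different from `i`, the blocks of `i` and `j` have to be
-- exchanged, which is `tensSwap_append`.
open Classical in
lemma tensListPull_flatten {ι : Type} {κ : ι → Type} (V : (Σ i, κ i) → C) (L : ∀ i, List (κ i))
    (i : ι) (l m : List ι) (hi : i ∈ l) (e : l.erase i = m) (s s' : List (Σ i, κ i))
    (hs : sigmaList L l = s) (hs' : sigmaList L m = s') (hnd : s.Nodup)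
    (h : s.Perm (((L i).map (Sigma.mk i) ++ s').map (fun x => x))) :
    tensListPull (fun i => tensList (fun j => V ⟨i, j⟩) (L i)) i l m hi e ≫
        (tensListRelabel V (Sigma.mk i) (L i) ⊗ₘ tensListFlattenTo V L m s' hs') ≫
        tensListAppend V s' ((L i).map (Sigma.mk i)) =
      tensListFlattenTo V L l s hs ≫ tensListReindex (V := V) (W := V) (fun x => x)
        (fun x => 𝟙 (V x)) ((L i).map (Sigma.mk i) ++ s') s h := by
  induction l generalizing m s s' with
  | nil => exact absurd hi List.not_mem_nil
  | cons j l ih =>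
    by_cases hj : j = i
    · subst hj
      obtain rfl : m = l := by rw [← e, List.erase_cons_head]
      have es : s = (L j).map (Sigma.mk j) ++ s' := by rw [← hs, ← hs']; rfl
      subst es
      rw [tensListReindex_id, Category.comp_id, tensListFlattenTo_cons V L j m s' hs' hs,
        tensListPull_head]
    · have hi' : i ∈ l := (List.mem_cons.1 hi).resolve_left (fun e => hj e.symm)
      have em : m = j :: l.erase i := by rw [← e, erase_cons_ne hj]
      subst em
      obtain ⟨t, ht⟩ : ∃ t, sigmaList L l = t := ⟨_, rfl⟩
      obtain ⟨t', ht'⟩ : ∃ t', sigmaList L (l.erase i) = t' := ⟨_, rfl⟩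
      have es : s = (L j).map (Sigma.mk j) ++ t := by rw [← hs, ← ht]; rfl
      have es' : s' = (L j).map (Sigma.mk j) ++ t' := by rw [← hs', ← ht']; rfl
      subst es es'
      have h' : t.Perm (((L i).map (Sigma.mk i) ++ t').map (fun x => x)) := by
        rw [List.map_id'] at h ⊢
        rw [← List.append_assoc] at h
        have h2 := h.trans ((List.perm_append_comm).append_right _)
        rw [List.append_assoc] at h2
        exact (List.perm_append_left_iff _).1 h2
      have hnd' : t.Nodup := (List.nodup_append.1 hnd).2.1
      have hp : ((L j).map (Sigma.mk j) ++ t).Perm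
          (((L j).map (Sigma.mk j) ++ ((L i).map (Sigma.mk i) ++ t')).map (fun x => x)) := by
        rw [List.map_id'] at h' ⊢
        exact (List.perm_append_left_iff _).2 h'
      have hq : ((L j).map (Sigma.mk j) ++ ((L i).map (Sigma.mk i) ++ t')).Perm
          (((L i).map (Sigma.mk i) ++ ((L j).map (Sigma.mk j) ++ t')).map (fun x => x)) := by
        rw [List.map_id'] at hp h ⊢
        exact hp.symm.trans h
      have IH := ih (l.erase i) hi' rfl t t' ht ht' hnd' h'
      have hsw := tensSwap_append V ((L j).map (Sigma.mk j)) ((L i).map (Sigma.mk i)) t'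
        (by rw [List.map_id'] at hp; exact hp.nodup_iff.1 hnd) hq
      have hc := tensListReindex_comp (V := V) (W := V) (U := V) (fun x => x) (fun x => 𝟙 (V x))
        (fun x => x) (fun x => 𝟙 (V x)) _ _ _ hp hq hnd h
      simp only [Category.comp_id] at hc
      rw [tensListPull_tail (fun i => tensList (fun j => V ⟨i, j⟩) (L i)) i j l _ hj hi e hi' rfl,
        tensListFlattenTo_cons V L j _ t' ht', tensListFlattenTo_cons V L j _ t ht, ← hc]
      simp only [Category.assoc]
      have ha := tensListReindex_append (V := V) (W := V) (fun x => x) (fun x => 𝟙 (V x))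
        ((L j).map (Sigma.mk j)) ((L i).map (Sigma.mk i) ++ t') ((L j).map (Sigma.mk j)) t
        (by rw [List.map_id']) h' hp
      rw [← reassoc_of% ha, tensListReindex_id, id_tensorHom, tensorHom_comp_whiskerLeft_assoc,
        ← IH, whiskerLeft_comp_tensorHom_assoc, Iso.inv_hom_id_assoc]
      have e1 : (tensListRelabel V (Sigma.mk i) (L i) ⊗ₘ
          (tensListRelabel V (Sigma.mk j) (L j) ⊗ₘ tensListFlattenTo V L (l.erase i) t' ht') ≫
            tensListAppend V t' ((L j).map (Sigma.mk j))) =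
          (tensListRelabel V (Sigma.mk i) (L i) ⊗ₘ tensListRelabel V (Sigma.mk j) (L j) ⊗ₘ
            tensListFlattenTo V L (l.erase i) t' ht') ≫
            _ ◁ tensListAppend V t' ((L j).map (Sigma.mk j)) := by
        rw [tensorHom_comp_whiskerLeft]
      rw [e1, Category.assoc, ← reassoc_of% tensSwap_natural, hsw,
        whiskerLeft_comp_tensorHom_assoc, tensorHom_comp_whiskerLeft_assoc, Category.assoc]

/-- Flattening is compatible with reindexing. -/
lemma tensListReindex_flatten {ι κ : Type} {ι' : ι → Type} {κ' : κ → Type} {V : (Σ i, ι' i) → C}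
    {W : (Σ k, κ' k) → C} (f : κ → ι) (g : ∀ k, κ' k → ι' (f k))
    (φ : ∀ k j, V ⟨f k, g k j⟩ ⟶ W ⟨k, j⟩) (L : ∀ i, List (ι' i)) (L' : ∀ k, List (κ' k))
    (hL : ∀ k, (L (f k)).Perm ((L' k).map (g k))) (l' : List κ) (l : List ι)
    (h : l.Perm (l'.map f)) (s : List (Σ i, ι' i)) (s' : List (Σ k, κ' k))
    (hs : sigmaList L l = s) (hs' : sigmaList L' l' = s') (hnd : s.Nodup)
    (h' : s.Perm (s'.map (fun x => ⟨f x.1, g x.1 x.2⟩))) :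
    tensListReindex (V := fun i => tensList (fun j => V ⟨i, j⟩) (L i))
        (W := fun k => tensList (fun j => W ⟨k, j⟩) (L' k)) f
        (fun k => tensListReindex (V := fun j => V ⟨f k, j⟩) (g k) (φ k) (L' k) (L (f k)) (hL k))
        l' l h ≫ tensListFlattenTo W L' l' s' hs' =
      tensListFlattenTo V L l s hs ≫
        tensListReindex (V := V) (W := W) (fun x => ⟨f x.1, g x.1 x.2⟩) (fun x => φ x.1 x.2)
          s' s h' := by
  classical
  induction l' generalizing l s s' with
  | nil =>
    obtain rfl : l = [] := List.perm_nil.1 h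
    obtain rfl : s = [] := by rw [← hs]; rfl
    obtain rfl : s' = [] := by rw [← hs']; rfl
    rw [tensListReindex_nil, tensListFlattenTo_nil, tensListFlattenTo_nil, tensListReindex_nil]
    simp
  | cons k l' ih =>
    have hk : f k ∈ l := h.mem_iff.2 List.mem_cons_self
    have hp : (l.erase (f k)).Perm (l'.map f) := (List.cons_perm_iff_perm_erase.1 h.symm).2.symm
    obtain ⟨t, ht⟩ : ∃ t, sigmaList L (l.erase (f k)) = t := ⟨_, rfl⟩
    obtain ⟨t', ht'⟩ : ∃ t', sigmaList L' l' = t' := ⟨_, rfl⟩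
    have es' : s' = (L' k).map (Sigma.mk k) ++ t' := by rw [← hs', ← ht']; rfl
    subst es'
    have hsig : ∀ {l₁ l₂ : List ι}, l₁.Perm l₂ → (sigmaList L l₁).Perm (sigmaList L l₂) := by
      intro l₁ l₂ hh
      induction hh with
      | nil => exact List.Perm.refl _
      | cons x _ ih => exact (List.perm_append_left_iff _).2 ih
      | swap x y l =>
        simp only [sigmaList, ← List.append_assoc]
        exact List.perm_append_comm.append_right _
      | trans _ _ h1 h2 => exact h1.trans h2
    have hst : s.Perm ((L (f k)).map (Sigma.mk (f k)) ++ t) := by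
      rw [← hs, ← ht]
      exact hsig (List.perm_cons_erase hk)
    have hst' : s.Perm (((L (f k)).map (Sigma.mk (f k)) ++ t).map (fun x => x)) := by
      rwa [List.map_id']
    have hLk : ((L (f k)).map (Sigma.mk (f k))).Perm
        (((L' k).map (Sigma.mk k)).map (fun x : Σ k, κ' k => (⟨f x.1, g x.1 x.2⟩ : Σ i, ι' i))) := by
      have := (hL k).map (Sigma.mk (β := ι') (f k))
      rw [List.map_map] at this ⊢
      exact this
    have hq : ((L (f k)).map (Sigma.mk (f k)) ++ t).Perm
        (((L' k).map (Sigma.mk k) ++ t').map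
          (fun x : Σ k, κ' k => (⟨f x.1, g x.1 x.2⟩ : Σ i, ι' i))) := hst.symm.trans h'
    have htt : t.Perm (t'.map (fun x : Σ k, κ' k => (⟨f x.1, g x.1 x.2⟩ : Σ i, ι' i))) := by
      rw [List.map_append] at hq
      exact (List.perm_append_left_iff _).1 (hq.trans (hLk.symm.append_right _))
    have hnd' : ((L (f k)).map (Sigma.mk (f k)) ++ t).Nodup := hst.nodup_iff.1 hnd
    have hndk : ((L (f k)).map (Sigma.mk (β := ι') (f k))).Nodup := (List.nodup_append.1 hnd').1
    have IH := ih (l.erase (f k)) hp t t' ht ht' (List.nodup_append.1 hnd').2.1 htt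
    -- The permutation from `s` to the target list is factored: first the block of `f k` is brought
    -- to the front, then the blocks are reindexed separately.
    have hc := tensListReindex_comp (V := V) (W := V) (U := W) (fun x => x) (fun x => 𝟙 (V x))
      (fun x : Σ k, κ' k => (⟨f x.1, g x.1 x.2⟩ : Σ i, ι' i)) (fun x => φ x.1 x.2) _ _ _
      hst' hq hnd h'
    simp only [Category.id_comp] at hc
    rw [tensListReindex_cons (V := fun i => tensList (fun j => V ⟨i, j⟩) (L i)) f _ k l' l _ h hk
      rfl hp, tensListFlattenTo_cons W L' k l' t' ht', ← hc,
      ← reassoc_of% (tensListPull_flatten V L (f k) l _ hk rfl s t hs ht hnd hst'),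
      ← tensListReindex_append (V := V) (W := W)
        (fun x : Σ k, κ' k => (⟨f x.1, g x.1 x.2⟩ : Σ i, ι' i)) (fun x => φ x.1 x.2)
        _ _ _ _ hLk htt hq]
    simp only [Category.assoc, Iso.inv_hom_id_assoc]
    rw [tensorHom_comp_tensorHom_assoc, tensorHom_comp_tensorHom_assoc, IH]
    have h1 := tensListRelabel_reindex V (W := fun x : κ' k => W ⟨k, x⟩) (Sigma.mk (f k)) (g k)
      (φ k) (L' k) (L (f k)) (hL k) (by rw [List.map_map] at hLk; exact hLk) hndk
    have h2 := tensListReindex_relabel (V := V) W (Sigma.mk k)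
      (fun x : Σ k, κ' k => (⟨f x.1, g x.1 x.2⟩ : Σ i, ι' i)) (fun x => φ x.1 x.2) (L' k)
      ((L (f k)).map (Sigma.mk (f k))) (by rw [List.map_map] at hLk; exact hLk) hLk hndk
    rw [← h1, Category.assoc, h2]

/-! #### Shuffles -/

lemma tensListShuffle_nil {ι : Type} (A B : ι → C) :
    tensListShuffle A B [] =
      (tensNil _).hom ≫ (λ_ (𝟙_ C)).inv ≫ ((tensNil A).inv ⊗ₘ (tensNil B).inv) := by
  have h : ((tensNil A).inv ⊗ₘ (tensNil B).inv) = 𝟙 _ := id_tensorHom_id _ _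
  refine Eq.trans ?_ (congrArg (fun t => (tensNil _).hom ≫ (λ_ (𝟙_ C)).inv ≫ t) h.symm)
  exact ((Category.id_comp _).trans (Category.comp_id _)).symm

lemma tensListShuffle_cons {ι : Type} (A B : ι → C) (i : ι) (l : List ι) :
    tensListShuffle A B (i :: l) =
      (tensCons _ i l).hom ≫ (A i ⊗ B i) ◁ tensListShuffle A B l ≫ tensorμ _ _ _ _ ≫
        ((tensCons A i l).inv ⊗ₘ (tensCons B i l).inv) := by
  have h : ((tensCons A i l).inv ⊗ₘ (tensCons B i l).inv) = 𝟙 _ := id_tensorHom_id _ _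
  have h' : ((A i ⊗ B i) ◁ tensListShuffle A B l ≫ tensorμ (A i) (B i) _ _ ≫
        ((tensCons A i l).inv ⊗ₘ (tensCons B i l).inv)) =
      (A i ⊗ B i) ◁ tensListShuffle A B l ≫ tensorμ (A i) (B i) _ _ := by
    rw [h]
    exact congrArg ((A i ⊗ B i) ◁ tensListShuffle A B l ≫ ·) (Category.comp_id _)
  exact h'.symm.trans (Category.id_comp _).symm

lemma tensorμ_braiding (A B A' B' : C) :
    tensorμ A B A' B' ≫ ((β_ A A').hom ⊗ₘ (β_ B B').hom) =
      (β_ (A ⊗ B) (A' ⊗ B')).hom ≫ tensorμ A' B' A B := by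
  -- Symmetry, and not merely a braiding, is needed here: `A` and `B'` pass each other twice, in
  -- opposite directions.
  have h : A' ◁ (β_ A B').hom ▷ B ≫ A' ◁ (β_ B' A).hom ▷ B = 𝟙 _ := by
    rw [← MonoidalCategory.whiskerLeft_comp, ← comp_whiskerRight, SymmetricCategory.symmetry]
    simp
  simp [tensorμ, MonoidalCategory.tensorHom_def, reassoc_of% h]

/-- Exchanging two pairs and then shuffling is shuffling and then exchanging in both components.
Associativity of `tensorμ` isolates the first two pairs, for which the claim is `tensorμ_braiding`.
-/
lemma tensSwap_tensorμ (A B A' B' Z W : C) :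
    tensSwap (A ⊗ B) (A' ⊗ B') (Z ⊗ W) ≫ (A' ⊗ B') ◁ tensorμ A B Z W ≫
        tensorμ A' B' (A ⊗ Z) (B ⊗ W) =
      (A ⊗ B) ◁ tensorμ A' B' Z W ≫ tensorμ A B (A' ⊗ Z) (B' ⊗ W) ≫
        (tensSwap A A' Z ⊗ₘ tensSwap B B' W) := by
  have h1 := tensor_associativity A B A' B' Z W
  have h2 := tensor_associativity A' B' A B Z W
  have e : (tensSwap A A' Z ⊗ₘ tensSwap B B' W) =
      ((α_ A A' Z).inv ⊗ₘ (α_ B B' W).inv) ≫ ((β_ A A').hom ▷ Z ⊗ₘ (β_ B B').hom ▷ W) ≫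
        ((α_ A' A Z).hom ⊗ₘ (α_ B' B W).hom) := by
    simp only [tensSwap, tensorHom_comp_tensorHom]
  have h3 : (A ⊗ B) ◁ tensorμ A' B' Z W ≫ tensorμ A B (A' ⊗ Z) (B' ⊗ W) ≫
      ((α_ A A' Z).inv ⊗ₘ (α_ B B' W).inv) =
      (α_ _ _ _).inv ≫ tensorμ A B A' B' ▷ (Z ⊗ W) ≫ tensorμ (A ⊗ A') (B ⊗ B') Z W := by
    rw [← cancel_epi (α_ (A ⊗ B) (A' ⊗ B') (Z ⊗ W)).hom, ← reassoc_of% h1]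
    simp only [tensorHom_comp_tensorHom, Iso.hom_inv_id, Iso.hom_inv_id_assoc, id_tensorHom_id,
      Category.comp_id]
  rw [e, reassoc_of% h3, ← tensorμ_natural_left_assoc, ← comp_whiskerRight_assoc,
    tensorμ_braiding]
  simp only [comp_whiskerRight, Category.assoc, tensSwap]
  rw [h2]

-- Induction on the list, the case of a head different from `i` being `tensSwap_tensorμ`.
open Classical in
lemma tensListPull_shuffle {ι : Type} (A B : ι → C) (i : ι) (l m : List ι) (hi : i ∈ l)
    (e : l.erase i = m) :
    tensListPull (fun i => A i ⊗ B i) i l m hi e ≫ (A i ⊗ B i) ◁ tensListShuffle A B m ≫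
        tensorμ _ _ _ _ =
      tensListShuffle A B l ≫ (tensListPull A i l m hi e ⊗ₘ tensListPull B i l m hi e) := by
  induction l generalizing m with
  | nil => exact absurd hi List.not_mem_nil
  | cons j l ih =>
    by_cases hj : j = i
    · subst hj
      obtain rfl : m = l := by rw [← e, List.erase_cons_head]
      rw [tensListPull_head, tensListPull_head, tensListPull_head, tensListShuffle_cons]
      simp
    · have hi' : i ∈ l := (List.mem_cons.1 hi).resolve_left (fun e => hj e.symm)
      have em : m = j :: l.erase i := by rw [← e, erase_cons_ne hj]
      subst em
      have IH := congrArg ((A j ⊗ B j) ◁ ·) (ih _ hi' rfl)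
      simp only [MonoidalCategory.whiskerLeft_comp] at IH
      rw [tensListPull_tail (fun i => A i ⊗ B i) i j l _ hj hi e hi' rfl,
        tensListPull_tail A i j l _ hj hi e hi' rfl, tensListPull_tail B i j l _ hj hi e hi' rfl,
        tensListShuffle_cons, tensListShuffle_cons]
      simp only [Category.assoc, MonoidalCategory.whiskerLeft_comp, tensorHom_comp_tensorHom,
        Iso.inv_hom_id_assoc, MonoidalCategory.whiskerLeft_inv_hom_assoc]
      simp only [← tensorHom_comp_tensorHom]
      rw [← tensorμ_natural_right_assoc, ← reassoc_of% IH, tensorμ_natural_right,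
        ← reassoc_of% whiskerLeft_tensSwap, reassoc_of% tensSwap_tensorμ]

/-- Shuffling is compatible with reindexing. -/
lemma tensListReindex_shuffle {ι κ : Type} {A B : ι → C} {A' B' : κ → C} (f : κ → ι)
    (φ : ∀ k, A (f k) ⟶ A' k) (ψ : ∀ k, B (f k) ⟶ B' k) (l' : List κ) (l : List ι)
    (h : l.Perm (l'.map f)) :
    tensListReindex (V := fun i => A i ⊗ B i) (W := fun k => A' k ⊗ B' k) f
        (fun k => φ k ⊗ₘ ψ k) l' l h ≫ tensListShuffle A' B' l' =
      tensListShuffle A B l ≫ (tensListReindex f φ l' l h ⊗ₘ tensListReindex f ψ l' l h) := by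
  classical
  induction l' generalizing l with
  | nil =>
    obtain rfl : l = [] := List.perm_nil.1 h
    rw [tensListReindex_nil, tensListReindex_nil, tensListReindex_nil, tensListShuffle_nil,
      tensListShuffle_nil]
    simp
  | cons k l' ih =>
    have hk : f k ∈ l := h.mem_iff.2 List.mem_cons_self
    have hp : (l.erase (f k)).Perm (l'.map f) := (List.cons_perm_iff_perm_erase.1 h.symm).2.symm
    rw [tensListReindex_cons (V := fun i => A i ⊗ B i) f _ k l' l _ h hk rfl hp,
      tensListReindex_cons f φ k l' l _ h hk rfl hp, tensListReindex_cons f ψ k l' l _ h hk rfl hp,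
      tensListShuffle_cons]
    simp only [Category.assoc, Iso.inv_hom_id_assoc]
    rw [tensorHom_comp_whiskerLeft_assoc, ih _ hp, ← whiskerLeft_comp_tensorHom_assoc,
      tensorμ_natural_assoc, reassoc_of% tensListPull_shuffle]
    simp only [tensorHom_comp_tensorHom]

end Flattening

end Koszul

/-! ### Coherence of flattening and shuffling -/

namespace Koszul

open MonoidalCategory

section Gathering

variable {C : Type*} [Category C] [MonoidalCategory C] [SymmetricCategory C]

/-! #### Invertibility -/

/-- These instances combine to the invertibility of gathering, without which the comultiplication
formula could not be solved for its right-hand side. -/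
instance isIso_tensListAppend {ι : Type} (V : ι → C) (l' l : List ι) :
    IsIso (tensListAppend V l' l) := by
  induction l with
  | nil =>
    rw [tensListAppend_nil]
    infer_instance
  | cons i l ih =>
    rw [tensListAppend_cons]
    exact IsIso.comp_isIso

instance isIso_tensListRelabel {ι κ : Type} (V : ι → C) (f : κ → ι) (l : List κ) :
    IsIso (tensListRelabel V f l) := by
  induction l with
  | nil =>
    rw [tensListRelabel_nil]
    exact IsIso.comp_isIso
  | cons i l ih =>
    rw [tensListRelabel_cons]
    exact IsIso.comp_isIso

instance isIso_tensListFlattenTo {ι : Type} {κ : ι → Type} (V : (Σ i, κ i) → C)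
    (L : ∀ i, List (κ i)) (l : List ι) (s : List (Σ i, κ i)) (hs : sigmaList L l = s) :
    IsIso (tensListFlattenTo V L l s hs) := by
  induction l generalizing s with
  | nil =>
    obtain rfl : s = [] := by rw [← hs]; rfl
    rw [tensListFlattenTo_nil]
    infer_instance
  | cons i l ih =>
    obtain rfl : s = (L i).map (Sigma.mk i) ++ sigmaList L l := by rw [← hs]; rfl
    have := ih _ rfl
    rw [tensListFlattenTo_cons V L i l _ rfl]
    infer_instance

instance isIso_tensorμ (A B A' B' : C) : IsIso (tensorμ A B A' B') :=
  ⟨tensorδ A B A' B', by simp, by simp⟩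

instance isIso_tensListShuffle {ι : Type} (A B : ι → C) (l : List ι) :
    IsIso (tensListShuffle A B l) := by
  induction l with
  | nil =>
    rw [tensListShuffle_nil]
    infer_instance
  | cons i l ih =>
    rw [tensListShuffle_cons]
    infer_instance

lemma tensListShuffle_natural {ι : Type} {A B A' B' : ι → C} (φ : ∀ k, A k ⟶ A' k)
    (ψ : ∀ k, B k ⟶ B' k) (l : List ι) :
    tensListMap (fun k => φ k ⊗ₘ ψ k) l ≫ tensListShuffle A' B' l =
      tensListShuffle A B l ≫ (tensListMap φ l ⊗ₘ tensListMap ψ l) := by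
  rw [tensListMap_eq_reindex _ _ (by simp), tensListMap_eq_reindex φ _ (by simp),
    tensListMap_eq_reindex ψ _ (by simp)]
  exact tensListReindex_shuffle (fun i => i) φ ψ l l (by simp)

/-- The inductive step of `tensListShuffle_assoc`, with the tails as free variables: `h` is the
induction hypothesis, and the head contributes the associativity of `tensorμ`. -/
lemma tensorμ_tensor_assoc {a b d A B D A' B' D' AB BD L M : C} (eA : A' ≅ a ⊗ A) (eB : B' ≅ b ⊗ B)
    (eD : D' ≅ d ⊗ D) (s₁ : L ⟶ A ⊗ BD) (s₂ : BD ⟶ B ⊗ D) (m : L ⟶ M) (s₃ : M ⟶ AB ⊗ D)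
    (s₄ : AB ⟶ A ⊗ B) (h : s₁ ≫ A ◁ s₂ = m ≫ s₃ ≫ s₄ ▷ D ≫ (α_ A B D).hom) :
    (a ⊗ b ⊗ d) ◁ s₁ ≫ tensorμ a (b ⊗ d) A BD ≫ (eA.inv ⊗ₘ
        ((b ⊗ d) ◁ s₂ ≫ tensorμ b d B D ≫ (eB.inv ⊗ₘ eD.inv))) =
      ((α_ a b d).inv ⊗ₘ m) ≫ ((a ⊗ b) ⊗ d) ◁ s₃ ≫ tensorμ (a ⊗ b) d AB D ≫
        (((a ⊗ b) ◁ s₄ ≫ tensorμ a b A B ≫ (eA.inv ⊗ₘ eB.inv)) ⊗ₘ eD.inv) ≫ (α_ _ _ _).hom := by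
  have e1 : (eA.inv ⊗ₘ ((b ⊗ d) ◁ s₂ ≫ tensorμ b d B D ≫ (eB.inv ⊗ₘ eD.inv))) =
      ((a ⊗ A) ◁ (b ⊗ d) ◁ s₂) ≫ (a ⊗ A) ◁ tensorμ b d B D ≫ (eA.inv ⊗ₘ eB.inv ⊗ₘ eD.inv) := by
    simp only [← id_tensorHom, tensorHom_comp_tensorHom, Category.id_comp]
  have e2 : (((a ⊗ b) ◁ s₄ ≫ tensorμ a b A B ≫ (eA.inv ⊗ₘ eB.inv)) ⊗ₘ eD.inv) =
      ((a ⊗ b) ◁ s₄) ▷ (d ⊗ D) ≫ tensorμ a b A B ▷ (d ⊗ D) ≫ ((eA.inv ⊗ₘ eB.inv) ⊗ₘ eD.inv) := by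
    simp only [← id_tensorHom, ← tensorHom_id, tensorHom_comp_tensorHom, Category.id_comp]
  have e3 : tensorμ a (b ⊗ d) A BD ≫ (a ⊗ A) ◁ (b ⊗ d) ◁ s₂ =
      (a ⊗ b ⊗ d) ◁ A ◁ s₂ ≫ tensorμ a (b ⊗ d) A (B ⊗ D) := by
    have := tensorμ_natural_right a (b ⊗ d) (𝟙 A) s₂
    simpa using this.symm
  have e4 : tensorμ (a ⊗ b) d AB D ≫ ((a ⊗ b) ◁ s₄) ▷ (d ⊗ D) =
      ((a ⊗ b) ⊗ d) ◁ s₄ ▷ D ≫ tensorμ (a ⊗ b) d (A ⊗ B) D := by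
    have := tensorμ_natural_right (a ⊗ b) d s₄ (𝟙 D)
    simpa using this.symm
  have h5 := associator_monoidal a b d A B D
  rw [e1, e2]
  simp only [Category.assoc]
  rw [reassoc_of% e3, reassoc_of% e4, associator_naturality, reassoc_of% h5]
  have h' := congrArg (fun t => (a ⊗ b ⊗ d) ◁ t) h
  simp only [MonoidalCategory.whiskerLeft_comp] at h'
  rw [reassoc_of% h']
  simp only [← id_tensorHom, tensorHom_comp_tensorHom_assoc, Category.comp_id, Category.id_comp,
    Iso.inv_hom_id, Category.assoc]

lemma tensListShuffle_assoc {ι : Type} (A B D : ι → C) (l : List ι) :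
    tensListShuffle A (fun i => B i ⊗ D i) l ≫ tensList A l ◁ tensListShuffle B D l =
      tensListMap (fun i => (α_ (A i) (B i) (D i)).inv) l ≫
        tensListShuffle (fun i => A i ⊗ B i) D l ≫ tensListShuffle A B l ▷ _ ≫ (α_ _ _ _).hom := by
  induction l with
  | nil =>
    rw [tensListShuffle_nil, tensListShuffle_nil, tensListShuffle_nil, tensListShuffle_nil,
      tensListMap_nil]
    simp only [Category.assoc, Iso.inv_hom_id_assoc, ← id_tensorHom, ← tensorHom_id,
      tensorHom_comp_tensorHom, tensorHom_comp_tensorHom_assoc, Category.comp_id, Iso.inv_hom_id]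
    congr 1
    simp only [MonoidalCategory.tensorHom_def, comp_whiskerRight, Category.assoc,
      MonoidalCategory.whiskerLeft_comp]
    simp [unitors_inv_equal]
  | cons i l ih =>
    have := tensorμ_tensor_assoc (tensCons A i l) (tensCons B i l) (tensCons D i l) _ _ _ _ _ ih
    rw [tensListShuffle_cons, tensListShuffle_cons, tensListShuffle_cons, tensListShuffle_cons,
      tensListMap_cons]
    have e1 : ∀ {Z : C} (t : (B i ⊗ D i) ⊗ tensList (fun i => B i ⊗ D i) l ⟶ Z),
        ((tensCons A i l).inv ⊗ₘ (tensCons (fun i => B i ⊗ D i) i l).inv) ≫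
          tensList A (i :: l) ◁ ((tensCons (fun i => B i ⊗ D i) i l).hom ≫ t) =
        (tensCons A i l).inv ⊗ₘ ((tensCons (fun i => B i ⊗ D i) i l).inv ≫
          (tensCons (fun i => B i ⊗ D i) i l).hom ≫ t) := fun t => by
      rw [← id_tensorHom, tensorHom_comp_tensorHom, Category.comp_id]
    have e2 : ∀ {Z : C} (t : (A i ⊗ B i) ⊗ tensList (fun i => A i ⊗ B i) l ⟶ Z),
        ((tensCons (fun i => A i ⊗ B i) i l).inv ⊗ₘ (tensCons D i l).inv) ≫
          ((tensCons (fun i => A i ⊗ B i) i l).hom ≫ t) ▷ tensList D (i :: l) =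
        ((tensCons (fun i => A i ⊗ B i) i l).inv ≫
          (tensCons (fun i => A i ⊗ B i) i l).hom ≫ t) ⊗ₘ (tensCons D i l).inv := fun t => by
      rw [← tensorHom_id, tensorHom_comp_tensorHom, Category.comp_id]
    simp only [Category.assoc, Iso.inv_hom_id_assoc]
    rw [e1]
    congr 1
    rw [reassoc_of% e2]
    simp only [Iso.inv_hom_id_assoc]
    exact this

/-! #### Compatibilities of flattening and shuffles -/

lemma tensListRelabel_shuffle {ι κ : Type} (A B : ι → C) (f : κ → ι) (l : List κ) :
    tensListRelabel (fun i => A i ⊗ B i) f l ≫ tensListShuffle A B (l.map f) =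
      tensListShuffle (fun j => A (f j)) (fun j => B (f j)) l ≫
        (tensListRelabel A f l ⊗ₘ tensListRelabel B f l) := by
  induction l with
  | nil =>
    rw [tensListRelabel_nil, tensListRelabel_nil, tensListRelabel_nil, tensListShuffle_nil]
    show _ ≫ tensListShuffle A B [] = _
    rw [tensListShuffle_nil]
    simp [tensorHom_comp_tensorHom]
  | cons i l ih =>
    have IH := congrArg (fun t => (A (f i) ⊗ B (f i)) ◁ t) ih
    simp only [MonoidalCategory.whiskerLeft_comp] at IH
    rw [tensListRelabel_cons, tensListRelabel_cons, tensListRelabel_cons, tensListShuffle_cons]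
    show _ ≫ tensListShuffle A B (f i :: l.map f) = _
    rw [tensListShuffle_cons]
    simp only [Category.assoc, Iso.inv_hom_id_assoc, tensorHom_comp_tensorHom]
    rw [reassoc_of% IH, tensorμ_natural_right_assoc]
    simp only [tensorHom_comp_tensorHom]

/-- The inductive step of `tensListAppend_shuffle`; again the only input beyond naturality is
associativity of `tensorμ`. -/
lemma tensorμ_append {a b A B A' B' P A₁ B₁ A₂ B₂ X Y Z : C} (eA : A' ≅ a ⊗ A)
    (eB : B' ≅ b ⊗ B) (e : Y ≅ (a ⊗ b) ⊗ Z) (p : P ⟶ A₁ ⊗ B₁) (s : Z ⟶ A ⊗ B)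
    (u : Z ⊗ P ⟶ X) (v : X ⟶ A₂ ⊗ B₂) (f : A ⊗ A₁ ⟶ A₂) (g : B ⊗ B₁ ⟶ B₂)
    (h : u ≫ v = (s ⊗ₘ p) ≫ tensorμ A B A₁ B₁ ≫ (f ⊗ₘ g)) {A₃ B₃ : C}
    (f' : a ⊗ A₂ ⟶ A₃) (g' : b ⊗ B₂ ⟶ B₃) :
    e.hom ▷ P ≫ (α_ _ _ _).hom ≫ (a ⊗ b) ◁ u ≫ (a ⊗ b) ◁ v ≫ tensorμ a b A₂ B₂ ≫ (f' ⊗ₘ g') =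
      ((e.hom ≫ (a ⊗ b) ◁ s ≫ tensorμ a b A B ≫ (eA.inv ⊗ₘ eB.inv)) ⊗ₘ p) ≫
        tensorμ A' B' A₁ B₁ ≫ (eA.hom ▷ A₁ ≫ (α_ _ _ _).hom ≫ a ◁ f ≫ f' ⊗ₘ
          eB.hom ▷ B₁ ≫ (α_ _ _ _).hom ≫ b ◁ g ≫ g') := by
  have h' := congrArg (fun t => (a ⊗ b) ◁ t) h
  simp only [MonoidalCategory.whiskerLeft_comp] at h'
  have h2 := tensor_associativity a b A B A₁ B₁
  rw [reassoc_of% h', tensorμ_natural_right_assoc]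
  have e1 : ((e.hom ≫ (a ⊗ b) ◁ s ≫ tensorμ a b A B ≫ (eA.inv ⊗ₘ eB.inv)) ⊗ₘ p) =
      e.hom ▷ P ≫ ((a ⊗ b) ◁ s ⊗ₘ p) ≫ tensorμ a b A B ▷ _ ≫ (eA.inv ⊗ₘ eB.inv) ▷ _ := by
    simp only [← id_tensorHom, ← tensorHom_id, tensorHom_comp_tensorHom, Category.id_comp,
      Category.comp_id, Category.assoc]
  rw [e1]
  simp only [Category.assoc, tensorμ_natural_left_assoc, tensorHom_comp_tensorHom]
  simp only [inv_hom_whiskerRight_assoc]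
  have e2 : ∀ {x y x' y' : C} (i : a ⊗ (A ⊗ A₁) ⟶ x) (j : b ⊗ (B ⊗ B₁) ⟶ y),
    ((α_ _ _ _).hom ≫ i ⊗ₘ (α_ _ _ _).hom ≫ j) = ((α_ _ _ _).hom ⊗ₘ (α_ _ _ _).hom) ≫ (i ⊗ₘ j) :=
      fun i j => (tensorHom_comp_tensorHom _ _ _ _).symm
  rw [e2 (x' := a) (y' := a), reassoc_of% h2, ← id_tensorHom _ (s ⊗ₘ p), ← associator_naturality_assoc]
  simp

lemma tensListAppend_shuffle {ι : Type} (A B : ι → C) (l' l : List ι) :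
    tensListAppend (fun i => A i ⊗ B i) l' l ≫ tensListShuffle A B (l ++ l') =
      (tensListShuffle A B l ⊗ₘ tensListShuffle A B l') ≫ tensorμ _ _ _ _ ≫
        (tensListAppend A l' l ⊗ₘ tensListAppend B l' l) := by
  induction l with
  | nil =>
    rw [tensListAppend_nil, tensListAppend_nil, tensListAppend_nil, tensListShuffle_nil]
    show _ ≫ tensListShuffle A B l' = _
    have h := tensor_left_unitality (tensList A l') (tensList B l')
    have e1 : ((tensNil fun i => A i ⊗ B i).hom ≫ (λ_ (𝟙_ C)).inv ≫
        ((tensNil A).inv ⊗ₘ (tensNil B).inv) ⊗ₘ tensListShuffle A B l') =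
      ((tensNil fun i => A i ⊗ B i).hom ⊗ₘ tensListShuffle A B l') ≫ (λ_ (𝟙_ C)).inv ▷ _ ≫
        ((tensNil A).inv ⊗ₘ (tensNil B).inv) ▷ _ := by
      simp only [← tensorHom_id, tensorHom_comp_tensorHom, Category.comp_id]
    rw [e1]
    simp only [Category.assoc]
    rw [tensorμ_natural_left_assoc, tensorHom_comp_tensorHom, inv_hom_whiskerRight_assoc,
      inv_hom_whiskerRight_assoc, ← h, MonoidalCategory.tensorHom_def]
    simp
  | cons i l ih =>
    have := tensorμ_append (tensCons A i l) (tensCons B i l)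
      (tensCons (fun i => A i ⊗ B i) i l) _ _ _ _ _ _ ih (tensCons A i (l ++ l')).inv
      (tensCons B i (l ++ l')).inv
    rw [tensListAppend_cons, tensListAppend_cons, tensListAppend_cons, tensListShuffle_cons]
    show _ ≫ tensListShuffle A B (i :: (l ++ l')) = _
    rw [tensListShuffle_cons]
    simp only [Category.assoc, Iso.inv_hom_id_assoc]
    exact this

/-! #### Compatibilities of flattening -/

lemma whisker_assoc_core {v A B D P Q R S E A' P' Q' : C} (e₁ : A' ≅ v ⊗ A) (e₂ : P' ≅ v ⊗ P)
    (e₃ : Q' ≅ v ⊗ Q) (p : A ⊗ B ⟶ P) (q : P ⊗ D ⟶ Q) (r : Q ⟶ R) (s : B ⊗ D ⟶ S)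
    (t : A ⊗ S ⟶ R) (h : p ▷ D ≫ q ≫ r = (α_ A B D).hom ≫ A ◁ s ≫ t) (z : v ⊗ R ⟶ E) :
    e₁.hom ▷ B ▷ D ≫ (α_ v A B).hom ▷ D ≫ (v ◁ p) ▷ D ≫ e₂.inv ▷ D ≫ e₂.hom ▷ D ≫
        (α_ v P D).hom ≫ v ◁ q ≫ e₃.inv ≫ e₃.hom ≫ v ◁ r ≫ z =
      (α_ A' B D).hom ≫ A' ◁ s ≫ e₁.hom ▷ S ≫ (α_ v A S).hom ≫ v ◁ t ≫ z := by
  have h' := congrArg (fun t => v ◁ t) h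
  simp only [MonoidalCategory.whiskerLeft_comp] at h'
  rw [inv_hom_whiskerRight_assoc, Iso.inv_hom_id_assoc, whisker_assoc_assoc,
    Iso.inv_hom_id_assoc, reassoc_of% h', whisker_exchange_assoc]
  simp

/-- The two bracketings of a threefold concatenation are equal lists, but not by definition.
Comparing both with a further list `y` by reindexing avoids transport along that equality. -/
lemma tensListAppend_assoc {ι : Type} (V : ι → C) (l₁ l₂ l₃ y : List ι)
    (h : (l₁ ++ l₂ ++ l₃).Perm (y.map (fun i => i)))
    (h' : (l₁ ++ (l₂ ++ l₃)).Perm (y.map (fun i => i))) (hnd : (l₁ ++ l₂ ++ l₃).Nodup) :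
    tensListAppend V l₂ l₁ ▷ _ ≫ tensListAppend V l₃ (l₁ ++ l₂) ≫
        tensListReindex (V := V) (W := V) (fun i => i) (fun i => 𝟙 (V i)) y _ h =
      (α_ _ _ _).hom ≫ _ ◁ tensListAppend V l₃ l₂ ≫ tensListAppend V (l₂ ++ l₃) l₁ ≫
        tensListReindex (V := V) (W := V) (fun i => i) (fun i => 𝟙 (V i)) y _ h' := by
  classical
  have key : ∀ (l₁ : List ι) (hp : (l₁ ++ l₂ ++ l₃).Perm ((l₁ ++ (l₂ ++ l₃)).map (fun i => i))),
    tensListAppend V l₂ l₁ ▷ _ ≫ tensListAppend V l₃ (l₁ ++ l₂) ≫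
        tensListReindex (V := V) (W := V) (fun i => i) (fun i => 𝟙 (V i)) _ _ hp =
      (α_ _ _ _).hom ≫ _ ◁ tensListAppend V l₃ l₂ ≫ tensListAppend V (l₂ ++ l₃) l₁ := by
    intro l₁ hp
    induction l₁ with
    | nil =>
      erw [tensListReindex_id]
      rw [tensListAppend_nil, tensListAppend_nil]
      simp only [comp_whiskerRight, Category.assoc]
      rw [whisker_exchange_assoc]
      erw [Category.comp_id]
      simp
    | cons i l₁ ih =>
      have hp' : (l₁ ++ l₂ ++ l₃).Perm ((l₁ ++ (l₂ ++ l₃)).map (fun i => i)) := by simp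
      have IH := congrArg (V i ◁ ·) (ih hp')
      simp only [MonoidalCategory.whiskerLeft_comp] at IH
      erw [tensListReindex_cons (V := V) (fun i => i) (fun i => 𝟙 (V i)) i (l₁ ++ (l₂ ++ l₃))
        (i :: (l₁ ++ l₂ ++ l₃)) (l₁ ++ l₂ ++ l₃) hp List.mem_cons_self (List.erase_cons_head ..)
        hp', tensListPull_head, tensListAppend_cons, tensListAppend_cons]
      rw [tensListAppend_cons]
      simp only [comp_whiskerRight, Category.assoc, id_tensorHom]
      exact whisker_assoc_core (tensCons V i l₁) (tensCons V i (l₁ ++ l₂))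
        (tensCons V i (l₁ ++ l₂ ++ l₃)) _ _ _ _ _ (ih hp') _
  have hp : (l₁ ++ l₂ ++ l₃).Perm ((l₁ ++ (l₂ ++ l₃)).map (fun i => i)) := by simp
  have hc := tensListReindex_comp (V := V) (W := V) (U := V) (fun i => i) (fun i => 𝟙 (V i))
    (fun i => i) (fun i => 𝟙 (V i)) y _ _ hp h' hnd h
  simp only [Category.comp_id] at hc
  rw [← hc, reassoc_of% key l₁ hp]

/-- Flattening the two halves separately gives `t₁ ++ t₂`, which agrees with `t` only up to the
bracketing of the blocks; the identity reindexing bridges this. -/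
lemma tensListFlattenTo_append {ι : Type} {κ : ι → Type} (V : (Σ i, κ i) → C)
    (L : ∀ i, List (κ i)) (l₁ l₂ : List ι) (t₁ t₂ t : List (Σ i, κ i))
    (h₁ : sigmaList L l₁ = t₁) (h₂ : sigmaList L l₂ = t₂) (ht : sigmaList L (l₁ ++ l₂) = t)
    (h : (t₁ ++ t₂).Perm (t.map (fun x => x))) (hnd : t.Nodup) :
    tensListAppend (fun i => tensList (fun j => V ⟨i, j⟩) (L i)) l₂ l₁ ≫
        tensListFlattenTo V L (l₁ ++ l₂) t ht =
      (tensListFlattenTo V L l₁ t₁ h₁ ⊗ₘ tensListFlattenTo V L l₂ t₂ h₂) ≫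
        tensListAppend V t₂ t₁ ≫
          tensListReindex (V := V) (W := V) (fun x => x) (fun x => 𝟙 (V x)) t _ h := by
  induction l₁ generalizing t₁ t with
  | nil =>
    obtain rfl : t₁ = [] := by rw [← h₁]; rfl
    obtain rfl : t = t₂ := by rw [← ht, ← h₂]; rfl
    erw [tensListReindex_id]
    rw [tensListAppend_nil, tensListAppend_nil, tensListFlattenTo_nil]
    show _ ≫ tensListFlattenTo V L l₂ t h₂ = _ ≫ _ ≫ 𝟙 _
    rw [Category.comp_id, MonoidalCategory.tensorHom_def]
    simp only [comp_whiskerRight, Category.assoc]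
    rw [whisker_exchange_assoc, inv_hom_whiskerRight_assoc]
    simp
  | cons i l₁ ih =>
    obtain ⟨u, hu⟩ : ∃ u, sigmaList L l₁ = u := ⟨_, rfl⟩
    obtain ⟨w, hw⟩ : ∃ w, sigmaList L (l₁ ++ l₂) = w := ⟨_, rfl⟩
    obtain rfl : t₁ = (L i).map (Sigma.mk i) ++ u := by rw [← h₁, ← hu]; rfl
    obtain rfl : t = (L i).map (Sigma.mk i) ++ w := by rw [← ht, ← hw]; rfl
    have hp : (u ++ t₂).Perm (w.map (fun x => x)) := by
      rw [List.map_id', List.append_assoc, List.perm_append_left_iff] at h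
      rwa [List.map_id']
    have hq : ((L i).map (Sigma.mk i) ++ (u ++ t₂)).Perm
        (((L i).map (Sigma.mk i) ++ w).map (fun x => x)) := by rwa [← List.append_assoc]
    have hr : ((L i).map (Sigma.mk i)).Perm (((L i).map (Sigma.mk i)).map (fun x => x)) := by
      rw [List.map_id']
    have IH := ih u w hu hw hp (hnd.of_append_right)
    have hnd' : ((L i).map (Sigma.mk i) ++ u ++ t₂).Nodup := by
      rw [List.map_id'] at h
      exact h.nodup_iff.2 hnd
    have h1 := tensListAppend_assoc V ((L i).map (Sigma.mk i)) u t₂ _ h hq hnd'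
    have h2 := tensListReindex_append (V := V) (W := V) (fun x => x) (fun x => 𝟙 (V x))
      ((L i).map (Sigma.mk i)) w ((L i).map (Sigma.mk i)) (u ++ t₂) hr hp hq
    rw [tensListReindex_id] at h2
    rw [tensListAppend_cons, tensListFlattenTo_cons V L i l₁ u hu]
    show _ ≫ tensListFlattenTo V L (i :: (l₁ ++ l₂)) _ ht = _
    rw [tensListFlattenTo_cons V L i (l₁ ++ l₂) w hw]
    have e1 : ((tensCons (fun i => tensList (fun j => V ⟨i, j⟩) (L i)) i l₁).hom ≫
          (tensListRelabel V (Sigma.mk i) (L i) ⊗ₘ tensListFlattenTo V L l₁ u hu) ≫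
            tensListAppend V u (List.map (Sigma.mk i) (L i)) ⊗ₘ
        tensListFlattenTo V L l₂ t₂ h₂) =
        (tensCons (fun i => tensList (fun j => V ⟨i, j⟩) (L i)) i l₁).hom ▷ _ ≫
          ((tensListRelabel V (Sigma.mk i) (L i) ⊗ₘ tensListFlattenTo V L l₁ u hu) ⊗ₘ
            tensListFlattenTo V L l₂ t₂ h₂) ≫
            tensListAppend V u (List.map (Sigma.mk i) (L i)) ▷ _ := by
      simp only [← tensorHom_id, tensorHom_comp_tensorHom, Category.id_comp, Category.comp_id]
    rw [e1]
    simp only [Category.assoc, Iso.inv_hom_id_assoc]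
    rw [h1, ← h2, associator_naturality_assoc]
    simp only [← id_tensorHom, tensorHom_comp_tensorHom_assoc, Category.id_comp, Category.comp_id,
      Category.assoc, IH]

lemma tensListFlattenTo_shuffle {ι : Type} {κ : ι → Type} (A B : (Σ i, κ i) → C)
    (L : ∀ i, List (κ i)) (l : List ι) (s : List (Σ i, κ i)) (hs : sigmaList L l = s) :
    tensListFlattenTo (fun x => A x ⊗ B x) L l s hs ≫ tensListShuffle A B s =
      tensListMap (fun i => tensListShuffle (fun j => A ⟨i, j⟩) (fun j => B ⟨i, j⟩) (L i)) l ≫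
        tensListShuffle (fun i => tensList (fun j => A ⟨i, j⟩) (L i))
          (fun i => tensList (fun j => B ⟨i, j⟩) (L i)) l ≫
          (tensListFlattenTo A L l s hs ⊗ₘ tensListFlattenTo B L l s hs) := by
  induction l generalizing s with
  | nil =>
    obtain rfl : s = [] := by rw [← hs]; rfl
    rw [tensListFlattenTo_nil, tensListFlattenTo_nil, tensListFlattenTo_nil, tensListShuffle_nil,
      tensListShuffle_nil, tensListMap_nil]
    simp [tensorHom_comp_tensorHom]
  | cons i l ih =>
    obtain ⟨t, ht⟩ : ∃ t, sigmaList L l = t := ⟨_, rfl⟩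
    obtain rfl : s = (L i).map (Sigma.mk i) ++ t := by rw [← hs, ← ht]; rfl
    rw [tensListFlattenTo_cons _ L i l t ht, tensListFlattenTo_cons _ L i l t ht,
      tensListFlattenTo_cons _ L i l t ht, tensListShuffle_cons, tensListMap_cons]
    simp only [Category.assoc, Iso.inv_hom_id_assoc, tensorHom_comp_tensorHom]
    rw [tensListAppend_shuffle, tensorHom_comp_tensorHom_assoc, ih t ht, tensListRelabel_shuffle]
    rw [← tensorHom_comp_tensorHom (tensListRelabel A (Sigma.mk i) (L i) ⊗ₘ _),
      ← tensorμ_natural_assoc]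
    simp only [← id_tensorHom, tensorHom_comp_tensorHom_assoc, Category.id_comp, Category.assoc]

lemma tensListRelabel_reindex_self {ι κ : Type} (V : ι → C) (f : κ → ι) (l : List κ)
    (h : (l.map f).Perm (l.map f)) (hl : (l.map f).Nodup) :
    tensListRelabel V f l ≫ tensListReindex (V := V) (W := fun j => V (f j)) f (fun j => 𝟙 (V (f j)))
      l (l.map f) h = 𝟙 _ := by
  rw [tensListRelabel_reindex V (W := fun j => V (f j)) f (fun j => j) (fun j => 𝟙 (V (f j))) l l
    (by simp) h hl]
  exact tensListReindex_id _ _ _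

/-- Both sides run through the same blocks in the same order, and only the outer names `k` and `f k`
differ. It is used to flatten over the part of a list of pairs which has a fixed first entry. -/
lemma tensListRelabel_flatten {ι κ : Type} {μ : ι → Type} (V : (Σ i, μ i) → C)
    (L : ∀ i, List (μ i)) (f : κ → ι) (l : List κ) (s : List (Σ k, μ (f k))) (t : List (Σ i, μ i))
    (hs : sigmaList (fun k => L (f k)) l = s) (ht : sigmaList L (l.map f) = t)
    (h : t.Perm (s.map (fun x => ⟨f x.1, x.2⟩))) (hnd : t.Nodup) :
    tensListRelabel (fun i => tensList (fun j => V ⟨i, j⟩) (L i)) f l ≫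
        tensListFlattenTo V L (l.map f) t ht ≫
          tensListReindex (V := V) (W := fun x : Σ k, μ (f k) => V ⟨f x.1, x.2⟩)
            (fun x => ⟨f x.1, x.2⟩) (fun x => 𝟙 _) s t h =
      tensListFlattenTo (fun x : Σ k, μ (f k) => V ⟨f x.1, x.2⟩) (fun k => L (f k)) l s hs := by
  induction l generalizing s t with
  | nil =>
    obtain rfl : s = [] := by rw [← hs]; rfl
    obtain rfl : t = [] := by rw [← ht]; rfl
    rw [tensListRelabel_nil, tensListReindex_nil, tensListFlattenTo_nil]
    show _ ≫ tensListFlattenTo V L [] [] ht ≫ _ = _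
    rw [tensListFlattenTo_nil]
    simp
  | cons k l ih =>
    obtain ⟨u, hu⟩ : ∃ u, sigmaList (fun k => L (f k)) l = u := ⟨_, rfl⟩
    obtain ⟨w, hw⟩ : ∃ w, sigmaList L (l.map f) = w := ⟨_, rfl⟩
    obtain rfl : s = (L (f k)).map (Sigma.mk k) ++ u := by rw [← hs, ← hu]; rfl
    obtain rfl : t = (L (f k)).map (Sigma.mk (f k)) ++ w := by rw [← ht, ← hw]; rfl
    have hM : ((L (f k)).map (Sigma.mk (f k))).Perm (((L (f k)).map (Sigma.mk k)).map
        (fun x : Σ k, μ (f k) => (⟨f x.1, x.2⟩ : Σ i, μ i))) := by rw [List.map_map]; rfl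
    have hw' : w.Perm (u.map (fun x : Σ k, μ (f k) => (⟨f x.1, x.2⟩ : Σ i, μ i))) := by
      rw [List.map_append] at h
      have e : ((L (f k)).map (Sigma.mk (f k))) = (((L (f k)).map (Sigma.mk k)).map
        (fun x : Σ k, μ (f k) => (⟨f x.1, x.2⟩ : Σ i, μ i))) := by rw [List.map_map]; rfl
      rw [← e] at h
      exact (List.perm_append_left_iff _).1 h
    have IH := ih u w hu hw hw' hnd.of_append_right
    have h1 := tensListReindex_append (V := V) (W := fun x : Σ k, μ (f k) => V ⟨f x.1, x.2⟩)
      (fun x => ⟨f x.1, x.2⟩) (fun x => 𝟙 _) ((L (f k)).map (Sigma.mk k)) u _ w hM hw' h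
    have h2 := tensListReindex_relabel (V := V) (fun x : Σ k, μ (f k) => V ⟨f x.1, x.2⟩)
      (Sigma.mk k) (fun x => (⟨f x.1, x.2⟩ : Σ i, μ i)) (fun x => 𝟙 _) (L (f k))
      ((L (f k)).map (Sigma.mk (f k))) (List.Perm.refl _) hM hnd.of_append_left
    rw [tensListRelabel_cons, tensListFlattenTo_cons _ _ k l u hu]
    show _ ≫ tensListFlattenTo V L (f k :: l.map f) _ ht ≫ _ = _
    rw [tensListFlattenTo_cons V L (f k) (l.map f) w hw]
    simp only [Category.assoc, Iso.inv_hom_id_assoc]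
    rw [← h1, ← h2]
    simp only [← id_tensorHom, tensorHom_comp_tensorHom_assoc, Category.id_comp, IH]
    have h3 := tensListRelabel_reindex_self V (Sigma.mk (f k)) (L (f k)) (List.Perm.refl _)
      hnd.of_append_left
    rw [reassoc_of% h3]

lemma sigmaList_append {ι : Type} {κ : ι → Type} (L : ∀ i, List (κ i)) (l₁ l₂ : List ι) :
    sigmaList L (l₁ ++ l₂) = sigmaList L l₁ ++ sigmaList L l₂ := by
  induction l₁ with
  | nil => rfl
  | cons i l ih => simp [sigmaList, ih]

lemma map_sigmaList_mk {ι : Type} {κ : ι → Type} {μ : (Σ i, κ i) → Type} (N : ∀ x, List (μ x))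
    (i : ι) (M : List (κ i)) :
    (sigmaList (fun j => N ⟨i, j⟩) M).map (Sigma.mk i) =
      (sigmaList N (M.map (Sigma.mk i))).map
        (fun x => (⟨x.1.1, x.1.2, x.2⟩ : Σ i, Σ j : κ i, μ ⟨i, j⟩)) := by
  induction M with
  | nil => rfl
  | cons j M ih => simp [sigmaList, ih]

/-- Associativity of flattening. -/
lemma tensListFlattenTo_flatten {ι : Type} {κ : ι → Type} {μ : (Σ i, κ i) → Type}
    (V : (Σ x, μ x) → C) (L : ∀ i, List (κ i)) (N : ∀ x, List (μ x)) (l : List ι)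
    (s : List (Σ i, κ i)) (t : List (Σ x, μ x)) (u : ∀ i, List (Σ j : κ i, μ ⟨i, j⟩))
    (v : List (Σ i, Σ j : κ i, μ ⟨i, j⟩)) (hs : sigmaList L l = s) (ht : sigmaList N s = t)
    (hu : ∀ i, sigmaList (fun j => N ⟨i, j⟩) (L i) = u i) (hv : sigmaList u l = v)
    (h : v.Perm (t.map (fun x => ⟨x.1.1, x.1.2, x.2⟩))) (hnd : t.Nodup) :
    tensListFlattenTo (fun x => tensList (fun n => V ⟨x, n⟩) (N x)) L l s hs ≫
        tensListFlattenTo V N s t ht =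
      tensListMap (fun i => tensListFlattenTo (fun y : Σ j : κ i, μ ⟨i, j⟩ => V ⟨⟨i, y.1⟩, y.2⟩)
          (fun j => N ⟨i, j⟩) (L i) (u i) (hu i)) l ≫
        tensListFlattenTo (fun y : Σ i, Σ j : κ i, μ ⟨i, j⟩ => V ⟨⟨y.1, y.2.1⟩, y.2.2⟩) u l v hv ≫
          tensListReindex (V := fun y : Σ i, Σ j : κ i, μ ⟨i, j⟩ => V ⟨⟨y.1, y.2.1⟩, y.2.2⟩)
            (W := V) (fun x => ⟨x.1.1, x.1.2, x.2⟩) (fun x => 𝟙 (V x)) t v h := by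
  induction l generalizing s t v with
  | nil =>
    obtain rfl : s = [] := by rw [← hs]; rfl
    obtain rfl : t = [] := by rw [← ht]; rfl
    obtain rfl : v = [] := by rw [← hv]; rfl
    rw [tensListFlattenTo_nil, tensListFlattenTo_nil, tensListFlattenTo_nil, tensListReindex_nil,
      tensListMap_nil]
    simp
  | cons i l ih =>
    obtain ⟨s', hs'⟩ : ∃ s', sigmaList L l = s' := ⟨_, rfl⟩
    obtain ⟨v', hv'⟩ : ∃ v', sigmaList u l = v' := ⟨_, rfl⟩
    obtain rfl : s = (L i).map (Sigma.mk i) ++ s' := by rw [← hs, ← hs']; rfl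
    obtain rfl : v = (u i).map (Sigma.mk i) ++ v' := by rw [← hv, ← hv']; rfl
    obtain ⟨t₁, ht₁⟩ : ∃ t₁, sigmaList N ((L i).map (Sigma.mk i)) = t₁ := ⟨_, rfl⟩
    obtain ⟨t₂, ht₂⟩ : ∃ t₂, sigmaList N s' = t₂ := ⟨_, rfl⟩
    obtain rfl : t = t₁ ++ t₂ := by rw [← ht, sigmaList_append, ht₁, ht₂]
    -- Over the single outer index `i`, the two ways of flattening list the triples in the same
    -- order. Hence the permutation `h` splits into one for this block and one for the remaining
    -- blocks.
    have e₁ : (u i).map (Sigma.mk i) =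
        t₁.map (fun x => (⟨x.1.1, x.1.2, x.2⟩ : Σ i, Σ j : κ i, μ ⟨i, j⟩)) := by
      rw [← hu, ← ht₁, map_sigmaList_mk]
    have h₁ : ((u i).map (Sigma.mk i)).Perm
        (t₁.map (fun x => (⟨x.1.1, x.1.2, x.2⟩ : Σ i, Σ j : κ i, μ ⟨i, j⟩))) := by rw [e₁]
    have h₂ : v'.Perm (t₂.map (fun x => (⟨x.1.1, x.1.2, x.2⟩ : Σ i, Σ j : κ i, μ ⟨i, j⟩))) := by
      rw [List.map_append, e₁] at h
      exact (List.perm_append_left_iff _).1 h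
    have IH := ih s' t₂ v' hs' ht₂ hv' h₂ hnd.of_append_right
    have h3 := tensListFlattenTo_append V N ((L i).map (Sigma.mk i)) s' t₁ t₂ (t₁ ++ t₂) ht₁ ht₂ ht
      (by simp) hnd
    rw [tensListReindex_id, Category.comp_id] at h3
    have h4 := tensListReindex_append
      (V := fun y : Σ i, Σ j : κ i, μ ⟨i, j⟩ => V ⟨⟨y.1, y.2.1⟩, y.2.2⟩) (W := V)
      (fun x => ⟨x.1.1, x.1.2, x.2⟩) (fun x => 𝟙 (V x)) t₁ t₂ _ v' h₁ h₂ h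
    have hy : t₁.Perm ((u i).map (fun y => (⟨⟨i, y.1⟩, y.2⟩ : Σ x, μ x))) := by
      have := congrArg (List.map (fun y : Σ i, Σ j : κ i, μ ⟨i, j⟩ =>
        (⟨⟨y.1, y.2.1⟩, y.2.2⟩ : Σ x, μ x))) e₁
      rw [List.map_map, List.map_map] at this
      refine List.Perm.trans ?_ (List.Perm.of_eq this.symm)
      exact List.Perm.of_eq (List.map_id _).symm
    have hnd₁ : t₁.Nodup := hnd.of_append_left
    have h5 := tensListRelabel_flatten V N (Sigma.mk i) (L i) (u i) t₁ (hu i) ht₁ hy hnd₁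
    have hz : t₁.Perm (((u i).map (Sigma.mk i)).map (fun y : Σ i, Σ j : κ i, μ ⟨i, j⟩ =>
        (⟨⟨y.1, y.2.1⟩, y.2.2⟩ : Σ x, μ x))) := by rw [List.map_map]; exact hy
    have h6 := tensListReindex_relabel (V := V)
      (fun y : Σ i, Σ j : κ i, μ ⟨i, j⟩ => V ⟨⟨y.1, y.2.1⟩, y.2.2⟩) (Sigma.mk i)
      (fun y => (⟨⟨y.1, y.2.1⟩, y.2.2⟩ : Σ x, μ x)) (fun y => 𝟙 _) (u i) t₁ hy hz hnd₁
    have h7 := tensListReindex_comp (V := V)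
      (W := fun y : Σ i, Σ j : κ i, μ ⟨i, j⟩ => V ⟨⟨y.1, y.2.1⟩, y.2.2⟩) (U := V)
      (fun y => (⟨⟨y.1, y.2.1⟩, y.2.2⟩ : Σ x, μ x)) (fun y => 𝟙 _)
      (fun x => ⟨x.1.1, x.1.2, x.2⟩) (fun x => 𝟙 (V x)) t₁ _ t₁ hz h₁ hnd₁ (by simp)
    -- The claim for the block of `i` alone: naming the pairs and then flattening agrees with
    -- flattening and then naming the triples.
    have h8 : tensListRelabel (fun x => tensList (fun n => V ⟨x, n⟩) (N x)) (Sigma.mk i) (L i) ≫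
        tensListFlattenTo V N ((L i).map (Sigma.mk i)) t₁ ht₁ =
        tensListFlattenTo (fun y : Σ j : κ i, μ ⟨i, j⟩ => V ⟨⟨i, y.1⟩, y.2⟩)
          (fun j => N ⟨i, j⟩) (L i) (u i) (hu i) ≫
          tensListRelabel (fun y : Σ i, Σ j : κ i, μ ⟨i, j⟩ => V ⟨⟨y.1, y.2.1⟩, y.2.2⟩)
            (Sigma.mk i) (u i) ≫
          tensListReindex (V := fun y : Σ i, Σ j : κ i, μ ⟨i, j⟩ => V ⟨⟨y.1, y.2.1⟩, y.2.2⟩)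
            (W := V) (fun x => ⟨x.1.1, x.1.2, x.2⟩) (fun x => 𝟙 (V x)) t₁ _ h₁ := by
      rw [← h5, Category.assoc, Category.assoc, reassoc_of% h6, h7]
      simp only [Category.comp_id]
      erw [tensListReindex_id, Category.comp_id]
    rw [tensListFlattenTo_cons _ L i l s' hs', tensListFlattenTo_cons _ u i l v' hv',
      tensListMap_cons]
    simp only [Category.assoc, Iso.inv_hom_id_assoc]
    rw [h3, ← h4]
    simp only [tensorHom_comp_tensorHom_assoc, IH, h8]

end Gathering

end Koszul

/-! ### Gathering: a shuffle followed by a flattening -/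

namespace Koszul

open MonoidalCategory

section Gathering

variable {C : Type*} [Category C] [MonoidalCategory C] [SymmetricCategory C]

/-- The canonical isomorphism `⨂ᵢ (A i ⊗ ⨂ⱼ B (i, j)) ⟶ (⨂ᵢ A i) ⊗ ⨂ B (i, j)`. -/
def tensListGather {ι : Type} {κ : ι → Type} (A : ι → C) (B : (Σ i, κ i) → C)
    (L : ∀ i, List (κ i)) (l : List ι) (s : List (Σ i, κ i)) (hs : sigmaList L l = s) :
    tensList (fun i => A i ⊗ tensList (fun j => B ⟨i, j⟩) (L i)) l ⟶ tensList A l ⊗ tensList B s :=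
  tensListShuffle A (fun i => tensList (fun j => B ⟨i, j⟩) (L i)) l ≫
    _ ◁ tensListFlattenTo B L l s hs

instance isIso_tensListGather {ι : Type} {κ : ι → Type} (A : ι → C) (B : (Σ i, κ i) → C)
    (L : ∀ i, List (κ i)) (l : List ι) (s : List (Σ i, κ i)) (hs : sigmaList L l = s) :
    IsIso (tensListGather A B L l s hs) := by
  unfold tensListGather
  infer_instance

/-- Combines the corresponding results for shuffles and flattenings: a permutation of the outer and
inner indices acts on the `A`-factors through the outer indices, and on the `B`-factors through the
pairs. -/
lemma tensListReindex_gather {ι κ : Type} {ι' : ι → Type} {κ' : κ → Type} {A : ι → C}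
    {B : (Σ i, ι' i) → C} {A' : κ → C} {B' : (Σ k, κ' k) → C} (f : κ → ι) (φ : ∀ k, A (f k) ⟶ A' k)
    (g : ∀ k, κ' k → ι' (f k)) (ψ : ∀ k (j : κ' k), B ⟨f k, g k j⟩ ⟶ B' ⟨k, j⟩)
    (L : ∀ i, List (ι' i)) (L' : ∀ k, List (κ' k)) (hL : ∀ k, (L (f k)).Perm ((L' k).map (g k)))
    (l' : List κ) (l : List ι) (h : l.Perm (l'.map f)) (s : List (Σ i, ι' i)) (s' : List (Σ k, κ' k))
    (hs : sigmaList L l = s) (hs' : sigmaList L' l' = s') (hnd : s.Nodup)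
    (h' : s.Perm (s'.map (fun x => (⟨f x.1, g x.1 x.2⟩ : Σ i, ι' i)))) :
    tensListReindex (V := fun i => A i ⊗ tensList (fun j => B ⟨i, j⟩) (L i))
        (W := fun k => A' k ⊗ tensList (fun j => B' ⟨k, j⟩) (L' k)) f
        (fun k => φ k ⊗ₘ tensListReindex (V := fun j => B ⟨f k, j⟩) (W := fun j => B' ⟨k, j⟩) (g k)
          (ψ k) (L' k) (L (f k)) (hL k)) l' l h ≫ tensListGather A' B' L' l' s' hs' =
      tensListGather A B L l s hs ≫ (tensListReindex f φ l' l h ⊗ₘ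
        tensListReindex (V := B) (W := B') (fun x => ⟨f x.1, g x.1 x.2⟩) (fun x => ψ x.1 x.2) s' s
          h') := by
  have h1 := tensListReindex_shuffle (A := A) (B := fun i => tensList (fun j => B ⟨i, j⟩) (L i))
    (A' := A') (B' := fun k => tensList (fun j => B' ⟨k, j⟩) (L' k)) f φ
    (fun k => tensListReindex (V := fun j => B ⟨f k, j⟩) (W := fun j => B' ⟨k, j⟩) (g k)
          (ψ k) (L' k) (L (f k)) (hL k)) l' l h
  have h2 := tensListReindex_flatten f g ψ L L' hL l' l h s s' hs hs' hnd h'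
  unfold tensListGather
  rw [reassoc_of% h1]
  simp only [← id_tensorHom, tensorHom_comp_tensorHom, Category.comp_id, Category.id_comp,
    Category.assoc, h2]

/-- Gathering is associative. -/
lemma tensListGather_gather {ι : Type} {κ : ι → Type} {μ : (Σ i, κ i) → Type} (X : ι → C)
    (Y : (Σ i, κ i) → C) (V : (Σ x, μ x) → C) (L : ∀ i, List (κ i)) (N : ∀ x, List (μ x))
    (l : List ι) (s : List (Σ i, κ i)) (t : List (Σ x, μ x))
    (u : ∀ i, List (Σ j : κ i, μ ⟨i, j⟩)) (v : List (Σ i, Σ j : κ i, μ ⟨i, j⟩))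
    (hs : sigmaList L l = s) (ht : sigmaList N s = t)
    (hu : ∀ i, sigmaList (fun j => N ⟨i, j⟩) (L i) = u i) (hv : sigmaList u l = v)
    (h : v.Perm (t.map (fun x => ⟨x.1.1, x.1.2, x.2⟩))) (hnd : t.Nodup) :
    tensListGather X (fun x => Y x ⊗ tensList (fun n => V ⟨x, n⟩) (N x)) L l s hs ≫
        tensList X l ◁ tensListGather Y V N s t ht =
      tensListMap (fun i => X i ◁ tensListGather (fun j => Y ⟨i, j⟩)
          (fun y : Σ j : κ i, μ ⟨i, j⟩ => V ⟨⟨i, y.1⟩, y.2⟩) (fun j => N ⟨i, j⟩) (L i) (u i) (hu i)) l ≫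
        tensListShuffle X (fun i => tensList (fun j => Y ⟨i, j⟩) (L i) ⊗
          tensList (fun y : Σ j : κ i, μ ⟨i, j⟩ => V ⟨⟨i, y.1⟩, y.2⟩) (u i)) l ≫
        tensList X l ◁ (tensListShuffle _ _ l ≫ (tensListFlattenTo Y L l s hs ⊗ₘ
          tensListFlattenTo (fun y : Σ i, Σ j : κ i, μ ⟨i, j⟩ => V ⟨⟨y.1, y.2.1⟩, y.2.2⟩) u l v hv ≫
          tensListReindex (V := fun y : Σ i, Σ j : κ i, μ ⟨i, j⟩ => V ⟨⟨y.1, y.2.1⟩, y.2.2⟩)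
            (W := V) (fun x => ⟨x.1.1, x.1.2, x.2⟩) (fun x => 𝟙 (V x)) t v h)) := by
  have h1 := tensListShuffle_natural (fun i => 𝟙 (X i)) (fun i => tensListGather (fun j => Y ⟨i, j⟩)
          (fun y : Σ j : κ i, μ ⟨i, j⟩ => V ⟨⟨i, y.1⟩, y.2⟩) (fun j => N ⟨i, j⟩) (L i) (u i) (hu i)) l
  simp only [id_tensorHom, tensListMap_id] at h1
  rw [reassoc_of% h1]
  conv_lhs => unfold tensListGather
  rw [Category.assoc, ← MonoidalCategory.whiskerLeft_comp, ← MonoidalCategory.whiskerLeft_comp]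
  congr 2
  have h2 := tensListFlattenTo_shuffle Y (fun x => tensList (fun n => V ⟨x, n⟩) (N x)) L l s hs
  have h3 := tensListFlattenTo_flatten V L N l s t u v hs ht hu hv h hnd
  rw [reassoc_of% h2]
  unfold tensListGather
  rw [tensListMap_comp]
  have h4 := tensListShuffle_natural
    (A := fun i => tensList (fun j => Y ⟨i, j⟩) (L i))
    (A' := fun i => tensList (fun j => Y ⟨i, j⟩) (L i))
    (fun i => 𝟙 (tensList (fun j => Y ⟨i, j⟩) (L i)))
    (fun i => tensListFlattenTo (fun y : Σ j : κ i, μ ⟨i, j⟩ => V ⟨⟨i, y.1⟩, y.2⟩)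
      (fun j => N ⟨i, j⟩) (L i) (u i) (hu i)) l
  simp only [id_tensorHom, tensListMap_id] at h4
  rw [Category.assoc, reassoc_of% h4]
  simp only [← id_tensorHom, tensorHom_comp_tensorHom, Category.comp_id, Category.id_comp, h3]

lemma tensListReindex_cons_head {ι κ : Type} {V : ι → C} {W : κ → C} (f : κ → ι)
    (φ : ∀ j, V (f j) ⟶ W j) (k : κ) (l' : List κ) (l : List ι)
    (h : (f k :: l).Perm ((k :: l').map f)) (hp : l.Perm (l'.map f)) :
    tensListReindex f φ (k :: l') (f k :: l) h = (tensCons V (f k) l).hom ≫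
      (φ k ⊗ₘ tensListReindex f φ l' l hp) ≫ (tensCons W k l').inv := by
  classical
  rw [tensListReindex_cons f φ k l' _ l h List.mem_cons_self (List.erase_cons_head ..) hp,
    tensListPull_head]

/-- The list `l ++ []` is not `l` by definition, so the right unit law for concatenation needs an
identity reindexing. -/
lemma tensListAppend_nil_right {ι : Type} (V : ι → C) (l : List ι)
    (h : (l ++ []).Perm (l.map (fun i => i))) :
    tensListAppend V [] l ≫ tensListReindex (V := V) (W := V) (fun i => i) (fun i => 𝟙 (V i)) l _ h =
      _ ◁ (tensNil V).hom ≫ (ρ_ _).hom := by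
  classical
  induction l with
  | nil =>
    refine (congrArg (_ ≫ ·) (tensListReindex_id V [] _)).trans ((Category.comp_id _).trans ?_)
    have : (tensNil V).hom ▷ tensList V [] ≫ (λ_ (tensList V [])).hom =
      ((tensNil V).hom ▷ tensList V [] ≫ 𝟙_ C ◁ (tensNil V).hom ≫ (λ_ (𝟙_ C)).hom) ≫
        (tensNil V).inv := by simp
    rw [tensListAppend_nil, this, ← whisker_exchange_assoc, unitors_equal]
    simp
  | cons i l ih =>
    have hp : (l ++ []).Perm (l.map (fun i => i)) := by simp
    have IH := congrArg (V i ◁ ·) (ih hp)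
    simp only [MonoidalCategory.whiskerLeft_comp] at IH
    rw [tensListAppend_cons]
    have e := tensListReindex_cons_head (V := V) (W := V) (fun i => i) (fun i => 𝟙 (V i)) i l
      (l ++ []) (by simp) hp
    rw [id_tensorHom] at e
    refine (congrArg (_ ≫ ·) e).trans ?_
    simp only [Category.assoc, Iso.inv_hom_id_assoc]
    rw [reassoc_of% IH]
    have e2 : tensList V (i :: l) ◁ (tensNil V).hom ≫ (ρ_ (tensList V (i :: l))).hom =
        (tensCons V i l).hom ▷ tensList V [] ≫ (V i ⊗ tensList V l) ◁ (tensNil V).hom ≫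
          (ρ_ _).hom ≫ (tensCons V i l).inv := by
      rw [← whisker_exchange_assoc]
      simp
    rw [e2]
    simp

/-- Gathering over a one-element list. -/
lemma tensListGather_singleton {ι : Type} {κ : ι → Type} (A : ι → C) (B : (Σ i, κ i) → C)
    (L : ∀ i, List (κ i)) (i : ι) (s : List (Σ i, κ i)) (hs : sigmaList L [i] = s)
    (h : s.Perm ((L i).map (Sigma.mk i))) (hnd : s.Nodup) :
    tensListGather A B L [i] s hs ≫ (((tensCons A i []).hom ≫ _ ◁ (tensNil A).hom ≫ (ρ_ _).hom) ⊗ₘ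
        tensListReindex (V := B) (W := fun j => B ⟨i, j⟩) (Sigma.mk i) (fun j => 𝟙 _) (L i) s h) =
      (tensCons _ i []).hom ≫ _ ◁ (tensNil _).hom ≫ (ρ_ _).hom := by
  obtain rfl : s = (L i).map (Sigma.mk i) ++ [] := by rw [← hs]; rfl
  have hnd' : ((L i).map (Sigma.mk i)).Nodup := hnd.of_append_left
  have hm : (((L i).map (Sigma.mk i)) ++ []).Perm (((L i).map (Sigma.mk i)).map (fun x => x)) := by
    rw [List.map_id', List.append_nil]
  have h1 := tensListAppend_nil_right B ((L i).map (Sigma.mk i)) hm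
  have h2 := tensListReindex_comp (V := B) (W := B) (U := fun j => B ⟨i, j⟩) (fun x => x)
    (fun x => 𝟙 _) (Sigma.mk i) (fun j => 𝟙 _) (L i) ((L i).map (Sigma.mk i))
    ((L i).map (Sigma.mk i) ++ []) hm (List.Perm.refl _) hnd h
  simp only [Category.comp_id] at h2
  have h3 := tensListRelabel_reindex_self B (Sigma.mk i) (L i) (List.Perm.refl _) hnd'
  unfold tensListGather
  rw [tensListFlattenTo_cons _ L i [] [] (show sigmaList L [] = [] from rfl), tensListShuffle_cons,
    tensListShuffle_nil, tensListFlattenTo_nil, ← h2]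
  have e1 : ((tensListRelabel B (Sigma.mk i) (L i) ⊗ₘ (tensNil (fun i => tensList (fun j => B ⟨i, j⟩)
        (L i))).hom ≫ (tensNil B).inv) ≫
      tensList B ((L i).map (Sigma.mk i)) ◁ (tensNil B).hom ≫ (ρ_ _).hom ≫
        tensListReindex (V := B) (W := fun j => B ⟨i, j⟩)
        (Sigma.mk i) (fun j => 𝟙 _) (L i) ((L i).map (Sigma.mk i)) (List.Perm.refl _)) =
      _ ◁ (tensNil _).hom ≫ (ρ_ _).hom := by
    rw [← id_tensorHom, tensorHom_comp_tensorHom_assoc, Category.assoc, Iso.inv_hom_id,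
      Category.comp_id, Category.comp_id, MonoidalCategory.tensorHom_def', Category.assoc,
      rightUnitor_naturality_assoc, h3]
    simp
  have e3 := tensor_right_unitality (A i) (tensList (fun j => B ⟨i, j⟩) (L i))
  simp only [← id_tensorHom (tensList A [i]), tensorHom_comp_tensorHom, Category.assoc,
    Category.id_comp, Iso.inv_hom_id_assoc, reassoc_of% h1, e1]
  simp only [MonoidalCategory.whiskerLeft_comp, Category.assoc, tensorμ_natural_right_assoc,
    tensorHom_comp_tensorHom, whiskerLeft_inv_hom_assoc]
  rw [e3]

/-- Collapsing a tensor product of objects over the unit. -/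
def tensListCollapse {ι : Type} {A : ι → C} (ε : ∀ i, A i ⟶ 𝟙_ C) : (l : List ι) →
    (tensList A l ⟶ 𝟙_ C)
  | [] => 𝟙 _
  | i :: l => (ε i ⊗ₘ tensListCollapse ε l) ≫ (λ_ _).hom

lemma tensListCollapse_nil {ι : Type} {A : ι → C} (ε : ∀ i, A i ⟶ 𝟙_ C) :
    tensListCollapse ε [] = (tensNil A).hom := rfl

lemma tensListCollapse_cons {ι : Type} {A : ι → C} (ε : ∀ i, A i ⟶ 𝟙_ C) (i : ι) (l : List ι) :
    tensListCollapse ε (i :: l) = (tensCons A i l).hom ≫ (ε i ⊗ₘ tensListCollapse ε l) ≫ (λ_ _).hom :=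
  (Category.id_comp _).symm

/-- Gathering when every inner list has one element. -/
lemma tensListGather_collapse {ι : Type} {κ : ι → Type} {A : ι → C} (ε : ∀ i, A i ⟶ 𝟙_ C)
    (B : (Σ i, κ i) → C) (L : ∀ i, List (κ i)) (j : ∀ i, κ i) (hL : ∀ i, L i = [j i])
    (l : List ι) (s : List (Σ i, κ i)) (hs : sigmaList L l = s)
    (h : s.Perm (l.map (fun i => (⟨i, j i⟩ : Σ i, κ i)))) (hj : ∀ i, (L i).Perm ([()].map (fun _ => j i))) :
    tensListGather A B L l s hs ≫ (tensListCollapse ε l ⊗ₘ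
        tensListReindex (V := B) (W := fun i => B ⟨i, j i⟩) (fun i => ⟨i, j i⟩) (fun i => 𝟙 _) l s h) ≫
          (λ_ _).hom =
      tensListMap (fun i => (ε i ⊗ₘ tensListReindex (V := fun j => B ⟨i, j⟩)
        (W := fun _ : Unit => B ⟨i, j i⟩) (fun _ => j i) (fun _ => 𝟙 _) [()] (L i) (hj i) ≫
        (tensCons _ () []).hom ≫ B ⟨i, j i⟩ ◁ (tensNil _).hom ≫ (ρ_ _).hom) ≫ (λ_ _).hom) l := by
  obtain rfl : L = fun i => [j i] := funext hL
  induction l generalizing s with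
  | nil =>
    obtain rfl : s = [] := by rw [← hs]; rfl
    unfold tensListGather
    rw [tensListReindex_nil, tensListMap_nil, tensListShuffle_nil, tensListFlattenTo_nil,
      tensListCollapse_nil]
    simp only [Category.assoc, ← id_tensorHom, tensorHom_comp_tensorHom_assoc]
    simp [MonoidalCategory.tensorHom_def]
  | cons i l ih =>
    obtain ⟨t, ht⟩ : ∃ t, sigmaList (fun i => [j i]) l = t := ⟨_, rfl⟩
    obtain rfl : s = ⟨i, j i⟩ :: t := by rw [← hs, ← ht]; rfl
    have hp : t.Perm (l.map (fun i => (⟨i, j i⟩ : Σ i, κ i))) := (List.perm_cons _).1 h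
    have IH := ih t hp ht
    have e0 := tensListReindex_cons_head (V := B) (W := fun i => B ⟨i, j i⟩) (fun i => ⟨i, j i⟩)
      (fun i => 𝟙 _) i l t h hp
    have e1 := tensListReindex_cons_head (V := fun j => B ⟨i, j⟩)
      (W := fun _ : Unit => B ⟨i, j i⟩) (fun _ => j i) (fun _ => 𝟙 _) () [] [] (hj i)
      (List.Perm.refl _)
    rw [tensListReindex_nil, id_tensorHom] at e1
    have e := tensListFlattenTo_cons B (fun i => [j i]) i l t ht hs
    have e2 : tensListFlattenTo B (fun i => [j i]) (i :: l) (⟨i, j i⟩ :: t) hs =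
      (tensCons (fun i => tensList (fun j => B ⟨i, j⟩) [j i]) i l).hom ≫
        ((tensListReindex (V := fun j => B ⟨i, j⟩) (W := fun _ : Unit => B ⟨i, j i⟩)
          (fun _ => j i) (fun _ => 𝟙 _) [()] [j i] (hj i) ≫
          (tensCons _ () []).hom ≫ B ⟨i, j i⟩ ◁ (tensNil _).hom ≫ (ρ_ _).hom) ⊗ₘ
            tensListFlattenTo B (fun i => [j i]) l t ht) ≫ (tensCons B ⟨i, j i⟩ t).inv := by
      refine e.trans ?_
      congr 1
      have er : tensListRelabel B (Sigma.mk i) [j i] = (tensCons _ (j i) []).hom ≫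
          B ⟨i, j i⟩ ◁ ((tensNil _).hom ≫ (tensNil B).inv) ≫ (tensCons B ⟨i, j i⟩ []).inv := by
        have := tensListRelabel_cons B (Sigma.mk i) (j i) []
        rw [tensListRelabel_nil] at this
        exact this
      rw [e1, er, MonoidalCategory.tensorHom_def']
      have e3 : tensListAppend B t (List.map (Sigma.mk i) [j i]) = (tensCons B ⟨i, j i⟩ []).hom ▷ _ ≫
        (α_ _ _ _).hom ≫ B ⟨i, j i⟩ ◁ ((tensNil B).hom ▷ _ ≫ (λ_ _).hom) ≫
          (tensCons B ⟨i, j i⟩ t).inv := by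
        have := tensListAppend_cons B t ⟨i, j i⟩ []
        rw [tensListAppend_nil] at this
        exact this
      rw [e3, MonoidalCategory.tensorHom_def']
      simp
    rw [e0, tensListCollapse_cons, tensListMap_cons, ← IH]
    unfold tensListGather
    rw [e2]
    rw [tensListShuffle_cons]
    -- Once every `A`-factor is collapsed to the unit, shuffling in the head is absorbed by the left
    -- unit law for `tensorμ`.
    have e4 := leftUnitor_monoidal (B ⟨i, j i⟩) (tensList (fun i => B ⟨i, j i⟩) l)
    simp only [← id_tensorHom (tensList A (i :: l)), tensorHom_comp_tensorHom,
      tensorHom_comp_tensorHom_assoc, Category.assoc, Category.id_comp, Iso.inv_hom_id_assoc,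
      Category.comp_id]
    generalize tensListReindex (V := fun j => B ⟨i, j⟩) (W := fun _ : Unit => B ⟨i, j i⟩)
      (fun _ => j i) (fun _ => 𝟙 _) [()] [j i] (hj i) ≫
          (tensCons (fun _ : Unit => B ⟨i, j i⟩) () []).hom ≫ B ⟨i, j i⟩ ◁ (tensNil _).hom ≫
            (ρ_ _).hom = q
    have e5 : ((λ_ (𝟙_ C)).hom ⊗ₘ (tensCons (fun i => B ⟨i, j i⟩) i l).inv) ≫
        (λ_ (tensList (fun i => B ⟨i, j i⟩) (i :: l))).hom =
      (λ_ (𝟙_ C)).hom ▷ _ ≫ (λ_ _).hom ≫ (tensCons (fun i => B ⟨i, j i⟩) i l).inv := by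
      rw [MonoidalCategory.tensorHom_def, Category.assoc, leftUnitor_naturality]
    rw [← tensorHom_comp_tensorHom (_ ⊗ₘ tensListCollapse ε l), Category.assoc, e5,
      ← tensorμ_natural_assoc, ← reassoc_of% e4]
    simp only [← id_tensorHom, tensorHom_comp_tensorHom,
      tensorHom_comp_tensorHom_assoc, Category.id_comp, Category.assoc]

end Gathering

end Koszul

/-! ### Additivity of the tensor product of complexes -/

namespace Koszul

open MonoidalCategory

section Additive

variable {k : Type u} [Field k]

lemma ι_tensorHom {K L K' L' : Ch k} (f : K ⟶ K') (g : L ⟶ L') (p q n : ℤ) (h : p + q = n) :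
    HomologicalComplex.ιTensorObj K L p q n h ≫ (f ⊗ₘ g).f n =
      (f.f p ⊗ₘ g.f q) ≫ HomologicalComplex.ιTensorObj K' L' p q n h := by
  refine (HomologicalComplex.ι_mapBifunctorMap f g (curriedTensor (ModuleCat.{u} k))
    (ComplexShape.down ℤ) p q n h).trans ?_
  rw [MonoidalCategory.tensorHom_def, Category.assoc]
  rfl

lemma tensorHom_f_ext {K L : Ch k} {M : Ch k} {f g : K ⊗ L ⟶ M}
    (h : ∀ p q n (h : p + q = n), HomologicalComplex.ιTensorObj K L p q n h ≫ f.f n =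
      HomologicalComplex.ιTensorObj K L p q n h ≫ g.f n) : f = g := by
  ext1 n
  exact HomologicalComplex.mapBifunctor.hom_ext (K₁ := K) (K₂ := L) (F := curriedTensor _)
    (c := ComplexShape.down ℤ) (fun p q hpq => h p q n hpq)

/-- Additivity makes tensor products distribute over the finite biproducts from which `H(V)` is
built. Each identity is checked on the summands `Kₚ ⊗ L_q` in a given degree. -/
instance : MonoidalPreadditive (Ch k) where
  whiskerLeft_zero {X Y Z} := tensorHom_f_ext fun p q n h => by
    rw [← id_tensorHom, ι_tensorHom]
    simp
  zero_whiskerRight {X Y Z} := tensorHom_f_ext fun p q n h => by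
    rw [← tensorHom_id, ι_tensorHom]
    simp
  whiskerLeft_add {X Y Z} f g := tensorHom_f_ext fun p q n h => by
    rw [← id_tensorHom, ← id_tensorHom, ← id_tensorHom, ι_tensorHom, HomologicalComplex.add_f_apply,
      HomologicalComplex.add_f_apply, Preadditive.comp_add, ι_tensorHom, ι_tensorHom]
    simp
  add_whiskerRight {X Y Z} f g := tensorHom_f_ext fun p q n h => by
    rw [← tensorHom_id, ← tensorHom_id, ← tensorHom_id, ι_tensorHom, HomologicalComplex.add_f_apply,
      HomologicalComplex.add_f_apply, Preadditive.comp_add, ι_tensorHom, ι_tensorHom]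
    simp

instance : HasFiniteBiproducts (Ch k) :=
  HasFiniteBiproducts.of_hasFiniteProducts

end Additive

section JointMono

variable {C : Type*} [Category C] [MonoidalCategory C]

lemma tensListMap_congr {ι : Type} {V W : ι → C} {φ ψ : ∀ i, V i ⟶ W i} (l : List ι)
    (h : ∀ i ∈ l, φ i = ψ i) : tensListMap φ l = tensListMap ψ l := by
  induction l with
  | nil => rfl
  | cons i l ih =>
    rw [tensListMap_cons, tensListMap_cons, h i List.mem_cons_self,
      ih fun j hj => h j (List.mem_cons_of_mem _ hj)]

variable [Preadditive C] [MonoidalPreadditive C]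

lemma tensListMap_eq_zero {ι : Type} {V W : ι → C} (φ : ∀ i, V i ⟶ W i) (l : List ι) (i : ι)
    (hi : i ∈ l) (h : φ i = 0) : tensListMap φ l = 0 := by
  induction l with
  | nil => exact absurd hi List.not_mem_nil
  | cons j l ih =>
    rw [tensListMap_cons]
    rcases List.mem_cons.1 hi with rfl | hi
    · simp [h]
    · simp [ih hi]

/-- If the endomorphisms `e i c` sum to the identity in each factor, their tensor products over all
tuples sum to the identity. A map into the tensor product is therefore detected by composing with
these products. The induction treats one factor at a time, which avoids expanding a product of sums.
-/
lemma comp_tensListMap_ext {ι : Type} {J : ι → Type} [∀ i, Finite (J i)] {V : ι → C}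
    (e : ∀ i, J i → (V i ⟶ V i)) (he : ∀ i, ∑ᶠ c, e i c = 𝟙 (V i)) (l : List ι) (hl : l.Nodup)
    {Z W : C} (a b : Z ⟶ W ⊗ tensList V l)
    (h : ∀ p : ∀ i, J i, a ≫ W ◁ tensListMap (fun i => e i (p i)) l =
      b ≫ W ◁ tensListMap (fun i => e i (p i)) l)
    (p₀ : ∀ i, J i) : a = b := by
  classical
  induction l generalizing W with
  | nil =>
    -- For the empty list all tuples give the same condition, and `p₀` ensures that there is one.
    have h0 := h p₀
    rw [tensListMap_nil] at h0
    simpa using h0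
  | cons i l ih =>
    have hl' := List.nodup_cons.1 hl
    have key : ∀ c, a ≫ W ◁ ((tensCons V i l).hom ≫ e i c ▷ _) =
        b ≫ W ◁ ((tensCons V i l).hom ≫ e i c ▷ _) := by
      intro c
      rw [← cancel_mono (α_ W (V i) (tensList V l)).inv]
      -- The head factor, already composed with `e i c`, is absorbed into the fixed left factor.
      -- This is why `W` is generalised.
      refine ih hl'.2 _ _ fun p => ?_
      have h1 := h (Function.update p i c)
      rw [tensListMap_cons, tensListMap_congr (φ := fun j => e j (Function.update p i c j))
        (ψ := fun j => e j (p j)) l] at h1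
      · simp only [Function.update_self, MonoidalCategory.tensorHom_def] at h1
        rw [← cancel_mono (W ◁ (tensCons V i l).hom)] at h1
        simp only [Category.assoc, ← MonoidalCategory.whiskerLeft_comp, Iso.inv_hom_id,
          Category.comp_id] at h1
        simp only [Category.assoc]
        simpa using congrArg (· ≫ (α_ _ _ _).inv) h1
      · intro j hj
        rw [Function.update_of_ne]
        rintro rfl
        exact hl'.1 hj
    have := Fintype.ofFinite (J i)
    -- Insert the identity of the head factor as the sum of the `e i x`.
    have hs : ∀ c : Z ⟶ W ⊗ tensList V (i :: l), c = (∑ x, c ≫ W ◁ ((tensCons V i l).hom ≫ e i x ▷ _)) ≫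
        W ◁ (tensCons V i l).inv := by
      intro c
      rw [← Preadditive.comp_sum, ← whiskerLeft_sum, ← Preadditive.comp_sum, ← sum_whiskerRight,
        ← finsum_eq_sum_of_fintype, he]
      simp
    rw [hs a, hs b]
    simp only [key]

end JointMono

end Koszul

/-! ### Pieces of a fixed tree, and their graftings -/

namespace Koszul

open MonoidalCategory RTree

/-- A tree embedded into the edges of the tree `Q`. -/
structure Piece (Q : RTree) where
  tree : RTree
  map : tree.Edge → Q.Edge
  le_iff : ∀ {a b : tree.Edge}, map a ≤ map b ↔ a ≤ b

namespace Piece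

variable {Q : RTree}

/-- The root of a piece, as an edge of the ambient tree. -/
def rt (P : Piece Q) : Q.Edge := P.map P.tree.root

lemma map_injective (P : Piece Q) : Function.Injective P.map := fun _ _ h =>
  le_antisymm (P.le_iff.1 h.le) (P.le_iff.1 h.ge)

lemma lt_iff (P : Piece Q) {a b : P.tree.Edge} : P.map a < P.map b ↔ a < b := by
  rw [lt_iff_le_not_ge, lt_iff_le_not_ge, P.le_iff, P.le_iff]

lemma rt_le (P : Piece Q) (x : P.tree.Edge) : P.rt ≤ P.map x := P.le_iff.2 (P.tree.root_le x)

lemma rt_mem (P : Piece Q) : P.rt ∈ Set.range P.map := ⟨_, rfl⟩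

/-- The edges of `P` are edges of `P'`, and both have the same root and the same leaves. -/
structure Sub (P P' : Piece Q) : Prop where
  subset : ∀ x, ∃ x', P'.map x' = P.map x
  root : P.rt = P'.rt
  leaf : ∀ l, IsMax l → ∃ l', IsMax l' ∧ P'.map l' = P.map l
  cover : ∀ l', IsMax l' → ∃ l, IsMax l ∧ P.map l = P'.map l'

lemma Sub.refl (P : Piece Q) : Sub P P :=
  ⟨fun x => ⟨x, rfl⟩, rfl, fun l hl => ⟨l, hl, rfl⟩, fun l hl => ⟨l, hl, rfl⟩⟩

lemma Sub.trans {P P' P'' : Piece Q} (h : Sub P P') (h' : Sub P' P'') : Sub P P'' where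
  subset x := by
    obtain ⟨y, hy⟩ := h.subset x
    obtain ⟨z, hz⟩ := h'.subset y
    exact ⟨z, hz.trans hy⟩
  root := h.root.trans h'.root
  leaf l hl := by
    obtain ⟨y, hy, e⟩ := h.leaf l hl
    obtain ⟨z, hz, e'⟩ := h'.leaf y hy
    exact ⟨z, hz, e'.trans e⟩
  cover l hl := by
    obtain ⟨y, hy, e⟩ := h'.cover l hl
    obtain ⟨z, hz, e'⟩ := h.cover y hy
    exact ⟨z, hz, e'.trans e⟩

/-- The morphism of trees over `Q`. -/
noncomputable def Sub.hom {P P' : Piece Q} (h : Sub P P') : (⟨P.tree⟩ : ATree) ⟶ ⟨P'.tree⟩ :=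
  ⟨{  toFun := fun x => (h.subset x).choose
      le_iff := by
        intro a b
        rw [← P'.le_iff, (h.subset a).choose_spec, (h.subset b).choose_spec, P.le_iff]
      map_root := P'.map_injective ((h.subset _).choose_spec.trans h.root)
      cover := fun t ht => by
        obtain ⟨l, hl, e⟩ := h.cover t ht
        exact ⟨l, hl, P'.le_iff.1 ((h.subset l).choose_spec.trans e).le⟩ },
    fun l hl => by
      obtain ⟨l', hl', e⟩ := h.leaf l hl
      have : (h.subset l).choose = l' := P'.map_injective ((h.subset l).choose_spec.trans e.symm)
      show IsMax (h.subset l).choose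
      rw [this]
      exact hl'⟩

lemma Sub.map_hom {P P' : Piece Q} (h : Sub P P') (x : P.tree.Edge) :
    P'.map (RTree.edge h.hom.hom x) = P.map x := (h.subset x).choose_spec

lemma Sub.of_hom {P P' : Piece Q} (c : (⟨P.tree⟩ : ATree) ⟶ ⟨P'.tree⟩)
    (hc : ∀ x, P'.map (RTree.edge c.hom x) = P.map x) : Sub P P' where
  subset x := ⟨_, hc x⟩
  root := by rw [rt, ← hc, RTree.edge_root, rt]
  leaf l hl := ⟨_, c.property l hl, hc l⟩
  cover l hl := by
    obtain ⟨m, hm⟩ := (RTree.leafMap_bijective c.hom c.property).2 ⟨l, hl⟩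
    exact ⟨m.1, m.2, (hc _).symm.trans (congrArg P'.map (congrArg Subtype.val hm))⟩

/-- Edges of a piece are determined by their images in the ambient tree, so there is at most one
morphism over that tree. For this reason all diagrams of inclusions of pieces commute, and none has
to be checked by hand. -/
lemma Sub.hom_eq {P P' : Piece Q} (h : Sub P P') (c : (⟨P.tree⟩ : ATree) ⟶ ⟨P'.tree⟩)
    (hc : ∀ x, P'.map (RTree.edge c.hom x) = P.map x) : c = h.hom := by
  apply WideSubcategory.hom_ext
  apply RTree.Hom.ext
  funext x
  exact P'.map_injective ((hc x).trans (h.map_hom x).symm)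

/-- `T` is obtained by grafting `R` onto `S`. -/
structure IsGraft (T S R : Piece Q) : Prop where
  lower : ∀ x, x ∈ Set.range S.map ↔ x ∈ Set.range T.map ∧ ¬ R.rt < x
  upper : ∀ x, x ∈ Set.range R.map ↔ x ∈ Set.range T.map ∧ R.rt ≤ x

lemma IsGraft.lower_subset {T S R : Piece Q} (h : IsGraft T S R) (x : S.tree.Edge) :
    ∃ t, T.map t = S.map x := ((h.lower _).1 ⟨x, rfl⟩).1

lemma IsGraft.upper_subset {T S R : Piece Q} (h : IsGraft T S R) (x : R.tree.Edge) :
    ∃ t, T.map t = R.map x := ((h.upper _).1 ⟨x, rfl⟩).1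

/-- The underlying grafting of trees. -/
noncomputable def IsGraft.grafting {T S R : Piece Q} (h : IsGraft T S R) :
    Grafting S.tree R.tree T.tree where
  lower x := (h.lower_subset x).choose
  upper x := (h.upper_subset x).choose
  lower_le_iff {a b} := by
    rw [← T.le_iff, (h.lower_subset a).choose_spec, (h.lower_subset b).choose_spec, S.le_iff]
  upper_le_iff {a b} := by
    rw [← T.le_iff, (h.upper_subset a).choose_spec, (h.upper_subset b).choose_spec, R.le_iff]
  range_lower x := by
    rw [← T.lt_iff, (h.upper_subset _).choose_spec]
    have := h.lower (T.map x)
    constructor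
    · rintro ⟨s, rfl⟩
      exact (this.1 ⟨s, (h.lower_subset s).choose_spec.symm⟩).2
    · intro hx
      obtain ⟨s, hs⟩ := this.2 ⟨⟨x, rfl⟩, hx⟩
      exact ⟨s, T.map_injective ((h.lower_subset s).choose_spec.trans hs)⟩
  range_upper x := by
    rw [← T.le_iff, (h.upper_subset _).choose_spec]
    have := h.upper (T.map x)
    constructor
    · rintro ⟨s, rfl⟩
      exact (this.1 ⟨s, (h.upper_subset s).choose_spec.symm⟩).2
    · intro hx
      obtain ⟨s, hs⟩ := this.2 ⟨⟨x, rfl⟩, hx⟩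
      exact ⟨s, T.map_injective ((h.upper_subset s).choose_spec.trans hs)⟩

lemma IsGraft.map_lower {T S R : Piece Q} (h : IsGraft T S R) (x : S.tree.Edge) :
    T.map (h.grafting.lower x) = S.map x := (h.lower_subset x).choose_spec

lemma IsGraft.map_upper {T S R : Piece Q} (h : IsGraft T S R) (x : R.tree.Edge) :
    T.map (h.grafting.upper x) = R.map x := (h.upper_subset x).choose_spec

lemma IsGraft.of_grafting {T S R : Piece Q} (g : Grafting S.tree R.tree T.tree)
    (hl : ∀ x, T.map (g.lower x) = S.map x) (hu : ∀ x, T.map (g.upper x) = R.map x) :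
    IsGraft T S R where
  lower x := by
    constructor
    · rintro ⟨s, rfl⟩
      refine ⟨⟨_, hl s⟩, ?_⟩
      rw [← hl, rt, ← hu, T.lt_iff]
      exact (g.range_lower _).1 ⟨s, rfl⟩
    · rintro ⟨⟨t, rfl⟩, ht⟩
      rw [rt, ← hu, T.lt_iff] at ht
      obtain ⟨s, rfl⟩ := (g.range_lower _).2 ht
      exact ⟨s, (hl s).symm⟩
  upper x := by
    constructor
    · rintro ⟨s, rfl⟩
      refine ⟨⟨_, hu s⟩, R.rt_le s⟩
    · rintro ⟨⟨t, rfl⟩, ht⟩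
      rw [rt, ← hu, T.le_iff] at ht
      obtain ⟨s, rfl⟩ := (g.range_upper _).2 ht
      exact ⟨s, (hu s).symm⟩

/-- Being a grafting is a condition on sets of edges only; pieces with isomorphic but different
underlying trees may thus be interchanged. -/
lemma IsGraft.congr {T S R T' S' R' : Piece Q} (h : IsGraft T S R)
    (hT : Set.range T'.map = Set.range T.map) (hS : Set.range S'.map = Set.range S.map)
    (hR : Set.range R'.map = Set.range R.map) (hrt : R'.rt = R.rt) : IsGraft T' S' R' where
  lower x := by rw [hS, hT, hrt]; exact h.lower x
  upper x := by rw [hR, hT, hrt]; exact h.upper x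

lemma rt_eq_of_range {P P' : Piece Q} (h : Set.range P'.map = Set.range P.map) : P'.rt = P.rt := by
  obtain ⟨x, hx⟩ := h ▸ P'.rt_mem
  obtain ⟨y, hy⟩ := h.symm ▸ P.rt_mem
  exact le_antisymm (hy ▸ P'.rt_le y) (hx ▸ P.rt_le x)

lemma isMax_iff (P : Piece Q) (x : P.tree.Edge) :
    IsMax x ↔ ∀ y ∈ Set.range P.map, P.map x ≤ y → y ≤ P.map x := by
  constructor
  · rintro h _ ⟨y, rfl⟩ hy
    exact P.le_iff.2 (h (P.le_iff.1 hy))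
  · intro h y hy
    exact P.le_iff.1 (h _ ⟨y, rfl⟩ (P.le_iff.2 hy))

lemma Sub.of_range {P P' : Piece Q} (h : Set.range P'.map = Set.range P.map) : Sub P P' where
  subset x := by
    have : P.map x ∈ Set.range P'.map := h ▸ ⟨x, rfl⟩
    exact this
  root := (rt_eq_of_range h).symm
  leaf l hl := by
    have : P.map l ∈ Set.range P'.map := h ▸ ⟨l, rfl⟩
    obtain ⟨y, hy⟩ := this
    refine ⟨y, ?_, hy⟩
    rw [isMax_iff] at hl ⊢
    rwa [hy, h]
  cover l hl := by
    have : P'.map l ∈ Set.range P.map := h ▸ ⟨l, rfl⟩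
    obtain ⟨y, hy⟩ := this
    refine ⟨y, ?_, hy⟩
    rw [isMax_iff] at hl ⊢
    rwa [hy, ← h]

/-- Removing everything above one edge. -/
def cutAt (T : Piece Q) (x : Q.Edge) : Piece Q where
  tree := T.tree.cut {e | T.map e = x}
  map e := T.map e.1
  le_iff := T.le_iff

lemma range_cutAt (T : Piece Q) {x : Q.Edge} (hx : x ∈ Set.range T.map) (y : Q.Edge) :
    y ∈ Set.range (T.cutAt x).map ↔ y ∈ Set.range T.map ∧ ¬ x < y := by
  constructor
  · rintro ⟨e, rfl⟩
    refine ⟨⟨e.1, rfl⟩, fun h => ?_⟩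
    obtain ⟨z, rfl⟩ := hx
    exact e.2 z rfl (T.lt_iff.1 h)
  · rintro ⟨⟨e, rfl⟩, h⟩
    refine ⟨⟨e, ?_⟩, rfl⟩
    rintro z rfl hz
    exact h (T.lt_iff.2 hz)

lemma IsGraft.rt_mem {T S R : Piece Q} (h : IsGraft T S R) : R.rt ∈ Set.range T.map :=
  ((h.upper _).1 R.rt_mem).1

lemma IsGraft.rt_mem_lower {T S R : Piece Q} (h : IsGraft T S R) : R.rt ∈ Set.range S.map :=
  (h.lower _).2 ⟨h.rt_mem, lt_irrefl _⟩

lemma IsGraft.rt_eq {T S R : Piece Q} (h : IsGraft T S R) : S.rt = T.rt := by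
  obtain ⟨x, hx⟩ := h.lower_subset S.tree.root
  have h1 : T.rt ≤ S.rt := (T.rt_le x).trans hx.le
  have h2 : T.rt ∈ Set.range S.map := (h.lower _).2 ⟨T.rt_mem, fun h' => by
    obtain ⟨y, hy⟩ := h.rt_mem
    exact absurd (hy ▸ T.rt_le y) h'.not_ge⟩
  obtain ⟨y, hy⟩ := h2
  exact le_antisymm (hy ▸ S.rt_le y) h1

/-- Grafting preserves inclusions. -/
lemma IsGraft.sub {T S R T' S' R' : Piece Q} (h : IsGraft T S R) (h' : IsGraft T' S' R')
    (hS : Sub S S') (hR : Sub R R') : Sub T T' := by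
  -- Proved for arbitrary graftings because it is used in both directions, for the leaves of `T` and
  -- for those of `T'`.
  have key : ∀ {T S R T' S' R' : Piece Q} (h : IsGraft T S R) (h' : IsGraft T' S' R')
    (hrt : R.rt = R'.rt) (hS : ∀ l, IsMax l → ∃ l', IsMax l' ∧ S'.map l' = S.map l)
    (hR : ∀ l, IsMax l → ∃ l', IsMax l' ∧ R'.map l' = R.map l),
    ∀ l, IsMax l → ∃ l', IsMax l' ∧ T'.map l' = T.map l := by
    intro T S R T' S' R' h h' hrt hS hR l hl
    by_cases hx : R.rt ≤ T.map l
    · obtain ⟨r, hr⟩ := (h.upper _).2 ⟨⟨l, rfl⟩, hx⟩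
      have hrm : IsMax r := fun y hy => by
        obtain ⟨t, ht⟩ := h.upper_subset y
        rw [← R.le_iff, hr, ← ht, T.le_iff] at hy ⊢
        exact hl hy
      obtain ⟨r', hr', e⟩ := hR r hrm
      obtain ⟨t', ht'⟩ := h'.upper_subset r'
      refine ⟨t', fun y hy => ?_, ht'.trans (e.trans hr)⟩
      have : T'.map y ∈ Set.range R'.map := (h'.upper _).2 ⟨⟨y, rfl⟩,
        (ht' ▸ R'.rt_le r').trans (T'.le_iff.2 hy)⟩
      obtain ⟨z, hz⟩ := this
      rw [← T'.le_iff, ← hz, ht', R'.le_iff] at hy ⊢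
      exact hr' hy
    · obtain ⟨s, hs⟩ := (h.lower _).2 ⟨⟨l, rfl⟩, fun h' => hx h'.le⟩
      have hsm : IsMax s := fun y hy => by
        obtain ⟨t, ht⟩ := h.lower_subset y
        rw [← S.le_iff, hs, ← ht, T.le_iff] at hy ⊢
        exact hl hy
      obtain ⟨s', hs', e⟩ := hS s hsm
      obtain ⟨t', ht'⟩ := h'.lower_subset s'
      refine ⟨t', fun y hy => ?_, ht'.trans (e.trans hs)⟩
      have : T'.map y ∈ Set.range S'.map := by
        refine (h'.lower _).2 ⟨⟨y, rfl⟩, fun hlt => ?_⟩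
        have h2 : S'.map s' ≤ T'.map y := ht' ▸ T'.le_iff.2 hy
        -- Both `R'.rt` and the image of `s'` lie below the image of `y`, so they are comparable. In
        -- either case `R'.rt` lies below `s'` (in the second one because `s'` is a leaf of `S'`,
        -- which contains `R'.rt`), contrary to `hx`.
        rcases Q.chain hlt.le h2 with h3 | h3
        · exact hx (hrt ▸ hs ▸ e ▸ h3)
        · obtain ⟨z, hz⟩ := h'.rt_mem_lower
          have h4 : R'.rt ≤ S'.map s' := by
            rw [← hz, S'.le_iff] at h3 ⊢
            exact hs' h3
          exact hx (hrt ▸ hs ▸ e ▸ h4)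
      obtain ⟨z, hz⟩ := this
      rw [← T'.le_iff, ← hz, ht', S'.le_iff] at hy ⊢
      exact hs' hy
  refine ⟨fun x => ?_, h.rt_eq.symm.trans (hS.root.trans h'.rt_eq),
    key h h' hR.root hS.leaf hR.leaf, key h' h hR.root.symm hS.cover hR.cover⟩
  by_cases hx : R.rt ≤ T.map x
  · obtain ⟨r, hr⟩ := (h.upper _).2 ⟨⟨x, rfl⟩, hx⟩
    obtain ⟨r', hr'⟩ := hR.subset r
    obtain ⟨t, ht⟩ := h'.upper_subset r'
    exact ⟨t, ht.trans (hr'.trans hr)⟩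
  · obtain ⟨s, hs⟩ := (h.lower _).2 ⟨⟨x, rfl⟩, fun h' => hx h'.le⟩
    obtain ⟨s', hs'⟩ := hS.subset s
    obtain ⟨t, ht⟩ := h'.lower_subset s'
    exact ⟨t, ht.trans (hs'.trans hs)⟩

/-- Graftings at different leaves. -/
lemma IsGraft.parallel {T P S A B : Piece Q} (h₁ : IsGraft T P A) (h₂ : IsGraft P S B)
    (hAB : ¬ B.rt ≤ A.rt) :
    IsGraft T (T.cutAt B.rt) B ∧ IsGraft (T.cutAt B.rt) S A := by
  have hB : B.rt ∈ Set.range T.map := ((h₁.lower _).1 h₂.rt_mem).1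
  have hBA : ¬ A.rt < B.rt := ((h₁.lower _).1 h₂.rt_mem).2
  -- The edges below `x` form a chain, so an edge above both roots would make the roots comparable.
  -- Consequently cutting at one root does not affect the edges above the other.
  have hxy : ∀ x, A.rt ≤ x → B.rt ≤ x → False := fun x h h' => by
    rcases Q.chain h h' with h3 | h3
    · rcases h3.eq_or_lt with h4 | h4
      · exact hAB h4.ge
      · exact hBA h4
    · exact hAB h3
  refine ⟨⟨range_cutAt T hB, fun x => ?_⟩, ⟨fun x => ?_, fun x => ?_⟩⟩
  · rw [h₂.upper, h₁.lower]
    exact ⟨fun h => ⟨h.1.1, h.2⟩, fun h => ⟨⟨h.1, fun h' => hxy x h'.le h.2⟩, h.2⟩⟩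
  · rw [h₂.lower, h₁.lower, range_cutAt T hB]
    tauto
  · rw [h₁.upper, range_cutAt T hB]
    exact ⟨fun h => ⟨⟨h.1, fun h' => hxy x h.2 h'.le⟩, h.2⟩, fun h => ⟨h.1.1, h.2⟩⟩

/-- Nested graftings. -/
lemma IsGraft.nested {T S W R A : Piece Q} (h₁ : IsGraft T S W) (h₂ : IsGraft W R A) :
    IsGraft T (T.cutAt A.rt) A ∧ IsGraft (T.cutAt A.rt) S R := by
  have hA : A.rt ∈ Set.range T.map := ((h₁.upper _).1 h₂.rt_mem).1
  have hWA : W.rt ≤ A.rt := ((h₁.upper _).1 h₂.rt_mem).2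
  have hR : R.rt = W.rt := h₂.rt_eq
  refine ⟨⟨range_cutAt T hA, fun x => ?_⟩, ⟨fun x => ?_, fun x => ?_⟩⟩
  · rw [h₂.upper, h₁.upper]
    exact ⟨fun h => ⟨h.1.1, h.2⟩, fun h => ⟨⟨h.1, hWA.trans h.2⟩, h.2⟩⟩
  · rw [h₁.lower, range_cutAt T hA, hR]
    exact ⟨fun h => ⟨⟨h.1, fun h' => h.2 (hWA.trans_lt h')⟩, h.2⟩, fun h => ⟨h.1.1, h.2⟩⟩
  · rw [h₂.lower, h₁.upper, range_cutAt T hA, hR]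
    tauto

end Piece

namespace Preoperad

open Piece

variable {k : Type u} [Field k] (X : Preoperad k) {Q : RTree}

/-- Functoriality of `X` for inclusions of pieces. -/
noncomputable def sub {P P' : Piece Q} (h : Sub P P') : X.val P'.tree ⟶ X.val P.tree :=
  X.X.map h.hom.op

lemma map_eq_sub {P P' : Piece Q} (h : Sub P P') (c : (⟨P.tree⟩ : ATree) ⟶ ⟨P'.tree⟩)
    (hc : ∀ x, P'.map (RTree.edge c.hom x) = P.map x) : X.X.map c.op = X.sub h := by
  rw [h.hom_eq c hc, sub]

lemma sub_refl (P : Piece Q) (h : Sub P P) : X.sub h = 𝟙 _ := by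
  rw [← X.map_eq_sub h (𝟙 _) (fun _ => rfl), op_id, X.X.map_id]

lemma sub_comp {P P' P'' : Piece Q} (h : Sub P P') (h' : Sub P' P'') (h'' : Sub P P'') :
    X.sub h' ≫ X.sub h = X.sub h'' := by
  rw [← X.map_eq_sub h'' (h.hom ≫ h'.hom) fun x => (h'.map_hom _).trans (h.map_hom x), op_comp,
    X.X.map_comp]
  rfl

/-- The structure map of `X` for a grafting of pieces. -/
noncomputable def graft {T S R : Piece Q} (h : IsGraft T S R) :
    X.val T.tree ⟶ X.val S.tree ⊗ X.val R.tree :=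
  X.θ h.grafting

lemma graft_natural {T S R T' S' R' : Piece Q} (h : IsGraft T S R) (h' : IsGraft T' S' R')
    (hT : Sub T T') (hS : Sub S S') (hR : Sub R R') :
    X.sub hT ≫ X.graft h = X.graft h' ≫ (X.sub hS ⊗ₘ X.sub hR) :=
  X.θ_natural h.grafting h'.grafting hS.hom hR.hom hT.hom
    (fun x => T'.map_injective (by rw [hT.map_hom, h.map_lower, h'.map_lower, hS.map_hom]))
    (fun x => T'.map_injective (by rw [hT.map_hom, h.map_upper, h'.map_upper, hR.map_hom]))

/-- Naturality of `θ` along identities shows that `θ` depends only on the two maps of edges of a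
grafting, and these are determined by the ambient tree. -/
lemma θ_eq_graft {T S R : Piece Q} (h : IsGraft T S R) (g : Grafting S.tree R.tree T.tree)
    (hl : ∀ x, T.map (g.lower x) = S.map x) (hu : ∀ x, T.map (g.upper x) = R.map x) :
    X.θ g = X.graft h := by
  have := X.θ_natural g h.grafting (𝟙 _) (𝟙 _) (𝟙 _)
    (fun x => T.map_injective ((hl x).trans (h.map_lower x).symm))
    (fun x => T.map_injective ((hu x).trans (h.map_upper x).symm))
  rw [op_id, op_id, op_id, X.X.map_id, X.X.map_id, X.X.map_id, Category.id_comp] at this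
  rw [this, id_tensorHom_id, Category.comp_id]
  rfl

lemma graft_nested {T S W R A P : Piece Q} (h₁ : IsGraft T S W) (h₂ : IsGraft W R A)
    (h₃ : IsGraft T P A) (h₄ : IsGraft P S R) :
    X.graft h₁ ≫ X.val S.tree ◁ X.graft h₂ =
      X.graft h₃ ≫ X.graft h₄ ▷ X.val A.tree ≫ (α_ _ _ _).hom :=
  X.θ_nested h₁.grafting h₂.grafting h₃.grafting h₄.grafting
    (fun x => T.map_injective (by rw [h₃.map_lower, h₄.map_lower, h₁.map_lower]))
    (fun x => T.map_injective (by rw [h₃.map_lower, h₄.map_upper, h₁.map_upper, h₂.map_lower]))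
    (fun x => T.map_injective (by rw [h₃.map_upper, h₁.map_upper, h₂.map_upper]))

lemma graft_parallel {T S P P' A B : Piece Q} (h₁ : IsGraft T P A) (h₂ : IsGraft P S B)
    (h₃ : IsGraft T P' B) (h₄ : IsGraft P' S A) :
    X.graft h₁ ≫ X.graft h₂ ▷ X.val A.tree ≫ (α_ _ _ _).hom ≫ X.val S.tree ◁ (β_ _ _).hom =
      X.graft h₃ ≫ X.graft h₄ ▷ X.val B.tree ≫ (α_ _ _ _).hom :=
  X.θ_parallel h₁.grafting h₂.grafting h₃.grafting h₄.grafting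
    (fun x => T.map_injective (by rw [h₁.map_lower, h₂.map_lower, h₃.map_lower, h₄.map_lower]))
    (fun x => T.map_injective (by rw [h₁.map_lower, h₂.map_upper, h₃.map_upper]))
    (fun x => T.map_injective (by rw [h₁.map_upper, h₃.map_lower, h₄.map_upper]))

end Preoperad

end Koszul

/-! ### Iterated structure maps as a relation, and independence of the order -/

namespace Koszul

open MonoidalCategory

section

variable {C : Type*} [Category C] [MonoidalCategory C]

/-- This lemma and its companions ending in `_aux` state the diagram chases behind the inductions on
`IsTheta` with free variables for the objects. They are pure statements about monoidal categories,
and the facts about `X` enter as hypotheses. -/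
lemma natural_nil_aux {A B B' N N' : C} (s : A ⟶ B) (t : B ⟶ B')
    (n : N ≅ 𝟙_ C) (n' : N' ≅ 𝟙_ C) :
    (s ≫ t) ≫ (ρ_ _).inv ≫ _ ◁ n'.inv =
      (s ≫ (ρ_ _).inv ≫ _ ◁ n.inv) ≫ (t ⊗ₘ (n.hom ≫ n'.inv)) := by
  simp [MonoidalCategory.tensorHom_def', whisker_exchange]

lemma natural_cons_aux {Z A A' S S' R R' M M' L L' : C} (m : Z ⟶ A ⊗ M) (g : A ⟶ S ⊗ R)
    (g' : A' ⟶ S' ⊗ R') (t : A ⟶ A') (s : S ⟶ S') (r : R ⟶ R') (n : M ⟶ M')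
    (c : L ≅ R ⊗ M) (c' : L' ≅ R' ⊗ M') (e : t ≫ g' = g ≫ (s ⊗ₘ r)) :
    m ≫ (t ⊗ₘ n) ≫ g' ▷ _ ≫ (α_ _ _ _).hom ≫ _ ◁ c'.inv =
      (m ≫ g ▷ _ ≫ (α_ _ _ _).hom ≫ _ ◁ c.inv) ≫ (s ⊗ₘ (c.hom ≫ (r ⊗ₘ n) ≫ c'.inv)) := by
  have : (t ⊗ₘ n) ≫ g' ▷ _ = g ▷ _ ≫ ((s ⊗ₘ r) ⊗ₘ n) := by
    simp only [← id_tensorHom, ← tensorHom_id, tensorHom_comp_tensorHom, Category.id_comp,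
      Category.comp_id, e]
  rw [reassoc_of% this, associator_naturality_assoc]
  simp only [← id_tensorHom, ← tensorHom_id, tensorHom_comp_tensorHom, Category.id_comp,
    Category.comp_id, Category.assoc, Iso.inv_hom_id_assoc]

lemma congr_right_aux {Z A S S' R M L : C} (m : Z ⟶ A ⊗ M) (g : A ⟶ S ⊗ R) (s : S ⟶ S')
    (c : L ≅ R ⊗ M) :
    (m ≫ g ▷ _ ≫ (α_ _ _ _).hom ≫ _ ◁ c.inv) ≫ s ▷ _ =
      m ≫ (g ≫ s ▷ _) ▷ _ ≫ (α_ _ _ _).hom ≫ _ ◁ c.inv := by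
  simp [whisker_exchange]

lemma congr_right_nil_aux {A B B' N : C} (f : A ⟶ B) (s : B ⟶ B') (n : N ≅ 𝟙_ C) :
    (f ≫ (ρ_ _).inv ≫ _ ◁ n.inv) ≫ s ▷ _ = (f ≫ s) ≫ (ρ_ _).inv ≫ _ ◁ n.inv := by
  simp [whisker_exchange]


lemma relabel_nil_aux {A B N N' : C} (f : A ⟶ B) (n : N ≅ 𝟙_ C) (n' : N' ≅ 𝟙_ C) :
    f ≫ (ρ_ _).inv ≫ _ ◁ n'.inv =
      (f ≫ (ρ_ _).inv ≫ _ ◁ n.inv) ≫ _ ◁ (n.hom ≫ n'.inv) := by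
  simp

lemma whisker_cons_aux {Z A S R M M' L L' : C} (m : Z ⟶ A ⊗ M) (g : A ⟶ S ⊗ R)
    (n : M ⟶ M') (c : L ≅ R ⊗ M) (c' : L' ≅ R ⊗ M') :
    (m ≫ A ◁ n) ≫ g ▷ _ ≫ (α_ _ _ _).hom ≫ _ ◁ c'.inv =
      (m ≫ g ▷ _ ≫ (α_ _ _ _).hom ≫ _ ◁ c.inv) ≫ _ ◁ (c.hom ≫ R ◁ n ≫ c'.inv) := by
  simp [whisker_exchange_assoc]

lemma swap_aux [BraidedCategory C] {Z A P P' S a b M La Lb Lab Lba : C} (m : Z ⟶ A ⊗ M)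
    (g' : A ⟶ P ⊗ a) (g : P ⟶ S ⊗ b) (g₁ : A ⟶ P' ⊗ b) (g₂ : P' ⟶ S ⊗ a)
    (ca : La ≅ a ⊗ M) (cba : Lba ≅ b ⊗ La) (cb : Lb ≅ b ⊗ M) (cab : Lab ≅ a ⊗ Lb)
    (e : g' ≫ g ▷ _ ≫ (α_ _ _ _).hom ≫ S ◁ (β_ _ _).hom = g₁ ≫ g₂ ▷ _ ≫ (α_ _ _ _).hom) :
    ((m ≫ g' ▷ _ ≫ (α_ _ _ _).hom ≫ _ ◁ ca.inv) ≫ g ▷ _ ≫ (α_ _ _ _).hom ≫ _ ◁ cba.inv) ≫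
      _ ◁ (cba.hom ≫ _ ◁ ca.hom ≫ tensSwap _ _ _ ≫ _ ◁ cb.inv ≫ cab.inv) =
    (m ≫ g₁ ▷ _ ≫ (α_ _ _ _).hom ≫ _ ◁ cb.inv) ≫ g₂ ▷ _ ≫ (α_ _ _ _).hom ≫ _ ◁ cab.inv := by
  have h₁ : (m ≫ g₁ ▷ _ ≫ (α_ _ _ _).hom ≫ _ ◁ cb.inv) ≫ g₂ ▷ _ ≫ (α_ _ _ _).hom ≫
      _ ◁ cab.inv = m ≫ (g₁ ≫ g₂ ▷ _ ≫ (α_ _ _ _).hom) ▷ M ≫ (α_ S (a ⊗ b) M).hom ≫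
        S ◁ ((α_ a b M).hom ≫ a ◁ cb.inv ≫ cab.inv) := by
    simp only [Category.assoc, whisker_exchange_assoc]
    monoidal
  rw [h₁, ← e]
  simp only [Category.assoc, whisker_exchange_assoc, associator_naturality_right_assoc,
    ← MonoidalCategory.whiskerLeft_comp, Iso.inv_hom_id_assoc]
  simp only [← MonoidalCategory.whiskerLeft_comp_assoc, Iso.inv_hom_id, 
    MonoidalCategory.whiskerLeft_id, Category.id_comp, Category.assoc, tensSwap]
  monoidal

open Classical in
lemma tensListReindex_swap [SymmetricCategory C] {ι : Type} (V : ι → C) {a b : ι} (hab : b ≠ a)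
    (l : List ι) (h : (b :: a :: l).Perm ((a :: b :: l).map (fun i => i))) :
    tensListReindex (V := V) (W := V) (fun i => i) (fun i => 𝟙 _) (a :: b :: l) (b :: a :: l) h =
      (tensCons V b (a :: l)).hom ≫ _ ◁ (tensCons V a l).hom ≫ tensSwap _ _ _ ≫
        _ ◁ (tensCons V b l).inv ≫ (tensCons V a (b :: l)).inv := by
  rw [tensListReindex_cons (V := V) (W := V) (fun i => i) (fun i => 𝟙 _) a (b :: l) (b :: a :: l)
    (b :: l) _ (by simp) (by rw [List.erase_cons_tail (by simpa using hab), List.erase_cons_head])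
    (by rw [List.map_id']), tensListReindex_id,
    tensListPull_tail V a b (a :: l) l hab (by simp)
      (by rw [List.erase_cons_tail (by simpa using hab), List.erase_cons_head]) (by simp)
      (List.erase_cons_head ..), tensListPull_head, id_tensorHom_id, Category.id_comp]
  simp only [Category.assoc]

end

open RTree Piece

namespace Preoperad

variable {k : Type u} [Field k] (X : Preoperad k) {Q : RTree}

/-- The morphism `m : X(T) ⟶ X(T₀) ⊗ ⨂ᵢ X(P i)` is an iterated structure map of `X`, obtained by
splitting off the pieces `P i` one after the other. -/
def IsTheta {ι : Type} (P : ι → Piece Q) (T : Piece Q) : (l : List ι) → (T₀ : Piece Q) →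
    (X.val T.tree ⟶ X.val T₀.tree ⊗ tensList (fun i => X.val (P i).tree) l) → Prop
  -- Equality of sets of edges, and not of pieces: a pruning which removes nothing is isomorphic to
  -- the tree but not equal to it.
  | [], T₀, m => ∃ h : Sub T₀ T, Set.range T₀.map = Set.range T.map ∧
      m = X.sub h ≫ (ρ_ _).inv ≫ _ ◁ (tensNil _).inv
  | a :: l, T₀, m => ∃ (T₁ : Piece Q) (m₁ : _) (g : IsGraft T₁ T₀ (P a)), IsTheta P T l T₁ m₁ ∧
      m = m₁ ≫ X.graft g ▷ _ ≫ (α_ _ _ _).hom ≫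
        _ ◁ (tensCons (fun i => X.val (P i).tree) a l).inv

variable {X}

/-- Induction over the pieces, using naturality of each structure map. The inclusion between the
intermediate pieces is not given, but is recovered from those of the two parts by `IsGraft.sub`.
With all inclusions trivial the lemma says that `IsTheta` determines the map. -/
lemma IsTheta.natural {ι : Type} {P P' : ι → Piece Q} {T T' T₀ T₀' : Piece Q} {l : List ι}
    {m : X.val T.tree ⟶ X.val T₀.tree ⊗ tensList (fun i => X.val (P i).tree) l}
    {m' : X.val T'.tree ⟶ X.val T₀'.tree ⊗ tensList (fun i => X.val (P' i).tree) l}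
    (h : X.IsTheta P T l T₀ m) (h' : X.IsTheta P' T' l T₀' m') (t : Sub T' T) (t₀ : Sub T₀' T₀)
    (φ : ∀ i, Sub (P' i) (P i)) :
    X.sub t ≫ m' = m ≫ (X.sub t₀ ⊗ₘ tensListMap (fun i => X.sub (φ i)) l) := by
  induction l generalizing T₀ T₀' with
  | nil =>
    obtain ⟨s, _, rfl⟩ := h
    obtain ⟨s', _, rfl⟩ := h'
    have e₁ := X.sub_comp s' t (s'.trans t)
    have e₂ := X.sub_comp t₀ s (s'.trans t)
    rw [tensListMap_nil, reassoc_of% e₁, ← e₂]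
    exact natural_nil_aux _ _ _ _
  | cons a l ih =>
    obtain ⟨T₁, m₁, g, h, rfl⟩ := h
    obtain ⟨T₁', m₁', g', h', rfl⟩ := h'
    have t₁ := g'.sub g t₀ (φ a)
    rw [reassoc_of% (ih h h' t₁), tensListMap_cons]
    exact natural_cons_aux _ _ _ _ _ _ _ _ _ (X.graft_natural g' g t₁ t₀ (φ a))

lemma IsTheta.congr_right {ι : Type} {P : ι → Piece Q} {T T₀ T₀' : Piece Q} {l : List ι}
    {m : X.val T.tree ⟶ X.val T₀.tree ⊗ tensList (fun i => X.val (P i).tree) l}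
    (h : X.IsTheta P T l T₀ m) (e : Set.range T₀'.map = Set.range T₀.map) (t : Sub T₀' T₀) :
    X.IsTheta P T l T₀' (m ≫ X.sub t ▷ _) := by
  cases l with
  | nil =>
    obtain ⟨s, hs, rfl⟩ := h
    refine ⟨t.trans s, e.trans hs, ?_⟩
    rw [← X.sub_comp t s]
    exact congr_right_nil_aux _ _ _
  | cons a l =>
    obtain ⟨T₁, m₁, g, h, rfl⟩ := h
    refine ⟨T₁, m₁, g.congr rfl e rfl rfl, h, ?_⟩
    have := X.graft_natural (g.congr rfl e rfl rfl) g (Sub.refl _) t (Sub.refl _)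
    rw [X.sub_refl, X.sub_refl, Category.id_comp] at this
    rw [this, tensorHom_id]
    exact congr_right_aux _ _ _ _

/-- The pieces with indices `a` and `b` are the last two to be split off. They sit at different
leaves, so `θ_parallel` exchanges them, the new intermediate piece being obtained by cutting at the
root of `P b` first. -/
lemma IsTheta.swap {ι : Type} {P : ι → Piece Q} {T T₀ : Piece Q} {a b : ι} {l : List ι}
    {m : X.val T.tree ⟶ X.val T₀.tree ⊗ tensList (fun i => X.val (P i).tree) (b :: a :: l)}
    (h : X.IsTheta P T (b :: a :: l) T₀ m) (hab : ¬ (P b).rt ≤ (P a).rt) :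
    X.IsTheta P T (a :: b :: l) T₀ (m ≫ _ ◁ ((tensCons (fun i => X.val (P i).tree) b (a :: l)).hom ≫
      _ ◁ (tensCons (fun i => X.val (P i).tree) a l).hom ≫ tensSwap (X.val (P b).tree) (X.val (P a).tree) _ ≫ _ ◁ (tensCons (fun i => X.val (P i).tree) b l).inv ≫
      (tensCons (fun i => X.val (P i).tree) a (b :: l)).inv)) := by
  obtain ⟨T₁, m₁, g, ⟨T₂, m₂, g', h, rfl⟩, rfl⟩ := h
  obtain ⟨g₁, g₂⟩ := g'.parallel g hab
  have h₁ : X.IsTheta P T (b :: l) _ (m₂ ≫ X.graft g₁ ▷ _ ≫ (α_ _ _ _).hom ≫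
    _ ◁ (tensCons (fun i => X.val (P i).tree) b l).inv) := ⟨_, m₂, g₁, h, rfl⟩
  exact ⟨_, _, g₂, h₁, swap_aux _ _ _ _ _ _ _ _ _ (X.graft_parallel g' g g₁ g₂)⟩

/-- A permutation is a composite of transpositions of neighbours, so `IsTheta.swap` suffices. The
hypothesis `hP` says that the roots of the pieces form an antichain, so that any two of them are
grafted in parallel. -/
lemma IsTheta.perm {ι : Type} {P : ι → Piece Q} (hP : ∀ i j, (P i).rt ≤ (P j).rt → i = j)
    {l l' : List ι} (hl : l.Perm l') (hnd : l.Nodup) {T T₀ : Piece Q}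
    {m : X.val T.tree ⟶ X.val T₀.tree ⊗ tensList (fun i => X.val (P i).tree) l}
    (h : X.IsTheta P T l T₀ m) (hl' : l.Perm (l'.map (fun i => i))) :
    X.IsTheta P T l' T₀ (m ≫ _ ◁ tensListReindex (V := fun i => X.val (P i).tree)
      (W := fun i => X.val (P i).tree) (fun i => i) (fun i => 𝟙 _) l' l hl') := by
  induction hl generalizing T₀ with
  | nil =>
    rw [tensListReindex_id]
    erw [MonoidalCategory.whiskerLeft_id, Category.comp_id]
    exact h
  | @cons a l l' hl ih =>
    obtain ⟨T₁, m₁, g, h, rfl⟩ := h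
    refine ⟨T₁, _, g, ih (List.nodup_cons.1 hnd).2 h (by rwa [List.map_id']), ?_⟩
    rw [tensListReindex_cons_head (V := fun i => X.val (P i).tree)
      (W := fun i => X.val (P i).tree) (fun i => i) (fun i => 𝟙 _) a l' l hl'
      (by rwa [List.map_id']), id_tensorHom]
    exact (whisker_cons_aux _ _ _ _ _).symm
  | swap a b l =>
    have hba : b ≠ a := by
      rintro rfl
      simp at hnd
    rw [tensListReindex_swap _ hba]
    exact IsTheta.swap h (fun e => hba (hP _ _ e))
  | @trans l l' l'' h₁ h₂ ih₁ ih₂ =>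
    have e₁ : l.Perm (l'.map (fun i => i)) := by rwa [List.map_id']
    have e₂ : l'.Perm (l''.map (fun i => i)) := by rwa [List.map_id']
    have := ih₂ (h₁.nodup_iff.1 hnd) (ih₁ hnd h e₁) e₂
    have hc := tensListReindex_comp (V := fun i => X.val (P i).tree)
      (W := fun i => X.val (P i).tree) (U := fun i => X.val (P i).tree) (fun i => i) (fun i => 𝟙 _)
      (fun i => i) (fun i => 𝟙 _) l'' l' l e₁ e₂ hnd hl'
    simp only [Category.comp_id] at hc
    rwa [Category.assoc, ← MonoidalCategory.whiskerLeft_comp, hc] at this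

lemma IsTheta.of_map {ι κ : Type} {P : ι → Piece Q} (f : κ → ι) {l : List κ} {T T₀ : Piece Q}
    {m : X.val T.tree ⟶ X.val T₀.tree ⊗ tensList (fun i => X.val (P i).tree) (l.map f)}
    (h : X.IsTheta P T (l.map f) T₀ m) :
    ∃ m' : X.val T.tree ⟶ X.val T₀.tree ⊗ tensList (fun j => X.val (P (f j)).tree) l,
      X.IsTheta (fun j => P (f j)) T l T₀ m' ∧
      m = m' ≫ _ ◁ tensListRelabel (fun i => X.val (P i).tree) f l := by
  induction l generalizing T₀ with
  | nil =>
    obtain ⟨s, hs, rfl⟩ := h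
    refine ⟨_, ⟨s, hs, rfl⟩, ?_⟩
    rw [tensListRelabel_nil]
    exact relabel_nil_aux _ _ _
  | cons a l ih =>
    obtain ⟨T₁, m₁, g, h, rfl⟩ := h
    obtain ⟨m', h', rfl⟩ := ih h
    refine ⟨_, ⟨T₁, m', g, h', rfl⟩, ?_⟩
    rw [tensListRelabel_cons]
    exact whisker_cons_aux _ _ _ _ _

/-- The form in which independence of the order is applied: bring the pieces into the order of `l'`,
rename them, and compare by naturality. Two iterated structure maps for corresponding pieces thus
differ only by the permutation of the factors. -/
lemma IsTheta.reindex {ι κ : Type} {P : ι → Piece Q} {P' : κ → Piece Q}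
    (hP : ∀ i j, (P i).rt ≤ (P j).rt → i = j) (f : κ → ι) {T T' T₀ T₀' : Piece Q} {l : List ι}
    {l' : List κ}
    {m : X.val T.tree ⟶ X.val T₀.tree ⊗ tensList (fun i => X.val (P i).tree) l}
    {m' : X.val T'.tree ⟶ X.val T₀'.tree ⊗ tensList (fun i => X.val (P' i).tree) l'}
    (h : X.IsTheta P T l T₀ m) (h' : X.IsTheta P' T' l' T₀' m') (t : Sub T' T) (t₀ : Sub T₀' T₀)
    (φ : ∀ j, Sub (P' j) (P (f j))) (hl : l.Perm (l'.map f)) (hnd : l.Nodup) :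
    X.sub t ≫ m' = m ≫ (X.sub t₀ ⊗ₘ tensListReindex (V := fun i => X.val (P i).tree)
      (W := fun j => X.val (P' j).tree) f (fun j => X.sub (φ j)) l' l hl) := by
  have e₁ : l.Perm ((l'.map f).map (fun i => i)) := by rwa [List.map_id']
  have h1 := h.perm hP hl hnd e₁
  obtain ⟨m₂, h2, e2⟩ := h1.of_map f
  have h3 := h2.natural h' t t₀ φ
  have h4 := tensListRelabel_reindex_self (fun i => X.val (P i).tree) f l' (List.Perm.refl _)
    (hl.nodup_iff.1 hnd)
  have h5 := congrArg (· ≫ X.val T₀.tree ◁ tensListReindex (V := fun i => X.val (P i).tree)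
    (W := fun j => X.val (P (f j)).tree) f (fun j => 𝟙 _) l' (l'.map f) (List.Perm.refl _)) e2
  simp only [Category.assoc, ← MonoidalCategory.whiskerLeft_comp, h4] at h5
  have hc := tensListReindex_comp (V := fun i => X.val (P i).tree)
      (W := fun i => X.val (P i).tree) (U := fun j => X.val (P (f j)).tree) (fun i => i)
      (fun i => 𝟙 _) f (fun i => 𝟙 _) l' _ l e₁ (List.Perm.refl _) hnd hl
  simp only [Category.comp_id] at hc
  rw [hc, MonoidalCategory.whiskerLeft_id, Category.comp_id] at h5
  rw [h3, ← h5, Category.assoc, ← id_tensorHom, tensorHom_comp_tensorHom, Category.id_comp,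
    tensListReindex_map _ _ _ _ _ _ hnd]
  simp

end Preoperad

end Koszul

/-! ### Iterated structure maps for nested families of pieces -/

namespace Koszul

open MonoidalCategory

section

variable {C : Type*} [Category C] [MonoidalCategory C]

lemma rightUnitor_inv_whiskerLeft_exchange {A B N : C} (f : A ⟶ B) (n : 𝟙_ C ⟶ N) :
    (ρ_ A).inv ≫ A ◁ n ≫ f ▷ N = f ≫ (ρ_ B).inv ≫ B ◁ n := by
  simp [whisker_exchange]

lemma nested_nil_aux {A S W B N : C} (g : A ⟶ S ⊗ W) (s : W ⟶ B) (n : N ≅ 𝟙_ C) :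
    g ≫ _ ◁ (s ≫ (ρ_ _).inv ≫ _ ◁ n.inv) =
      (𝟙 _ ≫ (ρ_ _).inv ≫ _ ◁ n.inv) ≫ (g ≫ S ◁ s) ▷ _ ≫ (α_ _ _ _).hom := by
  simp only [Category.id_comp, Category.assoc]
  rw [reassoc_of% rightUnitor_inv_whiskerLeft_exchange (g ≫ S ◁ s) n.inv]
  monoidal

lemma nested_cons_aux {A S W B R M L T P : C} (g : A ⟶ S ⊗ W) (m : W ⟶ B ⊗ M) (ga : B ⟶ R ⊗ T)
    (c : L ≅ T ⊗ M) {A' : C} (n : A ⟶ A' ⊗ M) (g₁ : A' ⟶ S ⊗ B) (g₃ : A' ⟶ P ⊗ T)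
    (g₄ : P ⟶ S ⊗ R) (e₁ : g ≫ _ ◁ m = n ≫ g₁ ▷ _ ≫ (α_ _ _ _).hom)
    (e₂ : g₁ ≫ _ ◁ ga = g₃ ≫ g₄ ▷ _ ≫ (α_ _ _ _).hom) :
    g ≫ _ ◁ (m ≫ ga ▷ _ ≫ (α_ _ _ _).hom ≫ _ ◁ c.inv) =
      (n ≫ g₃ ▷ _ ≫ (α_ _ _ _).hom ≫ _ ◁ c.inv) ≫ g₄ ▷ _ ≫ (α_ _ _ _).hom := by
  have h₁ : g ≫ _ ◁ (m ≫ ga ▷ _ ≫ (α_ _ _ _).hom ≫ _ ◁ c.inv) =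
      n ≫ (g₁ ≫ _ ◁ ga) ▷ M ≫ (α_ _ _ _).hom ≫ _ ◁ (α_ _ _ _).hom ≫ _ ◁ _ ◁ c.inv := by
    rw [MonoidalCategory.whiskerLeft_comp, reassoc_of% e₁]
    monoidal
  rw [h₁, e₂]
  simp only [Category.assoc, whisker_exchange_assoc]
  monoidal

lemma append_nil_aux {Z A B M N N' : C} (m : Z ⟶ A ⊗ M) (s : A ⟶ B)
    (n : N ≅ 𝟙_ C) (n' : N' ≅ 𝟙_ C) :
    m ≫ (s ≫ (ρ_ _).inv ≫ _ ◁ n.inv) ▷ _ ≫ (α_ _ _ _).hom ≫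
      _ ◁ ((n.hom ≫ n'.inv) ▷ _ ≫ n'.hom ▷ _ ≫ (λ_ _).hom) = m ≫ s ▷ _ := by
  have h : (B ◁ n.inv) ▷ M ≫ (B ◁ n.hom) ▷ M = 𝟙 _ := by
    rw [← comp_whiskerRight, whiskerLeft_inv_hom, id_whiskerRight]
  simp only [comp_whiskerRight, MonoidalCategory.whiskerLeft_comp, Category.assoc,
    ← associator_naturality_middle_assoc, reassoc_of% h,
    inv_hom_whiskerRight_assoc]
  simp

lemma append_cons_aux {Z A B S R M N N' L L' L'' K : C} (m : Z ⟶ A ⊗ M) (n : A ⟶ B ⊗ N)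
    (g : B ⟶ S ⊗ R) (r : N ⟶ N') (p : N' ⊗ M ⟶ K) (c : L ≅ R ⊗ N) (c' : L' ≅ R ⊗ N')
    (c'' : L'' ≅ R ⊗ K) :
    m ≫ (n ≫ g ▷ _ ≫ (α_ _ _ _).hom ≫ _ ◁ c.inv) ▷ _ ≫ (α_ _ _ _).hom ≫
      _ ◁ ((c.hom ≫ _ ◁ r ≫ c'.inv) ▷ _ ≫ c'.hom ▷ _ ≫ (α_ _ _ _).hom ≫ _ ◁ p ≫ c''.inv) =
    (m ≫ n ▷ _ ≫ (α_ _ _ _).hom ≫ _ ◁ (r ▷ _ ≫ p)) ≫ g ▷ _ ≫ (α_ _ _ _).hom ≫ _ ◁ c''.inv := by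
  have h : (S ◁ c.inv) ▷ M ≫ (S ◁ c.hom) ▷ M = 𝟙 _ := by
    rw [← comp_whiskerRight, whiskerLeft_inv_hom, id_whiskerRight]
  have h' : (S ◁ c'.inv) ▷ M ≫ (S ◁ c'.hom) ▷ M = 𝟙 _ := by
    rw [← comp_whiskerRight, whiskerLeft_inv_hom, id_whiskerRight]
  simp only [comp_whiskerRight, MonoidalCategory.whiskerLeft_comp, Category.assoc,
    ← associator_naturality_middle_assoc, reassoc_of% h, reassoc_of% h', whisker_exchange_assoc]
  have e : (B ◁ r) ▷ M ≫ g ▷ N' ▷ M = g ▷ N ▷ M ≫ ((S ⊗ R) ◁ r) ▷ M := by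
    rw [← comp_whiskerRight, whisker_exchange, comp_whiskerRight]
  rw [← associator_naturality_left_assoc, reassoc_of% e]
  monoidal

variable [SymmetricCategory C]

/-- Exchanging two factors. -/
def tensSwapRight (A B Z : C) : (Z ⊗ A) ⊗ B ⟶ (Z ⊗ B) ⊗ A :=
  (α_ _ _ _).hom ≫ Z ◁ (β_ A B).hom ≫ (α_ _ _ _).inv

lemma tensSwapRight_natural (A B : C) {Z Z' : C} (f : Z ⟶ Z') :
    tensSwapRight A B Z ≫ f ▷ B ▷ A = f ▷ A ▷ B ≫ tensSwapRight A B Z' := by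
  simp only [tensSwapRight, Category.assoc, associator_naturality_left_assoc,
    ← associator_inv_naturality_left, whisker_exchange_assoc]

lemma tensSwapRight_iso_left {A A' : C} (B Z : C) (c : A ≅ A') :
    tensSwapRight A B Z = (Z ◁ c.hom) ▷ B ≫ tensSwapRight A' B Z ≫ _ ◁ c.inv := by
  simp only [tensSwapRight, tensor_whiskerLeft, Category.assoc, Iso.inv_hom_id_assoc,
    whisker_assoc]
  rw [← MonoidalCategory.whiskerLeft_comp_assoc, ← MonoidalCategory.whiskerLeft_comp_assoc,
    BraidedCategory.braiding_naturality_left, Category.assoc,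
    ← MonoidalCategory.whiskerLeft_comp, Iso.hom_inv_id]
  simp

lemma tensSwapRight_iso_right (A : C) {B B' : C} (Z : C) (c : B ≅ B') :
    tensSwapRight A B Z = _ ◁ c.hom ≫ tensSwapRight A B' Z ≫ (Z ◁ c.inv) ▷ A := by
  simp only [tensSwapRight, tensor_whiskerLeft, Category.assoc, Iso.inv_hom_id_assoc,
    whisker_assoc]
  rw [← MonoidalCategory.whiskerLeft_comp_assoc, ← MonoidalCategory.whiskerLeft_comp_assoc,
    BraidedCategory.braiding_naturality_right, Category.assoc,
    ← comp_whiskerRight, Iso.hom_inv_id]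
  simp

lemma comm_nil_aux {A A' S B N : C} (s : A ⟶ A') (g : A' ⟶ S ⊗ B) (g' : A ⟶ S ⊗ B)
    (n : N ≅ 𝟙_ C) (e : s ≫ g = g') :
    (s ≫ (ρ_ _).inv ≫ _ ◁ n.inv) ≫ g ▷ _ =
      g' ≫ (𝟙 _ ≫ (ρ_ _).inv ≫ _ ◁ n.inv) ▷ _ ≫ tensSwapRight N B S := by
  subst e
  have h : (S ◁ n.inv) ▷ B ≫ (S ◁ n.hom) ▷ B = 𝟙 _ := by
    rw [← comp_whiskerRight, whiskerLeft_inv_hom, id_whiskerRight]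
  rw [tensSwapRight_iso_left _ _ n, tensSwapRight, braiding_tensorUnit_left]
  simp only [comp_whiskerRight, Category.assoc, reassoc_of% h, Category.id_comp]
  rw [rightUnitor_inv_whiskerLeft_exchange]
  monoidal

lemma comm_cons_aux {Z T₁ T₂ T' P S a B M L : C} (m : Z ⟶ T₁ ⊗ M) (ga : T₁ ⟶ T' ⊗ a)
    (g : T' ⟶ S ⊗ B) (c : L ≅ a ⊗ M) (g₃ : T₁ ⟶ P ⊗ B) (g₄ : P ⟶ S ⊗ a) (g' : Z ⟶ T₂ ⊗ B)
    (m' : T₂ ⟶ P ⊗ M)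
    (e : ga ≫ g ▷ _ ≫ (α_ _ _ _).hom ≫ S ◁ (β_ _ _).hom = g₃ ≫ g₄ ▷ _ ≫ (α_ _ _ _).hom)
    (e' : m ≫ g₃ ▷ _ = g' ≫ m' ▷ _ ≫ tensSwapRight M B P) :
    (m ≫ ga ▷ _ ≫ (α_ _ _ _).hom ≫ _ ◁ c.inv) ≫ g ▷ _ =
      g' ≫ (m' ≫ g₄ ▷ _ ≫ (α_ _ _ _).hom ≫ _ ◁ c.inv) ▷ _ ≫ tensSwapRight L B S := by
  have h : ga ≫ g ▷ _ = g₃ ≫ g₄ ▷ _ ≫ (α_ _ _ _).hom ≫ S ◁ (β_ _ _).hom ≫ (α_ _ _ _).inv := by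
    rw [← reassoc_of% e, ← MonoidalCategory.whiskerLeft_comp_assoc, SymmetricCategory.symmetry]
    simp
  have h₁ : (m ≫ ga ▷ _ ≫ (α_ _ _ _).hom ≫ _ ◁ c.inv) ≫ g ▷ _ =
      m ≫ (ga ≫ g ▷ _) ▷ M ≫ (α_ _ _ _).hom ≫ _ ◁ c.inv := by
    simp [whisker_exchange]
  rw [h₁, h, comp_whiskerRight_assoc, reassoc_of% e']
  simp only [comp_whiskerRight, Category.assoc]
  congr 2
  have h₂ : (S ◁ c.inv) ▷ B ≫ (S ◁ c.hom) ▷ B = 𝟙 _ := by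
    rw [← comp_whiskerRight, whiskerLeft_inv_hom, id_whiskerRight]
  rw [reassoc_of% tensSwapRight_natural M B g₄, tensSwapRight_iso_left _ _ c, reassoc_of% h₂]
  simp only [tensSwapRight, BraidedCategory.braiding_tensor_left_hom]
  monoidal

lemma comm_list_nil_aux {A B L M N : C} (m : A ⟶ B ⊗ L) (s : B ⟶ M) (n : N ≅ 𝟙_ C) :
    m ≫ (s ≫ (ρ_ _).inv ≫ _ ◁ n.inv) ▷ _ =
      (𝟙 _ ≫ (ρ_ _).inv ≫ _ ◁ n.inv) ≫ (m ≫ s ▷ _) ▷ _ ≫ tensSwapRight L N M := by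
  rw [tensSwapRight_iso_right _ _ n, tensSwapRight, braiding_tensorUnit_right]
  simp only [Category.id_comp, Category.assoc]
  rw [reassoc_of% rightUnitor_inv_whiskerLeft_exchange (m ≫ s ▷ _) n.inv,
    whiskerLeft_inv_hom_assoc]
  monoidal

lemma comm_list_cons_aux {Z A S R b L L' K T₁ T₂ : C} (m : Z ⟶ A ⊗ L) (n : A ⟶ R ⊗ L')
    (g : R ⟶ S ⊗ b) (c : K ≅ b ⊗ L') (n' : Z ⟶ T₁ ⊗ L') (m' : T₁ ⟶ R ⊗ L)
    (g' : T₁ ⟶ T₂ ⊗ b) (m'' : T₂ ⟶ S ⊗ L)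
    (e : m ≫ n ▷ _ = n' ≫ m' ▷ _ ≫ tensSwapRight L L' R)
    (e' : m' ≫ g ▷ _ = g' ≫ m'' ▷ _ ≫ tensSwapRight L b S) :
    m ≫ (n ≫ g ▷ _ ≫ (α_ _ _ _).hom ≫ _ ◁ c.inv) ▷ _ =
      (n' ≫ g' ▷ _ ≫ (α_ _ _ _).hom ≫ _ ◁ c.inv) ≫ m'' ▷ _ ≫ tensSwapRight L K S := by
  have e'' := congrArg (fun x => x ▷ L') e'
  simp only [comp_whiskerRight] at e''
  simp only [comp_whiskerRight, Category.assoc]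
  rw [reassoc_of% e, reassoc_of% tensSwapRight_natural L L' g, reassoc_of% e'',
    tensSwapRight_iso_right _ _ c]
  simp only [whisker_exchange_assoc, whiskerLeft_inv_hom_assoc]
  simp only [tensSwapRight, BraidedCategory.braiding_tensor_right_hom]
  monoidal

/-- The exchange of `B` with `P` is undone by the middle exchange in `tensorμ`, because the braiding
is symmetric. -/
lemma tensSwapRight_tensorμ (S A B P Q : C) :
    tensSwapRight B P (S ⊗ A) ▷ Q ≫ (α_ _ _ _).hom ≫ (α_ S A P).hom ▷ (B ⊗ Q) ≫ (α_ _ _ _).hom ≫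
      S ◁ tensorμ A P B Q = (α_ _ _ _).hom ≫ (α_ S A B).hom ▷ (P ⊗ Q) ≫ (α_ _ _ _).hom := by
  have h : tensSwapRight B P (S ⊗ A) ▷ Q ≫ (α_ _ _ _).hom ≫ (α_ S A P).hom ▷ (B ⊗ Q) ≫
      (α_ _ _ _).hom ≫ S ◁ tensorμ A P B Q =
      (α_ _ _ _).hom ▷ Q ≫ (α_ _ _ _).hom ≫ (S ⊗ A) ◁ ((β_ B P).hom ≫ (β_ P B).hom) ▷ Q ≫
        (α_ _ _ _).hom ≫ S ◁ A ◁ (α_ _ _ _).hom ≫ S ◁ (α_ _ _ _).inv := by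
    simp only [tensSwapRight, tensorμ]
    monoidal
  rw [h, SymmetricCategory.symmetry]
  monoidal

/-- The inductive step of `IsTheta.gather`. The hypotheses are the induction hypothesis for the tail
(`e₁`), associativity for the pieces nested in the head (`e₂`), and the commutation of these pieces
with the bases of the tail (`e₃`). -/
lemma gather_aux {Z T₁ S BL PS Wa BA PA T' A A' WL WL' BL' PS' : C}
    (m : Z ⟶ T₁ ⊗ WL) (φ : WL ⟶ BL ⊗ PS) (M1 : Z ⟶ A ⊗ PS) (M2 : A ⟶ T₁ ⊗ BL)
    (g : T₁ ⟶ S ⊗ Wa) (ma : Wa ⟶ BA ⊗ PA) (n : T₁ ⟶ T' ⊗ PA) (g'' : T' ⟶ S ⊗ BA)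
    (n' : A ⟶ A' ⊗ PA) (M2' : A' ⟶ T' ⊗ BL) (c : WL' ≅ Wa ⊗ WL) (cB : BL' ≅ BA ⊗ BL)
    (r : PA ⊗ PS ⟶ PS')
    (e₁ : m ≫ _ ◁ φ = M1 ≫ M2 ▷ _ ≫ (α_ _ _ _).hom)
    (e₂ : g ≫ _ ◁ ma = n ≫ g'' ▷ _ ≫ (α_ _ _ _).hom)
    (e₃ : M2 ≫ n ▷ _ = n' ≫ M2' ▷ _ ≫ tensSwapRight BL PA T') :
    (m ≫ g ▷ _ ≫ (α_ _ _ _).hom ≫ _ ◁ c.inv) ≫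
        _ ◁ (c.hom ≫ (ma ⊗ₘ φ) ≫ tensorμ _ _ _ _ ≫ (cB.inv ⊗ₘ r)) =
      (M1 ≫ n' ▷ _ ≫ (α_ _ _ _).hom ≫ _ ◁ r) ≫
        (M2' ≫ g'' ▷ _ ≫ (α_ _ _ _).hom ≫ _ ◁ cB.inv) ▷ _ ≫ (α_ _ _ _).hom := by
  have h₁ : (m ≫ g ▷ _ ≫ (α_ _ _ _).hom ≫ _ ◁ c.inv) ≫
        _ ◁ (c.hom ≫ (ma ⊗ₘ φ) ≫ tensorμ _ _ _ _ ≫ (cB.inv ⊗ₘ r)) =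
      (m ≫ _ ◁ φ) ≫ (g ≫ _ ◁ ma) ▷ _ ≫ (α_ _ _ _).hom ≫
        _ ◁ (tensorμ _ _ _ _ ≫ (cB.inv ⊗ₘ r)) := by
    simp only [MonoidalCategory.whiskerLeft_comp, Category.assoc, MonoidalCategory.tensorHom_def',
      comp_whiskerRight, whisker_exchange_assoc, whiskerLeft_inv_hom_assoc]
    simp
  have e₃' := congrArg (fun x => x ▷ PS) e₃
  simp only [comp_whiskerRight] at e₃'
  have h₂ : n ▷ (BL ⊗ PS) = (α_ _ _ _).inv ≫ n ▷ BL ▷ PS ≫ (α_ _ _ _).hom := by simp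
  have h₃ : M1 ≫ M2 ▷ PS ≫ n ▷ BL ▷ PS = M1 ≫ n' ▷ PS ≫ M2' ▷ PA ▷ PS ≫ tensSwapRight BL PA T' ▷ PS := by
    rw [e₃']
  rw [h₁, e₁, e₂]
  simp only [comp_whiskerRight, Category.assoc, h₂, Iso.hom_inv_id_assoc]
  rw [reassoc_of% h₃]
  have h₄ : tensSwapRight BL PA T' ▷ PS ≫ (α_ _ _ _).hom ≫ g'' ▷ PA ▷ (BL ⊗ PS) =
      g'' ▷ _ ▷ _ ▷ _ ≫ tensSwapRight BL PA (S ⊗ BA) ▷ PS ≫ (α_ _ _ _).hom := by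
    rw [← associator_naturality_left, ← comp_whiskerRight_assoc, tensSwapRight_natural,
      comp_whiskerRight_assoc]
  rw [reassoc_of% h₄, MonoidalCategory.whiskerLeft_comp, reassoc_of% tensSwapRight_tensorμ]
  simp only [whisker_exchange_assoc, MonoidalCategory.whiskerLeft_comp,
    MonoidalCategory.tensorHom_def]
  monoidal

lemma gather_nil_aux {A B W N P : C} (s : A ⟶ B) (w : W ≅ 𝟙_ C) (n : N ≅ 𝟙_ C) (p : P ≅ 𝟙_ C) :
    (s ≫ (ρ_ _).inv ≫ _ ◁ w.inv) ≫ _ ◁ (w.hom ≫ (λ_ (𝟙_ C)).inv ≫ (n.inv ⊗ₘ p.inv)) =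
      (𝟙 _ ≫ (ρ_ _).inv ≫ _ ◁ p.inv) ≫ (s ≫ (ρ_ _).inv ≫ _ ◁ n.inv) ▷ _ ≫ (α_ _ _ _).hom := by
  simp only [Category.id_comp, Category.assoc, MonoidalCategory.whiskerLeft_comp,
    whiskerLeft_inv_hom_assoc]
  rw [reassoc_of% rightUnitor_inv_whiskerLeft_exchange (s ≫ (ρ_ _).inv ≫ _ ◁ n.inv) p.inv,
    MonoidalCategory.tensorHom_def]
  monoidal

lemma gather_cons_aux {V A B AL BL X Y B' K M : C} (φ : V ⟶ A ⊗ B) {ML : C} (f : M ⟶ ML)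
    (h : ML ⟶ AL ⊗ X) (x : A ⊗ AL ⟶ K) (c : Y ≅ B ⊗ X) (r : B ⟶ B') (F : X ⟶ BL) {Z : C}
    (p : B' ⊗ BL ⟶ Z) :
    (φ ⊗ₘ f) ≫ (A ⊗ B) ◁ h ≫ tensorμ A B AL X ≫ (x ⊗ₘ c.inv) ≫
      K ◁ (c.hom ≫ (r ⊗ₘ F) ≫ p) =
    (φ ⊗ₘ (f ≫ h ≫ AL ◁ F)) ≫ tensorμ A B AL BL ≫ (x ⊗ₘ (r ▷ _ ≫ p)) := by
  have e := tensorμ_natural_right A B (𝟙 AL) F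
  rw [MonoidalCategory.whiskerLeft_id, id_tensorHom, id_tensorHom] at e
  have h₁ : (φ ⊗ₘ (f ≫ h ≫ AL ◁ F)) = (φ ⊗ₘ f) ≫ (A ⊗ B) ◁ h ≫ (A ⊗ B) ◁ AL ◁ F := by
    simp only [← id_tensorHom, tensorHom_comp_tensorHom, Category.id_comp, Category.comp_id]
  rw [h₁, Category.assoc, Category.assoc, reassoc_of% e]
  simp only [← id_tensorHom, ← tensorHom_id, tensorHom_comp_tensorHom, Category.id_comp,
    Category.comp_id, Iso.inv_hom_id_assoc, tensorHom_comp_tensorHom_assoc]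

lemma tensListMap_gather_nil {ι : Type} {κ : ι → Type} {V : ι → C} (A : ι → C)
    (B : (Σ i, κ i) → C) (L : ∀ i, List (κ i))
    (φ : ∀ i, V i ⟶ A i ⊗ tensList (fun j => B ⟨i, j⟩) (L i)) :
    tensListMap φ [] ≫ tensListGather A B L [] [] rfl =
      (tensNil V).hom ≫ (λ_ (𝟙_ C)).inv ≫ ((tensNil A).inv ⊗ₘ (tensNil B).inv) := by
  show tensListMap φ [] ≫ tensListShuffle A (fun i => tensList (fun j => B ⟨i, j⟩) (L i)) [] ≫
    _ ◁ ((tensNil _).hom ≫ (tensNil B).inv) = _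
  rw [tensListMap_nil, tensListShuffle_nil]
  simp only [← id_tensorHom, Category.id_comp, Category.assoc, tensorHom_comp_tensorHom,
    Iso.inv_hom_id_assoc, Category.comp_id]

lemma tensListMap_gather_cons {ι : Type} {κ : ι → Type} {V : ι → C} (A : ι → C)
    (B : (Σ i, κ i) → C) (L : ∀ i, List (κ i))
    (φ : ∀ i, V i ⟶ A i ⊗ tensList (fun j => B ⟨i, j⟩) (L i)) (i : ι) (l : List ι) :
    tensListMap φ (i :: l) ≫ tensListGather A B L (i :: l) (sigmaList L (i :: l)) rfl =
      (tensCons V i l).hom ≫ (φ i ⊗ₘ (tensListMap φ l ≫ tensListGather A B L l _ rfl)) ≫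
        tensorμ _ _ _ _ ≫ ((tensCons A i l).inv ⊗ₘ
          (tensListRelabel B (Sigma.mk i) (L i) ▷ _ ≫ tensListAppend B (sigmaList L l) _)) := by
  rw [tensListGather, tensListGather, tensListShuffle_cons, tensListMap_cons]
  erw [tensListFlattenTo_cons B L i l _ rfl rfl]
  simp only [Category.assoc, Iso.inv_hom_id_assoc]
  congr 1
  exact gather_cons_aux _ _ _ _ _ _ _ _

end

open RTree Piece

namespace Preoperad

variable {k : Type u} [Field k] {X : Preoperad k} {Q : RTree}

lemma IsTheta.refl {ι : Type} (P : ι → Piece Q) (T : Piece Q) :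
    X.IsTheta P T [] T (𝟙 _ ≫ (ρ_ _).inv ≫ _ ◁ (tensNil _).inv) :=
  ⟨Sub.refl _, rfl, by rw [X.sub_refl]⟩

/-- Iterated structure maps of `X` are compatible with nested graftings. -/
lemma IsTheta.nested {ι : Type} {P : ι → Piece Q} {T T₀ W B : Piece Q} {l : List ι}
    {m : X.val W.tree ⟶ X.val B.tree ⊗ tensList (fun i => X.val (P i).tree) l}
    (h : X.IsTheta P W l B m) (g : IsGraft T T₀ W) :
    ∃ (T' : Piece Q) (n : _) (g' : IsGraft T' T₀ B), X.IsTheta P T l T' n ∧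
      X.graft g ≫ _ ◁ m = n ≫ X.graft g' ▷ _ ≫ (α_ _ _ _).hom := by
  induction l generalizing B with
  | nil =>
    obtain ⟨s, hs, rfl⟩ := h
    have g' : IsGraft T T₀ B := g.congr rfl rfl hs (rt_eq_of_range hs)
    refine ⟨T, _, g', IsTheta.refl P T, ?_⟩
    have := X.graft_natural g' g (Sub.refl _) (Sub.refl _) s
    rw [X.sub_refl, X.sub_refl, Category.id_comp, id_tensorHom] at this
    rw [this]
    exact nested_nil_aux _ _ _
  | cons a l ih =>
    obtain ⟨B₁, m₁, ga, h, rfl⟩ := h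
    obtain ⟨T', n, g', h', e⟩ := ih h
    obtain ⟨g₃, g₄⟩ := g'.nested ga
    exact ⟨_, _, g₄, ⟨_, n, g₃, h', rfl⟩,
      nested_cons_aux _ _ _ _ _ _ _ _ e (X.graft_nested g' ga g₃ g₄)⟩

/-- The head of a list is split off last, so the pieces which are split off afterwards are placed in
front. -/
lemma IsTheta.append {ι κ : Type} {P : ι → Piece Q} (f : κ → ι) {T T₁ T₂ : Piece Q}
    {l : List ι} {l' : List κ}
    {m : X.val T.tree ⟶ X.val T₁.tree ⊗ tensList (fun i => X.val (P i).tree) l}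
    {n : X.val T₁.tree ⟶ X.val T₂.tree ⊗ tensList (fun j => X.val (P (f j)).tree) l'}
    (h : X.IsTheta P T l T₁ m) (h' : X.IsTheta (fun j => P (f j)) T₁ l' T₂ n) :
    X.IsTheta P T (l'.map f ++ l) T₂ (m ≫ n ▷ _ ≫ (α_ _ _ _).hom ≫
      _ ◁ (tensListRelabel (fun i => X.val (P i).tree) f l' ▷ _ ≫
        tensListAppend (fun i => X.val (P i).tree) l (l'.map f))) := by
  induction l' generalizing T₂ with
  | nil =>
    obtain ⟨s, hs, rfl⟩ := h'
    refine (congrArg (X.IsTheta P T l T₂) ?_).mpr (h.congr_right hs s)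
    have e := tensListAppend_nil (fun i => X.val (P i).tree) l
    rw [tensListRelabel_nil]
    refine (congrArg (fun x => m ≫ _ ≫ _ ≫ _ ◁ (_ ≫ x)) e).trans ?_
    exact append_nil_aux _ _ _ _
  | cons a l' ih =>
    obtain ⟨T₃, m₁, g, h', rfl⟩ := h'
    refine ⟨T₃, _, g, ih h', ?_⟩
    rw [tensListRelabel_cons]
    erw [tensListAppend_cons]
    exact append_cons_aux _ _ _ _ _ _ _ _

/-- Iterated structure maps of `X` commute with parallel graftings. -/
lemma IsTheta.comm_graft {ι : Type} {P : ι → Piece Q} {T T' T'' B : Piece Q} {l : List ι}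
    {m : X.val T.tree ⟶ X.val T'.tree ⊗ tensList (fun i => X.val (P i).tree) l}
    (h : X.IsTheta P T l T' m) (g : IsGraft T' T'' B) (hB : ∀ a ∈ l, ¬ B.rt ≤ (P a).rt) :
    ∃ (T₁ : Piece Q) (g' : IsGraft T T₁ B) (m' : _), X.IsTheta P T₁ l T'' m' ∧
      m ≫ X.graft g ▷ _ = X.graft g' ≫ m' ▷ _ ≫ tensSwapRight _ _ _ := by
  induction l generalizing T' T'' with
  | nil =>
    obtain ⟨s, hs, rfl⟩ := h
    have g' : IsGraft T T'' B := g.congr hs.symm rfl rfl rfl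
    refine ⟨T'', g', _, IsTheta.refl P T'', ?_⟩
    have := X.graft_natural g g' s (Sub.refl _) (Sub.refl _)
    rw [X.sub_refl, X.sub_refl, id_tensorHom_id, Category.comp_id] at this
    exact comm_nil_aux _ _ _ _ this
  | cons a l ih =>
    obtain ⟨T₁, m₁, ga, h, rfl⟩ := h
    obtain ⟨g₃, g₄⟩ := ga.parallel g (hB a List.mem_cons_self)
    obtain ⟨T₂, g', m', h', e⟩ := ih h g₃ (fun b hb => hB b (List.mem_cons_of_mem _ hb))
    exact ⟨T₂, g', _, ⟨_, m', g₄, h', rfl⟩,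
      comm_cons_aux _ _ _ _ _ _ _ _ (X.graft_parallel ga g g₃ g₄) e⟩

/-- Each piece of the second family is moved past the whole first family by `IsTheta.comm_graft`;
`hP` guarantees that the graftings concerned are parallel. -/
lemma IsTheta.comm {ι κ : Type} {P : ι → Piece Q} {P' : κ → Piece Q} {T T' T'' : Piece Q}
    {l : List ι} {l' : List κ}
    {m : X.val T.tree ⟶ X.val T'.tree ⊗ tensList (fun i => X.val (P i).tree) l}
    {n : X.val T'.tree ⟶ X.val T''.tree ⊗ tensList (fun i => X.val (P' i).tree) l'}
    (h : X.IsTheta P T l T' m) (h' : X.IsTheta P' T' l' T'' n)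
    (hP : ∀ a ∈ l, ∀ b ∈ l', ¬ (P' b).rt ≤ (P a).rt) :
    ∃ (T₁ : Piece Q) (n' : _) (m' : _), X.IsTheta P' T l' T₁ n' ∧ X.IsTheta P T₁ l T'' m' ∧
      m ≫ n ▷ _ = n' ≫ m' ▷ _ ≫ tensSwapRight _ _ _ := by
  induction l' generalizing T'' with
  | nil =>
    obtain ⟨s, hs, rfl⟩ := h'
    exact ⟨T, _, _, IsTheta.refl P' T, h.congr_right hs s, comm_list_nil_aux _ _ _⟩
  | cons b l' ih =>
    obtain ⟨R, n₁, g, h', rfl⟩ := h'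
    obtain ⟨T₁, n', m', h₁, h₂, e⟩ := ih h'
      (fun a ha b hb => hP a ha b (List.mem_cons_of_mem _ hb))
    obtain ⟨T₂, g', m'', h₃, e'⟩ := h₂.comm_graft g (fun a ha => hP a ha b List.mem_cons_self)
    exact ⟨T₂, _, m'', ⟨_, n', g', h₁, rfl⟩, h₃, comm_list_cons_aux _ _ _ _ _ _ _ _ e e'⟩

/-- Iterated structure maps of `X` for nested graftings. -/
lemma IsTheta.gather {ι : Type} {κ : ι → Type} {W B : ι → Piece Q} {P : (Σ i, κ i) → Piece Q}
    {T T₀ : Piece Q} {l : List ι} (L : ∀ i, List (κ i))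
    {m : X.val T.tree ⟶ X.val T₀.tree ⊗ tensList (fun i => X.val (W i).tree) l}
    {n : ∀ i, X.val (W i).tree ⟶
      X.val (B i).tree ⊗ tensList (fun j => X.val (P ⟨i, j⟩).tree) (L i)}
    (h : X.IsTheta W T l T₀ m) (hn : ∀ i, X.IsTheta (fun j => P ⟨i, j⟩) (W i) (L i) (B i) (n i))
    (hl : l.Nodup) (hP : ∀ i j (b : κ j), (P ⟨j, b⟩).rt ≤ (B i).rt → i = j) :
    ∃ (T₁ : Piece Q) (m₁ : _) (m₂ : _), X.IsTheta P T (sigmaList L l) T₁ m₁ ∧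
      X.IsTheta B T₁ l T₀ m₂ ∧
      m ≫ _ ◁ (tensListMap n l ≫ tensListGather (fun i => X.val (B i).tree)
        (fun x => X.val (P x).tree) L l (sigmaList L l) rfl) =
      m₁ ≫ m₂ ▷ _ ≫ (α_ _ _ _).hom := by
  induction l generalizing T₀ with
  | nil =>
    obtain ⟨s, hs, rfl⟩ := h
    refine ⟨T, _, _, IsTheta.refl P T, ⟨s, hs, rfl⟩, ?_⟩
    have e := tensListMap_gather_nil (fun i => X.val (B i).tree) (fun x => X.val (P x).tree) L n
    refine (congrArg (fun x => _ ≫ _ ◁ x) e).trans ?_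
    exact gather_nil_aux _ _ _ _
  | cons a l ih =>
    obtain ⟨T₁, m₁, g, h, rfl⟩ := h
    obtain ⟨A, M₁, M₂, h₁, h₂, e₁⟩ := ih h (List.nodup_cons.1 hl).2
    obtain ⟨T', n', g', h₃, e₂⟩ := (hn a).nested g
    -- The pieces nested in the block of `a` are split off before the bases of the other blocks.
    -- This is allowed since by `hP` none of them sits below such a base, `a` not being in `l`.
    obtain ⟨A', n'', M₂', h₄, h₅, e₃⟩ := h₂.comm h₃ (fun i hi b _ hb =>
      (List.nodup_cons.1 hl).1 (hP i a b hb ▸ hi))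
    refine ⟨A', _, _, h₁.append (Sigma.mk a) h₄, ⟨_, M₂', g', h₅, rfl⟩, ?_⟩
    have e := tensListMap_gather_cons (fun i => X.val (B i).tree) (fun x => X.val (P x).tree) L n a l
    refine (congrArg (fun x => _ ≫ _ ◁ x) e).trans ?_
    exact gather_aux _ _ _ _ _ _ _ _ _ _ _ _ _ e₁ e₂ e₃

end Preoperad

end Koszul

/-! ### The map `theta` as an iterated structure map, and its naturality -/

namespace Koszul

open MonoidalCategory RTree

lemma theta_natural_aux {C : Type*} [Category C] [MonoidalCategory C] {R R' A B A' B' M M' : C}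
    {m : R ⟶ A ⊗ M} {m' : R' ⟶ A' ⊗ M'} {d : R ⟶ R'} {s : A ⟶ B} {s' : A' ⟶ B'} {t : A ⟶ A'}
    {r : M ⟶ M'} {c : B ⟶ B'} (h : d ≫ m' = m ≫ (t ⊗ₘ r)) (e : t ≫ s' = s ≫ c) :
    d ≫ m' ≫ s' ▷ M' = (m ≫ s ▷ M) ≫ (c ⊗ₘ r) := by
  rw [reassoc_of% h]
  simp only [Category.assoc, ← tensorHom_id, tensorHom_comp_tensorHom, Category.id_comp,
    Category.comp_id, e]

namespace Piece

variable {Q : RTree}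

/-- The subtree of a piece above one of its edges. -/
abbrev above (E : Piece Q) (e : E.tree.Edge) : Piece Q where
  tree := E.tree.above e
  map x := E.map x.1
  le_iff := E.le_iff

/-- A pruning of a piece. -/
abbrev cut (E : Piece Q) (s : Set E.tree.Edge) : Piece Q where
  tree := E.tree.cut s
  map x := E.map x.1
  le_iff := E.le_iff

/-- Restriction of a piece along a morphism of trees. -/
abbrev restrict (E : Piece Q) {S : RTree} (f : S ⟶ E.tree) : Piece Q where
  tree := S
  map x := E.map (edge f x)
  le_iff := E.le_iff.trans (edge_le_iff f)

variable (Q) in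
/-- The piece consisting of all edges. -/
abbrev whole : Piece Q where
  tree := Q
  map x := x
  le_iff := Iff.rfl

/-- Provides the antichain hypothesis of `IsTheta.reindex`: an order embedding keeps distinct leaves
incomparable. -/
lemma above_antichain (E : Piece Q) {S : RTree} (f : S ⟶ E.tree) (i j : S.Leaf)
    (h : (E.above (edge f i.1)).rt ≤ (E.above (edge f j.1)).rt) : i = j :=
  leaf_eq_of_le f (E.le_iff.1 h) le_rfl

/-- The leaves of such a pruning are exactly the edges at which it is cut, because the comparison
map `toCut` is bijective on leaves. So it suffices that the images of the leaves of `S` and `S'`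
agree. -/
lemma Sub.cut {E E' : Piece Q} {S S' : RTree} (f : S ⟶ E.tree) (f' : S' ⟶ E'.tree)
    (hs : ∀ x, ∃ x', E'.map x' = E.map x) (hr : E.rt = E'.rt)
    (h : ∀ b : S.Leaf, ∃ b' : S'.Leaf, E'.map (edge f' b'.1) = E.map (edge f b.1))
    (h' : ∀ b' : S'.Leaf, ∃ b : S.Leaf, E'.map (edge f' b'.1) = E.map (edge f b.1)) :
    Sub (E.cut {e | ∃ b ∈ enum S.Leaf, edge f b.1 = e})
      (E'.cut {e | ∃ b ∈ enum S'.Leaf, edge f' b.1 = e}) where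
  subset x := by
    obtain ⟨x', hx'⟩ := hs x.1
    refine ⟨⟨x', ?_⟩, hx'⟩
    rintro _ ⟨b', _, rfl⟩ hlt
    obtain ⟨b, hb⟩ := h' b'
    refine x.2 _ ⟨b, mem_enum _, rfl⟩ ?_
    rw [← E.lt_iff, ← hb, ← hx']
    exact E'.lt_iff.2 hlt
  root := hr
  leaf l hl := by
    obtain ⟨b, hb⟩ := (leafMap_bijective (toCut f) (toCut_inner f)).2 ⟨l, hl⟩
    obtain ⟨b', hb'⟩ := h b
    refine ⟨_, (leafMap (toCut f') (toCut_inner f') b').2, hb'.trans ?_⟩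
    exact congrArg (fun x => E.map x.1.1) hb
  cover l hl := by
    obtain ⟨b, hb⟩ := (leafMap_bijective (toCut f') (toCut_inner f')).2 ⟨l, hl⟩
    obtain ⟨b', hb'⟩ := h' b
    refine ⟨_, (leafMap (toCut f) (toCut_inner f) b').2, hb'.symm.trans ?_⟩
    exact congrArg (fun x => E'.map x.1.1) hb

lemma Sub.toCut {E : Piece Q} {S : RTree} (f : S ⟶ E.tree) :
    Sub (E.restrict f) (E.cut {e | ∃ b ∈ enum S.Leaf, edge f b.1 = e}) :=
  Sub.of_hom ⟨RTree.toCut f, toCut_inner f⟩ fun _ => rfl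

end Piece

open Piece

namespace Preoperad

variable {k : Type u} [Field k] {X : Preoperad k} {Q : RTree}

/-- Recovers what is left after the splitting, which allows intermediate pieces obtained abstractly
to be identified with actual prunings. -/
lemma IsTheta.range {ι : Type} {P : ι → Piece Q} {T T₀ : Piece Q} {l : List ι}
    {m : X.val T.tree ⟶ X.val T₀.tree ⊗ tensList (fun i => X.val (P i).tree) l}
    (h : X.IsTheta P T l T₀ m) (x : Q.Edge) :
    x ∈ Set.range T₀.map ↔ x ∈ Set.range T.map ∧ ∀ a ∈ l, ¬ (P a).rt < x := by
  induction l generalizing T₀ with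
  | nil =>
    obtain ⟨_, hs, _⟩ := h
    simp [hs]
  | cons a l ih =>
    obtain ⟨T₁, m₁, g, h, _⟩ := h
    rw [g.lower, ih h, List.forall_mem_cons]
    tauto

-- Connects the recursion `thetaList` with the relation `IsTheta`. The tree is allowed to be a piece
-- `E` of a larger tree, so that several such maps can be compared inside one ambient tree.
variable (X) in
lemma isTheta_thetaList (E : Piece Q) {S : RTree} (f : S ⟶ E.tree) (l : List S.Leaf)
    (hl : l.Nodup) :
    X.IsTheta (fun b : S.Leaf => E.above (edge f b.1)) E l
      (E.cut {e | ∃ b ∈ l, edge f b.1 = e}) (X.thetaList f l hl) := by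
  induction l with
  | nil =>
    have s : Sub (E.cut {e | ∃ b ∈ ([] : List S.Leaf), edge f b.1 = e}) E :=
      Sub.of_hom ⟨cutNil f, cutNil_inner f⟩ fun _ => rfl
    refine ⟨s, ?_, ?_⟩
    · ext x
      constructor
      · rintro ⟨y, rfl⟩
        exact ⟨y.1, rfl⟩
      · rintro ⟨y, rfl⟩
        exact ⟨⟨y, by rintro _ ⟨_, h, _⟩; exact absurd h List.not_mem_nil⟩, rfl⟩
    · rw [← X.map_eq_sub s ⟨cutNil f, cutNil_inner f⟩ (fun _ => rfl)]
      erw [MonoidalCategory.whiskerLeft_id, Category.comp_id]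
      rfl
  | cons a l ih =>
    have g : IsGraft (E.cut {e | ∃ b ∈ l, edge f b.1 = e})
        (E.cut {e | ∃ b ∈ a :: l, edge f b.1 = e}) (E.above (edge f a.1)) :=
      IsGraft.of_grafting (cutGrafting f a l hl) (fun _ => rfl) (fun _ => rfl)
    refine ⟨_, _, g, ih (List.nodup_cons.1 hl).2, ?_⟩
    rw [thetaList, X.θ_eq_graft g (cutGrafting f a l hl) (fun _ => rfl) (fun _ => rfl)]
    erw [MonoidalCategory.whiskerLeft_id, Category.comp_id]

variable (X) in
lemma theta_eq (E : Piece Q) {S : RTree} (f : S ⟶ E.tree) :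
    X.theta f = X.thetaList f (enum S.Leaf) (nodup_enum _) ≫ X.sub (Sub.toCut f) ▷ _ := by
  rw [← X.map_eq_sub (Sub.toCut f) ⟨toCut f, toCut_inner f⟩ (fun _ => rfl)]
  rfl

variable (X) in
/-- Naturality of the iterated structure maps. -/
lemma theta_natural {S R S' R' : RTree} (f : S ⟶ R) (f' : S' ⟶ R') (c : (⟨S'⟩ : ATree) ⟶ ⟨S⟩)
    (d : (⟨R'⟩ : ATree) ⟶ ⟨R⟩) (e : c.hom ≫ f = f' ≫ d.hom)
    (φ : ∀ j : S'.Leaf, (⟨R'.above (edge f' j.1)⟩ : ATree) ⟶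
      ⟨R.above (edge f (leafMap c.hom c.property j).1)⟩)
    (hφ : ∀ j x, (edge (φ j).hom x).1 = edge d.hom x.1) :
    X.X.map d.op ≫ X.theta f' = X.theta f ≫ (X.X.map c.op ⊗ₘ
      tensListReindex (V := fun l : S.Leaf => X.val (R.above (edge f l.1)))
        (W := fun l : S'.Leaf => X.val (R'.above (edge f' l.1)))
        (leafMap c.hom c.property) (fun j => X.X.map (φ j).op) (enum S'.Leaf) (enum S.Leaf)
        (perm_enum_map (leafMap_bijective c.hom c.property))) := by
  have he : ∀ x, edge f (edge c.hom x) = edge d.hom (edge f' x) := fun x =>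
    congrFun (congrArg Hom.toFun e) x
  let E : Piece R := whole R
  -- Both trees are placed inside `R`, the tree `R'` by means of `d`; the required inclusions are
  -- then read off from sets of edges.
  let E' : Piece R := (whole R).restrict d.hom
  have t : Sub E' E := Sub.of_hom d fun _ => rfl
  have hφ' : ∀ j : S'.Leaf, Sub (E'.above (edge f' j.1))
      (E.above (edge f (leafMap c.hom c.property j).1)) := fun j => Sub.of_hom (φ j) (hφ j)
  have t₀ : Sub (E'.cut {e | ∃ b ∈ enum S'.Leaf, edge f' b.1 = e})
      (E.cut {e | ∃ b ∈ enum S.Leaf, edge f b.1 = e}) := Sub.cut _ _ t.subset t.root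
    (fun b => ⟨leafMap c.hom c.property b, he _⟩) (fun b => by
      obtain ⟨b', rfl⟩ := (leafMap_bijective c.hom c.property).2 b
      exact ⟨b', he _⟩)
  have key := (X.isTheta_thetaList E f _ (nodup_enum _)).reindex (E.above_antichain f)
    (leafMap c.hom c.property) (X.isTheta_thetaList E' f' _ (nodup_enum _)) t t₀ hφ'
    (perm_enum_map (leafMap_bijective c.hom c.property)) (nodup_enum _)
  have t' : Sub (E'.restrict f') (E.restrict f) := Sub.of_hom c he
  have h₁ := X.sub_comp (Sub.toCut (E := E') f') t₀ ((Sub.toCut (E := E') f').trans t₀)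
  have h₂ := X.sub_comp t' (Sub.toCut (E := E) f) ((Sub.toCut (E := E') f').trans t₀)
  rw [X.map_eq_sub t d (fun _ => rfl), X.map_eq_sub t' c he, X.theta_eq E, X.theta_eq E' f']
  have h₃ : (fun j => X.X.map (φ j).op) = fun j => X.sub (hφ' j) :=
    funext fun j => X.map_eq_sub (hφ' j) (φ j) (hφ j)
  rw [h₃]
  exact theta_natural_aux key (h₁.trans h₂.symm)

end Preoperad

end Koszul

/-! ### Unit and associativity laws for `theta` -/

namespace Koszul

open MonoidalCategory RTree Piece

section

variable {C : Type*} [Category C] [MonoidalCategory C]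

lemma collapse_cons_aux {Z A S R M L : C} (m : Z ⟶ A ⊗ M) (g : A ⟶ S ⊗ R) (c : L ≅ R ⊗ M)
    (ε : R ⟶ 𝟙_ C) (κ : M ⟶ 𝟙_ C) :
    (m ≫ g ▷ _ ≫ (α_ _ _ _).hom ≫ _ ◁ c.inv) ≫ _ ◁ (c.hom ≫ (ε ⊗ₘ κ) ≫ (λ_ _).hom) ≫ (ρ_ _).hom =
      (m ≫ A ◁ κ ≫ (ρ_ _).hom) ≫ g ≫ S ◁ ε ≫ (ρ_ _).hom := by
  have h : A ◁ κ ≫ (ρ_ A).hom ≫ g = g ▷ M ≫ (S ⊗ R) ◁ κ ≫ (ρ_ _).hom := by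
    rw [← whisker_exchange_assoc, rightUnitor_naturality]
  simp only [Category.assoc, MonoidalCategory.whiskerLeft_comp, whiskerLeft_inv_hom_assoc,
    reassoc_of% h, MonoidalCategory.tensorHom_def']
  monoidal

lemma collapse_whisker_aux {Z A B M : C} (m : Z ⟶ A ⊗ M) (s : A ⟶ B) (κ : M ⟶ 𝟙_ C) :
    (m ≫ s ▷ M) ≫ B ◁ κ ≫ (ρ_ _).hom = (m ≫ A ◁ κ ≫ (ρ_ _).hom) ≫ s := by
  rw [Category.assoc, Category.assoc, Category.assoc, ← rightUnitor_naturality,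
    whisker_exchange_assoc]

lemma whisker_tensor_aux {Z A B D M N Y : C} (m : Z ⟶ A ⊗ M) (s : A ⟶ B) (u : B ⟶ D) (r : M ⟶ N)
    (h : D ⊗ N ⟶ Y) :
    (m ≫ s ▷ M) ≫ (u ⊗ₘ r) ≫ h = (m ≫ (s ⊗ₘ r)) ≫ u ▷ _ ≫ h := by
  simp only [Category.assoc, ← tensorHom_id, tensorHom_comp_tensorHom_assoc, Category.id_comp,
    Category.comp_id]

lemma root_aux {R A N L : C} (m : R ⟶ A ⊗ R) (u : A ⟶ 𝟙_ C) (n : N ≅ 𝟙_ C) (c : L ≅ R ⊗ N)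
    (e : m ≫ u ▷ _ ≫ (λ_ _).hom = 𝟙 _) :
    ((𝟙 _ ≫ (ρ_ _).inv ≫ _ ◁ n.inv) ≫ m ▷ _ ≫ (α_ _ _ _).hom ≫ _ ◁ c.inv) ≫ u ▷ _ ≫ (λ_ _).hom ≫
      c.hom ≫ _ ◁ n.hom ≫ (ρ_ _).hom = 𝟙 _ := by
  have h : ((𝟙 _ ≫ (ρ_ _).inv ≫ _ ◁ n.inv) ≫ m ▷ _ ≫ (α_ _ _ _).hom ≫ _ ◁ c.inv) ≫ u ▷ _ ≫
      (λ_ _).hom ≫ c.hom ≫ _ ◁ n.hom ≫ (ρ_ _).hom = (ρ_ _).inv ≫ _ ◁ n.inv ≫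
      (m ≫ u ▷ _ ≫ (λ_ _).hom) ▷ N ≫ _ ◁ n.hom ≫ (ρ_ _).hom := by
    simp [whisker_exchange_assoc]
  rw [h, e]
  simp

lemma theta_comp_aux {Z A A' S R T₁ A'' M' W F PS BL : C} (m' : Z ⟶ A' ⊗ M') (t' : A' ⟶ R)
    (r : M' ⟶ PS) (m : Z ⟶ A ⊗ W) (t : A ⟶ S) (ga : W ⟶ BL ⊗ PS) (m₁ : Z ⟶ T₁ ⊗ PS)
    (t₁ : A' ⟶ T₁) (m₂ : T₁ ⟶ A ⊗ BL) (q : T₁ ⟶ R) (m'' : R ⟶ A'' ⊗ F) (a : A ⟶ A'')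
    (b : BL ⟶ F) (t'' : A'' ⟶ S) (e₁ : m₁ = m' ≫ (t₁ ⊗ₘ r))
    (e₂ : m ≫ _ ◁ ga = m₁ ≫ m₂ ▷ _ ≫ (α_ _ _ _).hom) (e₃ : q ≫ m'' = m₂ ≫ (a ⊗ₘ b))
    (e₄ : t₁ ≫ q = t') (e₅ : a ≫ t'' = t) :
    (m' ≫ t' ▷ _) ≫ ((m'' ≫ t'' ▷ _) ⊗ₘ r) ≫ (α_ _ _ _).hom =
      (m ≫ t ▷ _) ≫ S ◁ (ga ≫ b ▷ _) := by
  subst e₄ e₅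
  have h₁ : (m' ≫ (t₁ ≫ q) ▷ _) ≫ ((m'' ≫ t'' ▷ _) ⊗ₘ r) =
      (m' ≫ (t₁ ⊗ₘ r)) ≫ ((q ≫ m'') ≫ t'' ▷ _) ▷ _ := by
    simp only [Category.assoc, ← tensorHom_id, tensorHom_comp_tensorHom, Category.id_comp,
      Category.comp_id]
  have h₂ : (m ≫ (a ≫ t'') ▷ _) ≫ S ◁ (ga ≫ b ▷ _) =
      (m ≫ _ ◁ ga) ≫ (a ≫ t'') ▷ _ ≫ S ◁ b ▷ _ := by
    simp only [Category.assoc, MonoidalCategory.whiskerLeft_comp, whisker_exchange_assoc]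
  refine (Category.assoc _ _ _).symm.trans ?_
  have h₃ : (a ⊗ₘ b) ≫ t'' ▷ F = (a ≫ t'') ▷ BL ≫ S ◁ b := by
    simp only [← id_tensorHom, ← tensorHom_id, tensorHom_comp_tensorHom, Category.id_comp,
      Category.comp_id]
  rw [h₁, ← e₁, h₂, e₂, e₃, Category.assoc m₂, h₃]
  simp only [Category.assoc, comp_whiskerRight]
  monoidal

lemma tensListMap_gather_whiskerRight [SymmetricCategory C] {ι : Type} {κ : ι → Type}
    {V A A' : ι → C} (B : (Σ i, κ i) → C) (L : ∀ i, List (κ i))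
    (φ : ∀ i, V i ⟶ A i ⊗ tensList (fun j => B ⟨i, j⟩) (L i)) (ψ : ∀ i, A i ⟶ A' i) (l : List ι)
    (s : List (Σ i, κ i)) (hs : sigmaList L l = s) :
    tensListMap (fun i => φ i ≫ ψ i ▷ _) l ≫ tensListGather A' B L l s hs =
      (tensListMap φ l ≫ tensListGather A B L l s hs) ≫ tensListMap ψ l ▷ _ := by
  have h := tensListShuffle_natural ψ (fun i => 𝟙 (tensList (fun j => B ⟨i, j⟩) (L i))) l
  simp only [tensorHom_id, tensListMap_id] at h
  rw [tensListMap_comp, tensListGather, tensListGather, Category.assoc, reassoc_of% h]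
  simp only [Category.assoc, whisker_exchange]

end

namespace Preoperad

variable {k : Type u} [Field k] {X : Preoperad k} {Q : RTree}

/-- A piece receiving a morphism of `𝒜` from `η` is a single edge, and grafting it changes nothing.
By the right unit axiom of `X` its factor can be discarded, one piece after the other. -/
lemma IsTheta.collapse {ι : Type} {P : ι → Piece Q} {T T₀ : Piece Q} {l : List ι}
    {m : X.val T.tree ⟶ X.val T₀.tree ⊗ tensList (fun i => X.val (P i).tree) l}
    (h : X.IsTheta P T l T₀ m) (c : ∀ i, (⟨eta⟩ : ATree) ⟶ ⟨(P i).tree⟩) :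
    ∃ s : Sub T₀ T, Set.range T₀.map = Set.range T.map ∧
      m ≫ _ ◁ tensListCollapse (A := fun i => X.val (P i).tree)
        (fun i => X.X.map (c i).op ≫ X.unit.hom) l ≫ (ρ_ _).hom = X.sub s := by
  induction l generalizing T₀ with
  | nil =>
    obtain ⟨s, hs, rfl⟩ := h
    refine ⟨s, hs, ?_⟩
    rw [tensListCollapse_nil]
    simp
  | cons a l ih =>
    obtain ⟨T₁, m₁, g, h, rfl⟩ := h
    obtain ⟨s, hs, e⟩ := ih h
    -- The morphism from `η` preserves the root and sends leaves to leaves, so the root is a leaf.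
    have hmax : ∀ x : (P a).tree.Edge, x = (P a).tree.root := fun x => by
      have := (c a).property () (fun _ _ => le_rfl)
      have h₀ : edge (c a).hom () = (P a).tree.root := edge_root (c a).hom
      rw [h₀] at this
      exact le_antisymm (this ((P a).tree.root_le x)) ((P a).tree.root_le x)
    have hr : Set.range ((P a).restrict (c a).hom).map = Set.range (P a).map := by
      ext x
      constructor
      · rintro ⟨y, rfl⟩
        exact ⟨_, rfl⟩
      · rintro ⟨y, rfl⟩
        refine ⟨(), ?_⟩
        rw [hmax y]
        exact congrArg (P a).map (edge_root (c a).hom)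
    have hs' : Set.range T₀.map = Set.range T₁.map := by
      ext x
      rw [g.lower]
      refine ⟨fun h => h.1, fun h => ⟨h, fun h' => ?_⟩⟩
      obtain ⟨y, rfl⟩ := (g.upper x).2 ⟨h, h'.le⟩
      rw [hmax y] at h'
      exact lt_irrefl _ h'
    have s₁ : Sub T₀ T₁ := Sub.of_range hs'.symm
    have g' : IsGraft T₁ T₀ ((P a).restrict (c a).hom) := g.congr rfl rfl hr (rt_eq_of_range hr)
    have r : Sub ((P a).restrict (c a).hom) (P a) := Sub.of_hom (c a) (fun _ => rfl)
    have e₁ := X.graft_natural g' g (Sub.refl _) (Sub.refl _) r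
    rw [X.sub_refl, X.sub_refl, Category.id_comp, id_tensorHom,
      ← X.map_eq_sub r (c a) (fun _ => rfl)] at e₁
    have e₂ : X.graft g' ≫ X.val T₀.tree ◁ X.unit.hom ≫ (ρ_ _).hom = X.sub s₁ :=
      X.θ_eta_right g'.grafting s₁.hom
        (fun x => T₁.map_injective ((s₁.map_hom x).trans (g'.map_lower x).symm))
    rw [e₁, Category.assoc] at e₂
    refine ⟨s₁.trans s, hs'.trans hs, ?_⟩
    rw [tensListCollapse_cons]
    refine (collapse_cons_aux _ _ _ _ _).trans ?_
    rw [e, MonoidalCategory.whiskerLeft_comp, Category.assoc]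
    refine (congrArg (_ ≫ ·) e₂).trans ?_
    exact X.sub_comp _ _ _

variable (X) in
/-- The iterated structure map for the identity. -/
lemma theta_id (S : RTree) (c : ∀ l : S.Leaf, (⟨eta⟩ : ATree) ⟶ ⟨S.above (edge (𝟙 S) l.1)⟩) :
    X.theta (𝟙 S) ≫ X.val S ◁ tensListCollapse
      (A := fun l : S.Leaf => X.val (S.above (edge (𝟙 S) l.1)))
      (fun l => X.X.map (c l).op ≫ X.unit.hom) (enum S.Leaf) ≫ (ρ_ _).hom = 𝟙 _ := by
  obtain ⟨s, _, e⟩ := (X.isTheta_thetaList (whole S) (𝟙 S) _ (nodup_enum _)).collapse c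
  have t := Sub.toCut (E := whole S) (𝟙 S)
  have e' := congrArg (· ≫ X.sub t) e
  have h := X.sub_comp t s (Sub.refl (whole S))
  rw [X.sub_refl] at h
  rw [X.theta_eq (whole S) (𝟙 S)]
  exact (collapse_whisker_aux _ _ _).trans (e'.trans h)

lemma toAboveRoot_inner (T : RTree) (e : T.Edge) (he : e = T.root) : inner (toAboveRoot T e he) :=
  fun _ hl y hy => hl (b := y.1) hy

variable (X) in
/-- The iterated structure map for the inclusion of the root. -/
lemma theta_rootHom (R : RTree)
    (h : (enum eta.Leaf).Perm ([()].map (fun _ => (⟨(), fun _ _ => le_rfl⟩ : eta.Leaf)))) :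
    X.theta (rootHom R) ≫ (X.unit.hom ⊗ₘ
      tensListReindex (V := fun l : eta.Leaf => X.val (R.above (edge (rootHom R) l.1)))
        (W := fun _ : Unit => X.val R) (fun _ => ⟨(), fun _ _ => le_rfl⟩)
        (fun _ => X.X.map (Quiver.Hom.op (X := (⟨_⟩ : ATree)) (Y := ⟨_⟩)
          ⟨toAboveRoot R _ rfl, toAboveRoot_inner R _ rfl⟩)) [()] (enum eta.Leaf) h) ≫
      (λ_ _).hom ≫ (tensCons _ () []).hom ≫ _ ◁ (tensNil _).hom ≫ (ρ_ _).hom = 𝟙 _ := by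
  -- The tree `R` is itself grafted onto its root edge; with this presentation the left unit axiom
  -- of `X` applies.
  have g : IsGraft (whole R) ((whole R).restrict (rootHom R)) (whole R) := by
    refine ⟨fun x => ⟨?_, ?_⟩, fun x => ⟨fun _ => ⟨⟨x, rfl⟩, R.root_le x⟩, fun _ => ⟨x, rfl⟩⟩⟩
    · rintro ⟨_, rfl⟩
      exact ⟨⟨_, rfl⟩, lt_irrefl _⟩
    · rintro ⟨_, hx⟩
      exact ⟨(), ((R.root_le x).eq_or_lt).resolve_right hx⟩
  have h₁ : X.IsTheta (fun _ : Unit => whole R) (whole R) [()] ((whole R).restrict (rootHom R)) _ :=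
    ⟨_, _, g, IsTheta.refl _ _, rfl⟩
  have t := Sub.toCut (E := whole R) (rootHom R)
  have φ : Sub (whole R) ((whole R).above (edge (rootHom R) ())) :=
    Sub.of_hom ⟨toAboveRoot R _ rfl, toAboveRoot_inner R _ rfl⟩ (fun _ => rfl)
  have key := (X.isTheta_thetaList (whole R) (rootHom R) _ (nodup_enum _)).reindex
    ((whole R).above_antichain (rootHom R)) (fun _ : Unit => (⟨(), fun _ _ => le_rfl⟩ : eta.Leaf))
    h₁ (Sub.refl _) t (fun _ => φ) h (nodup_enum _)
  rw [X.sub_refl, Category.id_comp] at key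
  have e : X.graft g ≫ X.unit.hom ▷ _ ≫ (λ_ _).hom = 𝟙 _ :=
    (X.θ_eta_left g.grafting (𝟙 _) (fun x => (g.map_upper x).symm)).trans (by rw [op_id, X.X.map_id])
  have e' := root_aux _ _ (tensNil fun _ : Unit => X.val R) (tensCons (fun _ : Unit => X.val R) () []) e
  rw [X.theta_eq (whole R) (rootHom R),
    X.map_eq_sub φ ⟨toAboveRoot R _ rfl, toAboveRoot_inner R _ rfl⟩ (fun _ => rfl)]
  exact (whisker_tensor_aux _ _ _ _ _).trans ((congrArg (· ≫ _) key.symm).trans e')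

lemma aboveAbove_inner (T : RTree) (e : T.Edge) (x : (T.above e).Edge) :
    inner (aboveAbove T e x) :=
  fun _ hl y hy => hl (b := ⟨⟨y.1, x.2.trans y.2⟩, y.2⟩) hy

variable (X) in
/-- Iterated structure maps for a composition. -/
lemma theta_comp {S R T : RTree} (f : S ⟶ R) (g : R ⟶ T)
    (h : (enum R.Leaf).Perm ((sigmaList (fun l : S.Leaf => enum (R.above (edge f l.1)).Leaf)
      (enum S.Leaf)).map (leafOfAbove f))) :
    X.theta g ≫ (X.theta f ⊗ₘ tensListReindex (V := fun r : R.Leaf => X.val (T.above (edge g r.1)))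
      (W := fun x : (Σ l : S.Leaf, (R.above (edge f l.1)).Leaf) =>
        X.val ((T.above (edge (f ≫ g) x.1.1)).above (edge (aboveMap g (edge f x.1.1)) x.2.1)))
      (leafOfAbove f) (fun x => X.X.map (Quiver.Hom.op (X := (⟨_⟩ : ATree)) (Y := ⟨_⟩)
        ⟨aboveAbove T (edge (f ≫ g) x.1.1) (edge (aboveMap g (edge f x.1.1)) x.2.1),
          aboveAbove_inner _ _ _⟩)) _ (enum R.Leaf) h) ≫ (α_ _ _ _).hom =
    X.theta (f ≫ g) ≫ X.val S ◁
      (tensListMap (fun l : S.Leaf => X.theta (aboveMap g (edge f l.1))) (enum S.Leaf) ≫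
        tensListGather (fun l : S.Leaf => X.val (R.above (edge f l.1)))
          (fun x : (Σ l : S.Leaf, (R.above (edge f l.1)).Leaf) =>
            X.val ((T.above (edge (f ≫ g) x.1.1)).above (edge (aboveMap g (edge f x.1.1)) x.2.1)))
          (fun l => enum _) (enum S.Leaf) _ rfl) := by
  let E : Piece T := whole T
  let W : S.Leaf → Piece T := fun l => E.above (edge (f ≫ g) l.1)
  let fW : ∀ l : S.Leaf, R.above (edge f l.1) ⟶ (W l).tree := fun l => aboveMap g (edge f l.1)
  let B : S.Leaf → Piece T := fun l => (W l).cut 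
    {e | ∃ b ∈ enum (R.above (edge f l.1)).Leaf, edge (fW l) b.1 = e}
  let P : (Σ l : S.Leaf, (R.above (edge f l.1)).Leaf) → Piece T := fun x =>
    (W x.1).above (edge (fW x.1) x.2.1)
  have h₀ := X.isTheta_thetaList E (f ≫ g) _ (nodup_enum _)
  have hg := X.isTheta_thetaList E g _ (nodup_enum _)
  have hf := X.isTheta_thetaList (E.restrict g) f _ (nodup_enum _)
  have hW : ∀ l, X.IsTheta (fun b => P ⟨l, b⟩) (W l) (enum _) (B l)
    (X.thetaList (fW l) (enum _) (nodup_enum _)) := fun l =>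
      X.isTheta_thetaList (W l) (fW l) _ (nodup_enum _)
  have hP : ∀ i j (b : (R.above (edge f j.1)).Leaf), (P ⟨j, b⟩).rt ≤ (B i).rt → i = j :=
    fun i j b hb => leaf_eq_of_le (f ≫ g) le_rfl (((edge_le_iff g).2 b.1.2).trans hb)
  -- Cutting `T` at the leaves of `S` and then each upper part at the leaves of `R` is rewritten as
  -- cutting at all leaves of `R` first, leaving `T₁`, and then cutting `T₁` at the leaves of `S`.
  obtain ⟨T₁, m₁, m₂, h₁, h₂, e₂⟩ := h₀.gather (fun l => enum _) hW (nodup_enum _) hP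
  -- The piece `T₁` has the same edges as the pruning used by `theta g`, since the leaves of `R` are
  -- the leaves of the trees `R` has above the leaves of `S`.
  have hr : Set.range (E.cut {e | ∃ b ∈ enum R.Leaf, edge g b.1 = e}).map = Set.range T₁.map := by
    ext x
    rw [h₁.range, hg.range]
    refine and_congr_right fun _ => ⟨fun hx y hy => hx (leafOfAbove f y) (mem_enum _),
      fun hx y hy => ?_⟩
    obtain ⟨z, rfl⟩ := (leafOfAbove_bijective f).2 y
    exact hx z ((mem_sigmaList _ _ _).2 ⟨mem_enum _, mem_enum _⟩)
  have t₁ : Sub T₁ (E.cut {e | ∃ b ∈ enum R.Leaf, edge g b.1 = e}) := Sub.of_range hr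
  have t₁' : Sub (E.cut {e | ∃ b ∈ enum R.Leaf, edge g b.1 = e}) T₁ := Sub.of_range hr.symm
  have q : Sub (E.restrict g) T₁ := (Sub.toCut (E := E) g).trans t₁'
  have b : ∀ l, Sub ((E.restrict g).above (edge f l.1)) (B l) := fun l =>
    Sub.toCut (E := W l) (fW l)
  have a : Sub ((E.restrict g).cut {e | ∃ b ∈ enum S.Leaf, edge f b.1 = e})
      (E.cut {e | ∃ b ∈ enum S.Leaf, edge (f ≫ g) b.1 = e}) :=
    Sub.cut (E := E.restrict g) (E' := E) f (f ≫ g) (fun x => ⟨edge g x, rfl⟩) (edge_root g)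
      (fun b => ⟨b, rfl⟩) (fun b => ⟨b, rfl⟩)
  have φ : ∀ x, Sub (P x) (E.above (edge g (leafOfAbove f x).1)) := fun x =>
    Sub.of_hom ⟨aboveAbove T (edge (f ≫ g) x.1.1) (edge (aboveMap g (edge f x.1.1)) x.2.1),
          aboveAbove_inner _ _ _⟩ fun _ => rfl
  have e₁ := hg.reindex (E.above_antichain g) (leafOfAbove f) h₁ (Sub.refl _) t₁ φ h (nodup_enum _)
  rw [X.sub_refl, Category.id_comp] at e₁
  have e₃ := h₂.natural hf q a b
  have e₄ := X.sub_comp q t₁ (Sub.toCut (E := E) g)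
  have e₅ := X.sub_comp (Sub.toCut (E := E.restrict g) f) a (Sub.toCut (E := E) (f ≫ g))
  have hφ : ∀ x, X.X.map (Quiver.Hom.op (X := (⟨_⟩ : ATree)) (Y := ⟨_⟩)
        ⟨aboveAbove T (edge (f ≫ g) x.1.1) (edge (aboveMap g (edge f x.1.1)) x.2.1),
          aboveAbove_inner _ _ _⟩) = X.sub (φ x) := fun x => X.map_eq_sub (φ x) _ fun _ => rfl
  have key := theta_comp_aux _ _ _ _ _ _ _ _ _ _ _ _ _ _ e₁ e₂ e₃ e₄ e₅
  have hn := tensListMap_gather_whiskerRight (fun x => X.val (P x).tree)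
    (fun l : S.Leaf => enum (R.above (edge f l.1)).Leaf)
    (fun l => X.thetaList (fW l) (enum _) (nodup_enum _)) (fun l => X.sub (b l)) (enum S.Leaf) _ rfl
  have hW' : ∀ l : S.Leaf, X.theta (aboveMap g (edge f l.1)) =
      X.thetaList (fW l) (enum _) (nodup_enum _) ≫ X.sub (b l) ▷ _ := fun l =>
    X.theta_eq (W l) (fW l)
  have hφ' := funext hφ
  have hW'' := funext hW'
  rw [← hn] at key
  refine Eq.trans ?_ (key.trans ?_)
  · exact congrArg₂ (fun x y => x ≫ y ≫ (α_ _ _ _).hom) (X.theta_eq E g)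
      (congrArg₂ (fun x y => x ⊗ₘ y) (X.theta_eq (E.restrict g) f)
        (congrArg (fun φ => tensListReindex (V := fun r : R.Leaf => X.val (T.above (edge g r.1)))
          (W := fun x : (Σ l : S.Leaf, (R.above (edge f l.1)).Leaf) => X.val (P x).tree)
          (leafOfAbove f) φ _ _ h) hφ'))
  · exact congrArg₂ (fun x y => x ≫ X.val S ◁ (tensListMap y (enum S.Leaf) ≫ _))
      (X.theta_eq E (f ≫ g)).symm hW''.symm

end Preoperad

end Koszul

/-! ### The splitting map and its naturality -/

namespace Koszul

open MonoidalCategory RTree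

section

variable {C : Type*} [Category C] [MonoidalCategory C]

/-- After composition with the invertible gathering map `g'` the two sides decouple: `ht` is
naturality on the factors from `X`, and `hr` is naturality on the remaining factors. -/
lemma split_aux {S S' R R' N N' G G' P P' M M' : C} (s : R ⊗ N ⟶ S ⊗ G) (s' : R' ⊗ N' ⟶ S' ⊗ G')
    (g : G ⟶ P ⊗ M) (g' : G' ⟶ P' ⊗ M') (i : IsIso g') (t : R ⟶ S ⊗ P) (t' : R' ⟶ S' ⊗ P')
    (r : N ⟶ M) (r' : N' ⟶ M') (c : S ⟶ S') (b : G ⟶ G') (p : P ⟶ P') (w : M ⟶ M')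
    (a : R ⟶ R') (v : N ⟶ N') (hs : s ≫ S ◁ g = (t ⊗ₘ r) ≫ (α_ _ _ _).hom)
    (hs' : s' ≫ S' ◁ g' = (t' ⊗ₘ r') ≫ (α_ _ _ _).hom) (hb : b ≫ g' = g ≫ (p ⊗ₘ w))
    (ht : a ≫ t' = t ≫ (c ⊗ₘ p)) (hr : v ≫ r' = r ≫ w) :
    s ≫ (c ⊗ₘ b) = (a ⊗ₘ v) ≫ s' := by
  rw [← cancel_mono (S' ◁ g')]
  have h₁ : (c ⊗ₘ b) ≫ S' ◁ g' = S ◁ g ≫ (c ⊗ₘ (p ⊗ₘ w)) := by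
    simp only [← id_tensorHom, tensorHom_comp_tensorHom, Category.id_comp, Category.comp_id, hb]
  rw [Category.assoc, h₁, reassoc_of% hs, Category.assoc, hs', ← associator_naturality,
    tensorHom_comp_tensorHom_assoc, tensorHom_comp_tensorHom_assoc, ht, hr]

end

namespace Preoperad

variable {k : Type u} [Field k] {X : Preoperad k}

section

variable (X : Preoperad k) (V : Psh k) {S R T : RTree} (f : S ⟶ R) (g : R ⟶ T)

instance isIso_gather : IsIso (X.gather V f g) := by
  have := isIso_tensListGather (fun l : S.Leaf => X.val (R.above (edge f l.1)))
    (nestedFamily V f g) (fun l => enum _) (enum S.Leaf) _ rfl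
  exact MonoidalCategory.whiskerLeft_isIso (X.val S) (tensListGather
    (fun l : S.Leaf => X.val (R.above (edge f l.1))) (nestedFamily V f g) (fun l => enum _)
    (enum S.Leaf) _ rfl)

/-- The map `X(R) ⊗ ⨂ₘ V(Tₘ) ⟶ X(S) ⊗ ⨂ₗ (X(Rₗ) ⊗ ⨂ₘ V(Tₘ))` induced by the iterated structure map
of `X`. -/
noncomputable def split : X.factor V g ⟶
    X.val S ⊗ tens (fun l : S.Leaf => X.factor V (aboveMap g (edge f l.1))) :=
  X.expand V f g ≫ inv (X.gather V f g)

lemma split_gather : X.split V f g ≫ X.gather V f g = X.expand V f g := by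
  rw [split, Category.assoc, IsIso.inv_hom_id, Category.comp_id]

lemma perm_leafOfAbove : (enum R.Leaf).Perm ((sigmaList
    (fun l : S.Leaf => enum (R.above (edge f l.1)).Leaf) (enum S.Leaf)).map (leafOfAbove f)) :=
  perm_enum ((nodup_sigmaList _ (fun _ => nodup_enum _) _ (nodup_enum _)).map
      (leafOfAbove_bijective f).1) (fun m => by
        obtain ⟨x, rfl⟩ := (leafOfAbove_bijective f).2 m
        exact List.mem_map_of_mem ((mem_sigmaList _ _ _).2 ⟨mem_enum _, mem_enum _⟩))

end

section

variable {V V' : Psh k} {S R T S' R' T' : RTree}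

/-- The map `X(R) ⊗ ⨂ₘ V(Tₘ) ⟶ X(R') ⊗ ⨂ₘ V'(T'ₘ)` given by a morphism `R' ⟶ R` in `𝒜` and a
family of maps `V(Tₘ) ⟶ V'(T'ₘ)`. -/
noncomputable def factorHom (h : R ⟶ T) (h' : R' ⟶ T') (d : (⟨R'⟩ : ATree) ⟶ ⟨R⟩)
    (v : ∀ m : R'.Leaf, V.obj (op (T.above (edge h (leafMap d.hom d.property m).1))) ⟶
      V'.obj (op (T'.above (edge h' m.1)))) : X.factor V h ⟶ X.factor V' h' :=
  X.X.map d.op ⊗ₘ tensListReindex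
    (V := fun m : R.Leaf => V.obj (op (T.above (edge h m.1))))
    (W := fun m : R'.Leaf => V'.obj (op (T'.above (edge h' m.1))))
    (leafMap d.hom d.property) v (enum R'.Leaf) (enum R.Leaf)
    (perm_enum_map (leafMap_bijective d.hom d.property))

/-- The naturality of `split`. -/
lemma split_natural (f : S ⟶ R) (h : R ⟶ T) (f' : S' ⟶ R') (h' : R' ⟶ T')
    (c : (⟨S'⟩ : ATree) ⟶ ⟨S⟩) (d : (⟨R'⟩ : ATree) ⟶ ⟨R⟩) (e : c.hom ≫ f = f' ≫ d.hom)
    (v : ∀ m : R'.Leaf, V.obj (op (T.above (edge h (leafMap d.hom d.property m).1))) ⟶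
      V'.obj (op (T'.above (edge h' m.1))))
    (φ : ∀ j : S'.Leaf, (⟨R'.above (edge f' j.1)⟩ : ATree) ⟶
      ⟨R.above (edge f (leafMap c.hom c.property j).1)⟩)
    (hφ : ∀ j x, (edge (φ j).hom x).1 = edge d.hom x.1)
    (v' : ∀ (j : S'.Leaf) (m : (R'.above (edge f' j.1)).Leaf),
      V.obj (op ((T.above _).above (edge (aboveMap h (edge f (leafMap c.hom c.property j).1))
        (leafMap (φ j).hom (φ j).property m).1))) ⟶
      V'.obj (op ((T'.above _).above (edge (aboveMap h' (edge f' j.1)) m.1))))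
    (hi : ∀ (j : S'.Leaf) (m : (R'.above (edge f' j.1)).Leaf),
      leafMap d.hom d.property (leafOfAbove f' ⟨j, m⟩) =
        leafOfAbove f ⟨leafMap c.hom c.property j, leafMap (φ j).hom (φ j).property m⟩)
    (hv : ∀ (j : S'.Leaf) (m : (R'.above (edge f' j.1)).Leaf),
      v (leafOfAbove f' ⟨j, m⟩) ≫
          V'.map (aboveAbove T' (edge (f' ≫ h') j.1) (edge (aboveMap h' (edge f' j.1)) m.1)).op =
        eqToHom (by rw [hi]; rfl) ≫ V.map (aboveAbove T (edge (f ≫ h) (leafMap c.hom c.property j).1)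
          (edge (aboveMap h (edge f (leafMap c.hom c.property j).1))
            (leafMap (φ j).hom (φ j).property m).1)).op ≫ v' j m) :
    X.split V f h ≫ (X.X.map c.op ⊗ₘ tensListReindex
        (V := fun l : S.Leaf => X.factor V (aboveMap h (edge f l.1)))
        (W := fun l : S'.Leaf => X.factor V' (aboveMap h' (edge f' l.1)))
        (leafMap c.hom c.property)
        (fun j => factorHom (aboveMap h (edge f (leafMap c.hom c.property j).1))
          (aboveMap h' (edge f' j.1)) (φ j) (v' j)) (enum S'.Leaf) (enum S.Leaf)
        (perm_enum_map (leafMap_bijective c.hom c.property))) =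
      factorHom h h' d v ≫ X.split V' f' h' := by
  have hp : (sigmaList (fun l : S.Leaf => enum (R.above (edge f l.1)).Leaf) (enum S.Leaf)).Perm
      ((sigmaList (fun l : S'.Leaf => enum (R'.above (edge f' l.1)).Leaf) (enum S'.Leaf)).map
        (fun x => ⟨leafMap c.hom c.property x.1, leafMap (φ x.1).hom (φ x.1).property x.2⟩)) := by
    have h₁ : Function.Injective
        (fun x : (Σ l : S'.Leaf, (R'.above (edge f' l.1)).Leaf) =>
          (⟨leafMap c.hom c.property x.1, leafMap (φ x.1).hom (φ x.1).property x.2⟩ :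
            Σ l : S.Leaf, (R.above (edge f l.1)).Leaf)) := fun x y hxy => by
      have hxy' := congrArg (leafOfAbove f) hxy
      dsimp only at hxy'
      rw [← hi, ← hi] at hxy'
      exact (leafOfAbove_bijective f').1 ((leafMap_bijective d.hom d.property).1 hxy')
    refine (List.perm_ext_iff_of_nodup (nodup_sigmaList _ (fun _ => nodup_enum _) _ (nodup_enum _))
      ((nodup_sigmaList _ (fun _ => nodup_enum _) _ (nodup_enum _)).map h₁)).2 fun x => ?_
    refine ⟨fun _ => ?_, fun _ => (mem_sigmaList _ _ _).2 ⟨mem_enum _, mem_enum _⟩⟩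
    obtain ⟨y, hy⟩ := (leafMap_bijective d.hom d.property).2 (leafOfAbove f x)
    obtain ⟨z, rfl⟩ := (leafOfAbove_bijective f').2 y
    rw [hi] at hy
    have hz := (leafOfAbove_bijective f).1 hy
    exact List.mem_map.2 ⟨z, (mem_sigmaList _ _ _).2 ⟨mem_enum _, mem_enum _⟩, hz⟩
  have hb := tensListReindex_gather (A := fun l : S.Leaf => X.val (R.above (edge f l.1)))
    (B := nestedFamily V f h) (A' := fun l : S'.Leaf => X.val (R'.above (edge f' l.1)))
    (B' := nestedFamily V' f' h') (leafMap c.hom c.property) (fun j => X.X.map (φ j).op)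
    (fun j => leafMap (φ j).hom (φ j).property) v' (fun _ => enum _) (fun _ => enum _)
    (fun j => perm_enum_map (leafMap_bijective (φ j).hom (φ j).property)) (enum S'.Leaf)
    (enum S.Leaf) (perm_enum_map (leafMap_bijective c.hom c.property)) _ _ rfl rfl
    (nodup_sigmaList _ (fun _ => nodup_enum _) _ (nodup_enum _)) hp
  have ht := X.theta_natural f f' c d e φ hφ
  have hr : tensListReindex
      (V := fun m : R.Leaf => V.obj (op (T.above (edge h m.1))))
      (W := fun m : R'.Leaf => V'.obj (op (T'.above (edge h' m.1))))
      (leafMap d.hom d.property) v (enum R'.Leaf) (enum R.Leaf)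
      (perm_enum_map (leafMap_bijective d.hom d.property)) ≫
      tensListReindex (V := fun m : R'.Leaf => V'.obj (op (T'.above (edge h' m.1))))
        (W := nestedFamily V' f' h') (leafOfAbove f')
        (fun x => V'.map (aboveAbove T' (edge (f' ≫ h') x.1.1)
          (edge (aboveMap h' (edge f' x.1.1)) x.2.1)).op) _ (enum R'.Leaf) (perm_leafOfAbove f') =
      tensListReindex (V := fun m : R.Leaf => V.obj (op (T.above (edge h m.1))))
        (W := nestedFamily V f h) (leafOfAbove f)
        (fun x => V.map (aboveAbove T (edge (f ≫ h) x.1.1)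
          (edge (aboveMap h (edge f x.1.1)) x.2.1)).op) _ (enum R.Leaf) (perm_leafOfAbove f) ≫
      tensListReindex (V := nestedFamily V f h) (W := nestedFamily V' f' h')
        (fun x => (⟨leafMap c.hom c.property x.1, leafMap (φ x.1).hom (φ x.1).property x.2⟩ :
            Σ l : S.Leaf, (R.above (edge f l.1)).Leaf)) (fun x => v' x.1 x.2) _ _ hp := by
    have h₂ : (enum R.Leaf).Perm ((sigmaList
        (fun l : S'.Leaf => enum (R'.above (edge f' l.1)).Leaf) (enum S'.Leaf)).map
          (fun x => leafMap d.hom d.property (leafOfAbove f' x))) :=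
      ((perm_enum_map (leafMap_bijective d.hom d.property)).trans
        ((perm_leafOfAbove f').map _)).trans (by rw [List.map_map]; exact List.Perm.refl _)
    -- By functoriality of reindexing, both sides are a single reindexing from the leaves of `R`.
    -- Their index functions agree by `hi`, and their components agree by `hv`.
    have h₃ : (fun x => leafMap d.hom d.property (leafOfAbove f' x)) = fun x =>
        leafOfAbove f ⟨leafMap c.hom c.property x.1, leafMap (φ x.1).hom (φ x.1).property x.2⟩ :=
      funext fun x => hi x.1 x.2
    refine (tensListReindex_comp _ _ _ _ _ _ _ _ _ (nodup_enum _) h₂).trans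
      (Eq.trans ?_ (tensListReindex_comp _ _ _ _ _ _ _ _ _ (nodup_enum _) (h₃ ▸ h₂)).symm)
    exact tensListReindex_congr h₃ (fun x => hv x.1 x.2) _ _ _ _
  exact split_aux _ _ _ _ (isIso_tensListGather _ (nestedFamily V' f' h') _ _ _ rfl) _ _ _ _ _ _ _ _ _ _ (X.split_gather V f h) (X.split_gather V' f' h') hb
    ht hr

end

end Preoperad

end Koszul

/-! ### Special cases of the naturality of splitting -/

namespace Koszul

open MonoidalCategory RTree

lemma RTree.aboveMap_inner {S T : RTree} (c : S ⟶ T) (hc : inner c) (e : S.Edge) :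
    inner (aboveMap c e) := fun _ hl y hy =>
  hc _ (fun z hz => hl (b := ⟨z, le_trans (Subtype.property _) hz⟩) hz) (b := y.1) hy

/-- The restriction of a morphism in `𝒜` to the subtrees above corresponding edges. -/
def RTree.aboveInner {S T : RTree} (c : (⟨S⟩ : ATree) ⟶ ⟨T⟩) (e : S.Edge) :
    (⟨S.above e⟩ : ATree) ⟶ ⟨T.above (edge c.hom e)⟩ :=
  ⟨aboveMap c.hom e, aboveMap_inner c.hom c.property e⟩

lemma id_comp_aux {C : Type*} [Category C] {A B : C} (f : A ⟶ B) : 𝟙 A ≫ f = 𝟙 A ≫ f ≫ 𝟙 B := by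
  rw [Category.comp_id]

lemma map_square_aux {C D : Type*} [Category C] [Category D] (F : C ⥤ D) {A B B' Z : C} {a : A ⟶ B}
    {b : B ⟶ Z} {c : A ⟶ B'} {d : B' ⟶ Z} (h : a ≫ b = c ≫ d) :
    F.map a ≫ F.map b = F.map c ≫ F.map d := by
  rw [← F.map_comp, h, F.map_comp]

namespace Preoperad

variable {k : Type u} [Field k] (X : Preoperad k) {U V W : Psh k} {S R T S' R' T' : RTree}

lemma map_id_tensor_reindex {V W : S.Leaf → Ch k} (φ : ∀ l, V l ⟶ W l) :
    X.X.map (𝟙 (⟨S⟩ : ATree)).op ⊗ₘ tensListReindex (V := V) (W := W)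
      (leafMap (𝟙 (⟨S⟩ : ATree) :).hom (𝟙 (⟨S⟩ : ATree) :).property) φ (enum S.Leaf)
      (enum S.Leaf) (perm_enum_map (leafMap_bijective _ _)) = X.val S ◁ tensListMap φ (enum S.Leaf) := by
  rw [op_id, X.X.map_id, tensListMap_eq_reindex φ _
    (perm_enum_map (f := fun i => i) Function.bijective_id), ← id_tensorHom]
  rfl

/-- Functoriality of `X(S) ⊗ V(T/S)` in `V`, in `T` and in `S` consists of instances of `factorHom`.
The four naturality statements for `split` below are therefore specialisations of `split_natural`.
-/
lemma factorMap_eq (φ : V ⟶ W) (f : S ⟶ T) :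
    X.factorMap φ f = factorHom f f (𝟙 _) (fun _ => φ.app _) :=
  (X.map_id_tensor_reindex _).symm

lemma factorRestrict_eq (f : S ⟶ T) (g : T ⟶ T') :
    X.factorRestrict V f g = factorHom (f ≫ g) f (𝟙 _)
      (fun l => V.map (aboveMap g (edge f l.1)).op) :=
  (X.map_id_tensor_reindex _).symm

variable {X}

lemma factorHom_comp {S'' T'' : RTree} (h : S ⟶ T) (h' : S' ⟶ T') (h'' : S'' ⟶ T'')
    (d : (⟨S'⟩ : ATree) ⟶ ⟨S⟩) (d' : (⟨S''⟩ : ATree) ⟶ ⟨S'⟩)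
    (v : ∀ m : S'.Leaf, U.obj (op (T.above (edge h (leafMap d.hom d.property m).1))) ⟶
      V.obj (op (T'.above (edge h' m.1))))
    (v' : ∀ m : S''.Leaf, V.obj (op (T'.above (edge h' (leafMap d'.hom d'.property m).1))) ⟶
      W.obj (op (T''.above (edge h'' m.1)))) :
    factorHom (X := X) h h' d v ≫ factorHom h' h'' d' v' =
      factorHom h h'' (d' ≫ d) (fun m => v (leafMap d'.hom d'.property m) ≫ v' m) := by
  have h₁ := tensListReindex_comp (V := fun m : S.Leaf => U.obj (op (T.above (edge h m.1))))
    (W := fun m : S'.Leaf => V.obj (op (T'.above (edge h' m.1))))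
    (U := fun m : S''.Leaf => W.obj (op (T''.above (edge h'' m.1)))) _ v _ v' (enum S''.Leaf) (enum S'.Leaf) (enum S.Leaf)
    (perm_enum_map (leafMap_bijective d.hom d.property))
    (perm_enum_map (leafMap_bijective d'.hom d'.property)) (nodup_enum _)
    (perm_enum_map (leafMap_bijective (d' ≫ d).hom (d' ≫ d).property))
  refine (tensorHom_comp_tensorHom _ _ _ _).trans ?_
  exact congrArg₂ (fun x y => x ⊗ₘ y) (by rw [op_comp, X.X.map_comp]) h₁

lemma factorHom_id (h : S ⟶ T) :
    factorHom (X := X) (V := V) h h (𝟙 _) (fun _ => 𝟙 _) = 𝟙 _ := by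
  refine (X.map_id_tensor_reindex _).trans ?_
  exact (congrArg (X.val S ◁ ·) (tensListMap_id _ _)).trans (MonoidalCategory.whiskerLeft_id _ _)

variable (X V)

lemma split_inner (f : S ⟶ R) (d : (⟨R⟩ : ATree) ⟶ ⟨R'⟩) (h : R' ⟶ T) :
    X.factorInner V d h ≫ X.split V f (d.hom ≫ h) = X.split V (f ≫ d.hom) h ≫
      X.val S ◁ tensListMap (fun l : S.Leaf => X.factorInner V (aboveInner d (edge f l.1))
        (aboveMap h (edge (f ≫ d.hom) l.1))) (enum S.Leaf) := by
  have key := split_natural (X := X) (V := V) (V' := V) (f ≫ d.hom) h f (d.hom ≫ h) (𝟙 _) d rfl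
    (fun _ => 𝟙 _) (fun l => aboveInner d (edge f l.1)) (fun _ _ => rfl) (fun _ _ => 𝟙 _)
    (fun _ _ => rfl) (fun _ _ => id_comp_aux _)
  exact key.symm.trans (congrArg (_ ≫ ·) (X.map_id_tensor_reindex _))

lemma split_left_inner (c : (⟨S⟩ : ATree) ⟶ ⟨S'⟩) (f : S' ⟶ R) (h : R ⟶ T) :
    X.split V f h ≫ (X.X.map c.op ⊗ₘ tensListReindex
        (V := fun l : S'.Leaf => X.factor V (aboveMap h (edge f l.1)))
        (W := fun l : S.Leaf => X.factor V (aboveMap h (edge (c.hom ≫ f) l.1)))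
        (leafMap c.hom c.property) (fun _ => 𝟙 _) (enum S.Leaf) (enum S'.Leaf)
        (perm_enum_map (leafMap_bijective c.hom c.property))) = X.split V (c.hom ≫ f) h := by
  have key := split_natural (X := X) (V := V) (V' := V) f h (c.hom ≫ f) h c (𝟙 _) rfl
    (fun _ => 𝟙 _) (fun l => 𝟙 _) (fun _ _ => rfl) (fun _ _ => 𝟙 _)
    (fun _ _ => rfl) (fun _ _ => id_comp_aux _)
  rw [factorHom_id, Category.id_comp] at key
  refine Eq.trans ?_ key
  refine congrArg (fun φ => _ ≫ (_ ⊗ₘ tensListReindex (leafMap c.hom c.property) φ _ _ _)) ?_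
  exact funext fun j => (factorHom_id _).symm

lemma split_restrict (f : S ⟶ R) (h : R ⟶ T) (g : T ⟶ T') :
    X.factorRestrict V h g ≫ X.split V f h = X.split V f (h ≫ g) ≫
      X.val S ◁ tensListMap (fun l : S.Leaf => X.factorRestrict V (aboveMap h (edge f l.1))
        (aboveMap g (edge (f ≫ h) l.1))) (enum S.Leaf) := by
  have key := split_natural (X := X) (V := V) (V' := V) f (h ≫ g) f h (𝟙 _) (𝟙 _) rfl
    (fun l => V.map (aboveMap g (edge h l.1)).op) (fun l => 𝟙 _) (fun _ _ => rfl)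
    (fun j m => V.map (aboveMap (aboveMap g (edge (f ≫ h) j.1))
      (edge (aboveMap h (edge f j.1)) m.1)).op)
    (fun _ _ => rfl) (fun _ _ => by
      refine Eq.trans ?_ (Category.id_comp _).symm
      exact map_square_aux V rfl)
  refine (congrArg (· ≫ _) (X.factorRestrict_eq h g)).trans (key.symm.trans (congrArg (_ ≫ ·)
    ((X.map_id_tensor_reindex _).trans ?_)))
  exact congrArg (fun φ => X.val S ◁ tensListMap φ (enum S.Leaf))
    (funext fun l => (X.factorRestrict_eq _ _).symm)

variable {V}

lemma split_map (φ : V ⟶ W) (f : S ⟶ R) (h : R ⟶ T) :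
    X.factorMap φ h ≫ X.split W f h = X.split V f h ≫
      X.val S ◁ tensListMap (fun l : S.Leaf => X.factorMap φ (aboveMap h (edge f l.1)))
        (enum S.Leaf) := by
  have key := split_natural (X := X) (V := V) (V' := W) f h f h (𝟙 _) (𝟙 _) rfl
    (fun l => φ.app _) (fun l => 𝟙 _) (fun _ _ => rfl)
    (fun j m => φ.app _)
    (fun _ _ => rfl) (fun _ _ => (φ.naturality _).symm.trans (Category.id_comp _).symm)
  refine (congrArg (· ≫ _) (X.factorMap_eq φ h)).trans (key.symm.trans (congrArg (_ ≫ ·)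
    ((X.map_id_tensor_reindex _).trans ?_)))
  exact congrArg (fun φ => X.val S ◁ tensListMap φ (enum S.Leaf))
    (funext fun l => (X.factorMap_eq _ _).symm)

end Preoperad

end Koszul

/-! ### Splitting along a composition -/

namespace Koszul

open MonoidalCategory RTree

section

variable {C : Type*} [Category C] [MonoidalCategory C]

/-- The skeleton of `split_comp`. After cancelling the gathering isomorphism `γ` of the innermost
level, the claim decouples into associativity of the iterated structure maps (`hθ`) and an equality
of two reindexings of the leaves (`hr`). -/
lemma split_comp_aux {S R T N G P M G₁ P₁ M₁' M₁ B H Q M₂ E : C} (sg : T ⊗ N ⟶ R ⊗ G)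
    (γg : G ⟶ P ⊗ M) (θg : T ⟶ R ⊗ P) (r₀ : N ⟶ M) (sfg : T ⊗ N ⟶ S ⊗ G₁) (σ : G₁ ⟶ P₁ ⊗ M₁')
    (φ : M₁' ⟶ M₁) (θfg : T ⟶ S ⊗ P₁) (r₁ : N ⟶ M₁) (θf : R ⟶ S ⊗ B) (K : G ⟶ H) (γ : H ⟶ Q ⊗ M₂)
    (i : IsIso γ) (p : P ⟶ Q) (w : M ⟶ M₂) (D : G₁ ⟶ E) (Γ : E ⟶ B ⊗ H) (d : P₁ ⟶ B ⊗ Q)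
    (ρ : M₁' ⟶ M₂) (r₂ : M₁ ⟶ M₂) (hg : sg ≫ R ◁ γg = (θg ⊗ₘ r₀) ≫ (α_ _ _ _).hom)
    (hfg : sfg ≫ S ◁ (σ ≫ P₁ ◁ φ) = (θfg ⊗ₘ r₁) ≫ (α_ _ _ _).hom)
    (hK : K ≫ γ = γg ≫ (p ⊗ₘ w)) (hE : D ≫ Γ ≫ B ◁ γ = σ ≫ (d ⊗ₘ ρ) ≫ (α_ _ _ _).hom)
    (hρ : ρ = φ ≫ r₂) (hθ : θg ≫ (θf ⊗ₘ p) ≫ (α_ _ _ _).hom = θfg ≫ S ◁ d)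
    (hr : r₀ ≫ w = r₁ ≫ r₂) :
    sg ≫ (θf ⊗ₘ K) ≫ (α_ _ _ _).hom = sfg ≫ S ◁ (D ≫ Γ) := by
  rw [← cancel_mono (S ◁ B ◁ γ)]
  have h₁ : (θf ⊗ₘ K) ≫ (α_ S B H).hom ≫ S ◁ B ◁ γ = R ◁ γg ≫ (θf ⊗ₘ (p ⊗ₘ w)) ≫ (α_ S B _).hom := by
    rw [← associator_naturality_right]
    simp only [← id_tensorHom, tensorHom_comp_tensorHom_assoc, Category.id_comp, Category.comp_id, hK]
  have h₂ : S ◁ (D ≫ Γ) ≫ S ◁ B ◁ γ = S ◁ (σ ≫ P₁ ◁ φ) ≫ S ◁ ((d ⊗ₘ r₂) ≫ (α_ _ _ _).hom) := by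
    rw [← MonoidalCategory.whiskerLeft_comp, Category.assoc, hE, ← MonoidalCategory.whiskerLeft_comp,
      Category.assoc, hρ]
    simp only [← id_tensorHom, tensorHom_comp_tensorHom_assoc, Category.id_comp]
  simp only [Category.assoc]
  rw [h₁, h₂, reassoc_of% hg, reassoc_of% hfg]
  have h₃ : (θg ⊗ₘ r₀) ≫ (α_ R P M).hom ≫ (θf ⊗ₘ (p ⊗ₘ w)) ≫ (α_ S B (Q ⊗ M₂)).hom =
      ((θg ≫ (θf ⊗ₘ p) ≫ (α_ _ _ _).hom) ⊗ₘ (r₀ ≫ w)) ≫ (α_ _ _ _).hom ≫ S ◁ (α_ _ _ _).hom := by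
    rw [← associator_naturality_assoc, ← pentagon, tensorHom_comp_tensorHom_assoc,
      ← tensorHom_id, tensorHom_comp_tensorHom_assoc, Category.assoc, Category.comp_id]
  rw [h₃, hθ, hr, MonoidalCategory.whiskerLeft_comp, ← id_tensorHom S (d ⊗ₘ r₂),
    ← associator_naturality_assoc, id_tensorHom, tensorHom_comp_tensorHom_assoc]

/-- If every `ψ i` is a splitting map, then gathering all of them twice separates the factors from
`X` from the others. This is associativity of gathering and of shuffling. -/
lemma tensListMap_split_gather [SymmetricCategory C] {ι : Type} {κ : ι → Type}
    {μ : (Σ i, κ i) → Type} {X A : ι → C} {D : ι → C}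
    (Y : (Σ i, κ i) → C) (V : (Σ x, μ x) → C) (L : ∀ i, List (κ i)) (N : ∀ x, List (μ x))
    (l : List ι) (s : List (Σ i, κ i)) (t : List (Σ x, μ x))
    (u : ∀ i, List (Σ j : κ i, μ ⟨i, j⟩)) (v : List (Σ i, Σ j : κ i, μ ⟨i, j⟩))
    (hs : sigmaList L l = s) (ht : sigmaList N s = t)
    (hu : ∀ i, sigmaList (fun j => N ⟨i, j⟩) (L i) = u i) (hv : sigmaList u l = v)
    (h : v.Perm (t.map (fun x => ⟨x.1.1, x.1.2, x.2⟩))) (hnd : t.Nodup)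
    (ψ : ∀ i, A i ⊗ D i ⟶ X i ⊗ tensList (fun j => Y ⟨i, j⟩ ⊗
      tensList (fun n => V ⟨⟨i, j⟩, n⟩) (N ⟨i, j⟩)) (L i))
    (θ : ∀ i, A i ⟶ X i ⊗ tensList (fun j => Y ⟨i, j⟩) (L i))
    (r : ∀ i, D i ⟶ tensList (fun y : Σ j : κ i, μ ⟨i, j⟩ => V ⟨⟨i, y.1⟩, y.2⟩) (u i))
    (hψ : ∀ i, ψ i ≫ X i ◁ tensListGather (fun j => Y ⟨i, j⟩)
      (fun y : Σ j : κ i, μ ⟨i, j⟩ => V ⟨⟨i, y.1⟩, y.2⟩) (fun j => N ⟨i, j⟩) (L i) (u i) (hu i) =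
        (θ i ⊗ₘ r i) ≫ (α_ _ _ _).hom) :
    tensListMap ψ l ≫ tensListGather X (fun x => Y x ⊗ tensList (fun n => V ⟨x, n⟩) (N x)) L l s hs ≫
        tensList X l ◁ tensListGather Y V N s t ht =
      tensListShuffle A D l ≫ ((tensListMap θ l ≫ tensListGather X Y L l s hs) ⊗ₘ
        (tensListMap r l ≫ tensListFlattenTo
          (fun y : Σ i, Σ j : κ i, μ ⟨i, j⟩ => V ⟨⟨y.1, y.2.1⟩, y.2.2⟩) u l v hv ≫
          tensListReindex (V := fun y : Σ i, Σ j : κ i, μ ⟨i, j⟩ => V ⟨⟨y.1, y.2.1⟩, y.2.2⟩)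
            (W := V) (fun x => ⟨x.1.1, x.1.2, x.2⟩) (fun x => 𝟙 (V x)) t v h)) ≫
        (α_ _ _ _).hom := by
  rw [tensListGather_gather X Y V L N l s t u v hs ht hu hv h hnd, ← Category.assoc,
    ← tensListMap_comp]
  simp only [hψ]
  rw [tensListMap_comp, Category.assoc]
  have h₁ := tensListShuffle_assoc X (fun i => tensList (fun j => Y ⟨i, j⟩) (L i))
    (fun i => tensList (fun y : Σ j : κ i, μ ⟨i, j⟩ => V ⟨⟨i, y.1⟩, y.2⟩) (u i)) l
  have h₂ : tensListMap (fun i => (α_ (X i) (tensList (fun j => Y ⟨i, j⟩) (L i))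
      (tensList (fun y : Σ j : κ i, μ ⟨i, j⟩ => V ⟨⟨i, y.1⟩, y.2⟩) (u i))).hom) l ≫
      tensListMap (fun i => (α_ (X i) (tensList (fun j => Y ⟨i, j⟩) (L i))
        (tensList (fun y : Σ j : κ i, μ ⟨i, j⟩ => V ⟨⟨i, y.1⟩, y.2⟩) (u i))).inv) l = 𝟙 _ := by
    rw [← tensListMap_comp]
    simp only [Iso.hom_inv_id]
    exact tensListMap_id _ _
  have h₃ := tensListShuffle_natural θ r l
  rw [MonoidalCategory.whiskerLeft_comp, reassoc_of% h₁, reassoc_of% h₂, reassoc_of% h₃]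
  rw [tensListGather, ← id_tensorHom (tensList X l) (_ ⊗ₘ _), ← associator_naturality,
    ← tensorHom_id, ← id_tensorHom, tensorHom_comp_tensorHom_assoc, tensorHom_comp_tensorHom_assoc,
    Category.comp_id, Category.assoc]

end

namespace Preoperad

variable {k : Type u} [Field k] (X : Preoperad k) (V : Psh k) {S R T Q : RTree}

/-- The canonical isomorphism between the complexes `X(T') ⊗ V(Q'/T')`, `T'` and `Q'` being
subtrees of `T` and `Q` above an edge, or the corresponding subtrees of subtrees. -/
noncomputable def factorAbove (h : T ⟶ Q) (e : T.Edge) (x : (T.above e).Edge) :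
    X.factor V (aboveMap h x.1) ⟶ X.factor V (aboveMap (aboveMap h e) x) :=
  X.factorInner V ⟨aboveAbove T e x, aboveAbove_inner T e x⟩ (aboveMap h x.1) ≫
    X.factorRestrict V (aboveMap (aboveMap h e) x) (aboveAbove Q (edge h e) (edge (aboveMap h e) x))

lemma factorAbove_eq (h : T ⟶ Q) (e : T.Edge) (x : (T.above e).Edge) :
    X.factorAbove V h e x = factorHom (aboveMap h x.1) (aboveMap (aboveMap h e) x)
      ⟨aboveAbove T e x, aboveAbove_inner T e x⟩ (fun m => V.map (aboveMap (aboveAbove Q (edge h e)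
        (edge (aboveMap h e) x)) (edge (aboveMap (aboveMap h e) x) m.1)).op) := by
  refine (congrArg (_ ≫ ·) (X.factorRestrict_eq (V := V) (aboveMap (aboveMap h e) x)
    (aboveAbove Q (edge h e) (edge (aboveMap h e) x)))).trans ?_
  refine (factorHom_comp (X := X) (aboveMap h x.1)
    (aboveMap (aboveMap h e) x ≫ aboveAbove Q (edge h e) (edge (aboveMap h e) x))
    (aboveMap (aboveMap h e) x) ⟨aboveAbove T e x, aboveAbove_inner T e x⟩ (𝟙 _) _ _).trans ?_
  exact congrArg (factorHom (X := X) (aboveMap h x.1) (aboveMap (aboveMap h e) x)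
    ⟨aboveAbove T e x, aboveAbove_inner T e x⟩) (funext fun m => Category.id_comp _)

lemma perm_of_bijective {ι κ : Type} {f : κ → ι} (hf : Function.Bijective f) {l : List ι}
    {l' : List κ} (hl : l.Nodup) (hl' : l'.Nodup) (h : ∀ i, i ∈ l) (h' : ∀ j, j ∈ l') :
    l.Perm (l'.map f) :=
  (List.perm_ext_iff_of_nodup hl (hl'.map hf.1)).2 fun i => by
    obtain ⟨j, rfl⟩ := hf.2 i
    exact ⟨fun _ => List.mem_map_of_mem (h' j), fun _ => h _⟩

lemma nodup_sigmaList_enum {ι : Type} {κ : ι → Type} [∀ i, Finite (κ i)] {l : List ι}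
    (hl : l.Nodup) : (sigmaList (fun i => enum (κ i)) l).Nodup :=
  nodup_sigmaList _ (fun _ => nodup_enum _) _ hl

lemma mem_sigmaList_enum {ι : Type} {κ : ι → Type} [∀ i, Finite (κ i)] {l : List ι}
    (hl : ∀ i, i ∈ l) (x : Σ i, κ i) : x ∈ sigmaList (fun i => enum (κ i)) l :=
  (mem_sigmaList _ _ _).2 ⟨hl _, mem_enum _⟩

variable (f : S ⟶ R) (g : R ⟶ T) (h : T ⟶ Q)

/-- The splitting maps for a composition. -/
lemma split_comp : X.split V g h ≫ (X.theta f ⊗ₘ tensListReindex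
      (V := fun r : R.Leaf => X.factor V (aboveMap h (edge g r.1)))
      (W := fun x : (Σ l : S.Leaf, (R.above (edge f l.1)).Leaf) => X.factor V
        (aboveMap (aboveMap h (edge (f ≫ g) x.1.1)) (edge (aboveMap g (edge f x.1.1)) x.2.1)))
      (leafOfAbove f) (fun x => X.factorAbove V h (edge (f ≫ g) x.1.1)
        (edge (aboveMap g (edge f x.1.1)) x.2.1)) _ (enum R.Leaf) (perm_leafOfAbove f)) ≫
      (α_ _ _ _).hom =
    X.split V (f ≫ g) h ≫ X.val S ◁ (tensListMap (fun l : S.Leaf =>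
      X.split V (aboveMap g (edge f l.1)) (aboveMap h (edge (f ≫ g) l.1))) (enum S.Leaf) ≫
        tensListGather (fun l : S.Leaf => X.val (R.above (edge f l.1)))
          (fun x : (Σ l : S.Leaf, (R.above (edge f l.1)).Leaf) => X.factor V
            (aboveMap (aboveMap h (edge (f ≫ g) x.1.1)) (edge (aboveMap g (edge f x.1.1)) x.2.1)))
          (fun l => enum _) (enum S.Leaf) _ rfl) := by
  let TT : (Σ l : S.Leaf, (R.above (edge f l.1)).Leaf) → RTree := fun x =>
    (T.above (edge (f ≫ g) x.1.1)).above (edge (aboveMap g (edge f x.1.1)) x.2.1)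
  let Y : (Σ l : S.Leaf, (R.above (edge f l.1)).Leaf) → Ch k := fun x => X.val (TT x)
  let V' : (Σ x, (TT x).Leaf) → Ch k := fun y => nestedFamily V
    (aboveMap g (edge f y.1.1.1)) (aboveMap h (edge (f ≫ g) y.1.1.1)) ⟨y.1.2, y.2⟩
  let s := sigmaList (fun l : S.Leaf => enum (R.above (edge f l.1)).Leaf) (enum S.Leaf)
  have hs : s.Nodup := nodup_sigmaList_enum (nodup_enum _)
  have hs' : ∀ x, x ∈ s := mem_sigmaList_enum mem_enum
  let t := sigmaList (fun x => enum (TT x).Leaf) s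
  have ht : t.Nodup := nodup_sigmaList_enum hs
  have ht' : ∀ x, x ∈ t := mem_sigmaList_enum hs'
  let a' : ∀ x, TT x ⟶ T.above (edge g (leafOfAbove f x).1) := fun x =>
    aboveAbove T (edge (f ≫ g) x.1.1) (edge (aboveMap g (edge f x.1.1)) x.2.1)
  let aa : ∀ x, (⟨TT x⟩ : ATree) ⟶ ⟨T.above (edge g (leafOfAbove f x).1)⟩ := fun x =>
    ⟨aboveAbove T (edge (f ≫ g) x.1.1) (edge (aboveMap g (edge f x.1.1)) x.2.1),
      aboveAbove_inner _ _ _⟩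
  -- A leaf of `T` is addressed either through a leaf `r` of `R`, or through a pair consisting of a
  -- leaf of `S` and a leaf of `R` above it; `F` translates between the addresses.
  let F : (Σ x, (TT x).Leaf) → Σ r : R.Leaf, (T.above (edge g r.1)).Leaf := fun y =>
    ⟨leafOfAbove f y.1, leafMap (aa y.1).hom (aa y.1).property y.2⟩
  have hF : Function.Bijective F :=
    ⟨Function.Injective.sigma_map (f₁ := leafOfAbove f)
      (β₁ := fun x => (TT x).Leaf) (β₂ := fun r : R.Leaf => (T.above (edge g r.1)).Leaf)
      (f₂ := fun x => leafMap (a' x) (aboveAbove_inner _ _ _)) (leafOfAbove_bijective f).1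
      fun x => (leafMap_bijective (a' x) (aboveAbove_inner _ _ _)).1,
    Function.Surjective.sigma_map (f₁ := leafOfAbove f)
      (β₁ := fun x => (TT x).Leaf) (β₂ := fun r : R.Leaf => (T.above (edge g r.1)).Leaf)
      (f₂ := fun x => leafMap (a' x) (aboveAbove_inner _ _ _)) (leafOfAbove_bijective f).2
      fun x => (leafMap_bijective (a' x) (aboveAbove_inner _ _ _)).2⟩
  let u : ∀ l : S.Leaf, List (Σ j : (R.above (edge f l.1)).Leaf, (TT ⟨l, j⟩).Leaf) := fun l =>
    sigmaList (fun j => enum (TT ⟨l, j⟩).Leaf) (enum _)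
  have hu : ∀ l, (u l).Nodup := fun l => nodup_sigmaList_enum (nodup_enum _)
  have hu' : ∀ l x, x ∈ u l := fun l => mem_sigmaList_enum mem_enum
  let v := sigmaList u (enum S.Leaf)
  have hv : v.Nodup := nodup_sigmaList _ hu _ (nodup_enum _)
  have hv' : ∀ x, x ∈ v := fun x => (mem_sigmaList _ _ _).2 ⟨mem_enum _, hu' _ _⟩
  -- Grouping the triples by leaves of `S` or by pairs gives the same triples up to rebracketing.
  have hvt := perm_of_bijective (Equiv.sigmaAssoc
    (fun l (j : (R.above (edge f l.1)).Leaf) => (TT ⟨l, j⟩).Leaf)).bijective hv ht hv' ht'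
  -- The left-hand side gathers over the leaves of `R`; this rewrites it as gathering over pairs.
  have hK := tensListReindex_gather (A := fun r : R.Leaf => X.val (T.above (edge g r.1)))
    (B := nestedFamily V g h) (A' := Y) (B' := V') (leafOfAbove f) (fun x => X.X.map (aa x).op)
    (fun x => leafMap (aa x).hom (aa x).property)
    (fun x m => V.map (aboveMap (aboveAbove Q (edge h (edge (f ≫ g) x.1.1))
      (edge (aboveMap h (edge (f ≫ g) x.1.1)) (edge (aboveMap g (edge f x.1.1)) x.2.1)))
      (edge (aboveMap (aboveMap h (edge (f ≫ g) x.1.1)) (edge (aboveMap g (edge f x.1.1)) x.2.1))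
        m.1)).op)
    (fun _ => enum _) (fun _ => enum _)
    (fun x => perm_enum_map (leafMap_bijective (aa x).hom (aa x).property)) s (enum R.Leaf)
    (perm_leafOfAbove f) _ t rfl rfl (nodup_sigmaList_enum (nodup_enum _))
    (perm_of_bijective hF (nodup_sigmaList_enum (nodup_enum _)) ht (mem_sigmaList_enum mem_enum) ht')
  -- The right-hand side splits above each leaf of `S`; all these splittings are gathered at once.
  have hE := tensListMap_split_gather (X := fun l : S.Leaf => X.val (R.above (edge f l.1))) Y V'
    (fun _ => enum _) (fun _ => enum _) (enum S.Leaf) s t u v rfl rfl (fun _ => rfl) rfl hvt ht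
    (fun l => X.split V (aboveMap g (edge f l.1)) (aboveMap h (edge (f ≫ g) l.1)))
    (fun l => X.theta (aboveMap g (edge f l.1)))
    (fun l => tensListReindex _ _ _ _ (perm_leafOfAbove (aboveMap g (edge f l.1))))
    (fun l => X.split_gather V (aboveMap g (edge f l.1)) (aboveMap h (edge (f ≫ g) l.1)))
  have hθ := X.theta_comp f g (perm_leafOfAbove f)
  -- The reindexings carried out separately above the leaves of `S` flatten to a single reindexing.
  have hρ : tensListMap (fun l : S.Leaf => tensListReindex
        (V := fun m : (T.above (edge g (edge f l.1))).Leaf => nestedFamily V (f ≫ g) h ⟨l, m⟩)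
        (W := nestedFamily V (aboveMap g (edge f l.1)) (aboveMap h (edge (f ≫ g) l.1)))
        (leafOfAbove (aboveMap g (edge f l.1)))
        (fun x => V.map (aboveAbove _ (edge (aboveMap g (edge f l.1) ≫ aboveMap h (edge (f ≫ g) l.1))
          x.1.1) (edge (aboveMap (aboveMap h (edge (f ≫ g) l.1))
            (edge (aboveMap g (edge f l.1)) x.1.1)) x.2.1)).op) (u l) (enum _)
        (perm_leafOfAbove (aboveMap g (edge f l.1)))) (enum S.Leaf) ≫
      tensListFlattenTo (fun y : Σ l : S.Leaf, Σ j : (R.above (edge f l.1)).Leaf, (TT ⟨l, j⟩).Leaf =>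
        V' ⟨⟨y.1, y.2.1⟩, y.2.2⟩) u (enum S.Leaf) v rfl = _ :=
    (congrArg (· ≫ _) (tensListMap_eq_reindex _ _ (perm_enum_map Function.bijective_id))).trans
    (tensListReindex_flatten (V := nestedFamily V (f ≫ g) h)
      (W := fun y : Σ l : S.Leaf, Σ j : (R.above (edge f l.1)).Leaf, (TT ⟨l, j⟩).Leaf =>
        V' ⟨⟨y.1, y.2.1⟩, y.2.2⟩) (fun l => l) (fun l => leafOfAbove (aboveMap g (edge f l.1)))
      (fun l x => V.map (aboveAbove _ (edge (aboveMap g (edge f l.1) ≫ aboveMap h (edge (f ≫ g) l.1))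
          x.1.1) (edge (aboveMap (aboveMap h (edge (f ≫ g) l.1))
            (edge (aboveMap g (edge f l.1)) x.1.1)) x.2.1)).op) (fun _ => enum _) u
      (fun l => perm_leafOfAbove (aboveMap g (edge f l.1))) (enum S.Leaf) (enum S.Leaf)
      (perm_enum_map Function.bijective_id) _ v rfl rfl (nodup_sigmaList_enum (nodup_enum _))
      (perm_of_bijective (f := fun x => (⟨x.1, leafOfAbove (aboveMap g (edge f x.1.1)) x.2⟩ :
          Σ l : S.Leaf, (T.above (edge (f ≫ g) l.1)).Leaf))
        ⟨Function.Injective.sigma_map (f₁ := fun l : S.Leaf => l) (β₂ := fun l : S.Leaf =>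
          (T.above (edge (f ≫ g) l.1)).Leaf) Function.injective_id
            (fun l => (leafOfAbove_bijective (aboveMap g (edge f l.1))).1),
          Function.Surjective.sigma_map (f₁ := fun l : S.Leaf => l) (β₂ := fun l : S.Leaf =>
          (T.above (edge (f ≫ g) l.1)).Leaf) Function.surjective_id
            (fun l => (leafOfAbove_bijective (aboveMap g (edge f l.1))).2)⟩
        (nodup_sigmaList_enum (nodup_enum _)) hv (mem_sigmaList_enum mem_enum) hv'))
  refine split_comp_aux _ _ _ _ _ (tensListShuffle _ _ _) (tensListFlatten (nestedFamily V (f ≫ g) h)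
    _ _) _ _ _ _ (tensListGather Y V' _ _ t rfl) (isIso_tensListGather Y V' _ _ t rfl) _ _ _ _ _ _ _
    (X.split_gather V g h) (X.split_gather V (f ≫ g) h)
    (Eq.trans ?_ hK) hE ((Category.assoc _ _ _).symm.trans ((congrArg (· ≫ _) hρ).trans
      (Category.assoc _ _ _))) hθ ?_
  · exact congrArg (fun φ => tensListReindex (V := fun r : R.Leaf => X.factor V
      (aboveMap h (edge g r.1))) (leafOfAbove f) φ _ _ _ ≫ _)
      (funext fun x => X.factorAbove_eq V h _ _)
  -- On the factors from `V`, both sides reindex along the same bijection from triples to leaves of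
  -- `T`; the components agree by functoriality of `V`.
  · have hp : (enum T.Leaf).Perm (t.map fun x => leafOfAbove g (F x)) :=
      perm_of_bijective ((leafOfAbove_bijective g).comp hF) (nodup_enum _) ht mem_enum ht'
    let G : (Σ x, (TT x).Leaf) → Σ l : S.Leaf, (T.above (edge (f ≫ g) l.1)).Leaf := fun x =>
      ⟨x.1.1, leafOfAbove (aboveMap g (edge f x.1.1.1)) ⟨x.1.2, x.2⟩⟩
    have hG : Function.Bijective G := ((leafOfAbove_bijective (f ≫ g)).of_comp_iff' G).1
      ((leafOfAbove_bijective g).comp hF)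
    have hp' : (enum T.Leaf).Perm (t.map fun x => leafOfAbove (f ≫ g) (G x)) := hp
    refine (tensListReindex_comp _ _ _ _ _ _ _ _ _ (nodup_enum _) hp).trans (Eq.trans ?_
      ((congrArg (_ ≫ ·) (tensListReindex_comp _ _ _ _ _ _ _ _ _
        (nodup_sigmaList_enum (nodup_enum _)) (perm_of_bijective hG
          (nodup_sigmaList_enum (nodup_enum _)) ht (mem_sigmaList_enum mem_enum) ht'))).trans
        (tensListReindex_comp (leafOfAbove (f ≫ g)) _ G _ _ _ _ _ _ (nodup_enum _) hp')).symm)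
    refine congrArg (fun φ => tensListReindex (V := fun r : T.Leaf => V.obj (op
      (Q.above (edge h r.1)))) (W := V') (fun x => leafOfAbove g (F x)) φ _ _ hp) (funext fun x => ?_)
    refine Eq.trans ?_ (congrArg (_ ≫ ·) (Category.comp_id (V.map _)).symm)
    exact map_square_aux V rfl

end Preoperad

end Koszul

/-! ### Unit laws for the splitting map -/

namespace Koszul

open MonoidalCategory RTree

section

variable {C : Type*} [Category C] [MonoidalCategory C]

lemma split_rootHom_aux {R N S G P M H P' M' : C} (s : R ⊗ N ⟶ S ⊗ G) (γ : G ⟶ P ⊗ M)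
    (θ : R ⟶ S ⊗ P) (r : N ⟶ M) (u : S ⟶ 𝟙_ C) (K : G ⟶ H) (c : H ⟶ R ⊗ N) (Γ : H ⟶ P' ⊗ M')
    (a : P' ⟶ R) (q : M' ⟶ N) (p : P ⟶ P') (w : M ⟶ M')
    (hs : s ≫ S ◁ γ = (θ ⊗ₘ r) ≫ (α_ _ _ _).hom) (hc : Γ ≫ (a ⊗ₘ q) = c)
    (hK : K ≫ Γ = γ ≫ (p ⊗ₘ w)) (hθ : θ ≫ (u ⊗ₘ p) ≫ (λ_ _).hom ≫ a = 𝟙 _)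
    (hr : r ≫ w ≫ q = 𝟙 _) : s ≫ (u ⊗ₘ K) ≫ (λ_ _).hom ≫ c = 𝟙 _ := by
  have h₁ : (u ⊗ₘ K) ≫ (λ_ H).hom ≫ c =
      S ◁ γ ≫ (u ⊗ₘ (p ⊗ₘ w)) ≫ (λ_ _).hom ≫ (a ⊗ₘ q) := by
    rw [← hc, ← leftUnitor_naturality_assoc, ← leftUnitor_naturality]
    simp only [← id_tensorHom, tensorHom_comp_tensorHom_assoc, Category.id_comp, Category.comp_id,
      reassoc_of% hK]
  have h₂ : (α_ S P M).hom ≫ (u ⊗ₘ (p ⊗ₘ w)) ≫ (λ_ _).hom ≫ (a ⊗ₘ q) =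
      (((u ⊗ₘ p) ≫ (λ_ _).hom ≫ a) ⊗ₘ (w ≫ q)) := by
    rw [← associator_naturality_assoc, leftUnitor_tensor_hom, Category.assoc, Iso.hom_inv_id_assoc,
      ← tensorHom_id, tensorHom_comp_tensorHom, tensorHom_comp_tensorHom, Category.id_comp]
  rw [h₁, reassoc_of% hs, h₂, tensorHom_comp_tensorHom, hθ, hr, id_tensorHom_id]

lemma split_id_aux {S N G P M M' N' : C} (s : S ⊗ N ⟶ S ⊗ G) (γ : G ⟶ P ⊗ M) (θ : S ⟶ S ⊗ P)
    (r : N ⟶ M) (ε : P ⟶ 𝟙_ C) (q : M ⟶ M') (v : M' ⟶ N')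
    (hs : s ≫ S ◁ γ = (θ ⊗ₘ r) ≫ (α_ _ _ _).hom) (hθ : θ ≫ S ◁ ε ≫ (ρ_ _).hom = 𝟙 _)
    (i : N ⟶ N') (hr : r ≫ q ≫ v = i) :
    s ≫ S ◁ ((γ ≫ (ε ⊗ₘ q) ≫ (λ_ _).hom) ≫ v) = S ◁ i := by
  have h : (α_ S P M).hom ≫ S ◁ (((ε ⊗ₘ q) ≫ (λ_ _).hom) ≫ v) =
      ((S ◁ ε ≫ (ρ_ _).hom) ⊗ₘ (q ≫ v)) := by
    rw [Category.assoc, ← leftUnitor_naturality, MonoidalCategory.whiskerLeft_comp, ← id_tensorHom,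
      ← associator_naturality_assoc, id_tensorHom, MonoidalCategory.whiskerLeft_comp,
      ← associator_naturality_right_assoc, triangle]
    simp only [← id_tensorHom, ← tensorHom_id, tensorHom_comp_tensorHom,
      Category.id_comp, Category.comp_id]
  rw [Category.assoc, MonoidalCategory.whiskerLeft_comp, reassoc_of% hs, h, tensorHom_comp_tensorHom,
    hθ, hr, id_tensorHom]

lemma factorLeaf_aux {A D M N L L' P P' : C} (x : A ⟶ D) (u : D ⟶ 𝟙_ C) (a : M ⟶ N) (b : N ⟶ L')
    (r : M ⟶ L) (t : L ⟶ L') (c : L ⟶ P) (c' : L' ⟶ P') (v : P ⟶ P') (h : a ≫ b = r ≫ t)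
    (h' : t ≫ c' = c ≫ v) :
    (x ⊗ₘ a) ≫ (u ⊗ₘ b) ≫ (λ_ _).hom ≫ c' = ((x ≫ u) ⊗ₘ (r ≫ c)) ≫ (λ_ _).hom ≫ v := by
  rw [← leftUnitor_naturality, ← leftUnitor_naturality, tensorHom_comp_tensorHom_assoc, h]
  simp only [← id_tensorHom, tensorHom_comp_tensorHom_assoc, Category.comp_id, Category.assoc, h']

lemma tensListMap_singleton {V W : Unit → C} (φ : ∀ i, V i ⟶ W i) :
    tensListMap φ [()] ≫ (tensCons W () []).hom ≫ _ ◁ (tensNil _).hom ≫ (ρ_ _).hom =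
      ((tensCons V () []).hom ≫ _ ◁ (tensNil _).hom ≫ (ρ_ _).hom) ≫ φ () := by
  rw [tensListMap_cons, tensListMap_nil]
  simp only [Category.assoc, Iso.inv_hom_id_assoc, ← rightUnitor_naturality,
    MonoidalCategory.tensorHom_def, MonoidalCategory.whiskerLeft_comp, whiskerLeft_inv_hom_assoc,
    whisker_exchange_assoc]

end

namespace Preoperad

variable {k : Type u} [Field k] (X : Preoperad k) (V : Psh k) {S R T Q : RTree}

/-- The canonical isomorphism `X(R) ⊗ V(T/R) ⟶ X(R) ⊗ V(T/R)` for a tree regarded as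
the subtree above its root. -/
noncomputable def factorToRoot (h : R ⟶ T) :
    X.factor V (aboveMap h R.root) ⟶ X.factor V h :=
  X.factorInner V ⟨toAboveRoot R R.root rfl, toAboveRoot_inner R _ rfl⟩ (aboveMap h R.root) ≫
    X.factorRestrict V h (toAboveRoot T (edge h R.root) (edge_root h))

lemma factorToRoot_eq (h : R ⟶ T) :
    X.factorToRoot V h = factorHom (aboveMap h R.root) h
      ⟨toAboveRoot R R.root rfl, toAboveRoot_inner R _ rfl⟩
      (fun m => V.map (aboveMap (toAboveRoot T (edge h R.root) (edge_root h)) (edge h m.1)).op) := by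
  refine (congrArg (_ ≫ ·) (X.factorRestrict_eq (V := V) h
    (toAboveRoot T (edge h R.root) (edge_root h)))).trans ?_
  refine (factorHom_comp (X := X) (aboveMap h R.root)
    (h ≫ toAboveRoot T (edge h R.root) (edge_root h))
    h ⟨toAboveRoot R R.root rfl, toAboveRoot_inner R _ rfl⟩ (𝟙 _) _ _).trans ?_
  exact congrArg (factorHom (X := X) (aboveMap h R.root) h
    ⟨toAboveRoot R R.root rfl, toAboveRoot_inner R _ rfl⟩) (funext fun m => Category.id_comp _)

/-- Splitting along the inclusion of the root. -/
lemma split_rootHom (h : R ⟶ T)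
    (hp : (enum eta.Leaf).Perm ([()].map (fun _ => (⟨(), fun _ _ => le_rfl⟩ : eta.Leaf)))) :
    X.split V (rootHom R) h ≫ (X.unit.hom ⊗ₘ
      tensListReindex (V := fun l : eta.Leaf => X.factor V (aboveMap h (edge (rootHom R) l.1)))
        (W := fun _ : Unit => X.factor V h) (fun _ => ⟨(), fun _ _ => le_rfl⟩)
        (fun _ => X.factorToRoot V h) [()] (enum eta.Leaf) hp) ≫
      (λ_ _).hom ≫ (tensCons _ () []).hom ≫ _ ◁ (tensNil _).hom ≫ (ρ_ _).hom = 𝟙 _ := by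
  let c : (⟨R⟩ : ATree) ⟶ ⟨R.above R.root⟩ := ⟨toAboveRoot R R.root rfl, toAboveRoot_inner R _ rfl⟩
  let A : Unit → Ch k := fun _ => X.val R
  let B : (Σ _ : Unit, R.Leaf) → Ch k := fun y => V.obj (op (T.above (edge h y.2.1)))
  have h₁ : (sigmaList (fun _ : Unit => enum R.Leaf) [()]).Nodup := nodup_sigmaList_enum (by simp)
  have h₁' : ∀ x, x ∈ sigmaList (fun _ : Unit => enum R.Leaf) [()] := mem_sigmaList_enum (by simp)
  -- As `η` has only one leaf, the index pairs are just the leaves of `R`, regarded as the tree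
  -- above its root.
  let F : (Σ _ : Unit, R.Leaf) → Σ l : eta.Leaf, (R.above (edge (rootHom R) l.1)).Leaf := fun y =>
    ⟨⟨(), fun _ _ => le_rfl⟩, leafMap c.hom c.property y.2⟩
  have hF : Function.Bijective F := ((leafOfAbove_bijective (rootHom R)).of_comp_iff' F).1
    ⟨fun x y hxy => by cases x; cases y; exact congrArg (Sigma.mk ()) hxy,
      fun y => ⟨⟨(), y⟩, rfl⟩⟩
  have h₂ : (sigmaList (fun _ : Unit => enum R.Leaf) [()]).Perm ((enum R.Leaf).map (Sigma.mk ())) :=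
    perm_of_bijective ⟨sigma_mk_injective, fun y => ⟨y.2, rfl⟩⟩ h₁ (nodup_enum _) h₁' mem_enum
  have hc := tensListGather_singleton A B (fun _ => enum _) () _ rfl h₂ h₁
  have hK := tensListReindex_gather (A := fun l : eta.Leaf => X.val (R.above (edge (rootHom R) l.1)))
    (B := nestedFamily V (rootHom R) h) (A' := A) (B' := B)
    (fun _ : Unit => (⟨(), fun _ _ => le_rfl⟩ : eta.Leaf)) (fun _ => X.X.map c.op)
    (fun _ => leafMap c.hom c.property)
    (fun _ m => V.map (aboveMap (toAboveRoot T (edge h R.root) (edge_root h)) (edge h m.1)).op)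
    (fun _ => enum _) (fun _ => enum _)
    (fun _ => perm_enum_map (leafMap_bijective c.hom c.property)) [()] (enum eta.Leaf) hp _ _ rfl rfl
    (nodup_sigmaList_enum (nodup_enum _))
    (perm_of_bijective hF (nodup_sigmaList_enum (nodup_enum _)) h₁ (mem_sigmaList_enum mem_enum) h₁')
  have hθ := X.theta_rootHom R hp
  refine split_rootHom_aux _ _ _ _ _ _ _ _ _ _ _ _ (X.split_gather V (rootHom R) h) hc
    (Eq.trans ?_ hK) (Eq.trans ?_ hθ) ?_
  · exact congrArg (fun φ => tensListReindex (V := fun l : eta.Leaf => X.factor V (aboveMap h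
      (edge (rootHom R) l.1))) (W := fun _ : Unit => X.factor V h)
      (fun _ => (⟨(), fun _ _ => le_rfl⟩ : eta.Leaf)) φ _ _ _ ≫ _)
      (funext fun x => X.factorToRoot_eq V h)
  · rfl
  · have hp₁ : (enum R.Leaf).Perm ((enum R.Leaf).map fun x => leafOfAbove (rootHom R) (F ⟨(), x⟩)) :=
      perm_enum_map Function.bijective_id
    refine (congrArg (_ ≫ ·) (tensListReindex_comp _ _ (Sigma.mk ()) _ _ _ _ _ h₂
      (nodup_sigmaList_enum (nodup_enum _)) (perm_of_bijective (f := fun x => F ⟨(), x⟩)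
        (hF.comp ⟨sigma_mk_injective, fun y => ⟨y.2, rfl⟩⟩)
        (nodup_sigmaList_enum (nodup_enum _)) (nodup_enum _) (mem_sigmaList_enum mem_enum)
          mem_enum))).trans ?_
    refine (tensListReindex_comp (leafOfAbove (rootHom R)) _ (fun x => F ⟨(), x⟩) _ _ _ _ _ _
      (nodup_enum _) hp₁).trans (Eq.trans ?_ (tensListReindex_id _ _
        (perm_enum_map Function.bijective_id)))
    refine congrArg (fun φ => tensListReindex (V := fun r : R.Leaf => V.obj (op
      (T.above (edge h r.1)))) (W := fun r : R.Leaf => V.obj (op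
      (T.above (edge h r.1)))) (fun x => x) φ _ _ hp₁) (funext fun x => ?_)
    refine (congrArg (_ ≫ ·) (Category.comp_id (V.map _))).trans ?_
    exact ((V.map_comp _ _).symm.trans (V.map_id _))

/-- The canonical isomorphism `X(η) ⊗ V(T/η) ⟶ V(T)`, for any presentation of the inclusion of
the root. -/
noncomputable def factorEta (f : eta ⟶ T) : X.factor V f ⟶ V.obj (op T) :=
  (X.unit.hom ⊗ₘ tensListReindex (V := fun l : eta.Leaf => V.obj (op (T.above (edge f l.1))))
      (W := fun _ : Unit => V.obj (op T)) (fun _ => ⟨(), fun _ _ => le_rfl⟩)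
      (fun _ => V.map (toAboveRoot T _ (edge_root f)).op) [()] (enum eta.Leaf)
      (perm_enum (by simp) (fun _ => List.mem_singleton.2 rfl))) ≫
    (λ_ _).hom ≫ (tensCons (fun _ : Unit => V.obj (op T)) () []).hom ≫ _ ◁ (tensNil _).hom ≫ (ρ_ _).hom

lemma factorEta_rootHom : X.factorEta V (rootHom T) = X.factorRoot V T := by
  unfold factorEta factorRoot
  have : (_ : V.obj (op T) ⊗ 𝟙_ (Ch k) ⟶ _) = (ρ_ (V.obj (op T))).hom :=
    (congrArg (· ≫ _) (MonoidalCategory.whiskerLeft_id _ _)).trans (Category.id_comp _)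
  exact congrArg (fun x => _ ≫ (λ_ _).hom ≫ x) ((Category.id_comp _).trans this)

/-- The inclusion of the root into the subtree above a leaf. -/
def rootLeaf (l : S.Leaf) : (⟨eta⟩ : ATree) ⟶ ⟨S.above (edge (𝟙 S) l.1)⟩ :=
  ⟨rootHom _, fun _ _ y _ => l.2 y.2⟩

/-- The canonical isomorphism `X(Sₗ) ⊗ V(Tₗ/Sₗ) ⟶ V(Tₗ)` for a leaf `l`. -/
noncomputable def factorLeaf (f : S ⟶ T) (l : S.Leaf) :
    X.factor V (aboveMap f (edge (𝟙 S) l.1)) ⟶ V.obj (op (T.above (edge f l.1))) :=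
  X.factorInner V (rootLeaf l) (aboveMap f (edge (𝟙 S) l.1)) ≫
    X.factorEta V ((rootLeaf l).hom ≫ aboveMap f (edge (𝟙 S) l.1))

/-- The root of the subtree above a leaf. -/
def leafRoot (l : S.Leaf) : (S.above (edge (𝟙 S) l.1)).Leaf :=
  leafMap (rootLeaf l).hom (rootLeaf l).property ⟨(), fun _ _ => le_rfl⟩

lemma perm_leafRoot (l : S.Leaf) : (enum (S.above (edge (𝟙 S) l.1)).Leaf).Perm
    ([()].map (fun _ => leafRoot l)) :=
  (perm_enum_map (leafMap_bijective (rootLeaf l).hom (rootLeaf l).property)).trans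
    ((perm_enum (l := [⟨(), fun _ _ => le_rfl⟩]) (by simp) (fun _ => List.mem_singleton.2 rfl)).map _)

lemma factorLeaf_eq (f : S ⟶ T) (l : S.Leaf) : X.factorLeaf V f l =
    ((X.X.map (rootLeaf l).op ≫ X.unit.hom) ⊗ₘ tensListReindex
      (V := fun j => nestedFamily V (𝟙 S) f ⟨l, j⟩)
      (W := fun _ : Unit => nestedFamily V (𝟙 S) f ⟨l, leafRoot l⟩) (fun _ => leafRoot l) (fun _ => 𝟙 _)
      [()] _ (perm_leafRoot l) ≫
      (tensCons (fun _ : Unit => nestedFamily V (𝟙 S) f ⟨l, leafRoot l⟩) () []).hom ≫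
        _ ◁ (tensNil _).hom ≫ (ρ_ _).hom) ≫ (λ_ _).hom ≫
      V.map (toAboveRoot _ _ (edge_root ((rootLeaf l).hom ≫ aboveMap f (edge (𝟙 S) l.1)))).op := by
  let v : nestedFamily V (𝟙 S) f ⟨l, leafRoot l⟩ ⟶ V.obj (op (T.above (edge f l.1))) :=
    V.map (toAboveRoot _ _ (edge_root ((rootLeaf l).hom ≫ aboveMap f (edge (𝟙 S) l.1)))).op
  refine factorLeaf_aux (X.X.map (rootLeaf l).op) X.unit.hom _ _ _
    (tensListMap (fun _ : Unit => v) [()]) _ _ v ?_ (tensListMap_singleton fun _ : Unit => v)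
  refine (tensListReindex_comp _ _ _ _ _ _ _ _ _ (nodup_enum _) (perm_leafRoot l)).trans
    (Eq.trans ?_ (tensListReindex_map _ _ _ _ _ (perm_leafRoot l) (nodup_enum _)).symm)
  rfl

/-- Splitting along the identity. -/
lemma split_id (f : S ⟶ T) :
    X.split V (𝟙 S) f ≫ X.val S ◁ tensListMap (fun l : S.Leaf => X.factorLeaf V f l) (enum S.Leaf) =
      𝟙 _ := by
  let B := nestedFamily V (𝟙 S) f
  let v : ∀ l : S.Leaf, B ⟨l, leafRoot l⟩ ⟶ V.obj (op (T.above (edge f l.1))) := fun l =>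
    V.map (toAboveRoot _ _ (edge_root ((rootLeaf l).hom ≫ aboveMap f (edge (𝟙 S) l.1)))).op
  -- Above a leaf there is only the leaf itself, so every inner list is a singleton and gathering
  -- reduces to `tensListGather_collapse`.
  have hL : ∀ l : S.Leaf, enum (S.above (edge (𝟙 S) l.1)).Leaf = [leafRoot l] := fun l =>
    List.perm_singleton.1 (perm_leafRoot l)
  have hF : Function.Bijective (fun l : S.Leaf =>
      (⟨l, leafRoot l⟩ : Σ l : S.Leaf, (S.above (edge (𝟙 S) l.1)).Leaf)) :=
    ((leafOfAbove_bijective (𝟙 S)).of_comp_iff' _).1 Function.bijective_id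
  have hp : (sigmaList (fun l : S.Leaf => enum (S.above (edge (𝟙 S) l.1)).Leaf) (enum S.Leaf)).Perm
      ((enum S.Leaf).map fun l => ⟨l, leafRoot l⟩) :=
    perm_of_bijective hF (nodup_sigmaList_enum (nodup_enum _)) (nodup_enum _)
      (mem_sigmaList_enum mem_enum) mem_enum
  have hg := tensListGather_collapse (A := fun l : S.Leaf => X.val (S.above (edge (𝟙 S) l.1)))
    (fun l => X.X.map (rootLeaf l).op ≫ X.unit.hom) B
    (fun _ => enum _) leafRoot hL (enum S.Leaf) _ rfl hp perm_leafRoot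
  have hm : tensListMap (fun l : S.Leaf => X.factorLeaf V f l) (enum S.Leaf) = _ ≫ _ :=
    (congrArg (fun φ => tensListMap φ (enum S.Leaf)) (funext fun l => (X.factorLeaf_eq V f l).trans
      (Category.assoc _ _ _).symm)).trans
      ((tensListMap_comp _ v _).trans (congrArg (· ≫ _) hg.symm))
  rw [hm]
  refine (split_id_aux _ _ _ _ _ _ _ (X.split_gather V (𝟙 S) f) (X.theta_id S rootLeaf) (𝟙 _) ?_).trans
    (MonoidalCategory.whiskerLeft_id _ _)
  have hp₁ : (enum S.Leaf).Perm ((enum S.Leaf).map fun l => leafOfAbove (𝟙 S) ⟨l, leafRoot l⟩) :=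
    perm_enum_map Function.bijective_id
  refine (congrArg (_ ≫ ·) (tensListReindex_map _ _ v _ _ hp
    (nodup_sigmaList_enum (nodup_enum _)))).trans ?_
  refine (tensListReindex_comp _ _ _ _ _ _ _ _ _ (nodup_enum _) hp₁).trans (Eq.trans ?_
    (tensListReindex_id _ _ (perm_enum_map Function.bijective_id)))
  refine congrArg (fun φ => tensListReindex (V := fun r : S.Leaf => V.obj (op
    (T.above (edge f r.1)))) (W := fun r : S.Leaf => V.obj (op
    (T.above (edge f r.1)))) (fun x => x) φ _ _ hp₁) (funext fun x => ?_)
  refine (congrArg (_ ≫ ·) (Category.id_comp (V.map _))).trans ?_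
  exact ((V.map_comp _ _).symm.trans (V.map_id _))

end Preoperad

end Koszul

/-! ### Prunings, and invariant families as a finite biproduct -/

namespace Koszul

open MonoidalCategory RTree

namespace RTree

/-- The sets of edges at which a tree can be pruned. -/
def Cut (T : RTree) : Type :=
  {s : Set T.Edge // (∀ a ∈ s, ∀ b ∈ s, a ≤ b → a = b) ∧ ∀ t, IsMax t → ∃ e ∈ s, e ≤ t}

instance (T : RTree) : Finite T.Cut := inferInstanceAs (Finite (Subtype _))

/-- The inclusion of a pruning. -/
def incl {T : RTree} (s : T.Cut) : T.cut s.1 ⟶ T where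
  toFun x := x.1
  le_iff := Iff.rfl
  map_root := rfl
  cover t ht := by
    obtain ⟨e, he, h⟩ := s.2.2 t ht
    exact ⟨⟨e, fun a ha hlt => hlt.ne (s.2.1 a ha e he hlt.le)⟩, fun y hy =>
      (eq_of_le_of_not_lt hy (y.2 e he)).ge, h⟩

/-- The edges to which a morphism sends the leaves. -/
def leafCut {S T : RTree} (f : S ⟶ T) : T.Cut :=
  ⟨{e | ∃ b ∈ enum S.Leaf, edge f b.1 = e}, by
    rintro _ ⟨a, _, rfl⟩ _ ⟨b, _, rfl⟩ h
    rw [leaf_eq_of_le f h le_rfl], fun t ht => by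
    obtain ⟨l, hl, h⟩ := Hom.cover f t ht
    exact ⟨_, ⟨⟨l, hl⟩, mem_enum _, rfl⟩, h⟩⟩

/-- A morphism as a morphism in `𝒜` to a pruning. -/
def toLeafCut {S T : RTree} (f : S ⟶ T) : (⟨S⟩ : ATree) ⟶ ⟨T.cut (leafCut f).1⟩ :=
  ⟨toCut f, toCut_inner f⟩

lemma toLeafCut_incl {S T : RTree} (f : S ⟶ T) : (toLeafCut f).hom ≫ incl (leafCut f) = f := rfl

/-- Uniqueness of the factorisation into a morphism of `𝒜` and a pruning. The leaves of the pruning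
at `s` are the edges in `s`, and a morphism of `𝒜` is a bijection on leaves. -/
lemma leafCut_comp_incl {S T : RTree} (s : T.Cut) (d : (⟨S⟩ : ATree) ⟶ ⟨T.cut s.1⟩) :
    leafCut (d.hom ≫ incl s) = s := by
  apply Subtype.ext
  ext e
  constructor
  · rintro ⟨b, _, rfl⟩
    have hm := d.property b.1 b.2
    obtain ⟨t, ht, hbt⟩ := exists_leaf (edge d.hom b.1).1
    obtain ⟨e, he, het⟩ := s.2.2 t ht
    -- Both edges lie below `t`, hence are comparable, and an edge of the pruning cannot lie
    -- strictly above `e`.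
    have hle : (edge d.hom b.1).1 ≤ e := by
      rcases T.chain hbt het with h | h
      · exact h
      · exact (eq_of_le_of_not_lt h ((edge d.hom b.1).2 e he)).ge
    let e' : (T.cut s.1).Edge := ⟨e, fun a ha hlt => hlt.ne (s.2.1 a ha e he hlt.le)⟩
    have h : edge d.hom b.1 = e' := le_antisymm hle (hm (b := e') hle)
    change (edge d.hom b.1).1 ∈ s.1
    rw [h]
    exact he
  · intro he
    let e' : (T.cut s.1).Leaf := ⟨⟨e, fun a ha hlt => hlt.ne (s.2.1 a ha e he hlt.le)⟩, fun y hy =>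
      (eq_of_le_of_not_lt hy (y.2 e he)).ge⟩
    obtain ⟨b, hb⟩ := (leafMap_bijective d.hom d.property).2 e'
    exact ⟨b, mem_enum _, congrArg (fun x => x.1.1) hb⟩

lemma incl_hom_injective {S T : RTree} (s : T.Cut) {c d : S ⟶ T.cut s.1}
    (h : c ≫ incl s = d ≫ incl s) : c = d :=
  Hom.ext (funext fun x => Subtype.ext (congrFun (congrArg Hom.toFun h) x))

/-- A morphism whose image consists of the edges of a pruning identifies its source with that
pruning. Only one direction of this isomorphism is needed. -/
lemma exists_inner {P U : RTree} (p : P ⟶ U) (q : U.Cut)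
    (h : ∀ x, (∃ y, edge p y = x) ↔ ∀ e ∈ q.1, ¬ e < x) :
    ∃ c : (⟨U.cut q.1⟩ : ATree) ⟶ ⟨P⟩, c.hom ≫ p = incl q := by
  choose φ hφ using fun x : (U.cut q.1).Edge => (h x.1).2 x.2
  have hle : ∀ {a b}, φ a ≤ φ b ↔ a ≤ b := fun {a b} => by
    rw [← edge_le_iff p, hφ, hφ]
    rfl
  have hs : ∀ y, ∃ x, φ x = y := fun y =>
    ⟨⟨edge p y, (h _).1 ⟨y, rfl⟩⟩, edge_injective p (hφ _)⟩
  have hm : ∀ x, IsMax x ↔ IsMax (φ x) := fun x => by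
    constructor
    · intro hx y hy
      obtain ⟨z, rfl⟩ := hs y
      exact hle.2 (hx (hle.1 hy))
    · intro hx y hy
      exact hle.1 (hx (hle.2 hy))
  refine ⟨⟨⟨φ, hle, ?_, fun t ht => ?_⟩, fun x hx => (hm x).1 hx⟩, Hom.ext (funext hφ)⟩
  · exact edge_injective p ((hφ _).trans (edge_root p).symm)
  · obtain ⟨x, rfl⟩ := hs t
    exact ⟨x, (hm x).2 ht, le_rfl⟩

end RTree

namespace Preoperad

variable {k : Type u} [Field k] (X : Preoperad k) {V W : Psh k} {S S' S'' R T T' T'' Q : RTree}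

variable (V) in
lemma factorInner_comp (c : (⟨S⟩ : ATree) ⟶ ⟨S'⟩) (c' : (⟨S''⟩ : ATree) ⟶ ⟨S⟩) (f : S' ⟶ T) :
    X.factorInner V c f ≫ X.factorInner V c' (c.hom ≫ f) = X.factorInner V (c' ≫ c) f := by
  refine (factorHom_comp _ _ _ _ _ _ _).trans ?_
  exact congrArg (factorHom (X := X) f (c'.hom ≫ c.hom ≫ f) (c' ≫ c))
    (funext fun m => Category.comp_id _)

variable (V) in
lemma factorInner_id (f : S ⟶ T) : X.factorInner V (𝟙 _) f = 𝟙 _ := factorHom_id f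

variable (V) in
lemma factorInner_restrict (c : (⟨S⟩ : ATree) ⟶ ⟨S'⟩) (f : S' ⟶ T) (g : T ⟶ T') :
    X.factorInner V c (f ≫ g) ≫ X.factorRestrict V (c.hom ≫ f) g =
      X.factorRestrict V f g ≫ X.factorInner V c f := by
  refine (congrArg (_ ≫ ·) (X.factorRestrict_eq _ _)).trans
    (Eq.trans ?_ (congrArg (· ≫ _) (X.factorRestrict_eq _ _)).symm)
  refine (factorHom_comp (X := X) (f ≫ g) ((c.hom ≫ f) ≫ g) (c.hom ≫ f) c (𝟙 _) _ _).trans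
    (Eq.trans ?_ (factorHom_comp (X := X) (f ≫ g) f (c.hom ≫ f) (𝟙 _) c _ _).symm)
  refine (congrArg (factorHom (X := X) (f ≫ g) (c.hom ≫ f) c) (funext fun m => ?_))
  exact (Category.id_comp (V.map _)).trans (Category.comp_id (V.map _)).symm

lemma factorInner_map (φ : V ⟶ W) (c : (⟨S⟩ : ATree) ⟶ ⟨S'⟩) (f : S' ⟶ T) :
    X.factorInner V c f ≫ X.factorMap φ (c.hom ≫ f) =
      X.factorMap φ f ≫ X.factorInner W c f := by
  refine (congrArg (_ ≫ ·) (X.factorMap_eq _ _)).trans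
    (Eq.trans ?_ (congrArg (· ≫ _) (X.factorMap_eq _ _)).symm)
  refine (factorHom_comp (X := X) f (c.hom ≫ f) (c.hom ≫ f) c (𝟙 _) _ _).trans
    (Eq.trans ?_ (factorHom_comp (X := X) f f (c.hom ≫ f) (𝟙 _) c _ _).symm)
  refine (congrArg (factorHom (X := X) f (c.hom ≫ f) c) (funext fun m => ?_))
  exact (Category.id_comp (φ.app _)).trans (Category.comp_id (φ.app _)).symm

variable (V) in
lemma factorRestrict_id (f : S ⟶ T) : X.factorRestrict V f (𝟙 T) = 𝟙 _ := by
  refine Eq.trans ?_ (MonoidalCategory.whiskerLeft_id _ _)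
  refine congrArg (X.val S ◁ ·) (Eq.trans ?_ (tensListMap_id _ (enum S.Leaf)))
  exact congrArg (fun φ => tensListMap φ (enum S.Leaf)) (funext fun l => V.map_id _)

variable (V) in
lemma factorRestrict_comp (f : S ⟶ T) (g : T ⟶ T') (g' : T' ⟶ T'') :
    X.factorRestrict V (f ≫ g) g' ≫ X.factorRestrict V f g = X.factorRestrict V f (g ≫ g') := by
  refine (MonoidalCategory.whiskerLeft_comp _ _ _).symm.trans ?_
  refine congrArg (X.val S ◁ ·) ((tensListMap_comp _ _ (enum S.Leaf)).symm.trans ?_)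
  exact congrArg (fun φ => tensListMap φ (enum S.Leaf)) (funext fun l => (V.map_comp _ _).symm)

lemma factorRestrict_map (φ : V ⟶ W) (f : S ⟶ T) (g : T ⟶ T') :
    X.factorRestrict V f g ≫ X.factorMap φ f = X.factorMap φ (f ≫ g) ≫ X.factorRestrict W f g := by
  refine (MonoidalCategory.whiskerLeft_comp _ _ _).symm.trans
    (Eq.trans ?_ (MonoidalCategory.whiskerLeft_comp _ _ _))
  refine congrArg (X.val S ◁ ·) ((tensListMap_comp _ _ (enum S.Leaf)).symm.trans
    (Eq.trans ?_ (tensListMap_comp _ _ (enum S.Leaf))))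
  exact congrArg (fun φ => tensListMap φ (enum S.Leaf)) (funext fun l => φ.naturality _)

variable (V)

/-- The complex `H(V)(T)`: the biproduct, over all prunings `S` of `T`, of the complexes
`X(S) ⊗ V(T/S)`. -/
noncomputable def familyObj (T : RTree) : Ch k := ⨁ fun s : T.Cut => X.factor V (incl s)

/-- The projections of `H(V)(T)`. -/
noncomputable def proj (f : S ⟶ T) : X.familyObj V T ⟶ X.factor V f :=
  biproduct.π (fun s : T.Cut => X.factor V (incl s)) (leafCut f) ≫
    X.factorInner V (toLeafCut f) (incl (leafCut f))

/-- Prunings of a given morphism are equal only propositionally. Once they are identified, the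
morphisms into them agree because the inclusion is a monomorphism. -/
lemma π_factorInner_congr {s s' : T.Cut} (h : s = s') {d : (⟨S⟩ : ATree) ⟶ ⟨T.cut s.1⟩}
    {d' : (⟨S⟩ : ATree) ⟶ ⟨T.cut s'.1⟩} (e : d.hom ≫ incl s = d'.hom ≫ incl s') :
    biproduct.π (fun s : T.Cut => X.factor V (incl s)) s ≫ X.factorInner V d (incl s) =
      biproduct.π (fun s : T.Cut => X.factor V (incl s)) s' ≫ X.factorInner V d' (incl s') ≫
        eqToHom (by rw [e]) := by
  subst h
  obtain rfl : d = d' := by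
    ext1
    exact incl_hom_injective s e
  rw [eqToHom_refl, Category.comp_id]

lemma proj_comp_incl (s : T.Cut) (d : (⟨S⟩ : ATree) ⟶ ⟨T.cut s.1⟩) :
    X.proj V (d.hom ≫ incl s) =
      biproduct.π (fun s : T.Cut => X.factor V (incl s)) s ≫ X.factorInner V d (incl s) := by
  have h := X.π_factorInner_congr V (leafCut_comp_incl s d) (d := toLeafCut (d.hom ≫ incl s)) (d' := d)
    (toLeafCut_incl _)
  refine h.trans ?_
  refine congrArg (_ ≫ ·) ((congrArg (_ ≫ ·) (eqToHom_refl _ _)).trans (Category.comp_id _))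

lemma proj_incl (s : T.Cut) :
    X.proj V (incl s) = biproduct.π (fun s : T.Cut => X.factor V (incl s)) s := by
  refine (X.proj_comp_incl V s (𝟙 _)).trans ?_
  rw [factorInner_id]
  exact Category.comp_id _

/-- Invariance holds because precomposition with a morphism of `𝒜` does not change the pruning at
which the component is taken. -/
lemma proj_inner (c : (⟨S⟩ : ATree) ⟶ ⟨S'⟩) (f : S' ⟶ T) :
    X.proj V f ≫ X.factorInner V c f = X.proj V (c.hom ≫ f) := by
  refine Eq.trans ?_ (X.proj_comp_incl V (leafCut f) (c ≫ toLeafCut f)).symm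
  exact (Category.assoc _ _ _).trans (congrArg (_ ≫ ·) (X.factorInner_comp V _ _ _))

variable {V}

/-- The projections at inclusions of prunings are those of the biproduct, so they already suffice.
-/
lemma familyObj_hom_ext {Z : Ch k} {a b : Z ⟶ X.familyObj V T}
    (h : ∀ {S : RTree} (f : S ⟶ T), a ≫ X.proj V f = b ≫ X.proj V f) : a = b :=
  biproduct.hom_ext _ _ fun s => by
    have := h (incl s)
    rwa [proj_incl] at this

/-- A map to `H(V)(T)` given by an invariant family. -/
lemma exists_familyLift {Z : Ch k} (p : ∀ {S : RTree} (f : S ⟶ T), Z ⟶ X.factor V f)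
    (hp : ∀ {S S' : RTree} (c : (⟨S⟩ : ATree) ⟶ ⟨S'⟩) (f : S' ⟶ T),
      p f ≫ X.factorInner V c f = p (c.hom ≫ f)) :
    ∃ q : Z ⟶ X.familyObj V T, ∀ {S : RTree} (f : S ⟶ T), q ≫ X.proj V f = p f := by
  refine ⟨biproduct.lift fun s => p (incl s), fun f => ?_⟩
  refine (Category.assoc _ _ _).symm.trans ((congrArg (· ≫ _) (biproduct.lift_π _ _)).trans ?_)
  exact hp _ _

end Preoperad

end Koszul

/-! ### Unions of prunings over a forest, and the functor `H` -/

namespace Koszul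

open MonoidalCategory RTree

lemma comp_square_aux {C : Type*} [Category C] {A B D E F G : C} {a : A ⟶ B} {b : B ⟶ D} {p : D ⟶ E}
    {q : B ⟶ F} {m : F ⟶ E} {q' : A ⟶ G} {m' : G ⟶ F} (hb : b ≫ p = q ≫ m) (ha : a ≫ q = q' ≫ m') :
    (a ≫ b) ≫ p = q' ≫ m' ≫ m := by
  rw [Category.assoc, hb, reassoc_of% ha]

namespace RTree

section

variable {I : Type} {U : I → RTree} {T : RTree} (ι : ∀ i, (U i).Edge → T.Edge)

/-- Conditions for the trees `U i` to be the subtrees of `T` above the edges of a pruning. -/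
structure IsForest : Prop where
  le_iff : ∀ i {a b}, ι i a ≤ ι i b ↔ a ≤ b
  range : ∀ i y, (∃ x, ι i x = y) ↔ ι i (U i).root ≤ y
  disjoint : ∀ i j y, ι i (U i).root ≤ y → ι j (U j).root ≤ y → i = j
  cover : ∀ t, IsMax t → ∃ i, ι i (U i).root ≤ t

variable {ι} (h : IsForest ι) (q : ∀ i, (U i).Cut)

include h in
lemma IsForest.root_le (i : I) (x : (U i).Edge) : ι i (U i).root ≤ ι i x :=
  (h.le_iff i).2 ((U i).root_le x)

/-- The union of prunings of the trees of a forest. -/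
def IsForest.union : T.Cut :=
  ⟨{e | ∃ i, ∃ y ∈ (q i).1, ι i y = e}, by
    rintro _ ⟨i, a, ha, rfl⟩ _ ⟨j, b, hb, rfl⟩ hab
    obtain rfl := h.disjoint i j _ ((h.root_le i a).trans hab) (h.root_le j b)
    rw [(q i).2.1 a ha b hb ((h.le_iff i).1 hab)], fun t ht => by
    obtain ⟨i, hi⟩ := h.cover t ht
    obtain ⟨x, rfl⟩ := (h.range i t).2 hi
    obtain ⟨e, he, hex⟩ := (q i).2.2 x fun y hy => (h.le_iff i).1 (ht ((h.le_iff i).2 hy))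
    exact ⟨_, ⟨i, e, he, rfl⟩, (h.le_iff i).2 hex⟩⟩

/-- The trees of a forest are disjoint and closed upwards, so edges chosen in the other trees never
lie below an edge of `U i`. The union of prunings therefore restricts to the given pruning on each
tree. -/
lemma IsForest.not_lt_iff (i : I) (x : (U i).Edge) :
    (∀ e ∈ (h.union q).1, ¬ e < ι i x) ↔ ∀ e ∈ (q i).1, ¬ e < x := by
  have hlt : ∀ {a b}, ι i a < ι i b ↔ a < b := fun {a b} => by
    rw [lt_iff_le_not_ge, lt_iff_le_not_ge, h.le_iff, h.le_iff]
  constructor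
  · intro hx e he hlt'
    exact hx _ ⟨i, e, he, rfl⟩ (hlt.2 hlt')
  · rintro hx _ ⟨j, e, he, rfl⟩ hlt'
    obtain rfl := h.disjoint j i _ ((h.root_le j e).trans hlt'.le) (h.root_le i x)
    exact hx e he (hlt.1 hlt')

lemma IsForest.not_lt_root (i : I) (e : T.Edge) (he : e ∈ (h.union q).1) :
    ¬ e < ι i (U i).root :=
  (h.not_lt_iff q i _).2 (fun _ _ hlt => (hlt.trans_le ((U i).root_le _)).false) e he

end

variable {S R T : RTree}

lemma isForest_above (f : S ⟶ T) :
    IsForest (U := fun l : S.Leaf => T.above (edge f l.1)) (fun _ x => x.1) where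
  le_iff _ _ _ := Iff.rfl
  range _ y := ⟨by rintro ⟨x, rfl⟩; exact x.2, fun hy => ⟨⟨y, hy⟩, rfl⟩⟩
  disjoint _ _ _ h h' := leaf_eq_of_le f h h'
  cover t ht := by
    obtain ⟨l, hl, h⟩ := Hom.cover f t ht
    exact ⟨⟨l, hl⟩, h⟩

/-- The same forest as the one above the leaves of `R`, but with its trees written as subtrees of
subtrees, which is the form in which they occur in the iterated comultiplication. -/
lemma isForest_aboveAbove (f : S ⟶ R) (g : R ⟶ T) :
    IsForest (U := fun x : (Σ l : S.Leaf, (R.above (edge f l.1)).Leaf) =>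
      (T.above (edge (f ≫ g) x.1.1)).above (edge (aboveMap g (edge f x.1.1)) x.2.1))
      (fun _ x => x.1.1) where
  le_iff _ _ _ := Iff.rfl
  range x y := ⟨by rintro ⟨z, rfl⟩; exact z.2, fun hy => ⟨⟨⟨y, le_trans (Subtype.property _) hy⟩, hy⟩, rfl⟩⟩
  disjoint _ _ _ h h' := (leafOfAbove_bijective f).1 (leaf_eq_of_le g h h')
  cover t ht := by
    obtain ⟨l, hl, h⟩ := Hom.cover g t ht
    obtain ⟨x, hx⟩ := (leafOfAbove_bijective f).2 ⟨l, hl⟩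
    have hx' : x.2.1.1 = l := congrArg Subtype.val hx
    refine ⟨x, ?_⟩
    change edge g x.2.1.1 ≤ t
    rwa [hx']

/-- A morphism as a morphism to a larger pruning. -/
def liftCut (f : S ⟶ T) (s : T.Cut) (hs : ∀ l : S.Leaf, ∀ e ∈ s.1, ¬ e < edge f l.1) :
    S ⟶ T.cut s.1 where
  toFun x := ⟨edge f x, fun e he h => by
    obtain ⟨l, hl, hx⟩ := exists_leaf x
    exact hs ⟨l, hl⟩ e he (h.trans_le ((edge_le_iff f).2 hx))⟩
  le_iff := edge_le_iff f
  map_root := Subtype.ext (edge_root f)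
  cover t ht := by
    obtain ⟨m, hm, htm⟩ := exists_leaf t.1
    obtain ⟨l, hl, hlm⟩ := Hom.cover f m hm
    refine ⟨l, hl, ?_⟩
    rcases T.chain hlm htm with h | h
    · exact h
    · exact ht (b := ⟨edge f l, hs ⟨l, hl⟩⟩) h

/-- A factorisation `S ⟶ R ⟶ T` and the tuple of its restrictions above the leaves of `S` determine
the same pruning of `T`. This is what makes the components of the comultiplication match the
factorisations in its defining formula. -/
lemma leafCut_comp (f : S ⟶ R) (g : R ⟶ T) :
    leafCut g = (isForest_above (f ≫ g)).union fun l => leafCut (aboveMap g (edge f l.1)) := by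
  apply Subtype.ext
  ext e
  constructor
  · rintro ⟨b, _, rfl⟩
    obtain ⟨x, rfl⟩ := (leafOfAbove_bijective f).2 b
    exact ⟨x.1, _, ⟨x.2, mem_enum _, rfl⟩, rfl⟩
  · rintro ⟨l, _, ⟨b, _, rfl⟩, rfl⟩
    exact ⟨leafOfAbove f ⟨l, b⟩, mem_enum _, rfl⟩

lemma range_aboveMap_incl (s : T.Cut) (x : (T.cut s.1).Edge) (y : (T.above x.1).Edge) :
    (∃ z, edge (aboveMap (incl s) x) z = y) ↔ ∀ e ∈ s.1, ¬ e < y.1 := by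
  constructor
  · rintro ⟨z, rfl⟩
    exact z.1.2
  · intro hy
    exact ⟨⟨⟨y.1, hy⟩, y.2⟩, rfl⟩

end RTree

namespace Preoperad

variable {k : Type u} [Field k] (X : Preoperad k) {V W : Psh k} {S S' S'' R T T' T'' Q : RTree}

lemma exists_familyRestrict (g : T ⟶ T') : ∃ q : X.familyObj V T' ⟶ X.familyObj V T,
    ∀ {S : RTree} (f : S ⟶ T), q ≫ X.proj V f = X.proj V (f ≫ g) ≫ X.factorRestrict V f g :=
  X.exists_familyLift (fun f => X.proj V (f ≫ g) ≫ X.factorRestrict V f g) fun c f => by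
    refine (Category.assoc _ _ _).trans ((congrArg (_ ≫ ·) (X.factorInner_restrict V c f g).symm).trans
      ((Category.assoc _ _ _).symm.trans (congrArg (· ≫ _) ?_)))
    exact X.proj_inner V c (f ≫ g)

lemma exists_familyMap (φ : V ⟶ W) (T : RTree) : ∃ q : X.familyObj V T ⟶ X.familyObj W T,
    ∀ {S : RTree} (f : S ⟶ T), q ≫ X.proj W f = X.proj V f ≫ X.factorMap φ f :=
  X.exists_familyLift (fun f => X.proj V f ≫ X.factorMap φ f) fun c f => by
    rw [Category.assoc, ← factorInner_map, ← Category.assoc, proj_inner]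

variable (V) in
/-- The presheaf `H(V)`. -/
noncomputable def familyPsh : Psh k where
  obj T := X.familyObj V T.unop
  map g := (X.exists_familyRestrict g.unop).choose
  map_id T := X.familyObj_hom_ext fun f => by
    rw [(X.exists_familyRestrict (𝟙 T).unop).choose_spec]
    exact (congrArg (_ ≫ ·) (X.factorRestrict_id V f)).trans ((Category.comp_id _).trans
      (Category.id_comp _).symm)
  map_comp g g' := X.familyObj_hom_ext fun f => by
    rw [(X.exists_familyRestrict (g ≫ g').unop).choose_spec, Category.assoc,
      (X.exists_familyRestrict g'.unop).choose_spec, ← Category.assoc]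
    refine Eq.trans ?_ (congrArg (· ≫ _)
      ((X.exists_familyRestrict g.unop).choose_spec (f ≫ g'.unop)).symm)
    rw [Category.assoc]
    exact congrArg (_ ≫ ·) (X.factorRestrict_comp V f g'.unop g.unop).symm

lemma familyPsh_map_proj (f : S ⟶ T) (g : T ⟶ T') :
    (X.familyPsh V).map g.op ≫ X.proj V f = X.proj V (f ≫ g) ≫ X.factorRestrict V f g :=
  (X.exists_familyRestrict g).choose_spec f

/-- The functor `H`. -/
noncomputable def familyFunctor : Psh k ⥤ Psh k where
  obj V := X.familyPsh V
  map φ :=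
    { app := fun T => (X.exists_familyMap φ T.unop).choose
      naturality := fun T T' g => X.familyObj_hom_ext fun f => by
        refine (comp_square_aux ((X.exists_familyMap φ T'.unop).choose_spec f)
          (X.familyPsh_map_proj f g.unop)).trans (Eq.trans ?_
            (comp_square_aux (X.familyPsh_map_proj f g.unop)
              ((X.exists_familyMap φ T.unop).choose_spec (f ≫ g.unop))).symm)
        exact congrArg (_ ≫ ·) (X.factorRestrict_map φ f g.unop) }
  map_id V := by
    ext1
    funext T
    refine X.familyObj_hom_ext fun f => ?_
    refine ((X.exists_familyMap (𝟙 V) T.unop).choose_spec f).trans ?_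
    rw [Prealgebra.factorMap_id]
    exact (Category.comp_id _).trans (Category.id_comp _).symm
  map_comp φ ψ := by
    ext1
    funext T
    refine X.familyObj_hom_ext fun f => ?_
    refine ((X.exists_familyMap (φ ≫ ψ) T.unop).choose_spec f).trans (Eq.trans ?_
      (comp_square_aux ((X.exists_familyMap ψ T.unop).choose_spec f)
        ((X.exists_familyMap φ T.unop).choose_spec f)).symm)
    exact congrArg (_ ≫ ·) (Prealgebra.factorMap_comp φ ψ f)

lemma familyFunctor_map_proj (φ : V ⟶ W) (f : S ⟶ T) :
    (X.familyFunctor.map φ).app (op T) ≫ X.proj W f = X.proj V f ≫ X.factorMap φ f :=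
  (X.exists_familyMap φ T).choose_spec f

end Preoperad

end Koszul

/-! ### Construction of the comultiplication -/

namespace Koszul

open MonoidalCategory RTree

section

variable {C : Type*} [Category C] [MonoidalCategory C] [Preadditive C] [MonoidalPreadditive C]
  [HasFiniteBiproducts C]

/-- A finite tensor product of finite biproducts is the biproduct of the tensor products over all
tuples. The map is the sum of the prescribed components followed by the tensor products of the
inclusions. -/
lemma exists_hom_of_pieces {I : Type} [Finite I] {J : I → Type} [∀ i, Finite (J i)]
    (F : ∀ i, J i → C) (L : List I) (hL : ∀ i, i ∈ L) {Z W : C}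
    (p : ∀ q : ∀ i, J i, Z ⟶ W ⊗ tensList (fun i => F i (q i)) L) :
    ∃ a : Z ⟶ W ⊗ tensList (fun i => ⨁ F i) L, ∀ q : ∀ i, J i,
      a ≫ W ◁ tensListMap (W := fun i => F i (q i)) (fun i => biproduct.π (F i) (q i)) L = p q := by
  classical
  let _ := Fintype.ofFinite (∀ i, J i)
  refine ⟨∑ q, p q ≫ W ◁ tensListMap (V := fun i => F i (q i)) (fun i => biproduct.ι (F i) (q i)) L,
    fun q => ?_⟩
  rw [Preadditive.sum_comp, Finset.sum_eq_single q]
  · rw [Category.assoc, ← MonoidalCategory.whiskerLeft_comp, ← tensListMap_comp]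
    simp
  -- Two different tuples differ at some `i`, which occurs in `L`, and there the inclusion followed
  -- by the projection vanishes.
  · intro q' _ hq
    obtain ⟨i, hi⟩ := Function.ne_iff.1 hq
    rw [Category.assoc, ← MonoidalCategory.whiskerLeft_comp, ← tensListMap_comp,
      tensListMap_eq_zero _ L i (hL i) (biproduct.ι_π_ne _ hi), MonoidalPreadditive.whiskerLeft_zero,
      comp_zero]
  · intro h
    exact absurd (Finset.mem_univ q) h

/-- In each biproduct the idempotents formed by a projection and the corresponding inclusion sum to
the identity, so `comp_tensListMap_ext` applies. -/
lemma hom_ext_of_pieces {I : Type} {J : I → Type} [∀ i, Finite (J i)] [∀ i, Nonempty (J i)]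
    (F : ∀ i, J i → C) (L : List I) (hL : L.Nodup) {Z W : C}
    (a b : Z ⟶ W ⊗ tensList (fun i => ⨁ F i) L)
    (h : ∀ q : ∀ i, J i,
      a ≫ W ◁ tensListMap (W := fun i => F i (q i)) (fun i => biproduct.π (F i) (q i)) L =
        b ≫ W ◁ tensListMap (W := fun i => F i (q i)) (fun i => biproduct.π (F i) (q i)) L) :
    a = b := by
  classical
  refine comp_tensListMap_ext (J := J) (fun i c => biproduct.π (F i) c ≫ biproduct.ι (F i) c)
    (fun i => ?_) L hL a b (fun q => ?_) (fun i => Classical.arbitrary _)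
  · let _ := Fintype.ofFinite (J i)
    rw [finsum_eq_sum_of_fintype]
    exact biproduct.total
  · rw [tensListMap_comp _ (fun i => biproduct.ι (F i) (q i)), MonoidalCategory.whiskerLeft_comp,
      reassoc_of% (h q)]

end

namespace Preoperad

variable {k : Type u} [Field k] (X : Preoperad k) (V W : Psh k) {S S' S'' R T T' T'' Q : RTree}

/-- The map `factorInner`, for a composition equal to a given morphism. -/
noncomputable def factorTo (c : (⟨S⟩ : ATree) ⟶ ⟨S'⟩) (f' : S' ⟶ T) (f : S ⟶ T)
    (h : c.hom ≫ f' = f) : X.factor V f' ⟶ X.factor V f :=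
  X.factorInner V c f' ≫ eqToHom (by rw [h])

lemma factorTo_rfl (c : (⟨S⟩ : ATree) ⟶ ⟨S'⟩) (f' : S' ⟶ T) :
    X.factorTo V c f' _ rfl = X.factorInner V c f' := Category.comp_id _

lemma factorTo_congr {c d : (⟨S⟩ : ATree) ⟶ ⟨S'⟩} (e : c = d) {f' : S' ⟶ T} {f : S ⟶ T}
    (h : c.hom ≫ f' = f) (h' : d.hom ≫ f' = f) : X.factorTo V c f' f h = X.factorTo V d f' f h' := by
  subst e
  rfl

lemma proj_factorTo (c : (⟨S⟩ : ATree) ⟶ ⟨S'⟩) (f' : S' ⟶ T) (f : S ⟶ T)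
    (h : c.hom ≫ f' = f) : X.proj V f' ≫ X.factorTo V c f' f h = X.proj V f := by
  subst h
  rw [factorTo_rfl]
  exact X.proj_inner V c f'

lemma factorTo_inner (c : (⟨S⟩ : ATree) ⟶ ⟨S'⟩) (f' : S' ⟶ T) (f : S ⟶ T)
    (h : c.hom ≫ f' = f) (d : (⟨R⟩ : ATree) ⟶ ⟨S⟩) (e : (⟨R⟩ : ATree) ⟶ ⟨S'⟩)
    (he : e.hom ≫ f' = d.hom ≫ f) :
    X.factorTo V c f' f h ≫ X.factorInner V d f = X.factorTo V e f' (d.hom ≫ f) he := by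
  subst h
  -- The morphism `e` is forced, since `f'` is injective on edges.
  obtain rfl : e = d ≫ c := by
    ext1
    exact Hom.ext (funext fun x => edge_injective f' (congrFun (congrArg Hom.toFun he) x))
  rw [factorTo_rfl]
  exact (X.factorInner_comp V c d f').trans (X.factorTo_rfl V (d ≫ c) f').symm

section

variable (f : S ⟶ T) (q : ∀ l : S.Leaf, (T.above (edge f l.1)).Cut)

/-- The morphism to the union of prunings of the subtrees above the leaves. -/
noncomputable def liftUnion : S ⟶ T.cut ((isForest_above f).union q).1 :=
  liftCut f _ ((isForest_above f).not_lt_root q)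

/-- Above the leaf `l`, the union of the prunings restricts to `q l`. The two trees are isomorphic
rather than equal, which is why the components of the comultiplication need `factorTo`. -/
lemma exists_cutInner (l : S.Leaf) : ∃ c : (⟨(T.above (edge f l.1)).cut (q l).1⟩ : ATree) ⟶
    ⟨(T.cut ((isForest_above f).union q).1).above (edge (liftUnion f q) l.1)⟩,
    c.hom ≫ aboveMap (incl ((isForest_above f).union q)) (edge (liftUnion f q) l.1) = incl (q l) :=
  exists_inner _ (q l) fun x =>
    (range_aboveMap_incl _ (edge (liftUnion f q) l.1) x).trans ((isForest_above f).not_lt_iff q l x)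

/-- A component of the comultiplication. -/
noncomputable def comulPiece : X.familyObj V T ⟶
    X.val S ⊗ tens (fun l : S.Leaf => X.factor V (incl (q l))) :=
  X.proj V (incl ((isForest_above f).union q)) ≫
    X.split V (liftUnion f q) (incl ((isForest_above f).union q)) ≫
    X.val S ◁ tensListMap (fun l : S.Leaf => X.factorTo V (exists_cutInner f q l).choose
      (aboveMap (incl ((isForest_above f).union q)) (edge (liftUnion f q) l.1)) (incl (q l))
      (exists_cutInner f q l).choose_spec) (enum S.Leaf)

end

/-- The family of maps which defines the comultiplication. -/
noncomputable def comul (f : S ⟶ T) : X.familyObj V T ⟶ X.factor (X.familyPsh V) f :=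
  (exists_hom_of_pieces (fun (l : S.Leaf) (s : (T.above (edge f l.1)).Cut) => X.factor V (incl s))
    (enum S.Leaf) mem_enum (X.comulPiece V f)).choose

lemma comul_proj_incl (f : S ⟶ T) (q : ∀ l : S.Leaf, (T.above (edge f l.1)).Cut) :
    X.comul V f ≫ X.val S ◁ tensListMap (V := fun l : S.Leaf => X.familyObj V (T.above (edge f l.1)))
      (fun l : S.Leaf => X.proj V (incl (q l))) (enum S.Leaf) = X.comulPiece V f q := by
  refine Eq.trans ?_ ((exists_hom_of_pieces
    (fun (l : S.Leaf) (s : (T.above (edge f l.1)).Cut) => X.factor V (incl s))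
    (enum S.Leaf) mem_enum (X.comulPiece V f)).choose_spec q)
  simp only [proj_incl]
  rfl

/-- Expresses the value at an arbitrary factorisation through the value at the pruning of `g`, by
invariance and the compatibility of `split` with morphisms of `𝒜`. The pruning `s` is a variable so
that the union of a tuple of prunings can be substituted. -/
lemma proj_split (f : S ⟶ R) (g : R ⟶ T) (s : T.Cut) (hs : leafCut g = s)
    (h : ∀ l : S.Leaf, ∀ e ∈ s.1, ¬ e < edge (f ≫ g) l.1)
    (c : ∀ l : S.Leaf, (⟨R.above (edge f l.1)⟩ : ATree) ⟶
      ⟨(T.cut s.1).above (edge (liftCut (f ≫ g) s h) l.1)⟩)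
    (hc : ∀ l : S.Leaf, (c l).hom ≫ aboveMap (incl s) (edge (liftCut (f ≫ g) s h) l.1) =
      aboveMap g (edge f l.1)) :
    X.proj V g ≫ X.split V f g = X.proj V (incl s) ≫ X.split V (liftCut (f ≫ g) s h) (incl s) ≫
      X.val S ◁ tensListMap (fun l : S.Leaf => X.factorTo V (c l)
        (aboveMap (incl s) (edge (liftCut (f ≫ g) s h) l.1)) (aboveMap g (edge f l.1)) (hc l))
        (enum S.Leaf) := by
  subst hs
  refine (congrArg (· ≫ _) (X.proj_inner V (toLeafCut g) (incl (leafCut g))).symm).trans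
    ((Category.assoc _ _ _).trans (congrArg (_ ≫ ·)
      ((X.split_inner V f (toLeafCut g) (incl (leafCut g))).trans (congrArg (_ ≫ ·) ?_))))
  refine congrArg (fun φ => X.val S ◁ tensListMap φ (enum S.Leaf)) (funext fun l => ?_)
  have e : aboveInner (toLeafCut g) (edge f l.1) = c l := by
    ext1
    exact Hom.ext (funext fun x => edge_injective (aboveMap (incl (leafCut g)) _)
      (congrFun (congrArg Hom.toFun (hc l)) x).symm)
  exact (X.factorTo_rfl V (aboveInner (toLeafCut g) (edge f l.1)) _).symm.trans
    (X.factorTo_congr V e rfl (hc l))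

/-- The defining property of the comultiplication. -/
lemma comul_proj (f : S ⟶ R) (g : R ⟶ T) :
    X.comul V (f ≫ g) ≫ X.val S ◁ tensListMap
      (V := fun l : S.Leaf => X.familyObj V (T.above (edge (f ≫ g) l.1)))
      (fun l : S.Leaf => X.proj V (aboveMap g (edge f l.1))) (enum S.Leaf) =
    X.proj V g ≫ X.split V f g := by
  -- The component of the comultiplication on which the given projections depend.
  let q : ∀ l : S.Leaf, (T.above (edge (f ≫ g) l.1)).Cut := fun l => leafCut (aboveMap g (edge f l.1))
  have h₁ : (fun l : S.Leaf => X.proj V (aboveMap g (edge f l.1))) = fun l : S.Leaf =>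
      X.proj V (incl (q l)) ≫ X.factorInner V (toLeafCut (aboveMap g (edge f l.1))) (incl (q l)) :=
    funext fun l => (X.proj_inner V (toLeafCut (aboveMap g (edge f l.1))) (incl (q l))).symm
  let c : ∀ l : S.Leaf, (⟨R.above (edge f l.1)⟩ : ATree) ⟶
      ⟨(T.cut ((isForest_above (f ≫ g)).union q).1).above (edge (liftUnion (f ≫ g) q) l.1)⟩ :=
    fun l => toLeafCut (aboveMap g (edge f l.1)) ≫ (exists_cutInner (f ≫ g) q l).choose
  have hc : ∀ l, (c l).hom ≫ aboveMap (incl ((isForest_above (f ≫ g)).union q))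
      (edge (liftUnion (f ≫ g) q) l.1) = aboveMap g (edge f l.1) := fun l =>
    congrArg ((toLeafCut (aboveMap g (edge f l.1))).hom ≫ ·)
      (exists_cutInner (f ≫ g) q l).choose_spec
  refine Eq.trans ?_ (X.proj_split V f g _ (leafCut_comp f g)
    ((isForest_above (f ≫ g)).not_lt_root q) c hc).symm
  refine (congrArg (fun φ => X.comul V (f ≫ g) ≫ X.val S ◁ tensListMap
    (V := fun l : S.Leaf => X.familyObj V (T.above (edge (f ≫ g) l.1))) φ (enum S.Leaf)) h₁).trans ?_
  refine (congrArg (_ ≫ ·) ((congrArg (X.val S ◁ ·) (tensListMap_comp _ _ (enum S.Leaf))).trans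
    (MonoidalCategory.whiskerLeft_comp _ _ _))).trans ?_
  refine (Category.assoc _ _ _).symm.trans ((congrArg (· ≫ _) (X.comul_proj_incl V (f ≫ g) q)).trans ?_)
  refine (Category.assoc _ _ _).trans (congrArg (_ ≫ ·) ((Category.assoc _ _ _).trans
    (congrArg (_ ≫ ·) ?_)))
  refine (MonoidalCategory.whiskerLeft_comp _ _ _).symm.trans (congrArg (X.val S ◁ ·) ?_)
  refine (tensListMap_comp _ _ (enum S.Leaf)).symm.trans
    (congrArg (fun φ => tensListMap φ (enum S.Leaf)) (funext fun l => ?_))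
  exact X.factorTo_inner V _ _ _ _ _ _ (hc l)

end Preoperad

end Koszul

/-! ### Detection by prunings, and naturality of the comultiplication -/

namespace Koszul

open MonoidalCategory RTree

section

variable {C : Type*} [Category C] [MonoidalCategory C] [SymmetricCategory C]

lemma tensorHom_reindex_exchange {A A' : C} (x : A ⟶ A') {ι κ : Type} {V W : ι → C}
    (φ : ∀ i, V i ⟶ W i) (f : κ → ι) (l' : List κ) (l : List ι) (h : l.Perm (l'.map f))
    (hl : l.Nodup) :
    (x ⊗ₘ tensListReindex (V := V) (W := fun j => V (f j)) f (fun _ => 𝟙 _) l' l h) ≫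
        A' ◁ tensListMap (fun j => φ (f j)) l' =
      A ◁ tensListMap φ l ≫
        (x ⊗ₘ tensListReindex (V := W) (W := fun j => W (f j)) f (fun _ => 𝟙 _) l' l h) := by
  rw [← id_tensorHom, ← id_tensorHom, tensorHom_comp_tensorHom, tensorHom_comp_tensorHom,
    tensListReindex_map _ _ _ _ _ h hl, tensListMap_reindex _ _ _ _ _ h hl, Category.id_comp,
    Category.comp_id]
  simp only [Category.id_comp, Category.comp_id]

lemma whiskerLeft_tensListMap_comp {A : C} {ι : Type} {U V W : ι → C} (φ : ∀ i, U i ⟶ V i)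
    (ψ : ∀ i, V i ⟶ W i) (l : List ι) :
    A ◁ tensListMap φ l ≫ A ◁ tensListMap ψ l = A ◁ tensListMap (fun i => φ i ≫ ψ i) l := by
  rw [tensListMap_comp, MonoidalCategory.whiskerLeft_comp]

end

namespace Preoperad

variable {k : Type u} [Field k] (X : Preoperad k) (V : Psh k) {W : Psh k}
  {S S' S'' R T T' T'' Q : RTree}

instance (T : RTree) : Nonempty T.Cut := ⟨leafCut (𝟙 T)⟩

/-- By invariance, the projection at the pruning `q i` factors through the projection at any `p i`
that receives a morphism of `𝒜` over `U i` from that pruning. Hence one may test with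
representatives that arise by restricting one pruning of the whole tree. -/
lemma tens_family_hom_ext_aux {I : Type} {U : I → RTree} (L : List I) (hL : L.Nodup) {Z W : Ch k}
    (a b : Z ⟶ W ⊗ tensList (fun i => X.familyObj V (U i)) L)
    (h : ∀ q : ∀ i, (U i).Cut, ∃ (P : I → RTree) (p : ∀ i, P i ⟶ U i),
      (∀ i, ∃ c : (⟨(U i).cut (q i).1⟩ : ATree) ⟶ ⟨P i⟩, c.hom ≫ p i = incl (q i)) ∧
      a ≫ W ◁ tensListMap (fun i => X.proj V (p i)) L =
        b ≫ W ◁ tensListMap (fun i => X.proj V (p i)) L) : a = b := by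
  refine hom_ext_of_pieces (fun i (s : (U i).Cut) => X.factor V (incl s)) L hL a b fun q => ?_
  obtain ⟨P, p, hc, e⟩ := h q
  choose c hc using hc
  have h₁ : (fun i => biproduct.π (fun s : (U i).Cut => X.factor V (incl s)) (q i)) = fun i =>
      X.proj V (p i) ≫ X.factorTo V (c i) (p i) (incl (q i)) (hc i) := funext fun i =>
    (X.proj_incl V (q i)).symm.trans (X.proj_factorTo V _ _ _ _).symm
  have h₂ : W ◁ tensListMap (V := fun i => X.familyObj V (U i))
      (fun i => biproduct.π (fun s : (U i).Cut => X.factor V (incl s)) (q i)) L = _ :=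
    (congrArg (fun φ => W ◁ tensListMap φ L) h₁).trans (whiskerLeft_tensListMap_comp _ _ L).symm
  exact (congrArg (a ≫ ·) h₂).trans ((Category.assoc _ _ _).symm.trans ((congrArg (· ≫ _) e).trans
    ((Category.assoc _ _ _).trans (congrArg (b ≫ ·) h₂).symm)))

/-- Maps to `⨂ₗ H(V)(Tₗ)` are determined by their composites with the projections which come from
the prunings of `T`. -/
lemma tens_family_hom_ext (f : S ⟶ T) {Z W : Ch k}
    (a b : Z ⟶ W ⊗ tensList (fun l : S.Leaf => X.familyObj V (T.above (edge f l.1))) (enum S.Leaf))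
    (h : ∀ (s : T.Cut) (hs : ∀ l : S.Leaf, ∀ e ∈ s.1, ¬ e < edge f l.1),
      a ≫ W ◁ tensListMap (fun l : S.Leaf =>
          X.proj V (aboveMap (incl s) (edge (liftCut f s hs) l.1))) (enum S.Leaf) =
        b ≫ W ◁ tensListMap (fun l : S.Leaf =>
          X.proj V (aboveMap (incl s) (edge (liftCut f s hs) l.1))) (enum S.Leaf)) : a = b :=
  X.tens_family_hom_ext_aux V (enum S.Leaf) (nodup_enum _) a b fun q =>
    ⟨_, fun l : S.Leaf => aboveMap (incl ((isForest_above f).union q)) (edge (liftUnion f q) l.1),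
      exists_cutInner f q, h ((isForest_above f).union q) ((isForest_above f).not_lt_root q)⟩

/-- Maps to `⨂ H((V/Tₗ)ₘ)` are determined by their composites with the projections which come from
the prunings of `T`. -/
lemma tens_family_hom_ext₂ (f : S ⟶ R) (g : R ⟶ T)
    (L : List (Σ l : S.Leaf, (R.above (edge f l.1)).Leaf)) (hL : L.Nodup) {Z W : Ch k}
    (a b : Z ⟶ W ⊗ tensList (nestedFamily (X.familyPsh V) f g) L)
    (h : ∀ (s : T.Cut) (hs : ∀ r : R.Leaf, ∀ e ∈ s.1, ¬ e < edge g r.1),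
      a ≫ W ◁ tensListMap (V := nestedFamily (X.familyPsh V) f g)
        (fun x : (Σ l : S.Leaf, (R.above (edge f l.1)).Leaf) =>
          X.proj V (aboveMap (aboveMap (incl s) (edge (f ≫ liftCut g s hs) x.1.1))
            (edge (aboveMap (liftCut g s hs) (edge f x.1.1)) x.2.1))) L =
      b ≫ W ◁ tensListMap (V := nestedFamily (X.familyPsh V) f g)
        (fun x : (Σ l : S.Leaf, (R.above (edge f l.1)).Leaf) =>
          X.proj V (aboveMap (aboveMap (incl s) (edge (f ≫ liftCut g s hs) x.1.1))
            (edge (aboveMap (liftCut g s hs) (edge f x.1.1)) x.2.1))) L) : a = b := by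
  refine X.tens_family_hom_ext_aux V (U := fun x : (Σ l : S.Leaf, (R.above (edge f l.1)).Leaf) =>
      (T.above (edge (f ≫ g) x.1.1)).above (edge (aboveMap g (edge f x.1.1)) x.2.1)) L hL a b
      fun q => ?_
  -- A tuple of prunings of the trees above the leaves of `R` is the tuple of restrictions of this
  -- single pruning of `T`.
  let s := (isForest_aboveAbove f g).union q
  have hs : ∀ r : R.Leaf, ∀ e ∈ s.1, ¬ e < edge g r.1 := fun r => by
    obtain ⟨x, rfl⟩ := (leafOfAbove_bijective f).2 r
    exact (isForest_aboveAbove f g).not_lt_root q x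
  refine ⟨_, fun x => aboveMap (aboveMap (incl s) (edge (f ≫ liftCut g s hs) x.1.1))
            (edge (aboveMap (liftCut g s hs) (edge f x.1.1)) x.2.1), fun x => ?_, h s hs⟩
  refine exists_inner _ (q x) fun y => Iff.trans ⟨?_, fun hy => ?_⟩
    ((isForest_aboveAbove f g).not_lt_iff q x y)
  · rintro ⟨z, rfl⟩
    exact z.1.1.2
  · exact ⟨⟨⟨⟨y.1.1, hy⟩, y.1.2⟩, y.2⟩, rfl⟩

/-- The pattern for all compatibilities of the comultiplication: test with the prunings `s` through
which the morphism factors, rewrite both sides by `comul_proj` in terms of `split`, and use the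
corresponding naturality of `split`, here `split_left_inner`. -/
lemma comul_inner (c : (⟨S⟩ : ATree) ⟶ ⟨S'⟩) (f : S' ⟶ T) :
    X.comul V f ≫ X.factorInner (X.familyPsh V) c f = X.comul V (c.hom ≫ f) := by
  refine X.tens_family_hom_ext V (c.hom ≫ f) _ _ fun s hs => ?_
  have hs' : ∀ l : S'.Leaf, ∀ e ∈ s.1, ¬ e < edge f l.1 := fun l => by
    obtain ⟨l, rfl⟩ := (leafMap_bijective c.hom c.property).2 l
    exact hs l
  let α := liftCut f s hs'
  refine Eq.trans ?_ (X.comul_proj V (c.hom ≫ α) (incl s)).symm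
  refine (Category.assoc _ _ _).trans ((congrArg (_ ≫ ·) (tensorHom_reindex_exchange
    (V := fun l : S'.Leaf => X.familyObj V (T.above (edge f l.1))) (X.X.map c.op)
    (fun l : S'.Leaf => X.proj V (aboveMap (incl s) (edge α l.1))) (leafMap c.hom c.property)
    (enum S.Leaf) (enum S'.Leaf) (perm_enum_map (leafMap_bijective c.hom c.property))
    (nodup_enum _))).trans ?_)
  refine (Category.assoc _ _ _).symm.trans ((congrArg (· ≫ _) (X.comul_proj V α (incl s))).trans ?_)
  exact (Category.assoc _ _ _).trans (congrArg (_ ≫ ·) (X.split_left_inner V c α (incl s)))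

lemma comul_restrict (f : S ⟶ T) (g : T ⟶ T') :
    (X.familyPsh V).map g.op ≫ X.comul V f =
      X.comul V (f ≫ g) ≫ X.factorRestrict (X.familyPsh V) f g := by
  refine X.tens_family_hom_ext V f _ _ fun s hs => ?_
  let α := liftCut f s hs
  refine (comp_square_aux (X.comul_proj V α (incl s)) (X.familyPsh_map_proj (incl s) g)).trans ?_
  refine (congrArg (_ ≫ ·) (X.split_restrict V α (incl s) g)).trans ?_
  refine ((Category.assoc _ _ _).symm.trans (congrArg (· ≫ _)
    (X.comul_proj V α (incl s ≫ g)).symm)).trans ?_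
  refine (Category.assoc _ _ _).trans (Eq.trans (congrArg (_ ≫ ·) ?_) (Category.assoc _ _ _).symm)
  refine (whiskerLeft_tensListMap_comp _ _ _).trans (Eq.trans ?_
    (whiskerLeft_tensListMap_comp _ _ _).symm)
  exact congrArg (fun φ => X.val S ◁ tensListMap φ (enum S.Leaf)) (funext fun l =>
    (X.familyPsh_map_proj (aboveMap (incl s) (edge α l.1)) (aboveMap g (edge f l.1))).symm)

variable {V}

lemma comul_map (φ : V ⟶ W) (f : S ⟶ T) :
    (X.familyFunctor.map φ).app (op T) ≫ X.comul W f =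
      X.comul V f ≫ X.factorMap (X.familyFunctor.map φ) f := by
  refine X.tens_family_hom_ext W f _ _ fun s hs => ?_
  let α := liftCut f s hs
  refine (comp_square_aux (X.comul_proj W α (incl s)) (X.familyFunctor_map_proj φ (incl s))).trans ?_
  refine (congrArg (_ ≫ ·) (X.split_map φ α (incl s))).trans ?_
  refine ((Category.assoc _ _ _).symm.trans (congrArg (· ≫ _)
    (X.comul_proj V α (incl s)).symm)).trans ?_
  refine (Category.assoc _ _ _).trans (Eq.trans (congrArg (_ ≫ ·) ?_) (Category.assoc _ _ _).symm)
  refine (whiskerLeft_tensListMap_comp _ _ _).trans (Eq.trans ?_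
    (whiskerLeft_tensListMap_comp _ _ _).symm)
  exact congrArg (fun φ => X.val S ◁ tensListMap φ (enum S.Leaf)) (funext fun l =>
    (X.familyFunctor_map_proj φ (aboveMap (incl s) (edge α l.1))).symm)

end Preoperad

end Koszul

/-! ### Counit and the counit laws -/

namespace Koszul

open MonoidalCategory RTree

section

variable {C : Type*} [Category C] [MonoidalCategory C] [SymmetricCategory C]

/-- Naturality of the identification of `X(η) ⊗ V` with `V`, stated so that it covers naturality of
the counit in the presheaf and in the tree as well as the first counit law. -/
lemma tensListMap_reindex_unit {E : C} {ι : Type} {V V' : ι → C} {A A' : C} (u : E ⟶ 𝟙_ C) (i : ι)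
    (φ : ∀ i, V i ⟶ V' i) (r : V i ⟶ A) (r' : V' i ⟶ A') (w : A ⟶ A') (e : φ i ≫ r' = r ≫ w)
    (l : List ι) (hl : l.Nodup) (h : l.Perm ([()].map fun _ => i)) :
    E ◁ tensListMap φ l ≫ (u ⊗ₘ tensListReindex (V := V') (W := fun _ : Unit => A') (fun _ => i)
        (fun _ => r') [()] l h) ≫ (λ_ _).hom ≫ (tensCons _ () []).hom ≫ _ ◁ (tensNil _).hom ≫
          (ρ_ _).hom =
      ((u ⊗ₘ tensListReindex (V := V) (W := fun _ : Unit => A) (fun _ => i) (fun _ => r) [()] l h) ≫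
        (λ_ _).hom ≫ (tensCons _ () []).hom ≫ _ ◁ (tensNil _).hom ≫ (ρ_ _).hom) ≫ w := by
  have h₁ := tensListMap_singleton (V := fun _ : Unit => A) (W := fun _ => A') fun _ => w
  have h₂ := tensListReindex_map (V := V) (W := fun _ : Unit => A) (U := fun _ : Unit => A')
    (fun _ => i) (fun _ => r) (fun _ => w) [()] l h hl
  have h₃ := tensListMap_reindex (U := fun _ : Unit => A') φ (fun _ => i) (fun _ => r') [()] l h hl
  simp only [e] at h₃
  rw [← id_tensorHom, tensorHom_comp_tensorHom_assoc, Category.id_comp, h₃, ← h₂]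
  simp only [Category.assoc] at h₁ ⊢
  rw [← h₁, ← leftUnitor_naturality_assoc (tensListMap (fun _ : Unit => w) [()]), ← id_tensorHom (𝟙_ C),
    tensorHom_comp_tensorHom_assoc, Category.comp_id]

lemma comp_square_aux' {C : Type*} [Category C] {A B D E A' B' : C} {m : A ⟶ B} {p : B ⟶ D}
    {t : D ⟶ E} {q : A ⟶ A'} {r : A' ⟶ D} {t' : A' ⟶ B'} {n : B' ⟶ E} (h : m ≫ p = q ≫ r)
    (h' : r ≫ t = t' ≫ n) : m ≫ p ≫ t = (q ≫ t') ≫ n := by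
  rw [reassoc_of% h, h', Category.assoc]

lemma comp_triangle_aux {C : Type*} [Category C] {A B D E F : C} {a : A ⟶ B} {b : B ⟶ D}
    {p : D ⟶ E} {q : B ⟶ F} {m : F ⟶ E} {c : A ⟶ F} (h : b ≫ p = q ≫ m) (h' : a ≫ q = c) :
    (a ≫ b) ≫ p = c ≫ m := by
  rw [Category.assoc, h, reassoc_of% h']

end

namespace Preoperad

variable {k : Type u} [Field k] (X : Preoperad k) {V W : Psh k}
  {S S' S'' R T T' T'' Q : RTree}

lemma factorMap_factorEta (φ : V ⟶ W) (f : eta ⟶ T) :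
    X.factorMap φ f ≫ X.factorEta W f = X.factorEta V f ≫ φ.app (op T) :=
  tensListMap_reindex_unit (V := fun l : eta.Leaf => V.obj (op (T.above (edge f l.1))))
    (V' := fun l : eta.Leaf => W.obj (op (T.above (edge f l.1)))) X.unit.hom _ _ _ _ _
    (φ.naturality (toAboveRoot T _ (edge_root f)).op).symm _ (nodup_enum _) _

variable (V)

lemma factorRestrict_factorEta (f : eta ⟶ T) (g : T ⟶ T') :
    X.factorRestrict V f g ≫ X.factorEta V f = X.factorEta V (f ≫ g) ≫ V.map g.op :=
  tensListMap_reindex_unit (V := fun l : eta.Leaf => V.obj (op (T'.above (edge (f ≫ g) l.1))))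
    (V' := fun l : eta.Leaf => V.obj (op (T.above (edge f l.1)))) X.unit.hom
    (⟨(), fun _ _ => le_rfl⟩ : eta.Leaf) _
    (V.map (toAboveRoot T' _ (edge_root (f ≫ g))).op) (V.map (toAboveRoot T _ (edge_root f)).op) _
    (map_square_aux V (a := (aboveMap g (edge f eta.root)).op)
      (b := (toAboveRoot T _ (edge_root f)).op) (c := (toAboveRoot T' _ (edge_root (f ≫ g))).op)
      (d := g.op) rfl) _ (nodup_enum _) _

/-- The root inclusion of `T` and a composite `rootHom R ≫ h` agree, but not by definition. This is
why `factorEta` is defined for every presentation of the root inclusion. -/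
lemma eta_hom_eq (f g : eta ⟶ T) : f = g :=
  Hom.ext (funext fun _ => (edge_root f).trans (edge_root g).symm)

lemma proj_factorEta (f : eta ⟶ T) :
    X.proj V f ≫ X.factorEta V f = X.proj V (rootHom T) ≫ X.factorRoot V T := by
  obtain rfl := eta_hom_eq f (rootHom T)
  rw [factorEta_rootHom]

/-- The content of the first counit law: factor the root inclusion of `T` through `h` and apply
`comul_proj`; the splitting along the root of `R` is trivial by `split_rootHom`. -/
lemma comul_factorEta_proj (h : R ⟶ T) :
    X.comul V (rootHom R ≫ h) ≫ X.factorEta (X.familyPsh V) (rootHom R ≫ h) ≫ X.proj V h =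
      X.proj V h := by
  have hp : (enum eta.Leaf).Perm ([()].map (fun _ => (⟨(), fun _ _ => le_rfl⟩ : eta.Leaf))) :=
    perm_enum (by simp) (fun _ => List.mem_singleton.2 rfl)
  have e : X.proj V (aboveMap h R.root) ≫ X.factorToRoot V h =
      (X.familyPsh V).map (toAboveRoot T _ (edge_root (rootHom R ≫ h))).op ≫ X.proj V h :=
    (Category.assoc _ _ _).symm.trans ((congrArg (· ≫ _) (X.proj_inner V _ _)).trans
      (X.familyPsh_map_proj h (toAboveRoot T _ (edge_root h))).symm)
  have h₁ := tensListMap_reindex_unit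
    (V := fun l : eta.Leaf => X.familyObj V (T.above (edge (rootHom R ≫ h) l.1)))
    (V' := fun l : eta.Leaf => X.factor V (aboveMap h (edge (rootHom R) l.1))) X.unit.hom
    (⟨(), fun _ _ => le_rfl⟩ : eta.Leaf) (fun l => X.proj V (aboveMap h (edge (rootHom R) l.1)))
    _ _ _ e (enum _) (nodup_enum _) hp
  refine (congrArg (_ ≫ ·) h₁.symm).trans ?_
  refine (Category.assoc _ _ _).symm.trans ((congrArg (· ≫ _) (X.comul_proj V (rootHom R) h)).trans ?_)
  exact (Category.assoc _ _ _).trans ((congrArg (_ ≫ ·) (X.split_rootHom V h hp)).trans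
    (Category.comp_id _))

/-- The counit of the comonad `H`. -/
noncomputable def familyCounit : X.familyFunctor ⟶ 𝟭 (Psh k) where
  app V :=
    { app := fun T => X.proj V (rootHom T.unop) ≫ X.factorRoot V T.unop
      naturality := fun T' T g => by
        refine (congrArg (_ ≫ ·) (X.proj_factorEta V (rootHom T.unop)).symm).trans (Eq.trans ?_
          (congrArg (· ≫ _) (X.proj_factorEta V (rootHom T.unop ≫ g.unop))))
        exact comp_square_aux' (X.familyPsh_map_proj (rootHom T.unop) g.unop)
          (X.factorRestrict_factorEta V (rootHom T.unop) g.unop) }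
  naturality V W φ := by
    ext1
    funext T
    refine (congrArg (_ ≫ ·) (X.proj_factorEta W (rootHom T.unop)).symm).trans (Eq.trans ?_
          (congrArg (· ≫ _) (X.proj_factorEta V (rootHom T.unop))))
    exact comp_square_aux' (X.familyFunctor_map_proj φ (rootHom T.unop))
          (X.factorMap_factorEta φ (rootHom T.unop))

lemma proj_counit (f : eta ⟶ T) :
    X.proj V f ≫ X.factorEta V f = (X.familyCounit.app V).app (op T) := X.proj_factorEta V f

lemma exists_familyComul (T : RTree) : ∃ q : X.familyObj V T ⟶ X.familyObj (X.familyPsh V) T,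
    ∀ {S : RTree} (f : S ⟶ T), q ≫ X.proj (X.familyPsh V) f = X.comul V f :=
  X.exists_familyLift (fun f => X.comul V f) fun c f => X.comul_inner V c f

/-- The comultiplication of the comonad `H`. -/
noncomputable def familyComul : X.familyFunctor ⟶ X.familyFunctor ⋙ X.familyFunctor where
  app V :=
    { app := fun T => (X.exists_familyComul V T.unop).choose
      naturality := fun T' T g => X.familyObj_hom_ext fun f => by
        refine (Category.assoc _ _ _).trans ((congrArg (_ ≫ ·)
          ((X.exists_familyComul V T.unop).choose_spec f)).trans ?_)
        refine (X.comul_restrict V f g.unop).trans (Eq.trans ?_ (comp_triangle_aux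
          (X.familyPsh_map_proj f g.unop)
          ((X.exists_familyComul V T'.unop).choose_spec (f ≫ g.unop))).symm)
        rfl }
  naturality V W φ := by
    ext1
    funext T
    refine X.familyObj_hom_ext fun f => ?_
    refine (Category.assoc _ _ _).trans ((congrArg (_ ≫ ·)
          ((X.exists_familyComul W T.unop).choose_spec f)).trans ?_)
    refine (X.comul_map φ f).trans (Eq.trans ?_ (comp_triangle_aux
          (X.familyFunctor_map_proj (X.familyFunctor.map φ) f)
          ((X.exists_familyComul V T.unop).choose_spec f)).symm)
    rfl

lemma familyComul_proj (f : S ⟶ T) :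
    (X.familyComul.app V).app (op T) ≫ X.proj (X.familyPsh V) f = X.comul V f :=
  (X.exists_familyComul V T).choose_spec f

lemma familyComul_counit (T : RTree) : (X.familyComul.app V).app (op T) ≫
    (X.familyCounit.app (X.familyPsh V)).app (op T) = 𝟙 _ := by
  refine X.familyObj_hom_ext fun {R} h => ?_
  refine Eq.trans ?_ ((X.comul_factorEta_proj V h).trans (Category.id_comp _).symm)
  refine (congrArg (fun x => (_ ≫ x) ≫ _) (X.proj_counit (X.familyPsh V) (rootHom R ≫ h)).symm).trans ?_
  refine (Category.assoc _ _ _).trans ((congrArg (_ ≫ ·) (Category.assoc _ _ _)).trans ?_)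
  exact (Category.assoc _ _ _).symm.trans (congrArg (· ≫ _) (X.familyComul_proj V (rootHom R ≫ h)))

/-- Here `f` is factored as the identity of `S` followed by `f`, and `split_id` applies. -/
lemma familyComul_map_counit (T : RTree) : (X.familyComul.app V).app (op T) ≫
    (X.familyFunctor.map (X.familyCounit.app V)).app (op T) = 𝟙 _ := by
  refine X.familyObj_hom_ext fun {S} f => ?_
  refine (comp_triangle_aux (X.familyFunctor_map_proj (X.familyCounit.app V) f)
    (X.familyComul_proj V f)).trans (Eq.trans ?_ (Category.id_comp _).symm)
  refine (Category.comp_id _).symm.trans ?_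
  refine Eq.trans ?_ ((congrArg (_ ≫ ·) (X.split_id V f)).trans (Category.comp_id _))
  refine Eq.trans ?_ (((congrArg (· ≫ _) (X.comul_proj V (𝟙 S) f)).trans (Category.assoc _ _ _)))
  refine (Category.comp_id _).trans (Eq.trans (congrArg (_ ≫ ·) ?_) (Category.assoc _ _ _).symm)
  refine Eq.trans ?_ (whiskerLeft_tensListMap_comp _ _ _).symm
  refine congrArg (fun φ => X.val S ◁ tensListMap φ (enum S.Leaf)) (funext fun l => ?_)
  -- The counit at the tree above `l` is the projection at its root inclusion. This factors through
  -- the restriction of `f` by a morphism of `𝒜`, because `S` has only one edge above `l`.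
  refine (X.proj_counit V ((rootLeaf l).hom ≫ aboveMap f (edge (𝟙 S) l.1))).symm.trans ?_
  refine (congrArg (· ≫ _) (X.proj_inner V (rootLeaf l) (aboveMap f (edge (𝟙 S) l.1))).symm).trans ?_
  exact Category.assoc _ _ _

end Preoperad

end Koszul

/-! ### Compatibility of the comultiplication with splitting -/

namespace Koszul

open MonoidalCategory RTree

section

variable {C : Type*} [Category C] [MonoidalCategory C]

lemma comul_split_aux {Z S R E G B H K E₁ G₁ N N₁ Y : C} (cS : Z ⟶ S ⊗ E) (D : E ⟶ G)
    (Γ : G ⟶ B ⊗ H) (P : H ⟶ K) (cR : Z ⟶ R ⊗ N) (sp : R ⊗ N ⟶ S ⊗ G) (θ : R ⟶ S ⊗ B) (r : N ⟶ H)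
    (e : E ⟶ E₁) (D₁ : E₁ ⟶ G₁) (Γ₁ : G₁ ⟶ B ⊗ K) (q : Z ⟶ Y) (σ₁ : Y ⟶ S ⊗ E₁) (n : N ⟶ N₁)
    (σ₂ : Y ⟶ R ⊗ N₁) (r₁ : N₁ ⟶ K) (hs : sp ≫ S ◁ Γ = (θ ⊗ₘ r) ≫ (α_ _ _ _).hom)
    (hc : cS ≫ S ◁ e = q ≫ σ₁) (hD : D ≫ Γ ≫ B ◁ P = e ≫ D₁ ≫ Γ₁)
    (hc' : cR ≫ R ◁ n = q ≫ σ₂) (hr : r ≫ P = n ≫ r₁)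
    (hσ : σ₂ ≫ (θ ⊗ₘ r₁) ≫ (α_ _ _ _).hom = σ₁ ≫ S ◁ (D₁ ≫ Γ₁)) :
    ((cS ≫ S ◁ D) ≫ S ◁ Γ ≫ (α_ _ _ _).inv) ≫ (S ⊗ B) ◁ P =
      ((cR ≫ sp) ≫ S ◁ Γ ≫ (α_ _ _ _).inv) ≫ (S ⊗ B) ◁ P := by
  rw [← cancel_mono (α_ S B K).hom]
  have h₁ : (α_ S B H).inv ≫ (S ⊗ B) ◁ P ≫ (α_ S B K).hom = S ◁ B ◁ P := by simp
  simp only [Category.assoc, h₁]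
  rw [reassoc_of% hs, ← MonoidalCategory.whiskerLeft_comp, ← MonoidalCategory.whiskerLeft_comp, hD,
    MonoidalCategory.whiskerLeft_comp, reassoc_of% hc, ← hσ, ← reassoc_of% hc',
    ← associator_naturality_right, ← id_tensorHom, ← id_tensorHom, tensorHom_comp_tensorHom_assoc,
    tensorHom_comp_tensorHom_assoc, hr, Category.id_comp, Category.comp_id]

variable [SymmetricCategory C]

lemma tensListMap_whisker_gather {ι : Type} {κ : ι → Type} (A : ι → C) {B B' : (Σ i, κ i) → C}
    (φ : ∀ x, B x ⟶ B' x) (L : ∀ i, List (κ i)) (l : List ι) (s : List (Σ i, κ i))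
    (hs : sigmaList L l = s) (h : s.Nodup) :
    tensListMap (V := fun i => A i ⊗ tensList (fun j => B ⟨i, j⟩) (L i))
        (fun i => A i ◁ tensListMap (fun j => φ ⟨i, j⟩) (L i)) l ≫
      tensListGather A B' L l s hs = tensListGather A B L l s hs ≫ _ ◁ tensListMap φ s := by
  have hL : ∀ i, (L i).Perm ((L i).map fun j => j) := fun i => by simp
  have hl : l.Perm (l.map fun i => i) := by simp
  have hs' : s.Perm (s.map fun x => x) := by simp
  have h₁ := tensListReindex_gather (A := A) (B := B) (A' := A) (B' := B') (fun i => i)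
    (fun _ => 𝟙 _) (fun _ j => j) (fun i j => φ ⟨i, j⟩) L L hL l l hl s s hs hs h hs'
  rw [tensListReindex_id A] at h₁
  rw [tensListMap_eq_reindex _ _ hl, tensListMap_eq_reindex φ s hs', ← id_tensorHom]
  refine Eq.trans ?_ h₁
  simp only [← id_tensorHom, fun i => tensListMap_eq_reindex (fun j => φ ⟨i, j⟩) (L i) (hL i)]

end

namespace Preoperad

variable {k : Type u} [Field k] (X : Preoperad k) (V : Psh k) {W : Psh k}
  {S S' S'' R T T' T'' Q : RTree}

lemma map_aboveAbove_proj (h : T ⟶ Q) (e : T.Edge) (x : (T.above e).Edge) :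
    (X.familyPsh V).map (aboveAbove Q (edge h e) (edge (aboveMap h e) x)).op ≫
        X.proj V (aboveMap (aboveMap h e) x) =
      X.proj V (aboveMap h x.1) ≫ X.factorAbove V h e x :=
  (X.familyPsh_map_proj (aboveMap (aboveMap h e) x) _).trans (Eq.symm
    ((Category.assoc _ _ _).symm.trans (congrArg (· ≫ _) (X.proj_inner V
      ⟨aboveAbove T e x, aboveAbove_inner T e x⟩ (aboveMap h x.1)))))

/-- The comultiplication is compatible with splitting. -/
lemma comul_split (f : S ⟶ R) (g : R ⟶ T) :
    X.comul V (f ≫ g) ≫ X.val S ◁ tensListMap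
      (V := fun l : S.Leaf => X.familyObj V (T.above (edge (f ≫ g) l.1)))
      (fun l : S.Leaf => X.comul V (aboveMap g (edge f l.1))) (enum S.Leaf) =
    X.comul V g ≫ X.split (X.familyPsh V) f g := by
  have hL : (sigmaList (fun l : S.Leaf => enum (R.above (edge f l.1)).Leaf) (enum S.Leaf)).Nodup :=
    nodup_sigmaList_enum (nodup_enum _)
  have : IsIso (X.val S ◁ tensListGather (fun l : S.Leaf => X.val (R.above (edge f l.1)))
    (nestedFamily (X.familyPsh V) f g) (fun l => enum _) (enum S.Leaf) _ rfl) :=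
    X.isIso_gather (X.familyPsh V) f g
  -- Gathering exposes a single tensor product of values of `H(V)`, indexed by the leaves of `R`, so
  -- that the maps can be tested with prunings of `T` through which `g` factors. For each of them
  -- the claim becomes `split_comp`.
  refine (cancel_mono (X.val S ◁ tensListGather (fun l : S.Leaf => X.val (R.above (edge f l.1)))
    (nestedFamily (X.familyPsh V) f g) (fun l => enum _) (enum S.Leaf) _ rfl ≫ (α_ _ _ _).inv)).1 ?_
  refine X.tens_family_hom_ext₂ V f g _ hL _ _ fun s hs => ?_
  let β := liftCut g s hs
  let k' := incl s
  refine comul_split_aux _ _ _ _ _ _ _ _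
    (tensListMap (V := fun l : S.Leaf => X.familyObj V (T.above (edge (f ≫ g) l.1)))
      (fun l : S.Leaf => X.proj V (aboveMap k' (edge (f ≫ β) l.1))) (enum S.Leaf)) _ _
    (X.proj V k') _
    (tensListMap (V := fun r : R.Leaf => X.familyObj V (T.above (edge g r.1)))
      (fun r : R.Leaf => X.proj V (aboveMap k' (edge β r.1))) (enum R.Leaf)) _ _
    (X.split_gather (X.familyPsh V) f g) (X.comul_proj V (f ≫ β) k') ?_ (X.comul_proj V β k') ?_
    (X.split_comp V f β k')
  · have h₁ := tensListMap_whisker_gather (fun l : S.Leaf => X.val (R.above (edge f l.1)))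
      (B := nestedFamily (X.familyPsh V) f g)
      (B' := fun x : (Σ l : S.Leaf, (R.above (edge f l.1)).Leaf) => X.factor V
        (aboveMap (aboveMap k' (edge (f ≫ β) x.1.1)) (edge (aboveMap β (edge f x.1.1)) x.2.1)))
      (fun x => X.proj V (aboveMap (aboveMap k' (edge (f ≫ β) x.1.1))
        (edge (aboveMap β (edge f x.1.1)) x.2.1))) (fun l => enum _) (enum S.Leaf) _ rfl hL
    refine (congrArg (_ ≫ ·) h₁.symm).trans ((Category.assoc _ _ _).symm.trans (Eq.trans
      (congrArg (· ≫ _) ?_) (Category.assoc _ _ _)))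
    refine (tensListMap_comp _ _ (enum S.Leaf)).symm.trans (Eq.trans ?_
      (tensListMap_comp _ _ (enum S.Leaf)))
    exact congrArg (fun φ => tensListMap φ (enum S.Leaf)) (funext fun l =>
      X.comul_proj V (aboveMap β (edge f l.1)) (aboveMap k' (edge (f ≫ β) l.1)))
  · refine (tensListReindex_map _ _ _ _ _ (perm_leafOfAbove f) (nodup_enum _)).trans (Eq.trans ?_
      (tensListMap_reindex _ _ _ _ _ (perm_leafOfAbove f) (nodup_enum _)).symm)
    exact congrArg (fun φ => tensListReindex (V := fun r : R.Leaf => X.familyObj V (T.above (edge g r.1)))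
      (W := fun x : (Σ l : S.Leaf, (R.above (edge f l.1)).Leaf) => X.factor V
        (aboveMap (aboveMap k' (edge (f ≫ β) x.1.1)) (edge (aboveMap β (edge f x.1.1)) x.2.1)))
      (leafOfAbove f) φ _ _ (perm_leafOfAbove f)) (funext fun x => X.map_aboveAbove_proj V k'
        (edge (f ≫ β) x.1.1) (edge (aboveMap β (edge f x.1.1)) x.2.1))

end Preoperad

end Koszul

/-! ### Coassociativity and the comonad -/

namespace Koszul

open MonoidalCategory RTree

namespace Preoperad

variable {k : Type u} [Field k] (X : Preoperad k) (V : Psh k) {W : Psh k}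
  {S S' S'' R T T' T'' Q : RTree}

/-- Projecting to `f` and then to a pruning through which `f` factors, one side becomes the
comultiplication applied above the leaves of `S`, and the other becomes a comultiplication followed
by a splitting. These agree by `comul_split`. -/
lemma familyComul_coassoc (T : RTree) : (X.familyComul.app V).app (op T) ≫
    (X.familyFunctor.map (X.familyComul.app V)).app (op T) =
      (X.familyComul.app V).app (op T) ≫ (X.familyComul.app (X.familyPsh V)).app (op T) := by
  refine X.familyObj_hom_ext fun {S} f => ?_
  refine (comp_triangle_aux (X.familyFunctor_map_proj (X.familyComul.app V) f)
    (X.familyComul_proj V f)).trans (Eq.trans ?_ ((Category.assoc _ _ _).trans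
      (congrArg (_ ≫ ·) (X.familyComul_proj (X.familyPsh V) f))).symm)
  refine X.tens_family_hom_ext (X.familyPsh V) f _ _ fun s hs => ?_
  let α := liftCut f s hs
  refine Eq.trans ?_ ((Category.assoc _ _ _).trans
    (congrArg (_ ≫ ·) (X.comul_proj (X.familyPsh V) α (incl s)))).symm
  refine Eq.trans ?_ ((Category.assoc _ _ _).symm.trans (congrArg (· ≫ _)
    (X.familyComul_proj V (incl s)))).symm
  refine Eq.trans ?_ (X.comul_split V α (incl s))
  refine (Category.assoc _ _ _).trans (congrArg (_ ≫ ·) ?_)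
  refine (whiskerLeft_tensListMap_comp _ _ _).trans ?_
  exact congrArg (fun φ => X.val S ◁ tensListMap φ (enum S.Leaf)) (funext fun l =>
    X.familyComul_proj V (aboveMap (incl s) (edge α l.1)))

/-- The comonad `H`. -/
noncomputable def familyComonad : Comonad (Psh k) where
  toFunctor := X.familyFunctor
  ε := X.familyCounit
  δ := X.familyComul
  coassoc V := by
    ext1
    funext T
    exact X.familyComul_coassoc V T.unop
  left_counit V := by
    ext1
    funext T
    exact X.familyComul_counit V T.unop
  right_counit V := by
    ext1
    funext T
    exact X.familyComul_map_counit V T.unop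

lemma isPrealgebraComonad : IsPrealgebraComonad X X.familyComonad (fun V _ _ f => X.proj V f) where
  invariant V _ _ _ c f := X.proj_inner V c f
  existsUnique_lift V T Z p hp := by
    obtain ⟨q, hq⟩ := X.exists_familyLift (V := V) p hp
    exact ⟨q, hq, fun q' hq' => X.familyObj_hom_ext fun f => (hq' f).trans (hq f).symm⟩
  restrict_π V _ _ _ f g := X.familyPsh_map_proj f g
  map_π φ _ _ f := X.familyFunctor_map_proj φ f
  counit_eq V T := rfl
  comul_π V S R T f g := by
    refine (Category.assoc _ _ _).symm.trans ((congrArg (· ≫ _)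
      (X.familyComul_proj V (f ≫ g))).trans ?_)
    refine (Category.assoc _ _ _).symm.trans ((congrArg (· ≫ _) (X.comul_proj V f g)).trans ?_)
    exact (Category.assoc _ _ _).trans (congrArg (_ ≫ ·) (X.split_gather V f g))

end Preoperad

/-! ### Prealgebras and coalgebras -/

namespace Prealgebra

variable {k : Type u} [Field k] {X : Preoperad k} {S R T : RTree}

/-- The associativity axiom solved for its right-hand side by cancelling `gather`; in this form it
has the same shape as `comul_proj`. -/
lemma τ_split (A : Prealgebra X) (f : S ⟶ R) (g : R ⟶ T) :
    A.τ (f ≫ g) ≫ X.val S ◁ tensListMap (fun l : S.Leaf => A.τ (aboveMap g (edge f l.1)))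
      (enum S.Leaf) = A.τ g ≫ X.split A.M f g := by
  refine (cancel_mono (X.gather A.M f g)).1 ?_
  refine (Category.assoc _ _ _).trans ((A.τ_assoc f g).trans ?_)
  exact ((Category.assoc _ _ _).trans (congrArg (_ ≫ ·) (X.split_gather A.M f g))).symm

lemma exists_coaction (A : Prealgebra X) (T : RTree) :
    ∃ q : A.M.obj (op T) ⟶ X.familyObj A.M T,
      ∀ {S : RTree} (f : S ⟶ T), q ≫ X.proj A.M f = A.τ f :=
  X.exists_familyLift (fun f => A.τ f) fun c f => A.τ_inner c f

/-- The coaction of the comonad `H` on a prealgebra. -/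
noncomputable def coaction (A : Prealgebra X) : A.M ⟶ X.familyPsh A.M where
  app T := (A.exists_coaction T.unop).choose
  naturality T' T g := X.familyObj_hom_ext fun f => by
    refine (Category.assoc _ _ _).trans ((congrArg (_ ≫ ·)
      ((A.exists_coaction T.unop).choose_spec f)).trans ?_)
    exact (A.τ_natural f g.unop).trans (comp_triangle_aux (X.familyPsh_map_proj f g.unop)
      ((A.exists_coaction T'.unop).choose_spec (f ≫ g.unop))).symm

lemma coaction_proj (A : Prealgebra X) (f : S ⟶ T) :
    A.coaction.app (op T) ≫ X.proj A.M f = A.τ f :=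
  (A.exists_coaction T).choose_spec f

lemma coaction_counit (A : Prealgebra X) : A.coaction ≫ X.familyCounit.app A.M = 𝟙 _ := by
  ext1
  funext T
  refine Eq.trans ?_ (A.τ_eta T.unop)
  exact (Category.assoc _ _ _).symm.trans (congrArg (· ≫ _) (A.coaction_proj (rootHom T.unop)))

/-- Tested at a factorisation through a pruning, coassociativity of the coaction is exactly
`τ_split`. -/
lemma coaction_coassoc (A : Prealgebra X) :
    A.coaction ≫ X.familyComul.app A.M = A.coaction ≫ X.familyFunctor.map A.coaction := by
  ext1
  funext T
  refine X.familyObj_hom_ext fun {S} f => ?_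
  refine ((Category.assoc _ _ _).trans (congrArg (_ ≫ ·) (X.familyComul_proj A.M f))).trans
    (Eq.trans ?_ (comp_triangle_aux (X.familyFunctor_map_proj A.coaction f)
      (A.coaction_proj f)).symm)
  refine X.tens_family_hom_ext A.M f _ _ fun s hs => ?_
  let α := liftCut f s hs
  refine ((Category.assoc _ _ _).trans (congrArg (_ ≫ ·) (X.comul_proj A.M α (incl s)))).trans ?_
  refine ((Category.assoc _ _ _).symm.trans (congrArg (· ≫ _) (A.coaction_proj (incl s)))).trans ?_
  refine (A.τ_split α (incl s)).symm.trans (Eq.trans (congrArg (_ ≫ ·) (Eq.symm ?_))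
    (Category.assoc _ _ _).symm)
  refine (whiskerLeft_tensListMap_comp _ _ _).trans ?_
  exact congrArg (fun φ => X.val S ◁ tensListMap φ (enum S.Leaf)) (funext fun l =>
    A.coaction_proj (aboveMap (incl s) (edge α l.1)))

variable (X) in
/-- The functor which sends a prealgebra to the corresponding coalgebra. -/
noncomputable def toCoalgebra : Prealgebra X ⥤ X.familyComonad.Coalgebra where
  obj A := ⟨A.M, A.coaction, A.coaction_counit, A.coaction_coassoc⟩
  map {A B} φ := ⟨φ.hom, by
    ext1
    funext T
    refine X.familyObj_hom_ext fun f => ?_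
    refine (comp_triangle_aux (X.familyFunctor_map_proj φ.hom f) (A.coaction_proj f)).trans ?_
    refine (φ.comm f).symm.trans ?_
    exact ((Category.assoc _ _ _).trans (congrArg (_ ≫ ·) (B.coaction_proj f))).symm⟩

/-- The prealgebra corresponding to a coalgebra. -/
noncomputable def ofCoalgebra (A : X.familyComonad.Coalgebra) : Prealgebra X where
  M := A.A
  τ {_ T} f := A.a.app (op T) ≫ X.proj A.A f
  τ_natural {S T T'} f g := by
    refine (Category.assoc _ _ _).symm.trans ((congrArg (· ≫ _) (A.a.naturality g.op)).trans ?_)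
    exact (Category.assoc _ _ _).trans ((congrArg (_ ≫ ·) (X.familyPsh_map_proj f g)).trans
      (Category.assoc _ _ _).symm)
  τ_inner c f := (Category.assoc _ _ _).trans (congrArg (_ ≫ ·) (X.proj_inner A.A c f))
  τ_eta T := (Category.assoc _ _ _).trans (congrArg (fun φ => φ.app (op T)) A.counit)
  τ_assoc {S R T} f g := by
    -- Coassociativity read off at the projection belonging to `f ≫ g`; composing further with the
    -- projections above the leaves of `S` gives the associativity axiom.
    have h : A.a.app (op T) ≫ X.comul A.A (f ≫ g) =
        (A.a.app (op T) ≫ X.proj A.A (f ≫ g)) ≫ X.factorMap A.a (f ≫ g) := by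
      have h₁ := congrArg (fun φ => φ.app (op T) ≫ X.proj (X.familyPsh A.A) (f ≫ g)) A.coassoc
      refine Eq.trans ?_ (h₁.trans (comp_triangle_aux (X.familyFunctor_map_proj A.a (f ≫ g)) rfl))
      exact ((Category.assoc _ _ _).trans (congrArg (_ ≫ ·) (X.familyComul_proj A.A (f ≫ g)))).symm
    have h₂ : (A.a.app (op T) ≫ X.proj A.A (f ≫ g)) ≫ X.val S ◁ tensListMap (fun l : S.Leaf =>
        A.a.app (op (T.above (edge (f ≫ g) l.1))) ≫ X.proj A.A (aboveMap g (edge f l.1)))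
        (enum S.Leaf) = A.a.app (op T) ≫ X.proj A.A g ≫ X.split A.A f g := by
      refine Eq.trans ?_ (congrArg (_ ≫ ·) (X.comul_proj A.A f g))
      refine Eq.trans ?_ ((congrArg (· ≫ _) h).symm.trans (Category.assoc _ _ _))
      exact (congrArg (_ ≫ ·) (whiskerLeft_tensListMap_comp _ _ _).symm).trans
        (Category.assoc _ _ _).symm
    refine (Category.assoc _ _ _).symm.trans ((congrArg (· ≫ _) h₂).trans ?_)
    refine (Category.assoc _ _ _).trans ((congrArg (_ ≫ ·) ((Category.assoc _ _ _).trans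
      (congrArg (_ ≫ ·) (X.split_gather A.A f g)))).trans (Category.assoc _ _ _).symm)

variable (X) in
/-- The functor which sends a coalgebra to the corresponding prealgebra. -/
noncomputable def fromCoalgebra : X.familyComonad.Coalgebra ⥤ Prealgebra X where
  obj A := ofCoalgebra A
  map {A B} φ := ⟨φ.f, fun {S T} f => by
    have h := congrArg (fun ψ => ψ.app (op T) ≫ X.proj B.A f) φ.h
    refine (Category.assoc _ _ _).symm.trans (h.symm.trans ?_)
    exact comp_triangle_aux (X.familyFunctor_map_proj φ.f f) rfl⟩

/-- An isomorphism of categories requires equality of objects. The underlying presheaves agree by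
definition in the application, so heterogeneous equality of the structure maps is harmless. -/
lemma ext_τ {A B : Prealgebra X} (h : A.M = B.M)
    (h' : ∀ {S T : RTree} (f : S ⟶ T), HEq (A.τ f) (B.τ f)) : A = B := by
  obtain ⟨M, τ, h₁, h₂, h₃, h₄⟩ := A
  obtain ⟨M', τ', _, _, _, _⟩ := B
  obtain rfl : M = M' := h
  obtain rfl : @τ = @τ' := by
    funext S T f
    exact eq_of_heq (h' f)
  rfl

lemma hom_heq {A B A' B' : Prealgebra X} (hA : A = A') (hB : B = B') {φ : A ⟶ B} {φ' : A' ⟶ B'}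
    (h : HEq (Hom.hom φ) (Hom.hom φ')) : HEq φ φ' := by
  subst hA hB
  exact heq_of_eq (Hom.ext (eq_of_heq h))

lemma coalgebra_ext {G : Comonad (Psh k)} {A B : G.Coalgebra} (h : A.A = B.A) (h' : HEq A.a B.a) :
    A = B := by
  obtain ⟨M, a, _, _⟩ := A
  obtain ⟨M', a', _, _⟩ := B
  obtain rfl : M = M' := h
  obtain rfl : a = a' := eq_of_heq h'
  rfl

lemma coalgebra_hom_heq {G : Comonad (Psh k)} {A B A' B' : G.Coalgebra} (hA : A = A')
    (hB : B = B') {φ : A ⟶ B} {φ' : A' ⟶ B'} (h : HEq φ.f φ'.f) : HEq φ φ' := by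
  subst hA hB
  exact heq_of_eq (Comonad.Coalgebra.Hom.ext (eq_of_heq h))

lemma toCoalgebra_fromCoalgebra : toCoalgebra X ⋙ fromCoalgebra X = 𝟭 (Prealgebra X) := by
  have h (A : Prealgebra X) : (toCoalgebra X ⋙ fromCoalgebra X).obj A = A :=
    ext_τ rfl fun f => heq_of_eq (A.coaction_proj f)
  exact Functor.hext h fun A B φ => hom_heq (h A) (h B) HEq.rfl

lemma fromCoalgebra_toCoalgebra :
    fromCoalgebra X ⋙ toCoalgebra X = 𝟭 X.familyComonad.Coalgebra := by
  have h (A : X.familyComonad.Coalgebra) : (fromCoalgebra X ⋙ toCoalgebra X).obj A = A :=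
    coalgebra_ext rfl (heq_of_eq (by
      ext1
      funext T
      exact X.familyObj_hom_ext fun f => (ofCoalgebra A).coaction_proj f))
  exact Functor.hext h fun A B φ => coalgebra_hom_heq (h A) (h B) HEq.rfl

end Prealgebra

end Koszul

theorem mainTheorem7 {k : Type u} [Field k] (X : Preoperad k) :
    ∃ (H : Comonad (Psh k))
      (π : ∀ (V : Psh k) {S T : RTree} (f : S ⟶ T),
        (H.toFunctor.obj V).obj (op T) ⟶ X.factor V f),
      IsPrealgebraComonad X H π ∧
      ∃ (F : Prealgebra X ⥤ H.Coalgebra) (G : H.Coalgebra ⥤ Prealgebra X),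
        F ⋙ G = 𝟭 (Prealgebra X) ∧ G ⋙ F = 𝟭 H.Coalgebra ∧
        F ⋙ H.forget = Prealgebra.forget X ∧
        ∀ A : Prealgebra X,
          ∃ (a : A.M ⟶ H.toFunctor.obj A.M) (h₁ : a ≫ H.ε.app A.M = 𝟙 A.M)
            (h₂ : a ≫ H.δ.app A.M = a ≫ H.toFunctor.map a),
            F.obj A = { A := A.M, a := a, counit := h₁, coassoc := h₂ } ∧
            ∀ {S T : RTree} (f : S ⟶ T), a.app (op T) ≫ π A.M f = A.τ f :=
  ⟨X.familyComonad, fun V _ _ f => X.proj V f, X.isPrealgebraComonad, Prealgebra.toCoalgebra X,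
    Prealgebra.fromCoalgebra X, Prealgebra.toCoalgebra_fromCoalgebra,
    Prealgebra.fromCoalgebra_toCoalgebra, rfl, fun A =>
      ⟨A.coaction, A.coaction_counit, A.coaction_coassoc, rfl, fun f => A.coaction_proj f⟩⟩
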